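/- Let $\lambda$ be the security parameter, let $u=u(\lambda)$ satisfy $u=\omega(\log\lambda)$, and let $(\mathsf{Gen},\mathsf{Sign},\mathsf{Ver})$ be a digital signature scheme with message space $\{0,1\}^{u+1}$. Here $\mathsf{Gen}(1^\lambda)\to(k,\mathsf{vk})$ is probabilistic polynomial time, $\mathsf{Sign}$ and $\mathsf{Ver}$ are deterministic polynomial time, and for fixed $\lambda$ keys and signatures have fixed lengths that are computable in time $\mathrm{poly}(\lambda)$. Assume that the scheme is correct (there is a negligible $\varepsilon$ such that, for every $\lambda$ and every message $m$, $\Pr[\mathsf{Ver}(\mathsf{vk},m,\mathsf{Sign}(k,m))=\top]\ge 1-\varepsilon(\lambda)$) and strongly EUF-CMA secure: every quantum polynomial-time (QPT) adversary that is given $\mathsf{vk}$ and classical query access to $\mathsf{Sign}(k,\cdot)$ outputs only with negligible probability a pair $(m^*,\sigma^*)$ with $\mathsf{Ver}(\mathsf{vk},m^*,\sigma^*)=\top$ that is not one of the message-signature pairs returned by the oracle. (QPT means: polynomial-size quantum circuits, followed by measurements, whose descriptions are generated from $1^\lambda$ in polynomial time.) Consider the following quantum public-key encryption scheme with message space $\{0,1\}$.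 * $\mathsf{SKGen}(1^\lambda)$: run $(k,\mathsf{vk})\leftarrow\mathsf{Gen}(1^\lambda)$ and output the secret key $\mathsf{sk}=k$ and the verification key $\mathsf{vk}$. * $\mathsf{PKGen}(\mathsf{sk})$: choose $r\leftarrow\{0,1\}^u$ uniformly and output $\mathsf{pk}=(r,|\psi_r\rangle)$, where $|\psi_r\rangle=\frac1{\sqrt2}\big(|0\rangle_{\mathbf A}|\mathsf{Sign}(k,0\|r)\rangle_{\mathbf B}+|1\rangle_{\mathbf A}|\mathsf{Sign}(k,1\|r)\rangle_{\mathbf B}\big)$. * $\mathsf{Enc}(\mathsf{vk},\mathsf{pk},b)$: parse $\mathsf{pk}=(r,\rho)$ with $r$ classical and $\rho$ a state of $(\mathbf A,\mathbf B)$. Compute $\mathsf{Ver}(\mathsf{vk},\alpha\|r,\beta)$ coherently on the basis states $|\alpha\rangle_{\mathbf A}|\beta\rangle_{\mathbf B}$ and measure the result. If it is $\bot$, output $\mathsf{ct}=\bot$. Otherwise apply $Z^b$ to $\mathbf A$, measure all qubits of $(\mathbf A,\mathbf B)$ in the Hadamard basis with result $d$, and output $\mathsf{ct}=(r,d)$.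 * $\mathsf{Dec}(\mathsf{sk},\mathsf{ct})$: if $\mathsf{ct}=\bot$, output $\bot$; if $\mathsf{ct}=(r,d)$, output $d\cdot\big(0\|\mathsf{Sign}(k,0\|r)\ \oplus\ 1\|\mathsf{Sign}(k,1\|r)\big)$, the inner product being modulo $2$. Then $\mathsf{SKGen}$ is probabilistic polynomial time, $\mathsf{PKGen}$ and $\mathsf{Enc}$ are QPT, $\mathsf{Dec}$ is deterministic polynomial time, and the following hold. 1. Correctness: there is a negligible $\varepsilon$ such that, for all $\lambda$ and $b\in\{0,1\}$, $\Pr[\mathsf{Dec}(\mathsf{sk},\mathsf{ct})=b]\ge1-\varepsilon(\lambda)$, where $(\mathsf{sk},\mathsf{vk})\leftarrow\mathsf{SKGen}(1^\lambda)$, $\mathsf{pk}\leftarrow\mathsf{PKGen}(\mathsf{sk})$, $\mathsf{ct}\leftarrow\mathsf{Enc}(\mathsf{vk},\mathsf{pk},b)$. 2. IND-pkT-CPA security: for every polynomial $m$ and every QPT adversary $\mathcal A$ there is a negligible $\varepsilon$ such that, for all $\lambda$, $\mathcal A$ wins the following game with probability at most $\frac12+\varepsilon(\lambda)$. Sample $(\mathsf{sk},\mathsf{vk})\leftarrow\mathsf{SKGen}(1^\lambda)$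 and independent $\mathsf{pk}_1,\dots,\mathsf{pk}_m\leftarrow\mathsf{PKGen}(\mathsf{sk})$. Given $(\mathsf{vk},\mathsf{pk}_1,\dots,\mathsf{pk}_m)$, $\mathcal A$ outputs a public key register $\mathsf{pk}'$, messages $\mathsf{msg}_0,\mathsf{msg}_1$, and an internal quantum state $\mathsf{st}$, which may be entangled with $\mathsf{pk}'$. Sample $b\leftarrow\{0,1\}$ and $\mathsf{ct}^*\leftarrow\mathsf{Enc}(\mathsf{vk},\mathsf{pk}',\mathsf{msg}_b)$. Given $(\mathsf{ct}^*,\mathsf{st})$, $\mathcal A$ outputs a bit, and wins if it equals $b$. -/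

import Mathlib

open scoped Matrix

namespace PkT

/-! ## Bit strings, negligible functions, averages -/

/-- The set `{0,1}^n`. -/
abbrev Bits (n : ℕ) : Type := Fin n → Bool

/-- The first `a` bits of a string of length `a + b`. -/
def Bits.left {a b : ℕ} (x : Bits (a + b)) : Bits a := fun i => x (Fin.castAdd b i)

/-- The last `b` bits of a string of length `a + b`. -/
def Bits.right {a b : ℕ} (x : Bits (a + b)) : Bits b := fun i => x (Fin.natAdd a i)

/-- The inner product modulo 2 of two bit strings. -/
def Bits.dot {n : ℕ} (x y : Bits n) : Bool :=
  decide (Odd (Finset.univ.filter fun i => x i = true ∧ y i = true).card)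

/-- Bitwise exclusive or. -/
def Bits.xor {n : ℕ} (x y : Bits n) : Bits n := fun i => Bool.xor (x i) (y i)

/-- The expectation of `F` over a uniformly random string of `t` bits. -/
noncomputable def avg {t : ℕ} (F : Bits t → ℝ) : ℝ := (∑ ω, F ω) / 2 ^ t

/-- `ε(n) = n^{-ω(1)}`. -/
def Negligible (ε : ℕ → ℝ) : Prop :=
  Asymptotics.SuperpolynomialDecay Filter.atTop (fun n : ℕ => (n : ℝ)) ε

/-! ## A classical machine model with a step count

Programs work on binary trees (LISP data).  A program transforms one tree; it can build and take
apart pairs, branch on whether a computed tree is the empty tree, and loop while a computed tree is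
not empty.  Every operation costs one step.  This is the language WHILE in combinator form; its
polynomial time is polynomial time on Turing machines. -/

/-- Binary trees. -/
inductive Data : Type
  | nil : Data
  | cons : Data → Data → Data

/-- Natural numbers in unary. -/
def Data.ofNat : ℕ → Data
  | 0 => .nil
  | n + 1 => .cons .nil (Data.ofNat n)

/-- Lists of trees. -/
def Data.ofList : List Data → Data
  | [] => .nil
  | d :: l => .cons d (Data.ofList l)

/-- First component of a tree, `nil` for the empty tree. -/
def Data.fst : Data → Data
  | .nil => .nil
  | .cons a _ => a

/-- Second component of a tree, `nil` for the empty tree. -/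
def Data.snd : Data → Data
  | .nil => .nil
  | .cons _ b => b

/-- Programs. -/
inductive Prog : Type
  | id : Prog
  | nil : Prog
  | fst : Prog
  | snd : Prog
  | pair (f g : Prog) : Prog
  | comp (f g : Prog) : Prog
  /-- If the result of `c` is not `nil` then run `f`, else run `g`. -/
  | ite (c f g : Prog) : Prog
  /-- While the result of `c` is not `nil`, run `f`. -/
  | loop (c f : Prog) : Prog

/-- `P.Runs x y t`: started on `x`, the program `P` halts with result `y` after `t` steps. -/
inductive Prog.Runs : Prog → Data → Data → ℕ → Prop
  | id (x : Data) : Runs .id x x 1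
  | nil (x : Data) : Runs .nil x .nil 1
  | fst (x : Data) : Runs .fst x x.fst 1
  | snd (x : Data) : Runs .snd x x.snd 1
  | pair {f g : Prog} {x y z : Data} {s t : ℕ} (hf : Runs f x y s) (hg : Runs g x z t) :
      Runs (.pair f g) x (.cons y z) (s + t + 1)
  | comp {f g : Prog} {x y z : Data} {s t : ℕ} (hg : Runs g x y s) (hf : Runs f y z t) :
      Runs (.comp f g) x z (s + t + 1)
  | iteTrue {c f g : Prog} {x y a b : Data} {s t : ℕ} (hc : Runs c x (.cons a b) s)
      (hf : Runs f x y t) : Runs (.ite c f g) x y (s + t + 1)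
  | iteFalse {c f g : Prog} {x y : Data} {s t : ℕ} (hc : Runs c x .nil s)
      (hg : Runs g x y t) : Runs (.ite c f g) x y (s + t + 1)
  | loopDone {c f : Prog} {x : Data} {s : ℕ} (hc : Runs c x .nil s) :
      Runs (.loop c f) x x (s + 1)
  | loopStep {c f : Prog} {x y z a b : Data} {s t r : ℕ} (hc : Runs c x (.cons a b) s)
      (hf : Runs f x y t) (hl : Runs (.loop c f) y z r) : Runs (.loop c f) x z (s + t + r + 1)

/-- The sequence `F` is generated, on input `1^n`, in time polynomial in `n`. -/
def PolyTimeGenerated (F : ℕ → Data) : Prop :=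
  ∃ (P : Prog) (p : Polynomial ℕ), ∀ n : ℕ, ∃ t : ℕ, t ≤ p.eval n ∧ P.Runs (Data.ofNat n) (F n) t

/-- A length parameter that is computable in polynomial time from `1^n` (in unary, so that it is
also polynomially bounded). -/
def PolyTimeLength (f : ℕ → ℕ) : Prop := PolyTimeGenerated fun n => Data.ofNat (f n)

/-! ## Quantum circuits -/

/-- The elementary gates on `N` qubits: NOT, controlled NOT, Toffoli, Hadamard, `T` and `T†`. -/
inductive Gate (N : ℕ) : Type
  | x (i : Fin N) : Gate N
  | cx (i j : Fin N) (hij : i ≠ j) : Gate N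
  | ccx (i j k : Fin N) (hij : i ≠ j) (hik : i ≠ k) (hjk : j ≠ k) : Gate N
  | h (i : Fin N) : Gate N
  | t (i : Fin N) : Gate N
  | tdg (i : Fin N) : Gate N

/-- Flip the bit at position `j` if `c` holds. -/
def flipIf {N : ℕ} (c : Bool) (j : Fin N) (x : Bits N) : Bits N :=
  Function.update x j (Bool.xor (x j) c)

/-- The matrix of a permutation of the computational basis. -/
def basisMap {N : ℕ} (π : Bits N → Bits N) : Matrix (Bits N) (Bits N) ℂ :=
  fun x y => if x = π y then 1 else 0

/-- The unitary matrix of a gate. -/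
noncomputable def Gate.mat {N : ℕ} : Gate N → Matrix (Bits N) (Bits N) ℂ
  | .x i => basisMap fun y => flipIf true i y
  | .cx i j _ => basisMap fun y => flipIf (y i) j y
  | .ccx i j k _ _ _ => basisMap fun y => flipIf (y i && y j) k y
  | .h i => fun x y =>
      if ∀ j, j ≠ i → x j = y j then
        ((Real.sqrt 2 : ℝ) : ℂ)⁻¹ * (if x i = true ∧ y i = true then -1 else 1)
      else 0
  | .t i => Matrix.diagonal fun x => if x i = true then Complex.exp (Real.pi / 4 * Complex.I) else 1
  | .tdg i =>
      Matrix.diagonal fun x => if x i = true then Complex.exp (-(Real.pi / 4 * Complex.I)) else 1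

/-- The gates that permute the computational basis. -/
def Gate.IsClassical {N : ℕ} : Gate N → Prop
  | .x _ => True
  | .cx _ _ _ => True
  | .ccx _ _ _ _ _ _ => True
  | .h _ => False
  | .t _ => False
  | .tdg _ => False

/-- A list of wires as a tree. -/
def Data.ofWires {N : ℕ} (l : List (Fin N)) : Data := Data.ofList (l.map fun i => Data.ofNat i)

/-- The description of a gate: its kind and its wires. -/
def Gate.encode {N : ℕ} : Gate N → Data
  | .x i => .cons (Data.ofNat 0) (Data.ofWires [i])
  | .cx i j _ => .cons (Data.ofNat 1) (Data.ofWires [i, j])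
  | .ccx i j k _ _ _ => .cons (Data.ofNat 2) (Data.ofWires [i, j, k])
  | .h i => .cons (Data.ofNat 3) (Data.ofWires [i])
  | .t i => .cons (Data.ofNat 4) (Data.ofWires [i])
  | .tdg i => .cons (Data.ofNat 5) (Data.ofWires [i])

/-- The unitary of a list of gates, the head of the list being applied first. -/
noncomputable def gatesMat {N : ℕ} : List (Gate N) → Matrix (Bits N) (Bits N) ℂ
  | [] => 1
  | g :: gs => gatesMat gs * g.mat

/-- A quantum circuit with `a` input and `b` output qubits.  It starts with the input and `anc`
ancilla qubits in the state `|0⟩`, applies its gates, and ends with the output qubits followed by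
`rest` further qubits. -/
structure QCircuit (a b : ℕ) where
  anc : ℕ
  rest : ℕ
  size_eq : b + rest = a + anc
  gates : List (Gate (a + anc))

/-- The isometry computed by a circuit, from the input qubits to the pair (output, rest). -/
noncomputable def QCircuit.iso {a b : ℕ} (C : QCircuit a b) :
    Matrix (Bits b × Bits C.rest) (Bits a) ℂ :=
  fun y x =>
    gatesMat C.gates (fun i => Fin.append y.1 y.2 (Fin.cast C.size_eq.symm i))
      (Fin.append x fun _ => false)

/-- The description of a circuit: its number of ancillas and its gates. -/
def QCircuit.encode {a b : ℕ} (C : QCircuit a b) : Data :=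
  .cons (Data.ofNat C.anc) (Data.ofList (C.gates.map Gate.encode))

/-- Quantum polynomial time: a family of circuits, one for each security parameter, whose
descriptions are generated in polynomial time from `1^n`. -/
def QPT {a b : ℕ → ℕ} (C : ∀ n, QCircuit (a n) (b n)) : Prop :=
  PolyTimeGenerated fun n => (C n).encode

/-- `C` is a classical (reversible) circuit that computes `f`. -/
def QCircuit.Computes {a b : ℕ} (C : QCircuit a b) (f : Bits a → Bits b) : Prop :=
  (∀ g ∈ C.gates, g.IsClassical) ∧ ∀ x, ∃ c, C.iso (f x, c) x = 1

/-- Classical deterministic polynomial time, for functions on strings whose lengths are determined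
by the security parameter: a uniform family of polynomial-size classical circuits. -/
def DetPolyTime {a b : ℕ → ℕ} (f : ∀ n, Bits (a n) → Bits (b n)) : Prop :=
  ∃ C : ∀ n, QCircuit (a n) (b n), QPT C ∧ ∀ n, (C n).Computes (f n)

/-! ## Digital signatures -/

/-- The algorithms of a digital signature scheme for messages in `{0,1}^{msgLen n}`, with a
deterministic signing algorithm.  `gen` is a probabilistic algorithm, `coins` being the number of
its random bits; it returns the signing key and the verification key. -/
structure SigScheme (msgLen : ℕ → ℕ) where
  coins : ℕ → ℕ
  skLen : ℕ → ℕ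
  vkLen : ℕ → ℕ
  sigLen : ℕ → ℕ
  gen : ∀ n, Bits (coins n) → Bits (skLen n) × Bits (vkLen n)
  sign : ∀ n, Bits (skLen n) → Bits (msgLen n) → Bits (sigLen n)
  ver : ∀ n, Bits (vkLen n) → Bits (msgLen n) → Bits (sigLen n) → Bool

/-- All algorithms of the signature scheme run in polynomial time. -/
def SigScheme.Efficient {msgLen : ℕ → ℕ} (S : SigScheme msgLen) : Prop :=
  (PolyTimeLength msgLen ∧ PolyTimeLength S.coins ∧ PolyTimeLength S.skLen ∧
      PolyTimeLength S.vkLen ∧ PolyTimeLength S.sigLen) ∧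
    DetPolyTime (fun n ω => Fin.append (S.gen n ω).1 (S.gen n ω).2) ∧
    DetPolyTime (a := fun n => S.skLen n + msgLen n) (fun n x => S.sign n x.left x.right) ∧
    DetPolyTime (a := fun n => S.vkLen n + msgLen n + S.sigLen n) (b := fun _ => 1)
      (fun n x _ => S.ver n x.left.left x.left.right x.right)

/-- Honestly generated signatures are accepted, except with negligible probability. -/
def SigScheme.Correct {msgLen : ℕ → ℕ} (S : SigScheme msgLen) : Prop :=
  ∃ ε, Negligible ε ∧ ∀ n (m : Bits (msgLen n)),
    1 - ε n ≤ avg fun ω =>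
      if S.ver n (S.gen n ω).2 m (S.sign n (S.gen n ω).1 m) = true then 1 else 0

/-- A step of an oracle circuit on `N` qubits: a gate, or a classical oracle query.  In
`query c q a`, the wires `c` and `q` are measured; if the result of `c` is 1, then the oracle is
queried on the result of `q` and its answer is added (exclusive or) to the wires `a`. -/
inductive OracleOp (N qLen aLen : ℕ) : Type
  | gate (g : Gate N) : OracleOp N qLen aLen
  | query (c : Fin N) (q : Fin qLen → Fin N) (a : Fin aLen → Fin N) : OracleOp N qLen aLen

/-- The description of a step of an oracle circuit. -/
def OracleOp.encode {N qLen aLen : ℕ} : OracleOp N qLen aLen → Data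
  | .gate g => .cons .nil g.encode
  | .query c q a => .cons (Data.ofNat 1)
      (.cons (Data.ofNat c) (.cons (Data.ofWires (List.ofFn q)) (Data.ofWires (List.ofFn a))))

/-- Add the string `s` to the wires `a` of the basis state `x`. -/
def xorInto {N aLen : ℕ} (a : Fin aLen → Fin N) (s : Bits aLen) (x : Bits N) : Bits N :=
  fun i => Bool.xor (x i) (decide (∃ j, a j = i ∧ s j = true))

/-- Run an oracle circuit with oracle `O` from the (unnormalized) state `ψ` and the set `Q` of
query-answer pairs obtained so far, measure all wires at the end, and return the probability that
`win` holds of the final set of query-answer pairs and the measured string. -/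
noncomputable def runOracle {N qLen aLen : ℕ} (O : Bits qLen → Bits aLen)
    (win : Finset (Bits qLen × Bits aLen) → Bits N → Bool) :
    List (OracleOp N qLen aLen) → (Bits N → ℂ) → Finset (Bits qLen × Bits aLen) → ℝ
  | [], ψ, Q => ∑ x, if win Q x = true then ‖ψ x‖ ^ 2 else 0
  | .gate g :: ops, ψ, Q => runOracle O win ops (g.mat *ᵥ ψ) Q
  | .query c q a :: ops, ψ, Q =>
      runOracle O win ops (fun x => if x c = true then 0 else ψ x) Q +
        ∑ m : Bits qLen,
          runOracle O win ops
            (fun x =>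
              if xorInto a (O m) x c = true ∧ (fun j => xorInto a (O m) x (q j)) = m then
                ψ (xorInto a (O m) x)
              else 0)
            (insert (m, O m) Q)

/-- An adversary against a signature scheme, for one security parameter: an oracle circuit on the
verification key and `anc` ancillas, with the wires that hold its output message and signature. -/
structure Forger (vkLen msgLen sigLen : ℕ) where
  anc : ℕ
  ops : List (OracleOp (vkLen + anc) msgLen sigLen)
  outMsg : Fin msgLen → Fin (vkLen + anc)
  outSig : Fin sigLen → Fin (vkLen + anc)

/-- The description of a forger. -/
def Forger.encode {v m s : ℕ} (F : Forger v m s) : Data :=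
  .cons (Data.ofNat F.anc)
    (.cons (Data.ofList (F.ops.map OracleOp.encode))
      (.cons (Data.ofWires (List.ofFn F.outMsg)) (Data.ofWires (List.ofFn F.outSig))))

/-- The probability that the forger, given `vk` and classical access to the signing oracle, outputs
a message-signature pair that is accepted and was not returned by the oracle. -/
noncomputable def Forger.winProb {v m s : ℕ} (F : Forger v m s) (sign : Bits m → Bits s)
    (ver : Bits m → Bits s → Bool) (vk : Bits v) : ℝ :=
  runOracle sign
    (fun Q x =>
      decide (((fun j => x (F.outMsg j)), (fun j => x (F.outSig j))) ∉ Q) &&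
        ver (fun j => x (F.outMsg j)) (fun j => x (F.outSig j)))
    F.ops (Pi.single (Fin.append vk fun _ => false) 1) ∅

/-- Strong existential unforgeability under chosen message attacks, against quantum polynomial-time
adversaries with classical access to the signing oracle. -/
def SigScheme.StrongEUFCMA {msgLen : ℕ → ℕ} (S : SigScheme msgLen) : Prop :=
  ∀ F : ∀ n, Forger (S.vkLen n) (msgLen n) (S.sigLen n),
    PolyTimeGenerated (fun n => (F n).encode) →
      Negligible fun n => avg fun ω =>
        (F n).winProb (S.sign n (S.gen n ω).1) (S.ver n (S.gen n ω).2) (S.gen n ω).2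

/-- A strong EUF-CMA secure digital signature scheme (with deterministic signing). -/
def SigScheme.StrongEUFCMASecure {msgLen : ℕ → ℕ} (S : SigScheme msgLen) : Prop :=
  S.Efficient ∧ S.Correct ∧ S.StrongEUFCMA

/-! ## Quantum public-key encryption -/

/-- The algorithms of a quantum public-key encryption scheme.
* `skGen` maps its random bits to the secret key and the verification key;
* `pkGen` returns the density matrix of the quantum public key;
* `enc vk msg` is a measurement of the public key register whose result is the (classical)
  ciphertext: `enc vk msg ct` is the POVM element of the result `ct`;
* `dec` returns a message or `none` (for `⊥`). -/
structure QPKE where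
  coins : ℕ → ℕ
  skLen : ℕ → ℕ
  vkLen : ℕ → ℕ
  pkLen : ℕ → ℕ
  msgLen : ℕ → ℕ
  ctLen : ℕ → ℕ
  skGen : ∀ n, Bits (coins n) → Bits (skLen n) × Bits (vkLen n)
  pkGen : ∀ n, Bits (skLen n) → Matrix (Bits (pkLen n)) (Bits (pkLen n)) ℂ
  enc : ∀ n, Bits (vkLen n) → Bits (msgLen n) → Bits (ctLen n) →
    Matrix (Bits (pkLen n)) (Bits (pkLen n)) ℂ
  dec : ∀ n, Bits (skLen n) → Bits (ctLen n) → Option (Bits (msgLen n))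

/-- A message or `⊥` as a bit string. -/
def encodeOption {l : ℕ} : Option (Bits l) → Bits (l + 1)
  | none => fun _ => false
  | some m => Fin.cons true m

/-- `skGen` is PPT, `pkGen` and `enc` are QPT, and `dec` is deterministic polynomial time.  The
quantum algorithms run a circuit and discard the qubits that are not output; the output of `enc` is
moreover measured. -/
def QPKE.Efficient (E : QPKE) : Prop :=
  (PolyTimeLength E.coins ∧ PolyTimeLength E.skLen ∧ PolyTimeLength E.vkLen ∧
      PolyTimeLength E.pkLen ∧ PolyTimeLength E.msgLen ∧ PolyTimeLength E.ctLen) ∧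
    DetPolyTime (fun n ω => Fin.append (E.skGen n ω).1 (E.skGen n ω).2) ∧
    (∃ C : ∀ n, QCircuit (E.skLen n) (E.pkLen n), QPT C ∧
      ∀ n sk p p', E.pkGen n sk p p' =
        ∑ c, (C n).iso (p, c) sk * star ((C n).iso (p', c) sk)) ∧
    (∃ C : ∀ n, QCircuit (E.vkLen n + E.msgLen n + E.pkLen n) (E.ctLen n), QPT C ∧
      ∀ n vk msg ct p' p, E.enc n vk msg ct p' p =
        ∑ c, star ((C n).iso (ct, c) (Fin.append (Fin.append vk msg) p')) *
          (C n).iso (ct, c) (Fin.append (Fin.append vk msg) p)) ∧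
    DetPolyTime (a := fun n => E.skLen n + E.ctLen n)
      (fun n x => encodeOption (E.dec n x.left x.right))

/-- The probability that `dec` recovers `msg` from an encryption of `msg` under an honest key. -/
noncomputable def QPKE.decProb (E : QPKE) (n : ℕ) (msg : Bits (E.msgLen n)) : ℝ :=
  avg fun ω : Bits (E.coins n) =>
    ∑ ct, if E.dec n (E.skGen n ω).1 ct = some msg then
      (Matrix.trace (E.enc n (E.skGen n ω).2 msg ct * E.pkGen n (E.skGen n ω).1)).re else 0

/-- Correctness. -/
def QPKE.Correct (E : QPKE) : Prop :=
  ∃ ε, Negligible ε ∧ ∀ n msg, 1 - ε n ≤ E.decProb n msg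

/-- An adversary for the public key tampering game in which `m n` public keys are given out.  From
`vk, pk₁, …, pk_m` the first stage produces a public key register, two messages, and a state, which
is what remains; from the ciphertext and the state the second stage produces a bit. -/
structure QPKE.Adversary (E : QPKE) (m : ℕ → ℕ) where
  first : ∀ n, QCircuit (E.vkLen n + m n * E.pkLen n)
    (E.pkLen n + (E.msgLen n + E.msgLen n))
  second : ∀ n, QCircuit (E.ctLen n + (first n).rest) 1

/-- Both stages are quantum polynomial time. -/
def QPKE.Adversary.IsQPT {E : QPKE} {m : ℕ → ℕ} (A : E.Adversary m) : Prop :=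
  QPT A.first ∧ QPT A.second

/-- The state `|vk⟩⟨vk| ⊗ ρ^{⊗ m}`. -/
noncomputable def keysState {v k : ℕ} (m : ℕ) (vk : Bits v) (ρ : Matrix (Bits k) (Bits k) ℂ) :
    Matrix (Bits (v + m * k)) (Bits (v + m * k)) ℂ :=
  fun x y =>
    if x.left = vk ∧ y.left = vk then
      ∏ i : Fin m, ρ (fun j => x.right (finProdFinEquiv (i, j)))
        (fun j => y.right (finProdFinEquiv (i, j)))
    else 0

/-- The probability that the adversary wins the game for the keys `sk, vk` and the challenge bit
`b`: the first stage is run; its messages are measured, with results `msg₀, msg₁`; the register of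
the public key is measured by `Enc(vk, ·, msg_b)`, with result `ct`, which leaves the state `τ`; the
second stage is run on `ct` and `τ`, and its output is measured. -/
noncomputable def QPKE.Adversary.winProb {E : QPKE} {m : ℕ → ℕ} (A : E.Adversary m) (n : ℕ)
    (sk : Bits (E.skLen n)) (vk : Bits (E.vkLen n)) (b : Bool) : ℝ :=
  let ρ := (A.first n).iso * keysState (m n) vk (E.pkGen n sk) * (A.first n).isoᴴ
  ∑ msg₀ : Bits (E.msgLen n), ∑ msg₁ : Bits (E.msgLen n), ∑ ct : Bits (E.ctLen n),
    let M := E.enc n vk (if b = true then msg₁ else msg₀) ct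
    let τ : Matrix (Bits (A.first n).rest) (Bits (A.first n).rest) ℂ := fun c c' =>
      ∑ p, ∑ p', M p' p *
        ρ (Fin.append p (Fin.append msg₀ msg₁), c) (Fin.append p' (Fin.append msg₀ msg₁), c')
    let ρ₁ : Matrix (Bits (E.ctLen n + (A.first n).rest)) (Bits (E.ctLen n + (A.first n).rest)) ℂ :=
      fun x y => if x.left = ct ∧ y.left = ct then τ x.right y.right else 0
    let ρ₂ := (A.second n).iso * ρ₁ * (A.second n).isoᴴ
    ∑ c, (ρ₂ ((fun _ => b), c) ((fun _ => b), c)).re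

/-- Indistinguishability against public key tampering chosen plaintext attacks. -/
def QPKE.INDpkTCPA (E : QPKE) : Prop :=
  ∀ (m : Polynomial ℕ) (A : E.Adversary fun n => m.eval n), A.IsQPT →
    ∃ ε, Negligible ε ∧ ∀ n,
      (avg fun ω : Bits (E.coins n) =>
        (A.winProb n (E.skGen n ω).1 (E.skGen n ω).2 false +
          A.winProb n (E.skGen n ω).1 (E.skGen n ω).2 true) / 2) ≤ 1 / 2 + ε n

/-! ## The construction

A public key consists of `u` qubits (for the classical string `r`), the qubit `A` and the register
`B`, in this order.  The basis state of all three is a string `x` with `x.left = r`,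
`x.right 0 = α` and `Fin.tail x.right = β`. -/

/-- The basis vector `|x⟩`. -/
noncomputable def ket {k : ℕ} (x : Bits k) : Bits k → ℂ := Pi.single x 1

/-- The state `|r⟩ ⊗ (|0⟩|σ₀⟩ + |1⟩|σ₁⟩)/√2`. -/
noncomputable def pkVec {u l : ℕ} (r : Bits u) (σ₀ σ₁ : Bits l) : Bits (u + (l + 1)) → ℂ :=
  ((Real.sqrt 2 : ℝ) : ℂ)⁻¹ •
    (ket (Fin.append r (Fin.cons false σ₀)) + ket (Fin.append r (Fin.cons true σ₁)))

/-- The projection onto the basis states `|r⟩|α⟩|β⟩` with `Ver(vk, α‖r, β) = ⊤`: the operator of the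
result `⊤` in the coherent check of the signature. -/
noncomputable def checkProj {u l : ℕ} (ver : Bits (u + 1) → Bits l → Bool) :
    Matrix (Bits (u + (l + 1))) (Bits (u + (l + 1))) ℂ :=
  Matrix.diagonal fun x =>
    if ver (Fin.cons (x.right 0) x.left) (Fin.tail x.right) = true then 1 else 0

/-- `Z^b` on the qubit `A`. -/
noncomputable def zPow {u l : ℕ} (b : Bool) :
    Matrix (Bits (u + (l + 1))) (Bits (u + (l + 1))) ℂ :=
  Matrix.diagonal fun x => if b = true ∧ x.right 0 = true then -1 else 1

/-- Hadamard gates on each of the last `k` qubits. -/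
noncomputable def hadamardRight {u k : ℕ} : Matrix (Bits (u + k)) (Bits (u + k)) ℂ :=
  fun x y =>
    if x.left = y.left then
      (((Real.sqrt 2 : ℝ) : ℂ)⁻¹) ^ k * (if x.right.dot y.right = true then -1 else 1)
    else 0

/-- Encryption.  The ciphertext `(r, d)` is the string `1‖r‖d`, and `⊥` is the string `0…0`. -/
noncomputable def encPOVM {u l : ℕ} (ver : Bits (u + 1) → Bits l → Bool) (b : Bool)
    (ct : Bits (u + (l + 1) + 1)) : Matrix (Bits (u + (l + 1))) (Bits (u + (l + 1))) ℂ :=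
  if ct 0 = true then
    let S := hadamardRight * zPow b * checkProj ver
    Sᴴ * Matrix.vecMulVec (ket (Fin.tail ct)) (star (ket (Fin.tail ct))) * S
  else if ct = fun _ => false then 1 - checkProj ver
  else 0

/-- Decryption: `d · (0‖σ₀ ⊕ 1‖σ₁)`, where `σ_α = Sign(k, α‖r)`. -/
def decBit {u l : ℕ} (sign : Bits (u + 1) → Bits l) (ct : Bits (u + (l + 1) + 1)) :
    Option (Bits 1) :=
  if ct 0 = true then
    let r : Bits u := Bits.left (Fin.tail ct : Bits (u + (l + 1)))
    let d : Bits (l + 1) := Bits.right (Fin.tail ct : Bits (u + (l + 1)))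
    some fun _ => d.dot (Bits.xor (Fin.cons false (sign (Fin.cons false r)))
      (Fin.cons true (sign (Fin.cons true r))))
  else none

/-- The quantum public-key encryption scheme, with one-bit messages, obtained from a signature
scheme for messages of `u + 1` bits. -/
noncomputable def QPKE.ofSig (u : ℕ → ℕ) (S : SigScheme fun n => u n + 1) : QPKE where
  coins := S.coins
  skLen := S.skLen
  vkLen := S.vkLen
  pkLen n := u n + (S.sigLen n + 1)
  msgLen _ := 1
  ctLen n := u n + (S.sigLen n + 1) + 1
  skGen := S.gen
  pkGen n k := ∑ r : Bits (u n), ((2 : ℂ) ^ u n)⁻¹ •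
    Matrix.vecMulVec (pkVec r (S.sign n k (Fin.cons false r)) (S.sign n k (Fin.cons true r)))
      (star (pkVec r (S.sign n k (Fin.cons false r)) (S.sign n k (Fin.cons true r))))
  enc n vk msg ct := encPOVM (S.ver n vk) (msg 0) ct
  dec n k ct := decBit (S.sign n k) ct

end PkT

set_option linter.unusedSectionVars false

namespace PkT

/-! ## Polynomial time functions on encoded types -/

/-! Security rests on a duality: to read the relative phase between `|0⟩|σ₀⟩` and `|1⟩|σ₁⟩` is to be
able to map one of these basis states to the other, and such a map forges a signature.

Conditioned on the strings `r`, the keys handed out are a pure state, a sum over the values `f` of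
the `m` qubits `A`. The challenge bit enters only through the sign that `Z` puts on the accepted
part with `A = 1`. Since the two outcomes of the second stage have total probability one, the
success probabilities for the two challenge bits add up to at most 1 plus four times the modulus of
one interference term between the accepted parts with `A = 0` and `A = 1` (`game_terms_le`). The
string `r` is published in the ciphertext, hence never interferes, and the term splits into blocks,
one for each `r`.

Unforgeability cuts these blocks down (`norm_interf_le_sum`). An accepted `A = 0` string must be one
of the honest strings for `0‖rᵢ`. Split the state by the value of the qubit `A` of the `i`-th key:
in the branch `A = 1` nobody has seen the signature of `0‖rᵢ`, in the branch `A = 0` nobody has seen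
that of `1‖rᵢ`, and by strong unforgeability no second signature of a message that has been signed
can be found. What remains is the interference of the honest string `x₀` from one branch with the
honest string `x₁` from the other. It is a matrix element `⟨x₀| U† P U |x₁⟩`, where `U` is Hadamard
followed by the second stage and `P` projects onto the output 1. A forger that has only the branch
`x₁` applies `U†(1 - 2P)U` and measures; since `x₀ ≠ x₁` the identity contributes nothing, and the
amplitude of `x₀` is `-2` times this matrix element (`swapAmp`, `norm_interf_le_swapAmp`,
`actL_swapGates`).

Both forgers have classical signing queries only, yet they must prepare superposed keys. They ask
for both signatures of every key except at most one; for that one they ask only for the signature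
belonging to the value of its qubit `A`, which thereby is measured. The exceptional key is guessed
with `κ` random bits, one guess standing for no exception, at a loss of `2 ^ κ ≤ 2 * m + 1`.
Deferring the measurements (`runOracle_eq`) turns this into one unitary computation, and
`le_winProb_forger` reads off the probability of forgery. Cauchy–Schwarz over `r` and over the coins
of `Gen` passes from norms to probabilities, and strings `r` with a collision have total weight at
most `m ^ 2 / 2 ^ u`, which is negligible because `u` grows faster than the logarithm
(`gameProb_le`, `ofSig_indpkTCPA`).

Correctness is a computation (`sum_pkAmp`): if both signatures verify, the amplitude of `d` is
proportional to a sum of two signs whose product is `(-1)` to the power `b + d · (0‖σ₀ ⊕ 1‖σ₁)`, so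
it vanishes for every `d` that would decrypt wrongly.

Efficiency requires actual circuits and actual programs that print them. Polynomial time functions
are closed under the usual constructions on lists and unary numbers, circuits are written on
structured wire types and numbered only at the end, and signatures are computed, copied and
uncomputed so that no garbage spoils coherence (`clL_copyBlock`). Qubits that are discarded while
holding a copy of a register act as a measurement of it; this yields the mixture over `r` in key
generation and the measurement in encryption. -/

/-- The height of a tree. -/
def Data.height : Data → ℕ
  | .nil => 0
  | .cons a b => max a.height b.height + 1

theorem Data.height_fst_le (d : Data) : d.fst.height ≤ d.height := by
  cases d <;> simp [Data.fst, Data.height]; omega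

theorem Data.height_snd_le (d : Data) : d.snd.height ≤ d.height := by
  cases d <;> simp [Data.snd, Data.height]; omega

/-- Only pairing builds anything, and it adds one level. So the running time bounds the height of
the output, which makes compositions polynomial. Height is the right measure rather than size:
pairing a tree with itself doubles the size in a constant number of steps. -/
theorem Prog.Runs.height_le {P : Prog} {x y : Data} {t : ℕ} (h : P.Runs x y t) :
    y.height ≤ x.height + t := by
  induction h with
  | id x => omega
  | nil x => simp [Data.height]
  | fst x => have := x.height_fst_le; omega
  | snd x => have := x.height_snd_le; omega
  | pair _ _ h1 h2 => simp only [Data.height]; omega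
  | comp _ _ h1 h2 => omega
  | iteTrue _ _ h1 h2 => omega
  | iteFalse _ _ h1 h2 => omega
  | loopDone _ h1 => omega
  | loopStep _ _ _ h1 h2 h3 => omega

@[simp] theorem Data.height_ofNat (n : ℕ) : (Data.ofNat n).height = n := by
  induction n with
  | zero => rfl
  | succ n ih => simp [Data.ofNat, Data.height, ih]

/-- Types whose elements are represented by trees. -/
class TreeCode (α : Type) where
  code : α → Data


instance : TreeCode Data := ⟨fun d => d⟩
instance : TreeCode ℕ := ⟨Data.ofNat⟩
instance {α β : Type} [TreeCode α] [TreeCode β] : TreeCode (α × β) :=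
  ⟨fun x => .cons (TreeCode.code x.1) (TreeCode.code x.2)⟩
instance {α : Type} [TreeCode α] : TreeCode (List α) :=
  ⟨fun l => Data.ofList (l.map TreeCode.code)⟩

section
variable {α β γ σ : Type} [TreeCode α] [TreeCode β] [TreeCode γ] [TreeCode σ]

/-- The height of the code of an element. -/
def codeHeight (x : α) : ℕ := (TreeCode.code x).height

@[simp] theorem codeHeight_nat (n : ℕ) : codeHeight n = n := Data.height_ofNat n

@[simp] theorem codeHeight_prod (x : α × β) :
    codeHeight x = max (codeHeight x.1) (codeHeight x.2) + 1 := rfl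

@[simp] theorem codeHeight_nil : codeHeight ([] : List α) = 0 := rfl

@[simp] theorem codeHeight_cons (a : α) (l : List α) :
    codeHeight (a :: l) = max (codeHeight a) (codeHeight l) + 1 := rfl

theorem length_le_codeHeight (l : List α) : l.length ≤ codeHeight l := by
  induction l with
  | nil => simp
  | cons a l ih => simp only [List.length_cons, codeHeight_cons]; omega

theorem codeHeight_le_of_mem {l : List α} {a : α} (h : a ∈ l) : codeHeight a ≤ codeHeight l := by
  induction l with
  | nil => simp at h
  | cons b l ih =>
    simp only [List.mem_cons] at h
    simp only [codeHeight_cons]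
    rcases h with rfl | h
    · omega
    · have := ih h; omega

theorem codeHeight_list_le {l : List α} {B : ℕ} (h : ∀ a ∈ l, codeHeight a ≤ B) :
    codeHeight l ≤ B + l.length := by
  induction l with
  | nil => simp
  | cons a l ih =>
    have h1 := ih fun b hb => h b (by simp [hb])
    have h2 := h a (by simp)
    simp only [codeHeight_cons, List.length_cons]
    omega

theorem eval_mono (p : Polynomial ℕ) {a b : ℕ} (h : a ≤ b) : p.eval a ≤ p.eval b := by
  rw [Polynomial.eval_eq_sum, Polynomial.eval_eq_sum]
  exact Finset.sum_le_sum fun i _ => Nat.mul_le_mul_left _ (Nat.pow_le_pow_left h i)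

/-- `f` is computed on the codes by a program whose number of steps is polynomial in the height of
its input. -/
@[fun_prop] def PolyTime (f : α → β) : Prop :=
  ∃ (P : Prog) (p : Polynomial ℕ), ∀ x, ∃ t : ℕ, t ≤ p.eval (codeHeight x) ∧
    P.Runs (TreeCode.code x) (TreeCode.code (f x)) t

theorem polyTimeGenerated_iff (F : ℕ → Data) : PolyTimeGenerated F ↔ PolyTime F := by
  simp only [PolyTimeGenerated, PolyTime, codeHeight_nat]
  rfl

theorem polyTimeLength_iff (f : ℕ → ℕ) : PolyTimeLength f ↔ PolyTime f := by
  simp only [PolyTimeLength, PolyTimeGenerated, PolyTime, codeHeight_nat]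
  rfl

namespace PolyTime

/-- Programs see only codes, so a value may be exchanged for any value of another type with the same
tree. This gives successor, list constructors and replication for free from pairing, and later
replaces gates by their descriptions. -/
theorem of_code_eq {f : α → β} {g : α → γ} (hf : PolyTime f)
    (h : ∀ x, TreeCode.code (f x) = TreeCode.code (g x)) : PolyTime g := by
  obtain ⟨P, p, hP⟩ := hf
  exact ⟨P, p, fun x => by simpa only [h] using hP x⟩

theorem codeHeight_le {f : α → β} (hf : PolyTime f) :
    ∃ p : Polynomial ℕ, ∀ x, codeHeight (f x) ≤ p.eval (codeHeight x) := by
  obtain ⟨P, p, hP⟩ := hf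
  refine ⟨Polynomial.X + p, fun x => ?_⟩
  obtain ⟨t, ht, hr⟩ := hP x
  have := hr.height_le
  simp only [Polynomial.eval_add, Polynomial.eval_X, codeHeight] at *
  omega

@[fun_prop] theorem id : PolyTime fun x : α => x :=
  ⟨.id, 1, fun x => ⟨1, by simp, .id _⟩⟩

@[fun_prop] theorem comp {g : β → γ} {f : α → β} (hg : PolyTime g) (hf : PolyTime f) :
    PolyTime fun x => g (f x) := by
  obtain ⟨q, hq⟩ := hf.codeHeight_le
  obtain ⟨P, p, hP⟩ := hf
  obtain ⟨Q, r, hQ⟩ := hg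
  refine ⟨.comp Q P, p + r.comp q + 1, fun x => ?_⟩
  obtain ⟨s, hs, h1⟩ := hP x
  obtain ⟨t, ht, h2⟩ := hQ (f x)
  refine ⟨s + t + 1, ?_, .comp h1 h2⟩
  have := eval_mono r (hq x)
  simp only [Polynomial.eval_add, Polynomial.eval_one, Polynomial.eval_comp]
  omega

@[fun_prop] theorem prodMk {f : α → β} {g : α → γ} (hf : PolyTime f) (hg : PolyTime g) :
    PolyTime fun x => (f x, g x) := by
  obtain ⟨P, p, hP⟩ := hf
  obtain ⟨Q, q, hQ⟩ := hg
  refine ⟨.pair P Q, p + q + 1, fun x => ?_⟩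
  obtain ⟨s, hs, h1⟩ := hP x
  obtain ⟨t, ht, h2⟩ := hQ x
  refine ⟨s + t + 1, ?_, .pair h1 h2⟩
  simp only [Polynomial.eval_add, Polynomial.eval_one]
  omega

theorem fst' : PolyTime (Prod.fst : α × β → α) := ⟨.fst, 1, fun x => ⟨1, by simp, .fst _⟩⟩

theorem snd' : PolyTime (Prod.snd : α × β → β) := ⟨.snd, 1, fun x => ⟨1, by simp, .snd _⟩⟩

@[fun_prop] theorem fst {f : α → β × γ} (hf : PolyTime f) : PolyTime fun x => (f x).1 :=
  comp fst' hf

@[fun_prop] theorem snd {f : α → β × γ} (hf : PolyTime f) : PolyTime fun x => (f x).2 :=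
  comp snd' hf

@[fun_prop] theorem const (b : β) : PolyTime fun _ : α => b := by
  suffices H : ∀ d : Data, ∃ (P : Prog) (c : ℕ), ∀ x, P.Runs x d c by
    obtain ⟨P, c, h⟩ := H (TreeCode.code b)
    exact ⟨P, Polynomial.C c, fun x => ⟨c, by simp, h _⟩⟩
  intro d
  induction d with
  | nil => exact ⟨.nil, 1, fun x => .nil x⟩
  | cons a b iha ihb =>
    obtain ⟨P, c, hP⟩ := iha
    obtain ⟨Q, d, hQ⟩ := ihb
    exact ⟨.pair P Q, c + d + 1, fun x => .pair (hP x) (hQ x)⟩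

@[fun_prop] theorem dataCons {f g : α → Data} (hf : PolyTime f) (hg : PolyTime g) :
    PolyTime fun x => Data.cons (f x) (g x) :=
  (prodMk hf hg).of_code_eq fun _ => rfl

@[fun_prop] theorem listCons {f : α → β} {g : α → List β} (hf : PolyTime f) (hg : PolyTime g) :
    PolyTime fun x => f x :: g x :=
  (prodMk hf hg).of_code_eq fun _ => rfl

@[fun_prop] theorem toData {f : α → β} (hf : PolyTime f) : PolyTime fun x => TreeCode.code (f x) :=
  hf.of_code_eq fun _ => rfl

@[fun_prop] theorem ofList {f : α → List Data} (hf : PolyTime f) :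
    PolyTime fun x => Data.ofList (f x) :=
  hf.of_code_eq fun x => by
    simp only [TreeCode.code]
    exact congrArg _ (List.map_id _)

@[fun_prop] theorem succ {f : α → ℕ} (hf : PolyTime f) : PolyTime fun x => f x + 1 :=
  (prodMk (const Data.nil) hf).of_code_eq fun _ => rfl

@[fun_prop] theorem pred {f : α → ℕ} (hf : PolyTime f) : PolyTime fun x => f x - 1 := by
  have h : PolyTime fun n : ℕ => n - 1 :=
    ⟨.snd, 1, fun n => ⟨1, by simp, by
      have := Prog.Runs.snd (Data.ofNat n)
      cases n <;> exact this⟩⟩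
  exact comp h hf

@[fun_prop] theorem tail {f : α → List β} (hf : PolyTime f) : PolyTime fun x => (f x).tail := by
  have h : PolyTime fun l : List β => l.tail :=
    ⟨.snd, 1, fun l => ⟨1, by simp, by
      have := Prog.Runs.snd (TreeCode.code l)
      cases l <;> exact this⟩⟩
  exact comp h hf

@[fun_prop] theorem ite_zero {c : α → ℕ} {f g : α → β} (hc : PolyTime c) (hf : PolyTime f)
    (hg : PolyTime g) : PolyTime fun x => if c x = 0 then f x else g x := by
  obtain ⟨C, r, hC⟩ := hc
  obtain ⟨P, p, hP⟩ := hf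
  obtain ⟨Q, q, hQ⟩ := hg
  refine ⟨.ite C Q P, r + p + q + 1, fun x => ?_⟩
  obtain ⟨w, hw, h0⟩ := hC x
  obtain ⟨s, hs, h1⟩ := hP x
  obtain ⟨t, ht, h2⟩ := hQ x
  simp only [Polynomial.eval_add, Polynomial.eval_one]
  rcases hcx : c x with _ | k
  · rw [hcx] at h0
    exact ⟨w + s + 1, by omega, by simpa using Prog.Runs.iteFalse h0 h1⟩
  · rw [hcx] at h0
    exact ⟨w + t + 1, by omega, by simpa using Prog.Runs.iteTrue h0 h2⟩

/-- The source of all loops. A bound on the accumulator after every prefix has to be assumed: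
iterating a polynomial time step may let the heights grow exponentially. -/
theorem foldl {f : α → List β} {g : α → σ} {step : α → σ → β → σ} (hf : PolyTime f)
    (hg : PolyTime g) (hstep : PolyTime fun p : α × σ × β => step p.1 p.2.1 p.2.2)
    (hB : ∃ q : Polynomial ℕ, ∀ x, ∀ l', l' <+: f x →
      codeHeight (l'.foldl (step x) (g x)) ≤ q.eval (codeHeight x)) :
    PolyTime fun x => (f x).foldl (step x) (g x) := by
  obtain ⟨q, hq⟩ := hB
  obtain ⟨S, s, hS⟩ := hstep
  obtain ⟨pf, hpf⟩ := hf.codeHeight_le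
  -- One round costs a call of `S` on a triple of bounded height (the 2 counts the two pairings) and
  -- some bookkeeping, for which 40 steps are ample.
  set bound : Polynomial ℕ :=
    s.comp (Polynomial.X + q + pf + 2) + 40 with hbound
  -- The loop state is the triple of parameter, remaining list and accumulator.
  set body : Prog := .pair .fst (.pair (.comp .snd (.comp .fst .snd))
    (.comp S (.pair .fst (.pair (.comp .snd .snd) (.comp .fst (.comp .fst .snd)))))) with hbody
  set cond : Prog := .comp .fst .snd with hcond
  -- Induction on the remaining list `l`, with the consumed prefix `l'` arbitrary, so that the
  -- assumed bound on accumulators applies in each round.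
  have key : ∀ x : α, ∀ l l' : List β, l' ++ l = f x → ∃ t : ℕ,
      t ≤ (l.length + 1) * bound.eval (codeHeight x) ∧
      (Prog.loop cond body).Runs
        (.cons (TreeCode.code x) (.cons (TreeCode.code l)
          (TreeCode.code (l'.foldl (step x) (g x)))))
        (.cons (TreeCode.code x) (.cons .nil
          (TreeCode.code ((f x).foldl (step x) (g x))))) t := by
    intro x l
    induction l with
    | nil =>
      intro l' hl
      rw [List.append_nil] at hl
      subst hl
      refine ⟨1 + 1 + 1 + 1, ?_, .loopDone ?_⟩
      · simp [hbound]
      · exact .comp (.snd _) (.fst _)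
    | cons b l ih =>
      intro l' hl
      obtain ⟨t, ht, hrun⟩ := ih (l' ++ [b]) (by simpa using hl)
      obtain ⟨w, hw, hwrun⟩ := hS (x, l'.foldl (step x) (g x), b)
      have h1 : codeHeight b ≤ pf.eval (codeHeight x) :=
        (codeHeight_le_of_mem (by rw [← hl]; simp)).trans (hpf x)
      have h2 := hq x l' ⟨b :: l, hl⟩
      have h3 : w ≤ s.eval (codeHeight x + q.eval (codeHeight x) + pf.eval (codeHeight x) + 2) := by
        refine hw.trans (eval_mono s ?_)
        simp only [codeHeight_prod]
        omega
      have hc : cond.Runs (.cons (TreeCode.code x) (.cons (TreeCode.code (b :: l))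
          (TreeCode.code (l'.foldl (step x) (g x))))) (TreeCode.code (b :: l)) (1 + 1 + 1) :=
        .comp (.snd _) (.fst _)
      have hb : ∃ r, r ≤ w + 30 ∧
          body.Runs (.cons (TreeCode.code x) (.cons (TreeCode.code (b :: l))
            (TreeCode.code (l'.foldl (step x) (g x)))))
            (.cons (TreeCode.code x) (.cons (TreeCode.code l)
            (TreeCode.code ((l' ++ [b]).foldl (step x) (g x))))) r := by
        rw [List.foldl_append]
        refine ⟨_, ?_, .pair (.fst _) (.pair (.comp (.comp (.snd _) (.fst _)) (.snd _))
          (.comp (.pair (.fst _) (.pair (.comp (.snd _) (.snd _))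
            (.comp (.comp (.snd _) (.fst _)) (.fst _)))) hwrun))⟩
        omega
      obtain ⟨r, hr, hb⟩ := hb
      refine ⟨_, ?_, .loopStep hc hb hrun⟩
      simp only [List.length_cons]
      have h4 : w + 40 ≤ bound.eval (codeHeight x) := by
        simp [hbound]; omega
      nlinarith
  have hfin : PolyTime fun x => (x, f x, g x) := prodMk id (prodMk hf hg)
  obtain ⟨I, i, hI⟩ := hfin
  refine ⟨.comp (.comp .snd .snd) (.comp (.loop cond body) I),
    i + (pf + 1) * bound + 10, fun x => ?_⟩
  obtain ⟨t0, ht0, hr0⟩ := hI x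
  obtain ⟨t, ht, hr⟩ := key x (f x) [] rfl
  refine ⟨_, ?_, .comp (.comp hr0 hr) (.comp (.snd _) (.snd _))⟩
  have h5 : ((f x).length + 1) * bound.eval (codeHeight x) ≤
      (pf.eval (codeHeight x) + 1) * bound.eval (codeHeight x) :=
    Nat.mul_le_mul_right _ (by have := length_le_codeHeight (f x); have := hpf x; omega)
  simp only [Polynomial.eval_add, Polynomial.eval_mul, Polynomial.eval_one,
    Polynomial.eval_ofNat]
  omega

end PolyTime
end
-- Polynomial time operations on lists and unary numbers.
section
variable {α β γ σ : Type} [TreeCode α] [TreeCode β] [TreeCode γ] [TreeCode σ]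

theorem foldl_cons_map {β γ : Type} (h : β → γ) (l : List β) (acc : List γ) :
    l.foldl (fun s b => h b :: s) acc = (l.map h).reverse ++ acc := by
  induction l generalizing acc with
  | nil => simp
  | cons b l ih => simp [ih]

theorem foldl_append_flatten {γ : Type} (l : List (List γ)) (acc : List γ) :
    l.foldl (fun s b => b ++ s) acc = l.reverse.flatten ++ acc := by
  induction l generalizing acc with
  | nil => simp
  | cons b l ih => simp [ih]

theorem foldl_replicate_iterate {β σ : Type} (f : σ → σ) (b : β) (n : ℕ) (s : σ) :
    (List.replicate n b).foldl (fun s _ => f s) s = f^[n] s := by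
  induction n generalizing s with
  | zero => rfl
  | succ n ih => simp [List.replicate_succ, ih]

namespace PolyTime

-- A fold that conses builds the list backwards, so a second fold reverses it.
@[fun_prop] theorem listMap {f : α → List β} {g : α → β → γ} (hf : PolyTime f)
    (hg : PolyTime fun p : α × β => g p.1 p.2) : PolyTime fun x => (f x).map (g x) := by
  -- Stated for any list of entries of `f x` that is not longer than `f x`, so that it bounds the
  -- intermediate accumulators of both passes.
  have bd : ∃ q : Polynomial ℕ, ∀ x, ∀ l : List β, (∀ b ∈ l, b ∈ f x) → l.length ≤ (f x).length →
      codeHeight (l.map (g x)) ≤ q.eval (codeHeight x) := by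
    obtain ⟨q, hq⟩ := hg.codeHeight_le
    obtain ⟨p, hp⟩ := hf.codeHeight_le
    refine ⟨q.comp (Polynomial.X + p + 1) + p, fun x l hl hlen => ?_⟩
    refine (codeHeight_list_le (B := (q.comp (Polynomial.X + p + 1)).eval (codeHeight x)) ?_).trans ?_
    · intro c hc
      obtain ⟨b, hb, rfl⟩ := List.mem_map.1 hc
      refine (hq (x, b)).trans ?_
      rw [Polynomial.eval_comp]
      refine eval_mono q ?_
      have := codeHeight_le_of_mem (hl b hb)
      have := hp x
      simp only [codeHeight_prod, Polynomial.eval_add, Polynomial.eval_X, Polynomial.eval_one]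
      omega
    · have := length_le_codeHeight (f x)
      have := hp x
      simp only [Polynomial.eval_add, List.length_map]
      omega
  have h1 : PolyTime fun x => (f x).foldl (fun s b => g x b :: s) [] := by
    refine foldl (step := fun x s b => g x b :: s) (g := fun _ => []) hf (const _) ?_ ?_
    · have : PolyTime fun p : α × List γ × β => g p.1 p.2.2 :=
        comp (g := fun p : α × β => g p.1 p.2) (f := fun p : α × List γ × β => (p.1, p.2.2)) hg
          (by fun_prop)
      fun_prop
    · obtain ⟨q, hq⟩ := bd
      refine ⟨q, fun x l hl => ?_⟩
      rw [foldl_cons_map, List.append_nil, ← List.map_reverse]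
      exact hq x _ (fun b hb => hl.subset (List.mem_reverse.1 hb))
        (by simpa using hl.length_le)
  have h2 : PolyTime fun x => ((f x).foldl (fun s b => g x b :: s) []).foldl
      (fun s b => b :: s) [] := by
    refine foldl (step := fun _ s b => b :: s) (g := fun _ => []) h1 (const _) (by fun_prop) ?_
    obtain ⟨q, hq⟩ := bd
    refine ⟨q, fun x l hl => ?_⟩
    rw [foldl_cons_map, List.append_nil, ← List.map_reverse, List.map_id']
    rw [foldl_cons_map, List.append_nil, ← List.map_reverse] at hl
    obtain ⟨l1, rfl⟩ : ∃ l1, l = List.map (g x) l1 := by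
      obtain ⟨l2, hl2⟩ := hl
      obtain ⟨a, b, -, h, -⟩ := List.map_eq_append_iff.1 hl2.symm
      exact ⟨a, h.symm⟩
    rw [← List.map_reverse]
    have hl' := hl.length_le
    obtain ⟨l2, hl2⟩ := hl
    obtain ⟨a, b, hab, h, -⟩ := List.map_eq_append_iff.1 hl2.symm
    rw [List.map_reverse, ← h, ← List.map_reverse]
    have ha : a <+: (f x).reverse := ⟨b, hab.symm⟩
    exact hq x _ (fun c hc => List.mem_reverse.1 (ha.subset (List.mem_reverse.1 hc)))
      (by simpa using ha.length_le)
  refine h2.of_code_eq fun x => ?_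
  rw [foldl_cons_map, foldl_cons_map]
  simp [Function.comp_def]

@[fun_prop] theorem listReverse {f : α → List β} (hf : PolyTime f) :
    PolyTime fun x => (f x).reverse := by
  have h2 : PolyTime fun x => (f x).foldl (fun s b => b :: s) [] := by
    refine foldl (step := fun _ s b => b :: s) (g := fun _ => []) hf (const _) (by fun_prop) ?_
    obtain ⟨q, hq⟩ := hf.codeHeight_le
    refine ⟨q + q, fun x l hl => ?_⟩
    rw [foldl_cons_map, List.append_nil, List.map_id']
    refine (codeHeight_list_le fun a ha =>
      codeHeight_le_of_mem (hl.subset (List.mem_reverse.1 ha))).trans ?_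
    have := hl.length_le
    have := length_le_codeHeight (f x)
    have := hq x
    simp only [Polynomial.eval_add, List.length_reverse]
    omega
  refine h2.of_code_eq fun x => ?_
  rw [foldl_cons_map]
  simp

@[fun_prop] theorem listAppend {f g : α → List β} (hf : PolyTime f) (hg : PolyTime g) :
    PolyTime fun x => f x ++ g x := by
  have h2 : PolyTime fun x => (f x).reverse.foldl (fun s b => b :: s) (g x) := by
    refine foldl (step := fun _ s b => b :: s) (g := g) (f := fun x => (f x).reverse)
      (by fun_prop) hg (by fun_prop) ?_
    obtain ⟨q, hq⟩ := hf.codeHeight_le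
    obtain ⟨p, hp⟩ := hg.codeHeight_le
    refine ⟨(q + p) + (q + p), fun x l hl => ?_⟩
    have h3 := hl.length_le
    have h4 := length_le_codeHeight (f x)
    have h5 := hq x
    have h6 := hp x
    have h7 := length_le_codeHeight (g x)
    rw [foldl_cons_map, List.map_id']
    refine (codeHeight_list_le (B := q.eval (codeHeight x) + p.eval (codeHeight x))
      fun a ha => ?_).trans ?_
    · rcases List.mem_append.1 ha with ha | ha
      · have := codeHeight_le_of_mem (List.mem_reverse.1 (hl.subset (List.mem_reverse.1 ha)))
        omega
      · have := codeHeight_le_of_mem ha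
        omega
    · simp only [Polynomial.eval_add, List.length_append, List.length_reverse] at *
      omega
  refine h2.of_code_eq fun x => ?_
  rw [foldl_cons_map]
  simp

@[fun_prop] theorem listFlatten {f : α → List (List β)} (hf : PolyTime f) :
    PolyTime fun x => (f x).flatten := by
  have h2 : PolyTime fun x => (f x).reverse.foldl (fun s b => b ++ s) [] := by
    refine foldl (step := fun _ s b => b ++ s) (g := fun _ => []) (f := fun x => (f x).reverse)
      (by fun_prop) (const _) (by fun_prop) ?_
    obtain ⟨q, hq⟩ := hf.codeHeight_le
    refine ⟨q + q * q, fun x l hl => ?_⟩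
    have h3 := hl.length_le
    have h4 := length_le_codeHeight (f x)
    have h5 := hq x
    have hmem : ∀ a ∈ l.reverse, codeHeight a ≤ q.eval (codeHeight x) := fun a ha =>
      (codeHeight_le_of_mem (List.mem_reverse.1 (hl.subset (List.mem_reverse.1 ha)))).trans h5
    rw [foldl_append_flatten, List.append_nil]
    refine (codeHeight_list_le (B := q.eval (codeHeight x)) fun a ha => ?_).trans ?_
    · obtain ⟨b, hb, hab⟩ := List.mem_flatten.1 ha
      exact (codeHeight_le_of_mem hab).trans (hmem b hb)
    · have h8 : ∀ L : List (List β), (∀ a ∈ L, codeHeight a ≤ q.eval (codeHeight x)) →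
          L.flatten.length ≤ L.length * q.eval (codeHeight x) := by
        intro L hL
        induction L with
        | nil => simp
        | cons a L ih =>
          have h9 := ih fun b hb => hL b (by simp [hb])
          have h10 := (length_le_codeHeight a).trans (hL a (by simp))
          simp only [List.flatten_cons, List.length_append, List.length_cons]
          linarith
      have h11 := h8 _ hmem
      have h12 : l.reverse.length * q.eval (codeHeight x) ≤
          q.eval (codeHeight x) * q.eval (codeHeight x) :=
        Nat.mul_le_mul_right _ (by simp only [List.length_reverse] at *; omega)
      simp only [Polynomial.eval_add, Polynomial.eval_mul]
      omega
  refine h2.of_code_eq fun x => ?_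
  rw [foldl_append_flatten]
  simp

@[fun_prop] theorem listReplicateNil {f : α → ℕ} (hf : PolyTime f) :
    PolyTime fun x => List.replicate (f x) Data.nil := by
  refine hf.of_code_eq fun x => ?_
  induction f x with
  | zero => rfl
  | succ n ih => exact congrArg (Data.cons Data.nil) ih

theorem iterate {k : α → ℕ} {g : α → σ} {step : α → σ → σ} (hk : PolyTime k)
    (hg : PolyTime g) (hstep : PolyTime fun p : α × σ => step p.1 p.2)
    (hB : ∃ q : Polynomial ℕ, ∀ x, ∀ i ≤ k x,
      codeHeight ((step x)^[i] (g x)) ≤ q.eval (codeHeight x)) :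
    PolyTime fun x => (step x)^[k x] (g x) := by
  have h : PolyTime fun x => (List.replicate (k x) Data.nil).foldl
      (fun s _ => step x s) (g x) := by
    refine foldl (step := fun x s (_ : Data) => step x s) (by fun_prop) hg ?_ ?_
    · exact comp (g := fun p : α × σ => step p.1 p.2)
        (f := fun p : α × σ × Data => (p.1, p.2.1)) hstep (by fun_prop)
    · obtain ⟨q, hq⟩ := hB
      refine ⟨q, fun x l hl => ?_⟩
      obtain ⟨hl1, hl2⟩ := List.prefix_replicate_iff.1 hl
      rw [hl2, foldl_replicate_iterate]
      exact hq x _ hl1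
  simpa only [foldl_replicate_iterate] using h

@[fun_prop] theorem add {f g : α → ℕ} (hf : PolyTime f) (hg : PolyTime g) :
    PolyTime fun x => f x + g x := by
  have h0 : ∀ i a : ℕ, (fun s => s + 1)^[i] a = a + i := by
    intro i
    induction i with
    | zero => simp
    | succ i ih => intro a; rw [Function.iterate_succ_apply, ih]; omega
  have h : PolyTime fun x => (fun s => s + 1)^[g x] (f x) := by
    refine iterate (step := fun _ s => s + 1) hg hf (by fun_prop) ?_
    obtain ⟨q, hq⟩ := hf.codeHeight_le
    obtain ⟨p, hp⟩ := hg.codeHeight_le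
    refine ⟨q + p, fun x i hi => ?_⟩
    have := hq x
    have := hp x
    simp only [h0, codeHeight_nat, Polynomial.eval_add] at *
    omega
  simpa only [h0] using h

@[fun_prop] theorem mul {f g : α → ℕ} (hf : PolyTime f) (hg : PolyTime g) :
    PolyTime fun x => f x * g x := by
  have h0 : ∀ b i a : ℕ, (fun s => s + b)^[i] a = a + b * i := by
    intro b i
    induction i with
    | zero => simp
    | succ i ih => intro a; rw [Function.iterate_succ_apply, ih]; ring
  have h : PolyTime fun x => (fun s => s + f x)^[g x] 0 := by
    refine iterate (step := fun x s => s + f x) hg (const 0) (by fun_prop) ?_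
    obtain ⟨q, hq⟩ := hf.codeHeight_le
    obtain ⟨p, hp⟩ := hg.codeHeight_le
    refine ⟨q * p, fun x i hi => ?_⟩
    have h1 := hq x
    have h2 := hp x
    simp only [h0, codeHeight_nat, Polynomial.eval_mul, zero_add] at *
    exact Nat.mul_le_mul h1 (hi.trans h2)
  simpa only [h0, zero_add] using h

@[fun_prop] theorem sub {f g : α → ℕ} (hf : PolyTime f) (hg : PolyTime g) :
    PolyTime fun x => f x - g x := by
  have h0 : ∀ i a : ℕ, (fun s => s - 1)^[i] a = a - i := by
    intro i
    induction i with
    | zero => simp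
    | succ i ih => intro a; rw [Function.iterate_succ_apply, ih]; omega
  have h : PolyTime fun x => (fun s => s - 1)^[g x] (f x) := by
    refine iterate (step := fun _ s => s - 1) hg hf (by fun_prop) ?_
    obtain ⟨q, hq⟩ := hf.codeHeight_le
    refine ⟨q, fun x i hi => ?_⟩
    have := hq x
    simp only [h0, codeHeight_nat] at *
    omega
  simpa only [h0] using h

@[fun_prop] theorem listRange {f : α → ℕ} (hf : PolyTime f) :
    PolyTime fun x => List.range (f x) := by
  have h0 : ∀ i : ℕ, (fun l : List ℕ => 0 :: l.map fun j => j + 1)^[i] [] = List.range i := by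
    intro i
    induction i with
    | zero => simp
    | succ i ih => rw [Function.iterate_succ_apply', ih, List.range_succ_eq_map]
  have h : PolyTime fun x => (fun l : List ℕ => 0 :: l.map fun j => j + 1)^[f x] [] := by
    refine iterate (step := fun _ (l : List ℕ) => 0 :: l.map fun j => j + 1) hf (const [])
      (by fun_prop) ?_
    obtain ⟨q, hq⟩ := hf.codeHeight_le
    refine ⟨q + q, fun x i hi => ?_⟩
    have h1 := hq x
    rw [h0]
    refine (codeHeight_list_le (B := i) fun a ha => ?_).trans ?_
    · rw [codeHeight_nat]
      exact (List.mem_range.1 ha).le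
    · simp only [List.length_range, Polynomial.eval_add, codeHeight_nat] at *
      omega
  simpa only [h0] using h

@[fun_prop] theorem listGetD {f : α → List ℕ} {g : α → ℕ} (hf : PolyTime f) (hg : PolyTime g) :
    PolyTime fun x => (f x).getD (g x) 0 := by
  have h0 : ∀ (i : ℕ) (l : List ℕ), List.tail^[i] l = l.drop i := by
    intro i
    induction i with
    | zero => simp
    | succ i ih => intro l; rw [Function.iterate_succ_apply, ih]; simp
  have h : PolyTime fun x => List.tail^[g x] (f x) := by
    refine iterate (step := fun _ (s : List ℕ) => s.tail) hg hf (by fun_prop) ?_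
    obtain ⟨q, hq⟩ := hf.codeHeight_le
    refine ⟨q + q, fun x i hi => ?_⟩
    have h1 := hq x
    rw [show (fun s : List ℕ => s.tail) = List.tail from rfl, h0]
    refine (codeHeight_list_le (B := codeHeight (f x)) fun a ha =>
      codeHeight_le_of_mem (List.mem_of_mem_drop ha)).trans ?_
    have h2 := length_le_codeHeight (f x)
    simp only [List.length_drop, Polynomial.eval_add]
    omega
  have h1 : PolyTime fun l : List ℕ => l.headD 0 :=
    ⟨.fst, 1, fun l => ⟨1, by simp, by
      have := Prog.Runs.fst (TreeCode.code l)
      cases l <;> exact this⟩⟩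
  refine (comp h1 h).of_code_eq fun x => ?_
  simp only [h0]
  congr 1
  simp [List.getD_eq_getElem?_getD, List.headD_eq_head?_getD]

theorem polynomialEval (p : Polynomial ℕ) : PolyTime fun n : ℕ => p.eval n := by
  induction p using Polynomial.induction_on' with
  | add p q hp hq => simp only [Polynomial.eval_add]; fun_prop
  | monomial k a =>
    simp only [Polynomial.eval_monomial]
    induction k with
    | zero => simp only [pow_zero]; fun_prop
    | succ k ih => simp only [pow_succ, ← mul_assoc]; fun_prop

@[fun_prop] theorem half {f : α → ℕ} (hf : PolyTime f) : PolyTime fun x => f x / 2 := by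
  -- Swapping the two counters while increasing one distributes the increments evenly; this halves
  -- without any comparison.
  have h0 : ∀ i : ℕ, (fun s : ℕ × ℕ => (s.2, s.1 + 1))^[i] (0, 0) = (i / 2, (i + 1) / 2) := by
    intro i
    induction i with
    | zero => simp
    | succ i ih => rw [Function.iterate_succ_apply', ih]; ext <;> simp; omega
  have h : PolyTime fun x => (fun s : ℕ × ℕ => (s.2, s.1 + 1))^[f x] (0, 0) := by
    refine iterate (step := fun _ (s : ℕ × ℕ) => (s.2, s.1 + 1)) hf (const _) (by fun_prop) ?_
    obtain ⟨q, hq⟩ := hf.codeHeight_le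
    refine ⟨q + 2, fun x i hi => ?_⟩
    have h1 := hq x
    simp only [h0, codeHeight_prod, codeHeight_nat, Polynomial.eval_add,
      Polynomial.eval_ofNat] at *
    omega
  simp only [h0] at h
  exact fst h

@[fun_prop] theorem parity {f : α → ℕ} (hf : PolyTime f) : PolyTime fun x => f x % 2 := by
  have h : PolyTime fun x => f x - 2 * (f x / 2) := by fun_prop
  refine h.of_code_eq fun x => ?_
  congr 1
  omega

-- Together with `parity` this computes binary digits, which determine the controls in the circuit
-- that selects a key.
@[fun_prop] theorem divPow {f g : α → ℕ} (hf : PolyTime f) (hg : PolyTime g) :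
    PolyTime fun x => f x / 2 ^ g x := by
  have h0 : ∀ i a : ℕ, (fun s => s / 2)^[i] a = a / 2 ^ i := by
    intro i
    induction i with
    | zero => simp
    | succ i ih => intro a; rw [Function.iterate_succ_apply, ih, Nat.div_div_eq_div_mul, pow_succ']
  have h : PolyTime fun x => (fun s => s / 2)^[g x] (f x) := by
    refine iterate (step := fun _ s => s / 2) hg hf (by fun_prop) ?_
    obtain ⟨q, hq⟩ := hf.codeHeight_le
    refine ⟨q, fun x i hi => ?_⟩
    have h1 := hq x
    simp only [h0, codeHeight_nat] at *
    exact (Nat.div_le_self _ _).trans h1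
  simpa only [h0] using h

-- Halve and count until zero. Since `a < 2 ^ a`, as many rounds as the unary number itself suffice,
-- and rounds after zero change nothing.
@[fun_prop] theorem natSize {f : α → ℕ} (hf : PolyTime f) : PolyTime fun x => Nat.size (f x) := by
  set st : ℕ × ℕ → ℕ × ℕ := fun s => (s.1 / 2, if s.1 = 0 then s.2 else s.2 + 1) with hst
  have hsz : ∀ a, a ≠ 0 → Nat.size a = Nat.size (a / 2) + 1 := by
    intro a ha
    conv_lhs => rw [← Nat.bit_bodd_div2 a]
    rw [Nat.size_bit (by rwa [Nat.bit_bodd_div2]), Nat.div2_val]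
  have h0 : ∀ i a c : ℕ, (st^[i] (a, c)).2 ≤ c + i := by
    intro i
    induction i with
    | zero => simp
    | succ i ih =>
      intro a c
      rw [Function.iterate_succ_apply]
      refine (ih _ _).trans ?_
      dsimp only
      split_ifs <;> omega
  have h0' : ∀ i a c : ℕ, (st^[i] (a, c)).1 ≤ a := by
    intro i
    induction i with
    | zero => simp
    | succ i ih =>
      intro a c
      rw [Function.iterate_succ_apply]
      exact (ih _ _).trans (Nat.div_le_self _ _)
  have h1 : ∀ i a c : ℕ, a < 2 ^ i → (st^[i] (a, c)).2 = c + Nat.size a := by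
    intro i
    induction i with
    | zero => intro a c ha; simp at ha; simp [ha]
    | succ i ih =>
      intro a c ha
      rw [Function.iterate_succ_apply]
      simp only [hst] at *
      rw [ih _ _ (by omega)]
      by_cases h : a = 0
      · simp [h]
      · rw [hsz a h]; simp [h]; omega
  have h : PolyTime fun x => st^[f x] (f x, 0) := by
    refine iterate (step := fun _ => st) hf (by fun_prop) (by simp only [hst]; fun_prop) ?_
    obtain ⟨q, hq⟩ := hf.codeHeight_le
    refine ⟨q + q + 1, fun x i hi => ?_⟩
    have h1 := hq x
    have h2 := h0 i (f x) 0
    have h3 := h0' i (f x) 0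
    simp only [codeHeight_prod, codeHeight_nat, Polynomial.eval_add, Polynomial.eval_one] at *
    omega
  refine (snd h).of_code_eq fun x => ?_
  rw [h1 _ _ _ Nat.lt_two_pow_self, zero_add]

end PolyTime
end
/-! ## Circuits on an arbitrary set of wires -/

/-- State vectors of qubits indexed by `ι`. -/
abbrev St (ι : Type) : Type := (ι → Bool) → ℂ

/-- The elementary gates on wires indexed by `ι`. -/
inductive QGate (ι : Type) : Type
  | x (i : ι) : QGate ι
  | cx (i j : ι) (hij : i ≠ j) : QGate ι
  | ccx (i j k : ι) (hij : i ≠ j) (hik : i ≠ k) (hjk : j ≠ k) : QGate ι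
  | h (i : ι) : QGate ι
  | t (i : ι) : QGate ι
  | tdg (i : ι) : QGate ι

section
variable {ι κ : Type} [DecidableEq ι] [DecidableEq κ]

/-- Flip the bit of wire `j` if `c` holds. -/
def flipAt (c : Bool) (j : ι) (x : ι → Bool) : ι → Bool :=
  Function.update x j (Bool.xor (x j) c)

theorem flipAt_self (c : Bool) (j : ι) (x : ι → Bool) : flipAt c j x j = Bool.xor (x j) c := by
  simp [flipAt]

theorem flipAt_of_ne {c : Bool} {i j : ι} (h : i ≠ j) (x : ι → Bool) : flipAt c j x i = x i := by
  simp [flipAt, h]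

theorem flipAt_flipAt (c : Bool) (j : ι) (x : ι → Bool) : flipAt c j (flipAt c j x) = x := by
  simp [flipAt]

/-- The action of the classical gates on basis states; the other gates are ignored. -/
def QGate.cl : QGate ι → (ι → Bool) → ι → Bool
  | .x i, y => flipAt true i y
  | .cx i j _, y => flipAt (y i) j y
  | .ccx i j k _ _ _, y => flipAt (y i && y j) k y
  | .h _, y => y
  | .t _, y => y
  | .tdg _, y => y

/-- The target differs from the controls, so the second application undoes the first. Hence pulling
a state vector back along `cl` is the same as permuting its basis states by it, and no inverses
appear in `QGate.act`. -/
theorem QGate.cl_involutive (g : QGate ι) : Function.Involutive g.cl := by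
  intro y
  cases g with
  | x i => exact flipAt_flipAt _ _ _
  | cx i j h => simp only [QGate.cl, flipAt_of_ne h, flipAt_flipAt]
  | ccx i j k h1 h2 h3 => simp only [QGate.cl, flipAt_of_ne h2, flipAt_of_ne h3, flipAt_flipAt]
  | h i => rfl
  | t i => rfl
  | tdg i => rfl

/-- The gates that permute the basis states. -/
def QGate.IsCl : QGate ι → Prop
  | .h _ => False
  | .t _ => False
  | .tdg _ => False
  | _ => True

/-- `1/√2`. -/
noncomputable def rt : ℂ := ((Real.sqrt 2 : ℝ) : ℂ)⁻¹

theorem rt_mul_rt : rt * rt = 1 / 2 := by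
  rw [rt, ← mul_inv, ← Complex.ofReal_mul, Real.mul_self_sqrt (by norm_num)]
  norm_num

theorem star_rt : star rt = rt := by
  simp only [rt, star_inv₀, RCLike.star_def, Complex.conj_ofReal]

/-- The action of a gate on state vectors. -/
noncomputable def QGate.act : QGate ι → St ι →ₗ[ℂ] St ι
  | .h i => rt • (LinearMap.funLeft ℂ ℂ (fun x => Function.update x i false) +
      LinearMap.mulLeft ℂ (fun x : ι → Bool => if x i = true then -1 else 1) ∘ₗ
        LinearMap.funLeft ℂ ℂ (fun x => Function.update x i true))
  | .t i => LinearMap.mulLeft ℂ (fun x : ι → Bool =>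
      if x i = true then Complex.exp (Real.pi / 4 * Complex.I) else 1)
  | .tdg i => LinearMap.mulLeft ℂ (fun x : ι → Bool =>
      if x i = true then Complex.exp (-(Real.pi / 4 * Complex.I)) else 1)
  | g => LinearMap.funLeft ℂ ℂ g.cl

theorem QGate.act_cl {g : QGate ι} (hg : g.IsCl) (ψ : St ι) (x : ι → Bool) :
    g.act ψ x = ψ (g.cl x) := by
  cases g <;> first | rfl | exact hg.elim

theorem QGate.act_h (i : ι) (ψ : St ι) (x : ι → Bool) :
    (QGate.h i).act ψ x = rt * (ψ (Function.update x i false) +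
      (if x i = true then -1 else 1) * ψ (Function.update x i true)) := rfl

theorem QGate.act_t (i : ι) (ψ : St ι) (x : ι → Bool) :
    (QGate.t i).act ψ x =
      (if x i = true then Complex.exp (Real.pi / 4 * Complex.I) else 1) * ψ x := rfl

theorem QGate.act_tdg (i : ι) (ψ : St ι) (x : ι → Bool) :
    (QGate.tdg i).act ψ x =
      (if x i = true then Complex.exp (-(Real.pi / 4 * Complex.I)) else 1) * ψ x := rfl

/-- The action of a list of gates, the head being applied first. -/
noncomputable def actL : List (QGate ι) → St ι →ₗ[ℂ] St ι
  | [] => LinearMap.id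
  | g :: gs => actL gs ∘ₗ g.act

@[simp] theorem actL_nil (ψ : St ι) : actL [] ψ = ψ := rfl

@[simp] theorem actL_cons (g : QGate ι) (gs : List (QGate ι)) (ψ : St ι) :
    actL (g :: gs) ψ = actL gs (g.act ψ) := rfl

theorem actL_append (gs hs : List (QGate ι)) (ψ : St ι) :
    actL (gs ++ hs) ψ = actL hs (actL gs ψ) := by
  induction gs generalizing ψ with
  | nil => rfl
  | cons g gs ih => simp [ih]

/-- The action of a list of classical gates on basis states. -/
def clL : List (QGate ι) → (ι → Bool) → ι → Bool
  | [], y => y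
  | g :: gs, y => clL gs (g.cl y)

@[simp] theorem clL_nil (y : ι → Bool) : clL [] y = y := rfl

@[simp] theorem clL_cons (g : QGate ι) (gs : List (QGate ι)) (y : ι → Bool) :
    clL (g :: gs) y = clL gs (g.cl y) := rfl

theorem clL_append (gs hs : List (QGate ι)) (y : ι → Bool) :
    clL (gs ++ hs) y = clL hs (clL gs y) := by
  induction gs generalizing y with
  | nil => rfl
  | cons g gs ih => simp [ih]

/-- Basis vectors. -/
noncomputable def bket [Fintype ι] (x : ι → Bool) : St ι := Pi.single x 1

theorem bket_apply [Fintype ι] (x y : ι → Bool) : bket x y = if y = x then 1 else 0 := by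
  simp [bket, Pi.single_apply]

theorem QGate.act_bket [Fintype ι] {g : QGate ι} (hg : g.IsCl) (x : ι → Bool) :
    g.act (bket x) = bket (g.cl x) := by
  funext y
  rw [QGate.act_cl hg, bket_apply, bket_apply]
  refine if_congr ⟨fun h => ?_, fun h => ?_⟩ rfl rfl
  · rw [← h, g.cl_involutive]
  · rw [h, g.cl_involutive]

theorem actL_bket [Fintype ι] {gs : List (QGate ι)} (hg : ∀ g ∈ gs, g.IsCl) (x : ι → Bool) :
    actL gs (bket x) = bket (clL gs x) := by
  induction gs generalizing x with
  | nil => rfl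
  | cons g gs ih =>
    rw [actL_cons, QGate.act_bket (hg g (by simp)), ih fun g hg' => hg g (by simp [hg']), clL_cons]

/-! ### Inverses and unitarity -/

/-- The inverse of a gate. -/
def QGate.inv : QGate ι → QGate ι
  | .t i => .tdg i
  | .tdg i => .t i
  | g => g

theorem QGate.act_inv_act (g : QGate ι) (ψ : St ι) : g.inv.act (g.act ψ) = ψ := by
  funext x
  have hcl : ∀ g : QGate ι, g.IsCl → g.act (g.act ψ) x = ψ x := fun g hg => by
    rw [act_cl hg, act_cl hg, g.cl_involutive]
  cases g with
  | x i => exact hcl _ trivial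
  | cx i j h => exact hcl _ trivial
  | ccx i j k h1 h2 h3 => exact hcl _ trivial
  | h i =>
    have h2 := rt_mul_rt
    simp only [QGate.inv, act_h, Function.update_self, Function.update_idem]
    cases hx : x i
    · rw [show Function.update x i false = x by rw [← hx, Function.update_eq_self]]
      simp
      linear_combination (2 * ψ x) * h2
    · rw [show Function.update x i true = x by rw [← hx, Function.update_eq_self]]
      simp
      linear_combination (2 * ψ x) * h2
  | t i =>
    simp only [QGate.inv, act_t, act_tdg]
    split_ifs
    · rw [← mul_assoc, ← Complex.exp_add]; simp
    · simp
  | tdg i =>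
    simp only [QGate.inv, act_t, act_tdg]
    split_ifs
    · rw [← mul_assoc, ← Complex.exp_add]; simp
    · simp

theorem QGate.inv_inv (g : QGate ι) : g.inv.inv = g := by cases g <;> rfl

theorem QGate.IsCl.inv {g : QGate ι} (hg : g.IsCl) : g.inv = g := by
  cases g <;> first | rfl | exact hg.elim

/-- The inverse of a list of gates. -/
def invL (gs : List (QGate ι)) : List (QGate ι) := (gs.map QGate.inv).reverse

theorem actL_invL_actL (gs : List (QGate ι)) (ψ : St ι) : actL (invL gs) (actL gs ψ) = ψ := by
  induction gs generalizing ψ with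
  | nil => rfl
  | cons g gs ih =>
    rw [invL, List.map_cons, List.reverse_cons, actL_append, actL_cons]
    change actL [g.inv] (actL (invL gs) (actL gs (g.act ψ))) = ψ
    rw [ih, actL_cons, actL_nil, QGate.act_inv_act]

theorem invL_invL (gs : List (QGate ι)) : invL (invL gs) = gs := by
  simp only [invL, List.map_reverse, List.map_map, List.reverse_reverse]
  rw [show (QGate.inv ∘ QGate.inv : QGate ι → QGate ι) = _root_.id from
    funext fun g => g.inv_inv, List.map_id]

theorem clL_invL_clL {gs : List (QGate ι)} (hg : ∀ g ∈ gs, g.IsCl) (y : ι → Bool) :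
    clL (invL gs) (clL gs y) = y := by
  induction gs generalizing y with
  | nil => rfl
  | cons g gs ih =>
    rw [invL, List.map_cons, List.reverse_cons, clL_append, clL_cons]
    change clL [g.inv] (clL (invL gs) (clL gs (g.cl y))) = y
    rw [ih (fun g hg' => hg g (by simp [hg'])), clL_cons, clL_nil, (hg g (by simp)).inv,
      g.cl_involutive]

theorem isCl_invL {gs : List (QGate ι)} (hg : ∀ g ∈ gs, g.IsCl) : ∀ g ∈ invL gs, g.IsCl := by
  intro g hg'
  simp only [invL, List.mem_reverse, List.mem_map] at hg'
  obtain ⟨g', h1, rfl⟩ := hg'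
  rw [(hg g' h1).inv]
  exact hg g' h1

/-- The inner product of state vectors. -/
noncomputable def ip {X : Type} [Fintype X] (φ ψ : X → ℂ) : ℂ := ∑ x, star (φ x) * ψ x

theorem QGate.ip_act [Fintype ι] (g : QGate ι) (φ ψ : St ι) :
    ip (g.act φ) (g.act ψ) = ip φ ψ := by
  have hcl : ∀ g : QGate ι, g.IsCl → ip (g.act φ) (g.act ψ) = ip φ ψ := fun g hg => by
    simp only [ip, act_cl hg]
    exact Equiv.sum_comp g.cl_involutive.toPerm fun x => star (φ x) * ψ x
  cases g with
  | x i => exact hcl _ trivial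
  | cx i j h => exact hcl _ trivial
  | ccx i j k h1 h2 h3 => exact hcl _ trivial
  | h i =>
    have h2 := rt_mul_rt
    -- Averaging over the flip of wire `i` groups the two basis states that the Hadamard gate mixes;
    -- on each such pair the identity is the unitarity of a 2 by 2 matrix.
    have hs : ∀ G : (ι → Bool) → ℂ, ∑ x, G x = 1 / 2 * ∑ x, (G x + G (flipAt true i x)) := by
      intro G
      have := Equiv.sum_comp (QGate.x i).cl_involutive.toPerm G
      rw [Finset.sum_add_distrib]
      simp only [Function.Involutive.coe_toPerm, QGate.cl] at this
      rw [this]; ring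
    simp only [ip]
    rw [hs fun x => star ((QGate.h i).act φ x) * (QGate.h i).act ψ x, hs fun x => star (φ x) * ψ x]
    congr 1
    refine Finset.sum_congr rfl fun x _ => ?_
    simp only [act_h, flipAt, Function.update_self, Function.update_idem, star_mul', star_add,
      star_rt]
    cases hx : x i
    · rw [show Function.update x i false = x by rw [← hx, Function.update_eq_self]]
      simp
      linear_combination (2 * ((starRingEnd ℂ) (φ x) * ψ x) + 2 *
        ((starRingEnd ℂ) (φ (Function.update x i true)) * ψ (Function.update x i true))) * h2
    · rw [show Function.update x i true = x by rw [← hx, Function.update_eq_self]]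
      simp
      linear_combination (2 * ((starRingEnd ℂ) (φ x) * ψ x) + 2 *
        ((starRingEnd ℂ) (φ (Function.update x i false)) * ψ (Function.update x i false))) * h2
  | t i =>
    simp only [ip, act_t, star_mul']
    refine Finset.sum_congr rfl fun x _ => ?_
    split_ifs
    · have : star (Complex.exp (Real.pi / 4 * Complex.I)) * Complex.exp (Real.pi / 4 * Complex.I)
          = 1 := by
        rw [RCLike.star_def, ← Complex.exp_conj, ← Complex.exp_add]
        simp [Complex.conj_ofNat]
      linear_combination (star (φ x) * ψ x) * this
    · simp
  | tdg i =>
    simp only [ip, act_tdg, star_mul']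
    refine Finset.sum_congr rfl fun x _ => ?_
    split_ifs
    · have : star (Complex.exp (-(Real.pi / 4 * Complex.I))) *
          Complex.exp (-(Real.pi / 4 * Complex.I)) = 1 := by
        rw [RCLike.star_def, ← Complex.exp_conj, ← Complex.exp_add]
        simp [Complex.conj_ofNat]
      linear_combination (star (φ x) * ψ x) * this
    · simp

theorem ip_actL [Fintype ι] (gs : List (QGate ι)) (φ ψ : St ι) :
    ip (actL gs φ) (actL gs ψ) = ip φ ψ := by
  induction gs generalizing φ ψ with
  | nil => rfl
  | cons g gs ih => rw [actL_cons, actL_cons, ih, QGate.ip_act]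

theorem ip_actL_right [Fintype ι] (gs : List (QGate ι)) (φ ψ : St ι) :
    ip φ (actL gs ψ) = ip (actL (invL gs) φ) ψ := by
  rw [← ip_actL (invL gs) φ, actL_invL_actL]

/-! ### Circuits on a part of the wires -/

/-- Rename the wires of a gate. -/
def QGate.map (e : ι ↪ κ) : QGate ι → QGate κ
  | .x i => .x (e i)
  | .cx i j hij => .cx (e i) (e j) (e.injective.ne hij)
  | .ccx i j k h1 h2 h3 =>
      .ccx (e i) (e j) (e k) (e.injective.ne h1) (e.injective.ne h2) (e.injective.ne h3)
  | .h i => .h (e i)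
  | .t i => .t (e i)
  | .tdg i => .tdg (e i)

theorem QGate.IsCl.map {e : ι ↪ κ} {g : QGate ι} (hg : g.IsCl) : (g.map e).IsCl := by
  cases g <;> trivial

theorem update_extend (e : ι ↪ κ) (y : ι → Bool) (x : κ → Bool) (i : ι) (b : Bool) :
    Function.update (Function.extend e y x) (e i) b =
      Function.extend e (Function.update y i b) x := by
  funext k
  by_cases hk : ∃ j, e j = k
  · obtain ⟨j, rfl⟩ := hk
    rw [e.injective.extend_apply]
    by_cases hj : j = i
    · subst hj; simp
    · rw [Function.update_of_ne (e.injective.ne hj), Function.update_of_ne hj,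
        e.injective.extend_apply]
  · rw [Function.extend_apply' _ _ _ hk, Function.update_of_ne (fun h => hk ⟨i, h.symm⟩),
      Function.extend_apply' _ _ _ hk]

theorem flipAt_extend (e : ι ↪ κ) (y : ι → Bool) (x : κ → Bool) (i : ι) (c : Bool) :
    flipAt c (e i) (Function.extend e y x) = Function.extend e (flipAt c i y) x := by
  rw [flipAt, update_extend, e.injective.extend_apply, flipAt]

theorem extend_comp_self (e : ι ↪ κ) (x : κ → Bool) : Function.extend e (x ∘ e) x = x := by
  funext k
  by_cases hk : ∃ j, e j = k
  · obtain ⟨j, rfl⟩ := hk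
    rw [e.injective.extend_apply]; rfl
  · rw [Function.extend_apply' _ _ _ hk]

theorem QGate.cl_map (e : ι ↪ κ) (g : QGate ι) (y : ι → Bool) (x : κ → Bool) :
    (g.map e).cl (Function.extend e y x) = Function.extend e (g.cl y) x := by
  cases g <;> simp only [QGate.map, QGate.cl, flipAt_extend, e.injective.extend_apply]

theorem clL_map_extend (e : ι ↪ κ) (gs : List (QGate ι)) (y : ι → Bool) (x : κ → Bool) :
    clL (gs.map (QGate.map e)) (Function.extend e y x) = Function.extend e (clL gs y) x := by
  induction gs generalizing y with
  | nil => rfl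
  | cons g gs ih => rw [List.map_cons, clL_cons, QGate.cl_map, ih, clL_cons]

theorem clL_map (e : ι ↪ κ) (gs : List (QGate ι)) (x : κ → Bool) :
    clL (gs.map (QGate.map e)) x = Function.extend e (clL gs (x ∘ e)) x := by
  rw [← clL_map_extend, extend_comp_self]

/-- The part of a state vector in which the wires outside the range of `e` are in the basis
state `x`. -/
noncomputable def slice (e : ι ↪ κ) (x : κ → Bool) (ψ : St κ) : St ι := fun y => ψ (Function.extend e y x)

/-- A gate on embedded wires neither reads nor changes the others, so it acts on every slice
separately. This reduces each subcircuit to its action on its own wires. -/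
theorem slice_act_map (e : ι ↪ κ) (x : κ → Bool) (g : QGate ι) (ψ : St κ) :
    slice e x ((g.map e).act ψ) = g.act (slice e x ψ) := by
  funext y
  have hcl : ∀ g : QGate ι, g.IsCl →
      slice e x ((g.map e).act ψ) y = g.act (slice e x ψ) y := fun g hg => by
    rw [slice, QGate.act_cl hg.map, QGate.act_cl hg, QGate.cl_map, slice]
  cases g with
  | x i => exact hcl _ trivial
  | cx i j h => exact hcl _ trivial
  | ccx i j k h1 h2 h3 => exact hcl _ trivial
  | h i => simp only [slice, QGate.map, QGate.act_h, update_extend, e.injective.extend_apply]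
  | t i => simp only [slice, QGate.map, QGate.act_t, e.injective.extend_apply]
  | tdg i => simp only [slice, QGate.map, QGate.act_tdg, e.injective.extend_apply]

theorem slice_actL_map (e : ι ↪ κ) (x : κ → Bool) (gs : List (QGate ι)) (ψ : St κ) :
    slice e x (actL (gs.map (QGate.map e)) ψ) = actL gs (slice e x ψ) := by
  induction gs generalizing ψ with
  | nil => rfl
  | cons g gs ih => rw [List.map_cons, actL_cons, ih, slice_act_map, actL_cons]

theorem actL_map_apply (e : ι ↪ κ) (gs : List (QGate ι)) (ψ : St κ) (x : κ → Bool) :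
    actL (gs.map (QGate.map e)) ψ x = actL gs (slice e x ψ) (x ∘ e) := by
  rw [← slice_actL_map, slice, extend_comp_self]

/-! ### Layers of gates -/

/-- Gates with distinct targets whose controls are not targets act independently. -/
theorem clL_parallel {J : Type} {g : J → QGate ι} {tgt : J → ι} {F : J → (ι → Bool) → Bool}
    (hg : ∀ j y, (g j).cl y = flipAt (F j y) (tgt j) y)
    (hF : ∀ j y j' c, F j (flipAt c (tgt j') y) = F j y) (ht : Function.Injective tgt)
    {l : List J} (hl : l.Nodup) (y : ι → Bool) :
    (∀ j ∈ l, clL (l.map g) y (tgt j) = Bool.xor (y (tgt j)) (F j y)) ∧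
      ∀ k, (∀ j ∈ l, tgt j ≠ k) → clL (l.map g) y k = y k := by
  induction l generalizing y with
  | nil => simp
  | cons a l ih =>
    obtain ⟨hal, hl⟩ := List.nodup_cons.1 hl
    obtain ⟨h1, h2⟩ := ih hl ((g a).cl y)
    rw [List.map_cons, clL_cons]
    refine ⟨fun j hj => ?_, fun k hk => ?_⟩
    · rcases List.mem_cons.1 hj with rfl | hj
      · rw [h2 _ (fun j' hj' h => hal (by rwa [ht h] at hj')), hg, flipAt_self]
      · rw [h1 j hj, hg, hF, flipAt_of_ne]
        exact fun h => hal ((ht h) ▸ hj)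
    · rw [h2 k fun j hj => hk j (by simp [hj]), hg, flipAt_of_ne (hk a (by simp)).symm]

end

/-- `∏ᵢ (-1)^{xᵢyᵢ}`. -/
noncomputable def sgn {n : ℕ} (x y : Bits n) : ℂ :=
  ∏ i, if x i = true ∧ y i = true then -1 else 1

theorem sgn_eq {n : ℕ} (x y : Bits n) : (if x.dot y = true then (-1 : ℂ) else 1) = sgn x y := by
  rw [sgn, Finset.prod_ite, Finset.prod_const, Finset.prod_const_one, mul_one]
  simp only [Bits.dot, decide_eq_true_eq]
  split_ifs with h
  · rw [h.neg_one_pow]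
  · rw [(Nat.not_odd_iff_even.1 h).neg_one_pow]

theorem sgn_comm {n : ℕ} (x y : Bits n) : sgn x y = sgn y x := by
  simp only [sgn, and_comm]

theorem sum_bits_succ {n : ℕ} {M : Type} [AddCommMonoid M] (F : Bits (n + 1) → M) :
    ∑ x, F x = ∑ y : Bits n, (F (Fin.cons false y) + F (Fin.cons true y)) := by
  rw [← Equiv.sum_comp (Fin.consEquiv fun _ => Bool) F, Fintype.sum_prod_type, Fintype.sum_bool,
    add_comm, ← Finset.sum_add_distrib]
  rfl

/-- Hadamard gates on the wires `e 0, e 1, …`. -/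
def hLayer {ι : Type} {k : ℕ} (e : Fin k ↪ ι) : List (QGate ι) :=
  (List.finRange k).map fun i => QGate.h (e i)

theorem hLayer_eq_map {ι : Type} {k : ℕ} (e : Fin k ↪ ι) :
    hLayer e = (hLayer (Function.Embedding.refl (Fin k))).map (QGate.map e) := by
  simp only [hLayer, List.map_map]
  rfl

theorem actL_hLayer_refl {k : ℕ} (ψ : St (Fin k)) (x : Bits k) :
    actL (hLayer (Function.Embedding.refl (Fin k))) ψ x = rt ^ k * ∑ y, sgn x y * ψ y := by
  induction k with
  | zero =>
    simp [hLayer, sgn, Subsingleton.elim x (fun _ => false)]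
    exact congrArg ψ (Subsingleton.elim _ _)
  | succ k ih =>
    have h1 : hLayer (Function.Embedding.refl (Fin (k + 1))) = QGate.h 0 ::
        (hLayer (Function.Embedding.refl (Fin k))).map (QGate.map (Fin.succEmb k)) := by
      simp only [hLayer, List.finRange_succ, List.map_cons, List.map_map]
      rfl
    have h2 : ∀ y : Bits k, Function.extend (Fin.succEmb k) y x = Fin.cons (x 0) y := by
      intro y
      funext i
      refine Fin.cases ?_ (fun i => ?_) i
      · rw [Function.extend_apply' _ _ _ (by rintro ⟨j, hj⟩; exact Fin.succ_ne_zero j hj)]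
        rfl
      · exact (Fin.succEmb k).injective.extend_apply _ _ i
    have h3 : ∀ y : Bits (k + 1), sgn x y =
        (if x 0 = true ∧ y 0 = true then -1 else 1) * sgn (x ∘ Fin.succ) (y ∘ Fin.succ) := by
      intro y
      rw [sgn, Fin.prod_univ_succ]; rfl
    -- The first gate acts on wire 0 and the remaining ones are the layer for `k` on the other
    -- wires; one factor `rt` and one factor of `sgn` split off.
    rw [h1, actL_cons, actL_map_apply, ih, sum_bits_succ, pow_succ, mul_assoc]
    congr 1
    rw [Finset.mul_sum]
    refine Finset.sum_congr rfl fun y _ => ?_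
    have h4 : ∀ b, Function.update (Fin.cons (x 0) y : Bits (k + 1)) 0 b = Fin.cons b y :=
      fun b => Fin.update_cons_zero _ _ _
    simp only [slice, h2, QGate.act_h, h4, h3, Fin.cons_zero]
    rw [show (x ∘ ⇑(Fin.succEmb k) : Bits k) = x ∘ Fin.succ from rfl]
    rw [show ((Fin.cons false y : Bits (k + 1)) ∘ Fin.succ) = y from rfl,
      show ((Fin.cons true y : Bits (k + 1)) ∘ Fin.succ) = y from rfl]
    cases x 0 <;> simp <;> ring

theorem actL_hLayer {ι : Type} [DecidableEq ι] {k : ℕ} (e : Fin k ↪ ι) (ψ : St ι)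
    (x : ι → Bool) :
    actL (hLayer e) ψ x = rt ^ k * ∑ y, sgn (x ∘ e) y * ψ (Function.extend e y x) := by
  rw [hLayer_eq_map, actL_map_apply, actL_hLayer_refl]
  rfl

/-! ## Circuits on numbered wires -/

/-- A gate on numbered wires as a gate on arbitrary wires. -/
def Gate.toQ {N : ℕ} : Gate N → QGate (Fin N)
  | .x i => .x i
  | .cx i j h1 => .cx i j h1
  | .ccx i j k h1 h2 h3 => .ccx i j k h1 h2 h3
  | .h i => .h i
  | .t i => .t i
  | .tdg i => .tdg i

/-- A gate on arbitrary wires as a gate on numbered wires. -/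
def QGate.toGate {N : ℕ} : QGate (Fin N) → Gate N
  | .x i => .x i
  | .cx i j h1 => .cx i j h1
  | .ccx i j k h1 h2 h3 => .ccx i j k h1 h2 h3
  | .h i => .h i
  | .t i => .t i
  | .tdg i => .tdg i

@[simp] theorem QGate.toQ_toGate {N : ℕ} (g : QGate (Fin N)) : g.toGate.toQ = g := by
  cases g <;> rfl

theorem Gate.isCl_toQ {N : ℕ} {g : Gate N} : g.toQ.IsCl ↔ g.IsClassical := by
  cases g <;> rfl

theorem basisMap_mulVec {N : ℕ} {π : Bits N → Bits N} (h : Function.Involutive π) (ψ : Bits N → ℂ)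
    (x : Bits N) : (basisMap π *ᵥ ψ) x = ψ (π x) := by
  simp only [Matrix.mulVec, dotProduct, basisMap, ite_mul, one_mul, zero_mul]
  rw [Finset.sum_eq_single (π x)]
  · simp [h x]
  · intro y _ hy
    rw [if_neg]
    rintro rfl
    exact hy (h y).symm
  · simp

theorem Gate.mat_mulVec {N : ℕ} (g : Gate N) (ψ : Bits N → ℂ) : g.mat *ᵥ ψ = g.toQ.act ψ := by
  funext x
  cases g with
  | x i => exact basisMap_mulVec (QGate.x i).cl_involutive ψ x
  | cx i j h => exact basisMap_mulVec (QGate.cx i j h).cl_involutive ψ x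
  | ccx i j k h1 h2 h3 => exact basisMap_mulVec (QGate.ccx i j k h1 h2 h3).cl_involutive ψ x
  | t i =>
    simp only [Gate.mat, Matrix.mulVec_diagonal, Gate.toQ, QGate.act_t]
  | tdg i =>
    simp only [Gate.mat, Matrix.mulVec_diagonal, Gate.toQ, QGate.act_tdg]
  | h i =>
    simp only [Gate.mat, Gate.toQ, QGate.act_h, Matrix.mulVec, dotProduct]
    have hne : Function.update x i false ≠ Function.update x i true := fun h => by
      have := congrFun h i
      simp at this
    have hiff : ∀ y : Bits N, (∀ j, j ≠ i → x j = y j) ↔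
        y = Function.update x i false ∨ y = Function.update x i true := by
      intro y
      constructor
      · intro h
        have : y = Function.update x i (y i) := by
          funext j
          by_cases hj : j = i
          · subst hj; simp
          · rw [Function.update_of_ne hj, h j hj]
        cases hy : y i <;> rw [hy] at this <;> simp [← this]
      · rintro (rfl | rfl) j hj <;> simp [hj]
    rw [← Finset.sum_subset (Finset.subset_univ
      {Function.update x i false, Function.update x i true}), Finset.sum_pair hne]
    · rw [if_pos ((hiff _).2 (Or.inl rfl)), if_pos ((hiff _).2 (Or.inr rfl))]
      cases x i <;> simp [rt] <;> ring
    · intro y _ hy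
      rw [if_neg, zero_mul]
      rw [hiff]
      simpa using hy

theorem gatesMat_mulVec {N : ℕ} (gs : List (Gate N)) (ψ : Bits N → ℂ) :
    gatesMat gs *ᵥ ψ = actL (gs.map Gate.toQ) ψ := by
  induction gs generalizing ψ with
  | nil => simp [gatesMat]
  | cons g gs ih =>
    rw [gatesMat, ← Matrix.mulVec_mulVec, ih, Gate.mat_mulVec, List.map_cons, actL_cons]

/-- The gates of a circuit. -/
def QCircuit.qgates {a b : ℕ} (C : QCircuit a b) : List (QGate (Fin (a + C.anc))) :=
  C.gates.map Gate.toQ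

/-- The wires of the output of a circuit. -/
def QCircuit.outWire {a b : ℕ} (C : QCircuit a b) (i : Fin b) : Fin (a + C.anc) :=
  Fin.cast C.size_eq (Fin.castAdd C.rest i)

/-- The wires of a circuit that are not output. -/
def QCircuit.restWire {a b : ℕ} (C : QCircuit a b) (i : Fin C.rest) : Fin (a + C.anc) :=
  Fin.cast C.size_eq (Fin.natAdd b i)

theorem QCircuit.iso_eq {a b : ℕ} (C : QCircuit a b) (y : Bits b × Bits C.rest) (x : Bits a) :
    C.iso y x = actL C.qgates (bket (Fin.append x fun _ => false))
      (fun i => Fin.append y.1 y.2 (Fin.cast C.size_eq.symm i)) := by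
  rw [QCircuit.qgates, ← gatesMat_mulVec, bket, Matrix.mulVec_single_one]
  rfl

theorem QCircuit.Computes.isCl {a b : ℕ} {C : QCircuit a b} {f : Bits a → Bits b}
    (h : C.Computes f) : ∀ g ∈ C.qgates, g.IsCl := by
  intro g hg
  obtain ⟨g', hg', rfl⟩ := List.mem_map.1 hg
  exact Gate.isCl_toQ.2 (h.1 g' hg')

theorem QCircuit.Computes.clL_outWire {a b : ℕ} {C : QCircuit a b} {f : Bits a → Bits b}
    (h : C.Computes f) (x : Bits a) (i : Fin b) :
    clL C.qgates (Fin.append x fun _ => false) (C.outWire i) = f x i := by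
  obtain ⟨c, hc⟩ := h.2 x
  rw [QCircuit.iso_eq, actL_bket h.isCl, bket_apply] at hc
  split_ifs at hc with h1
  · rw [← h1]
    simp [QCircuit.outWire]
  · simp at hc

/-! ### Computing a classical function without leaving garbage. -/

section
variable {ι : Type} [DecidableEq ι]

/-- Compute the output of a circuit, add it (exclusive or) to the wires `t`, and uncompute. -/
def copyBlock {a b : ℕ} (C : QCircuit a b) (e : Fin (a + C.anc) ↪ ι) (t : Fin b → ι)
    (hd : ∀ i j, e i ≠ t j) : List (QGate ι) :=
  C.qgates.map (QGate.map e) ++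
    ((List.finRange b).map fun i => QGate.cx (e (C.outWire i)) (t i) (hd _ _)) ++
    (invL C.qgates).map (QGate.map e)

/-- The standard way to identify the state after a layer: check the values on the target wires, and
that the other wires are unchanged. -/
theorem extend_eq_of_forall {J : Type} {e : J → ι} (he : Function.Injective e) {v : J → Bool}
    {s s' : ι → Bool} (h1 : ∀ j, s' (e j) = v j) (h2 : ∀ k, (∀ j, e j ≠ k) → s' k = s k) :
    s' = Function.extend e v s := by
  funext k
  by_cases hk : ∃ j, e j = k
  · obtain ⟨j, rfl⟩ := hk
    rw [he.extend_apply, h1]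
  · rw [Function.extend_apply' _ _ _ hk, h2 k fun j hj => hk ⟨j, hj⟩]

theorem clL_finRange_map {k : ℕ} {g : Fin k → QGate ι} {tgt : Fin k → ι}
    {F : Fin k → (ι → Bool) → Bool} (hg : ∀ j y, (g j).cl y = flipAt (F j y) (tgt j) y)
    (hF : ∀ j y j' c, F j (flipAt c (tgt j') y) = F j y) (ht : Function.Injective tgt)
    (y : ι → Bool) : clL ((List.finRange k).map g) y =
      Function.extend tgt (fun j => Bool.xor (y (tgt j)) (F j y)) y := by
  obtain ⟨h1, h2⟩ := clL_parallel hg hF ht (List.nodup_finRange k) y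
  exact extend_eq_of_forall ht (fun j => h1 j (List.mem_finRange j))
    fun k hk => h2 k fun j _ => hk j

theorem isCl_copyBlock {a b : ℕ} {C : QCircuit a b} {f : Bits a → Bits b} (hC : C.Computes f)
    {e : Fin (a + C.anc) ↪ ι} {t : Fin b → ι} (hd : ∀ i j, e i ≠ t j) :
    ∀ g ∈ copyBlock C e t hd, g.IsCl := by
  intro g hg
  simp only [copyBlock, List.mem_append, List.mem_map] at hg
  rcases hg with (⟨g', h1, rfl⟩ | ⟨i, -, rfl⟩) | ⟨g', h1, rfl⟩
  · exact (hC.isCl _ h1).map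
  · trivial
  · exact (isCl_invL hC.isCl _ h1).map

/-- The targets lie outside the circuit, so adding the output to them does not disturb the
uncomputation, and every wire of the circuit returns to its initial value. That the ancillas come
back clean is essential: the block is applied to superpositions of inputs, and leftover garbage
would destroy their interference. -/
theorem clL_copyBlock {a b : ℕ} {C : QCircuit a b} {f : Bits a → Bits b} (hC : C.Computes f)
    {e : Fin (a + C.anc) ↪ ι} {t : Fin b → ι} (hd : ∀ i j, e i ≠ t j)
    (ht : Function.Injective t) (s : ι → Bool) (x : Bits a)
    (hs : s ∘ e = Fin.append x fun _ => false) :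
    clL (copyBlock C e t hd) s = Function.extend t (fun j => Bool.xor (s (t j)) (f x j)) s := by
  have he : ∀ (k : ι → Bool) (y : Fin (a + C.anc) → Bool) j,
      Function.extend e y k (t j) = k (t j) := fun k y j =>
    Function.extend_apply' _ _ _ fun ⟨i, hi⟩ => hd i j hi
  rw [copyBlock, clL_append, clL_append, clL_map e C.qgates, hs]
  rw [clL_finRange_map (tgt := t) (F := fun i y => y (e (C.outWire i))) (fun _ _ => rfl)
    (fun j y j' c => flipAt_of_ne (hd _ _) _) ht]
  simp only [he, e.injective.extend_apply, hC.clL_outWire]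
  rw [clL_map]
  symm
  have h1 : (Function.extend t (fun j => Bool.xor (s (t j)) (f x j))
      (Function.extend e (clL C.qgates (Fin.append x fun _ => false)) s)) ∘ e =
      clL C.qgates (Fin.append x fun _ => false) := by
    funext i
    rw [Function.comp_apply, Function.extend_apply' _ _ _ fun ⟨j, hj⟩ => hd i j hj.symm,
      e.injective.extend_apply]
  rw [h1, clL_invL_clL hC.isCl]
  refine extend_eq_of_forall e.injective (fun i => ?_) fun k hk => ?_
  · rw [Function.extend_apply' _ _ _ fun ⟨j, hj⟩ => hd i j hj.symm, ← hs]
    rfl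
  · by_cases hk' : ∃ j, t j = k
    · obtain ⟨j, rfl⟩ := hk'
      rw [ht.extend_apply, ht.extend_apply]
    · rw [Function.extend_apply' _ _ _ hk', Function.extend_apply' _ _ _ hk',
        Function.extend_apply' _ _ _ fun ⟨i, hi⟩ => hk i hi]

end

/-! ## Generation of circuits -/

/-- The description of a gate, for the numbers `num` of its wires. -/
def QGate.enc {ι : Type} (num : ι → ℕ) : QGate ι → Data
  | .x i => TreeCode.code (0, [num i])
  | .cx i j _ => TreeCode.code (1, [num i, num j])
  | .ccx i j k _ _ _ => TreeCode.code (2, [num i, num j, num k])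
  | .h i => TreeCode.code (3, [num i])
  | .t i => TreeCode.code (4, [num i])
  | .tdg i => TreeCode.code (5, [num i])

theorem QGate.encode_toGate {N : ℕ} (g : QGate (Fin N)) : g.toGate.encode = g.enc Fin.val := by
  cases g <;> rfl

theorem Gate.encode_eq {N : ℕ} (g : Gate N) : g.encode = g.toQ.enc Fin.val := by
  cases g <;> rfl

theorem QGate.enc_map {ι κ : Type} (e : ι ↪ κ) (num : κ → ℕ) (g : QGate ι) :
    (g.map e).enc num = g.enc (num ∘ e) := by
  cases g <;> rfl

/-- The gate described by a kind and a list of wires, in terms of the kind and the wires. -/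
def QGate.raw {ι : Type} (num : ι → ℕ) : QGate ι → ℕ × List ℕ
  | .x i => (0, [num i])
  | .cx i j _ => (1, [num i, num j])
  | .ccx i j k _ _ _ => (2, [num i, num j, num k])
  | .h i => (3, [num i])
  | .t i => (4, [num i])
  | .tdg i => (5, [num i])

theorem QGate.code_raw {ι : Type} (num : ι → ℕ) (g : QGate ι) :
    TreeCode.code (g.raw num) = g.enc num := by
  cases g <;> rfl

theorem QGate.raw_comp {ι : Type} (num : ι → ℕ) (f : ℕ → ℕ) (g : QGate ι) :
    g.raw (f ∘ num) = ((g.raw num).1, (g.raw num).2.map f) := by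
  cases g <;> rfl

/-- Inverting a gate only exchanges the kinds 4 and 5, the gates `T` and `T†`; the other kinds are
their own inverses. -/
theorem QGate.raw_inv {ι : Type} (num : ι → ℕ) (g : QGate ι) :
    g.inv.raw num = ([0, 1, 2, 3, 5, 4].getD (g.raw num).1 0, (g.raw num).2) := by
  cases g <;> rfl

/-- The list of gates `G x` on wires with the numbers `num x` is generated in polynomial time. -/
def PolyGates {α : Type} [TreeCode α] {ι : α → Type} (num : ∀ x, ι x → ℕ)
    (G : ∀ x, List (QGate (ι x))) : Prop :=
  PolyTime fun x => (G x).map (QGate.raw (num x))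

section
variable {α : Type} [TreeCode α] {ι : α → Type} {num : ∀ x, ι x → ℕ}

theorem PolyGates.append {G H : ∀ x, List (QGate (ι x))} (hG : PolyGates num G)
    (hH : PolyGates num H) : PolyGates num fun x => G x ++ H x := by
  unfold PolyGates at *
  simp only [List.map_append]
  fun_prop

theorem PolyGates.inv {G : ∀ x, List (QGate (ι x))} (hG : PolyGates num G) :
    PolyGates num fun x => invL (G x) := by
  unfold PolyGates at *
  simp only [invL, List.map_reverse, List.map_map, Function.comp_def, QGate.raw_inv]
  have h : PolyTime fun x => (((G x).map (QGate.raw (num x))).map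
      fun p : ℕ × List ℕ => ([0, 1, 2, 3, 5, 4].getD p.1 0, p.2)).reverse := by
    fun_prop
  simpa only [List.map_map, Function.comp_def] using h

/-- Renaming wires is a table lookup: `L x` lists the new numbers by old number, so relabelling a
description is again polynomial time. -/
theorem PolyGates.map {κ : α → Type} {num' : ∀ x, κ x → ℕ} {G : ∀ x, List (QGate (ι x))}
    (hG : PolyGates num G) (e : ∀ x, ι x ↪ κ x) {L : α → List ℕ} (hL : PolyTime L)
    (h : ∀ x i, num' x (e x i) = (L x).getD (num x i) 0) :
    PolyGates num' fun x => (G x).map (QGate.map (e x)) := by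
  unfold PolyGates at *
  have h1 : ∀ x (g : QGate (ι x)), (g.map (e x)).raw (num' x) =
      ((g.raw (num x)).1, (g.raw (num x)).2.map fun i => (L x).getD i 0) := by
    intro x g
    rw [← QGate.raw_comp]
    have : (num' x) ∘ (e x) = (fun i => (L x).getD i 0) ∘ (num x) := funext fun i => h x i
    rw [← this]
    cases g <;> rfl
  simp only [List.map_map, Function.comp_def, h1]
  have h2 : PolyTime fun x => ((G x).map (QGate.raw (num x))).map
      fun p : ℕ × List ℕ => (p.1, p.2.map fun i => (L x).getD i 0) := by
    fun_prop
  simpa only [List.map_map, Function.comp_def] using h2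

theorem PolyTime.finRange_map {β : Type} [TreeCode β] {k : α → ℕ} (hk : PolyTime k)
    {F : ∀ x, Fin (k x) → β} {R : α → ℕ → β} (hR : PolyTime fun p : α × ℕ => R p.1 p.2)
    (h : ∀ x i, F x i = R x i.val) : PolyTime fun x => (List.finRange (k x)).map (F x) := by
  have h1 : PolyTime fun x => (List.range (k x)).map (R x) := by fun_prop
  refine h1.of_code_eq fun x => ?_
  congr 1
  rw [← List.map_coe_finRange_eq_range, List.map_map]
  exact List.map_congr_left fun i _ => (h x i).symm

theorem PolyTime.finRange_flatMap {β : Type} [TreeCode β] {k : α → ℕ} (hk : PolyTime k)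
    {F : ∀ x, Fin (k x) → List β} {R : α → ℕ → List β}
    (hR : PolyTime fun p : α × ℕ => R p.1 p.2)
    (h : ∀ x i, F x i = R x i.val) : PolyTime fun x => (List.finRange (k x)).flatMap (F x) := by
  simp only [List.flatMap]
  exact PolyTime.listFlatten (PolyTime.finRange_map hk hR h)

end

theorem qpt_iff {a b : ℕ → ℕ} (C : ∀ n, QCircuit (a n) (b n)) :
    QPT C ↔ PolyTime (fun n => (C n).anc) ∧ PolyGates (fun _ => Fin.val) fun n => (C n).qgates := by
  have h0 : ∀ n, (C n).encode = TreeCode.code ((C n).anc, (C n).qgates.map (QGate.raw Fin.val)) := by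
    intro n
    simp only [QCircuit.encode, TreeCode.code, QCircuit.qgates, List.map_map]
    congr 2
    refine List.map_congr_left fun g _ => ?_
    rw [Gate.encode_eq, ← QGate.code_raw]
    rfl
  rw [QPT, polyTimeGenerated_iff]
  simp only [h0]
  constructor
  · intro h
    have h1 : PolyTime fun n => ((C n).anc, (C n).qgates.map (QGate.raw Fin.val)) :=
      h.of_code_eq fun n => rfl
    exact ⟨h1.fst, h1.snd⟩
  · rintro ⟨h1, h2⟩
    exact PolyTime.toData (PolyTime.prodMk h1 h2)

theorem comp_append {α β : Type} {m n : ℕ} (s : α → β) (f : Fin m → α) (g : Fin n → α) :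
    s ∘ Fin.append f g = Fin.append (s ∘ f) (s ∘ g) := by
  funext i
  refine Fin.addCases (fun i => ?_) (fun i => ?_) i <;> simp

theorem sum_bits_append {m n : ℕ} {M : Type} [AddCommMonoid M] (F : Bits (m + n) → M) :
    ∑ x, F x = ∑ p : Bits m, ∑ q : Bits n, F (Fin.append p q) := by
  rw [← Equiv.sum_comp (Fin.appendEquiv m n) F, Fintype.sum_prod_type]
  rfl

theorem append_left_right {m n : ℕ} (x : Bits (m + n)) : Fin.append x.left x.right = x :=
  Fin.append_castAdd_natAdd

@[simp] theorem left_append {m n : ℕ} (x : Bits m) (y : Bits n) :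
    Bits.left (Fin.append x y : Bits (m + n)) = x := by
  funext i; simp [Bits.left]

@[simp] theorem right_append {m n : ℕ} (x : Bits m) (y : Bits n) :
    Bits.right (Fin.append x y : Bits (m + n)) = y := by
  funext i; simp [Bits.right]

theorem append_inj {m n : ℕ} {x x' : Bits m} {y y' : Bits n} :
    (Fin.append x y : Bits (m + n)) = Fin.append x' y' ↔ x = x' ∧ y = y' := by
  constructor
  · intro h
    have h1 := congrArg Bits.left h
    have h2 := congrArg Bits.right h
    simp only [left_append, right_append] at h1 h2
    exact ⟨h1, h2⟩
  · rintro ⟨rfl, rfl⟩; rfl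

/-! ## Circuits with separate input, output and work wires -/

/-- Input, output and work wires. -/
abbrev BodyWire (a b k : ℕ) : Type := Fin a ⊕ (Fin b ⊕ Fin k)

section
variable {a b k : ℕ}

/-- The state of input, output and work wires. -/
def bodyState (x : Bits a) (y : Bits b) (w : Bits k) : BodyWire a b k → Bool :=
  Sum.elim x (Sum.elim y w)

theorem bodyState_inj {x x' : Bits a} {y y' : Bits b} {w w' : Bits k} :
    bodyState x y w = bodyState x' y' w' ↔ x = x' ∧ y = y' ∧ w = w' := by
  constructor
  · intro h
    exact ⟨funext fun i => congrFun h (.inl i), funext fun i => congrFun h (.inr (.inl i)),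
      funext fun i => congrFun h (.inr (.inr i))⟩
  · rintro ⟨rfl, rfl, rfl⟩; rfl

/-- The numbers of the input, output and work wires in a circuit that starts by moving its input
out of the way. -/
def bodyNum (a b k : ℕ) : BodyWire a b k → ℕ :=
  Sum.elim (fun i => a + b + i) (Sum.elim (fun j => j) fun w => a + b + a + w)

theorem bodyNum_lt (i : BodyWire a b k) : bodyNum a b k i < a + (b + a + k) := by
  rcases i with i | i | i <;> simp only [bodyNum, Sum.elim_inl, Sum.elim_inr] <;> omega

theorem bodyNum_injective : Function.Injective (bodyNum a b k) := by
  rintro (i | i | i) (j | j | j) h <;>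
    simp only [bodyNum, Sum.elim_inl, Sum.elim_inr] at h <;>
    first
    | (exfalso; omega)
    | (congr; exact Fin.ext (by omega))

/-- The input, output and work wires among the wires of the circuit. -/
def bodyEmb (a b k : ℕ) : BodyWire a b k ↪ Fin (a + (b + a + k)) :=
  ⟨fun i => ⟨bodyNum a b k i, bodyNum_lt i⟩, fun i j h =>
    bodyNum_injective (by simpa using h)⟩

/-- Move the input to the input wires. -/
def moveIn (a b k : ℕ) : List (QGate (Fin (a + (b + a + k)))) :=
  ((List.finRange a).map fun i => QGate.cx ⟨i, by omega⟩ ⟨a + b + i, by omega⟩ (by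
    rw [Ne, Fin.mk.injEq]; omega)) ++
  (List.finRange a).map fun i => QGate.cx ⟨a + b + i, by omega⟩ ⟨i, by omega⟩ (by
    rw [Ne, Fin.mk.injEq]; omega)

/-- The circuit that runs `G` on input, output and work wires. -/
def wrap (G : List (QGate (BodyWire a b k))) : QCircuit a b where
  anc := b + a + k
  rest := a + a + k
  size_eq := by omega
  gates := (moveIn a b k ++ G.map (QGate.map (bodyEmb a b k))).map QGate.toGate

theorem wrap_qgates (G : List (QGate (BodyWire a b k))) :
    (wrap G).qgates = moveIn a b k ++ G.map (QGate.map (bodyEmb a b k)) := by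
  simp only [QCircuit.qgates, wrap, List.map_map]
  conv_rhs => rw [← List.map_id (moveIn a b k ++ _)]
  exact List.map_congr_left fun g _ => g.toQ_toGate

theorem moveIn_isCl : ∀ g ∈ moveIn a b k, g.IsCl := by
  intro g hg
  simp only [moveIn, List.mem_append, List.mem_map] at hg
  rcases hg with ⟨i, -, rfl⟩ | ⟨i, -, rfl⟩ <;> trivial

/-- The first layer of CNOTs copies the input, the second erases the original with the help of the
copy. This is necessary because a circuit receives its input on the same low-numbered wires on which
its output must end. -/
theorem clL_moveIn (x : Bits a) :
    clL (moveIn a b k) (Fin.append x fun _ => false) =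
      Function.extend (bodyEmb a b k) (bodyState x (fun _ => false) fun _ => false)
        fun _ => false := by
  have h1 := clL_finRange_map (k := a) (ι := Fin (a + (b + a + k)))
    (g := fun i => QGate.cx ⟨i, by omega⟩ ⟨a + b + i, by omega⟩ (by
      rw [Ne, Fin.mk.injEq]; omega)) (tgt := fun i => ⟨a + b + i, by omega⟩)
    (F := fun i y => y ⟨i, by omega⟩) (fun _ _ => rfl)
    (fun j y j' c => flipAt_of_ne (by rw [Ne, Fin.mk.injEq]; omega) _)
    (fun i j h => Fin.ext (by simpa using h))
  have h2 := clL_finRange_map (k := a) (ι := Fin (a + (b + a + k)))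
    (g := fun i => QGate.cx ⟨a + b + i, by omega⟩ ⟨i, by omega⟩ (by
      rw [Ne, Fin.mk.injEq]; omega)) (tgt := fun i => ⟨i, by omega⟩)
    (F := fun i y => y ⟨a + b + i, by omega⟩) (fun _ _ => rfl)
    (fun j y j' c => flipAt_of_ne (by rw [Ne, Fin.mk.injEq]; omega) _)
    (fun i j h => Fin.ext (by simpa using h))
  rw [moveIn, clL_append, h1, h2]
  have hinj1 : Function.Injective fun i : Fin a => (⟨a + b + i, by omega⟩ : Fin (a + (b + a + k))) :=
    fun i j h => Fin.ext (by simpa using h)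
  have hinj2 : Function.Injective fun i : Fin a => (⟨i, by omega⟩ : Fin (a + (b + a + k))) :=
    fun i j h => Fin.ext (by simpa using h)
  have hlow : ∀ i : Fin a, (Fin.append x (fun _ => false) : Bits (a + (b + a + k)))
      ⟨i, by omega⟩ = x i := fun i => Fin.append_left x _ i
  have hhigh : ∀ i : Fin (a + (b + a + k)), a ≤ i.val →
      (Fin.append x (fun _ => false) : Bits (a + (b + a + k))) i = false := by
    intro i hi
    obtain ⟨j, rfl⟩ : ∃ j : Fin (b + a + k), i = Fin.natAdd a j :=
      ⟨⟨i - a, by omega⟩, Fin.ext (by simp; omega)⟩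
    simp
  have hne : ∀ i j : Fin a, (⟨a + b + i, by omega⟩ : Fin (a + (b + a + k))) ≠ ⟨j, by omega⟩ :=
    fun i j => by rw [Ne, Fin.mk.injEq]; omega
  refine extend_eq_of_forall (bodyEmb a b k).injective ?_ ?_
  · rintro (i | i | i)
    · change Function.extend _ _ _ (⟨a + b + i, by omega⟩ : Fin (a + (b + a + k))) = x i
      rw [Function.extend_apply' _ _ _ fun ⟨j, hj⟩ => hne i j hj.symm, hinj1.extend_apply, hlow,
        hhigh _ (by simp; omega), Bool.false_xor]
    · change Function.extend _ _ _ (⟨i, by omega⟩ : Fin (a + (b + a + k))) = false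
      by_cases hi : i.val < a
      · have := hinj2.extend_apply (fun j => Bool.xor (Function.extend
          (fun i : Fin a => (⟨a + b + i, by omega⟩ : Fin (a + (b + a + k))))
          (fun j => Bool.xor ((Fin.append x (fun _ => false) : Bits (a + (b + a + k)))
            ⟨a + b + j, by omega⟩) ((Fin.append x (fun _ => false) : Bits (a + (b + a + k)))
            ⟨j, by omega⟩)) (Fin.append x fun _ => false) ⟨j, by omega⟩)
          (Function.extend (fun i : Fin a => (⟨a + b + i, by omega⟩ : Fin (a + (b + a + k))))
          (fun j => Bool.xor ((Fin.append x (fun _ => false) : Bits (a + (b + a + k)))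
            ⟨a + b + j, by omega⟩) ((Fin.append x (fun _ => false) : Bits (a + (b + a + k)))
            ⟨j, by omega⟩)) (Fin.append x fun _ => false) ⟨a + b + j, by omega⟩))
          (Function.extend (fun i : Fin a => (⟨a + b + i, by omega⟩ : Fin (a + (b + a + k))))
          (fun j => Bool.xor ((Fin.append x (fun _ => false) : Bits (a + (b + a + k)))
            ⟨a + b + j, by omega⟩) ((Fin.append x (fun _ => false) : Bits (a + (b + a + k)))
            ⟨j, by omega⟩)) (Fin.append x fun _ => false)) ⟨i, hi⟩
        refine this.trans ?_
        rw [hinj1.extend_apply, Function.extend_apply' _ _ _ fun ⟨j, hj⟩ => hne j ⟨i, hi⟩ hj,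
          hlow, hhigh _ (by simp; omega), Bool.false_xor, Bool.xor_self]
      · rw [Function.extend_apply' _ _ _ (by rintro ⟨j, hj⟩; rw [Fin.mk.injEq] at hj; omega),
          Function.extend_apply' _ _ _ (by rintro ⟨j, hj⟩; rw [Fin.mk.injEq] at hj; omega),
          hhigh _ (by simp; omega)]
    · change Function.extend _ _ _ (⟨a + b + a + i, by omega⟩ : Fin (a + (b + a + k))) = false
      rw [Function.extend_apply' _ _ _ (by rintro ⟨j, hj⟩; rw [Fin.mk.injEq] at hj; omega),
          Function.extend_apply' _ _ _ (by rintro ⟨j, hj⟩; rw [Fin.mk.injEq] at hj; omega),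
          hhigh _ (by simp; omega)]
  · intro i hi
    have hb : b ≤ i.val := by
      by_contra h
      exact hi (.inr (.inl ⟨i, by omega⟩)) rfl
    have hab : i.val < a + b := by
      by_contra h
      by_cases h' : i.val < a + b + a
      · exact hi (.inl ⟨i - (a + b), by omega⟩) (Fin.ext (by simp [bodyEmb, bodyNum]; omega))
      · exact hi (.inr (.inr ⟨i - (a + b + a), by omega⟩))
          (Fin.ext (by simp [bodyEmb, bodyNum]; omega))
    by_cases hia : i.val < a
    · have : i = ⟨(⟨i, hia⟩ : Fin a), by omega⟩ := rfl
      rw [this, hinj2.extend_apply, hinj1.extend_apply,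
        Function.extend_apply' _ _ _ fun ⟨j, hj⟩ => hne j ⟨i, hia⟩ hj,
        hlow, hhigh _ (by simp; omega), Bool.false_xor, Bool.xor_self]
    · rw [Function.extend_apply' _ _ _ (by rintro ⟨j, hj⟩; rw [← hj] at hia; exact hia j.2),
          Function.extend_apply' _ _ _ (by rintro ⟨j, hj⟩; rw [← hj] at hab; simp at hab),
          hhigh _ (by omega)]

/-- The amplitudes of the circuit that runs `G`. -/
noncomputable def bodyAmp (G : List (QGate (BodyWire a b k))) (x i : Bits a) (y : Bits b)
    (w : Bits k) : ℂ :=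
  actL G (bket (bodyState x (fun _ => false) fun _ => false)) (bodyState i y w)

/-- The `a` wires numbered from `b` on belong to neither input, output nor work wires of `G`. After
the move they hold zero and stay so; `j` is their value, which explains why the amplitude vanishes
for `j ≠ 0`. -/
theorem wrap_iso (G : List (QGate (BodyWire a b k))) (x i : Bits a) (y : Bits b) (w : Bits k)
    (j : Bits a) :
    (wrap G).iso (y, (Fin.append (Fin.append j i) w : Bits (a + a + k))) x =
      if j = fun _ => false then bodyAmp G x i y w else 0 := by
  have hs : a + (b + a + k) = b + (a + a + k) := by omega
  set z : Bits (a + (b + a + k)) := fun t => Fin.append y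
    (Fin.append (Fin.append j i) w : Bits (a + a + k)) (Fin.cast hs t) with hz
  have hiso : (wrap G).iso (y, (Fin.append (Fin.append j i) w : Bits (a + a + k))) x =
      actL (moveIn a b k ++ G.map (QGate.map (bodyEmb a b k)))
        (bket (Fin.append x fun _ => false : Bits (a + (b + a + k)))) z := by
    rw [QCircuit.iso_eq, wrap_qgates]
    rfl
  rw [hiso, actL_append, actL_bket moveIn_isCl, clL_moveIn, actL_map_apply]
  have hbody : z ∘ bodyEmb a b k = bodyState i y w := by
    funext t
    rcases t with t | t | t
    · have : Fin.cast hs (bodyEmb a b k (.inl t)) =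
          Fin.natAdd b (Fin.castAdd k (Fin.natAdd a t)) :=
        Fin.ext (by simp [bodyEmb, bodyNum]; omega)
      simp only [Function.comp_apply, hz]
      rw [this]
      rw [Fin.append_right, Fin.append_left, Fin.append_right]
      rfl
    · have : Fin.cast hs (bodyEmb a b k (.inr (.inl t))) =
          Fin.castAdd (a + a + k) t := Fin.ext (by simp [bodyEmb, bodyNum])
      simp only [Function.comp_apply, hz]
      rw [this]
      simp [bodyState]
    · have : Fin.cast hs (bodyEmb a b k (.inr (.inr t))) =
          Fin.natAdd b (Fin.natAdd (a + a) t) := Fin.ext (by simp [bodyEmb, bodyNum]; omega)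
      simp only [Function.comp_apply, hz]
      rw [this]
      simp [bodyState]
  have hjunk : ∀ t : Fin a, z ⟨b + t, by omega⟩ = j t := by
    intro t
    have : Fin.cast hs ⟨b + t, by omega⟩ =
        Fin.natAdd b (Fin.castAdd k (Fin.castAdd a t)) := Fin.ext (by simp)
    simp only [hz]
    rw [this]
    simp
  -- The numbering of `bodyEmb` misses exactly the wires `b, …, a + b - 1`; the two facts here are
  -- the two inclusions.
  have hnot : ∀ t : Fin a, ¬∃ s, bodyEmb a b k s = ⟨b + t, by omega⟩ := by
    rintro t ⟨s | s | s, hs⟩ <;> simp [bodyEmb, bodyNum] at hs <;> omega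
  have hcover : ∀ t : Fin (a + (b + a + k)), (¬∃ s, bodyEmb a b k s = t) →
      ∃ t' : Fin a, t = ⟨b + t', by omega⟩ := by
    intro t ht
    have hb : b ≤ t.val := by
      by_contra h
      exact ht ⟨.inr (.inl ⟨t, by omega⟩), rfl⟩
    have hab : t.val < a + b := by
      by_contra h
      by_cases h' : t.val < a + b + a
      · exact ht ⟨.inl ⟨t - (a + b), by omega⟩, Fin.ext (by simp [bodyEmb, bodyNum]; omega)⟩
      · exact ht ⟨.inr (.inr ⟨t - (a + b + a), by omega⟩),
          Fin.ext (by simp [bodyEmb, bodyNum]; omega)⟩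
    exact ⟨⟨t - b, by omega⟩, Fin.ext (by simp; omega)⟩
  have hslice : slice (bodyEmb a b k) z (bket (Function.extend (bodyEmb a b k)
      (bodyState x (fun _ => false) fun _ => false) fun _ => false)) =
      if j = fun _ => false then bket (bodyState x (fun _ => false) fun _ => false) else 0 := by
    funext y'
    rw [slice, bket_apply]
    split_ifs with h1 h2 h2
    · rw [bket_apply, if_pos]
      funext t
      have := congrFun h1 (bodyEmb a b k t)
      rwa [(bodyEmb a b k).injective.extend_apply, (bodyEmb a b k).injective.extend_apply] at this
    · refine absurd (funext fun t => ?_) h2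
      have := congrFun h1 ⟨b + t, by omega⟩
      rw [Function.extend_apply' _ _ _ (hnot t), Function.extend_apply' _ _ _ (hnot t), hjunk]
        at this
      exact this
    · rw [bket_apply, if_neg]
      rintro rfl
      refine h1 (funext fun t => ?_)
      by_cases ht : ∃ s, bodyEmb a b k s = t
      · obtain ⟨s, rfl⟩ := ht
        rw [(bodyEmb a b k).injective.extend_apply, (bodyEmb a b k).injective.extend_apply]
      · obtain ⟨t', rfl⟩ := hcover t ht
        rw [Function.extend_apply' _ _ _ ht, Function.extend_apply' _ _ _ ht, hjunk, h2]
    · rfl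
  rw [hslice, hbody]
  split_ifs with h
  · rfl
  · simp

/-- The partial trace over the discarded wires, in which the idle wires contribute a single term. -/
theorem sum_wrap_iso (G : List (QGate (BodyWire a b k))) (y y' : Bits b) (x x' : Bits a) :
    ∑ c, (wrap G).iso (y, c) x * star ((wrap G).iso (y', c) x') =
      ∑ i, ∑ w, bodyAmp G x i y w * star (bodyAmp G x' i y' w) := by
  have : ∀ F : Bits (wrap G).rest → ℂ, ∑ c, F c = ∑ j : Bits a, ∑ i : Bits a, ∑ w : Bits k,
      F (Fin.append (Fin.append j i) w : Bits (a + a + k)) := by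
    intro F
    have h1 := sum_bits_append (m := a + a) (n := k) F
    have h2 := sum_bits_append (m := a) (n := a) fun p => ∑ q : Bits k, F (Fin.append p q)
    exact h1.trans h2
  rw [this]
  simp only [wrap_iso]
  rw [Finset.sum_eq_single (fun _ => false : Bits a)]
  · simp
  · intro j _ hj
    simp [hj]
  · simp

theorem wrap_computes {G : List (QGate (BodyWire a b k))} (hG : ∀ g ∈ G, g.IsCl)
    {f : Bits a → Bits b} (h : ∀ x, ∃ i w, clL G (bodyState x (fun _ => false) fun _ => false) =
      bodyState i (f x) w) : (wrap G).Computes f := by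
  refine ⟨fun g hg => ?_, fun x => ?_⟩
  · obtain ⟨g', hg', rfl⟩ := List.mem_map.1 hg
    refine (Gate.isCl_toQ (g := g'.toGate)).1 ?_
    rw [QGate.toQ_toGate]
    rcases List.mem_append.1 hg' with h1 | h1
    · exact moveIn_isCl _ h1
    · obtain ⟨g'', h2, rfl⟩ := List.mem_map.1 h1
      exact (hG _ h2).map
  · obtain ⟨i, w, hx⟩ := h x
    refine ⟨(Fin.append (Fin.append (fun _ => false) i) w : Bits (a + a + k)), ?_⟩
    rw [wrap_iso, if_pos rfl, bodyAmp, actL_bket hG, hx, bket_apply, if_pos rfl]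

end

theorem qpt_wrap {a b k : ℕ → ℕ} (ha : PolyTime a) (hb : PolyTime b) (hk : PolyTime k)
    {G : ∀ n, List (QGate (BodyWire (a n) (b n) (k n)))}
    (hG : PolyGates (fun n => bodyNum (a n) (b n) (k n)) G) : QPT fun n => wrap (G n) := by
  rw [qpt_iff]
  refine ⟨by simp only [wrap]; fun_prop, ?_⟩
  simp only [wrap_qgates]
  refine PolyGates.append (ι := fun n => Fin (a n + (b n + a n + k n))) (PolyGates.append ?_ ?_) ?_
  · unfold PolyGates
    simp only [List.map_map]
    exact PolyTime.finRange_map ha (R := fun n i => (1, [i, a n + b n + i])) (by fun_prop)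
      fun _ _ => rfl
  · unfold PolyGates
    simp only [List.map_map]
    exact PolyTime.finRange_map ha (R := fun n i => (1, [a n + b n + i, i])) (by fun_prop)
      fun _ _ => rfl
  · unfold PolyGates at *
    simp only [List.map_map]
    refine hG.of_code_eq fun n => ?_
    congr 1
    refine List.map_congr_left fun g _ => ?_
    cases g <;> rfl

/-! ## Layers of wires -/

section
variable {ι : Type} [DecidableEq ι]

/-- Controlled NOT gates from the wires `s` to the wires `t`. -/
def cxLayer {k : ℕ} (s t : Fin k → ι) (h : ∀ i, s i ≠ t i) : List (QGate ι) :=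
  (List.finRange k).map fun i => QGate.cx (s i) (t i) (h i)

/-- Toffoli gates from the wires `c` and `s` to the wires `t`. -/
def ccxLayer {k : ℕ} (c s t : Fin k → ι) (h1 : ∀ i, c i ≠ s i) (h2 : ∀ i, c i ≠ t i)
    (h3 : ∀ i, s i ≠ t i) : List (QGate ι) :=
  (List.finRange k).map fun i => QGate.ccx (c i) (s i) (t i) (h1 i) (h2 i) (h3 i)

theorem isCl_cxLayer {k : ℕ} {s t : Fin k → ι} {h : ∀ i, s i ≠ t i} :
    ∀ g ∈ cxLayer s t h, g.IsCl := by
  intro g hg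
  obtain ⟨i, -, rfl⟩ := List.mem_map.1 hg
  trivial

theorem isCl_ccxLayer {k : ℕ} {c s t : Fin k → ι} {h1 : ∀ i, c i ≠ s i} {h2 : ∀ i, c i ≠ t i}
    {h3 : ∀ i, s i ≠ t i} : ∀ g ∈ ccxLayer c s t h1 h2 h3, g.IsCl := by
  intro g hg
  obtain ⟨i, -, rfl⟩ := List.mem_map.1 hg
  trivial

theorem clL_cxLayer {k : ℕ} {s t : Fin k → ι} {h : ∀ i, s i ≠ t i} (hst : ∀ i j, s i ≠ t j)
    (ht : Function.Injective t) (y : ι → Bool) :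
    clL (cxLayer s t h) y = Function.extend t (fun i => Bool.xor (y (t i)) (y (s i))) y :=
  clL_finRange_map (F := fun i y => y (s i)) (fun _ _ => rfl)
    (fun _ _ _ _ => flipAt_of_ne (hst _ _) _) ht y

theorem clL_ccxLayer {k : ℕ} {c s t : Fin k → ι} {h1 : ∀ i, c i ≠ s i} {h2 : ∀ i, c i ≠ t i}
    {h3 : ∀ i, s i ≠ t i} (hct : ∀ i j, c i ≠ t j) (hst : ∀ i j, s i ≠ t j)
    (ht : Function.Injective t) (y : ι → Bool) :
    clL (ccxLayer c s t h1 h2 h3) y =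
      Function.extend t (fun i => Bool.xor (y (t i)) (y (c i) && y (s i))) y :=
  clL_finRange_map (F := fun i y => y (c i) && y (s i)) (fun _ _ => rfl)
    (fun _ _ _ _ => by simp only [flipAt_of_ne (hct _ _), flipAt_of_ne (hst _ _)]) ht y

theorem actL_hLayer_bket [Fintype ι] {k : ℕ} (e : Fin k ↪ ι) (s : ι → Bool) :
    actL (hLayer e) (bket s) =
      rt ^ k • ∑ y, sgn (s ∘ e) y • bket (Function.extend e y s) := by
  funext z
  have hz : ∀ (y : Bits k) (s z : ι → Bool), Function.extend e y z = s ↔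
      y = s ∘ e ∧ ∀ i, (∀ j, e j ≠ i) → z i = s i := by
    intro y s z
    constructor
    · rintro rfl
      refine ⟨funext fun j => (e.injective.extend_apply _ _ j).symm, fun i hi => ?_⟩
      rw [Function.extend_apply' _ _ _ fun ⟨j, hj⟩ => hi j hj]
    · rintro ⟨rfl, h⟩
      exact (extend_eq_of_forall e.injective (fun j => rfl) fun i hi => (h i hi).symm).symm
  rw [actL_hLayer, Pi.smul_apply, Finset.sum_apply, smul_eq_mul]
  congr 1
  simp only [Pi.smul_apply, bket_apply, smul_eq_mul, mul_ite, mul_one, mul_zero]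
  have h1 : ∀ y, Function.extend e y z = s ↔
      y = s ∘ e ∧ ∀ i, (∀ j, e j ≠ i) → z i = s i := fun y => hz y s z
  have h2 : ∀ y, z = Function.extend e y s ↔
      y = z ∘ e ∧ ∀ i, (∀ j, e j ≠ i) → z i = s i := fun y => by
    rw [eq_comm, hz y z s]
    simp only [eq_comm]
  simp only [h1, h2]
  by_cases h : ∀ i, (∀ j, e j ≠ i) → z i = s i
  · have h' : (∀ i, (∀ j, e j ≠ i) → z i = s i) ↔ True := iff_true_intro h
    simp only [h', and_true]
    simp [sgn_comm]
  · have h' : (∀ i, (∀ j, e j ≠ i) → z i = s i) ↔ False := iff_false_intro h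
    simp only [h', and_false]
    simp

theorem actL_hLayer_bket_zero [Fintype ι] {k : ℕ} (e : Fin k ↪ ι) (s : ι → Bool)
    (hs : ∀ i, s (e i) = false) :
    actL (hLayer e) (bket s) = rt ^ k • ∑ y, bket (Function.extend e y s) := by
  rw [actL_hLayer_bket]
  congr 1
  refine Finset.sum_congr rfl fun y _ => ?_
  simp [sgn, hs]

end

section
variable {α : Type} [TreeCode α] {ι : α → Type} {num : ∀ x, ι x → ℕ} {k : α → ℕ}

/-- The numbers of the wires `e x` are computed in polynomial time. -/
def PolyWires (num : ∀ x, ι x → ℕ) (e : ∀ x, Fin (k x) → ι x) : Prop :=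
  PolyTime fun x => List.ofFn fun i => num x (e x i)

theorem PolyWires.of {e : ∀ x, Fin (k x) → ι x} (hk : PolyTime k) {R : α → ℕ → ℕ}
    (hR : PolyTime fun p : α × ℕ => R p.1 p.2) (h : ∀ x i, num x (e x i) = R x i.val) :
    PolyWires num e := by
  unfold PolyWires
  simp only [List.ofFn_eq_map]
  exact PolyTime.finRange_map hk hR h

theorem PolyWires.append {k' : α → ℕ} {e : ∀ x, Fin (k x) → ι x} {f : ∀ x, Fin (k' x) → ι x}
    (he : PolyWires num e) (hf : PolyWires num f) :
    PolyWires num fun x => Fin.append (e x) (f x) := by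
  unfold PolyWires at *
  have h : ∀ x, (List.ofFn fun i => num x (Fin.append (e x) (f x) i)) =
      (List.ofFn fun i => num x (e x i)) ++ List.ofFn fun i => num x (f x i) := by
    intro x
    rw [← List.ofFn_fin_append]
    exact congrArg _ (comp_append (num x) (e x) (f x))
  simp only [h]
  fun_prop

theorem PolyWires.cons {w : ∀ x, ι x} {e : ∀ x, Fin (k x) → ι x}
    (hw : PolyTime fun x => num x (w x)) (he : PolyWires num e) :
    PolyWires num (k := fun x => k x + 1) fun x => Fin.cons (w x) (e x) := by
  unfold PolyWires at *
  have h : ∀ x, (List.ofFn fun i => num x ((Fin.cons (w x) (e x) : Fin (k x + 1) → ι x) i)) =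
      num x (w x) :: List.ofFn fun i => num x (e x i) := by
    intro x
    rw [List.ofFn_succ]
    rfl
  simp only [h]
  fun_prop

theorem PolyWires.getD (e : ∀ x, Fin (k x) → ι x) (x : α) (i : Fin (k x)) :
    (List.ofFn fun i => num x (e x i)).getD i 0 = num x (e x i) := by
  rw [List.getD_eq_getElem _ _ (by simp)]
  simp

theorem PolyWires.exists_list {e : ∀ x, Fin (k x) → ι x} (he : PolyWires num e) :
    ∃ L : α → List ℕ, PolyTime L ∧ ∀ x i, num x (e x i) = (L x).getD i.val 0 :=
  ⟨_, he, fun x i => (PolyWires.getD e x i).symm⟩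

theorem PolyGates.mapWires {G : ∀ x, List (QGate (Fin (k x)))}
    (hG : PolyGates (fun _ => Fin.val) G) (e : ∀ x, Fin (k x) ↪ ι x)
    (he : PolyWires num fun x => e x) : PolyGates num fun x => (G x).map (QGate.map (e x)) :=
  hG.map e he fun x i => (PolyWires.getD (num := num) (fun x => e x) x i).symm

theorem PolyGates.hLayer {e : ∀ x, Fin (k x) ↪ ι x} (he : PolyWires num fun x => e x) :
    PolyGates num fun x => hLayer (e x) := by
  unfold PolyGates PolyWires at *
  have h : PolyTime fun x => (List.ofFn fun i => num x (e x i)).map fun i => (3, [i]) := by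
    fun_prop
  refine h.of_code_eq fun x => ?_
  congr 1
  simp only [List.ofFn_eq_map, PkT.hLayer, List.map_map]
  rfl

theorem PolyGates.cxLayer [∀ x, DecidableEq (ι x)] (hk : PolyTime k)
    {s t : ∀ x, Fin (k x) → ι x} {h : ∀ x i, s x i ≠ t x i}
    (hs : PolyWires num s) (ht : PolyWires num t) :
    PolyGates num fun x => cxLayer (s x) (t x) (h x) := by
  unfold PolyGates
  simp only [PkT.cxLayer, List.map_map]
  obtain ⟨L, hL, hL'⟩ := hs.exists_list
  obtain ⟨M, hM, hM'⟩ := ht.exists_list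
  refine PolyTime.finRange_map hk (R := fun x i => (1, [(L x).getD i 0, (M x).getD i 0]))
    (by fun_prop) fun x i => ?_
  rw [← hL', ← hM']
  rfl

theorem PolyGates.ccxLayer [∀ x, DecidableEq (ι x)] (hk : PolyTime k)
    {c s t : ∀ x, Fin (k x) → ι x} {h1 : ∀ x i, c x i ≠ s x i} {h2 : ∀ x i, c x i ≠ t x i}
    {h3 : ∀ x i, s x i ≠ t x i}
    (hc : PolyWires num c) (hs : PolyWires num s) (ht : PolyWires num t) :
    PolyGates num fun x => ccxLayer (c x) (s x) (t x) (h1 x) (h2 x) (h3 x) := by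
  unfold PolyGates
  simp only [PkT.ccxLayer, List.map_map]
  obtain ⟨K, hK, hK'⟩ := hc.exists_list
  obtain ⟨L, hL, hL'⟩ := hs.exists_list
  obtain ⟨M, hM, hM'⟩ := ht.exists_list
  refine PolyTime.finRange_map hk
    (R := fun x i => (2, [(K x).getD i 0, (L x).getD i 0, (M x).getD i 0]))
    (by fun_prop) fun x i => ?_
  rw [← hK', ← hL', ← hM']
  rfl

end

theorem PolyGates.copyBlock {ι : ℕ → Type} [∀ n, DecidableEq (ι n)] {num : ∀ n, ι n → ℕ}
    {a b : ℕ → ℕ} {C : ∀ n, QCircuit (a n) (b n)} (hC : QPT C) (hb : PolyTime b)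
    {e : ∀ n, Fin (a n + (C n).anc) ↪ ι n} {t : ∀ n, Fin (b n) → ι n}
    {hd : ∀ n i j, e n i ≠ t n j} (he : PolyWires num fun n => e n) (ht : PolyWires num t) :
    PolyGates num fun n => copyBlock (C n) (e n) (t n) (hd n) := by
  obtain ⟨-, hG⟩ := (qpt_iff C).1 hC
  refine PolyGates.append (PolyGates.append (hG.mapWires e he) ?_) (hG.inv.mapWires e he)
  unfold PolyGates
  simp only [List.map_map]
  obtain ⟨L, hL, hL'⟩ := he.exists_list
  obtain ⟨M, hM, hM'⟩ := ht.exists_list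
  refine PolyTime.finRange_map hb (R := fun x i => (1, [(L x).getD i 0, (M x).getD i 0]))
    (by fun_prop) fun x i => ?_
  rw [← hM']
  have := hL' x ((C x).outWire i)
  simp only [QCircuit.outWire, Fin.val_cast, Fin.val_castAdd] at this
  rw [← this]
  rfl

/-! ## Generation of public keys -/

/-- The basis state of the public key `r` with the message bit `m 0`, where `r` is the tail
of `m`. -/
def keyString {u l : ℕ} (sign : Bits (u + 1) → Bits l) (m : Bits (u + 1)) : Bits (u + (l + 1)) :=
  Fin.append (Fin.tail m) (Fin.cons (m 0) (sign m))

section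
variable {sk u l : ℕ} (C : QCircuit (sk + (u + 1)) l)

/-- The wires of a message in the circuit that generates public keys. -/
def pkGenMsg {k : ℕ} : Fin (u + 1) → BodyWire sk (u + (l + 1)) k :=
  Fin.cons (.inr (.inl (Fin.natAdd u 0))) fun i => .inr (.inl (Fin.castAdd (l + 1) i))

theorem pkGenMsg_injective {k : ℕ} :
    Function.Injective (pkGenMsg : Fin (u + 1) → BodyWire sk (u + (l + 1)) k) := by
  refine Fin.cons_injective_iff.2 ⟨?_, fun i j h => ?_⟩
  · rintro ⟨i, hi⟩
    simp only [Sum.inr.injEq, Sum.inl.injEq, Fin.ext_iff, Fin.val_castAdd, Fin.val_natAdd] at hi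
    have := i.2
    simp at hi
    omega
  · simpa [Fin.ext_iff] using h

/-- The wires of the register of the signature. -/
def pkGenSig {k : ℕ} (j : Fin l) : BodyWire sk (u + (l + 1)) k :=
  .inr (.inl (Fin.natAdd u j.succ))

/-- The wires on which signatures are computed. -/
def pkGenSign : Fin (sk + (u + 1) + C.anc) ↪ BodyWire sk (u + (l + 1)) (u + C.anc) :=
  ⟨Fin.append (Fin.append .inl pkGenMsg) fun i => .inr (.inr (Fin.natAdd u i)), by
    refine Fin.append_injective_iff.2 ⟨Fin.append_injective_iff.2
      ⟨Sum.inl_injective, pkGenMsg_injective, fun i j => ?_⟩, fun i j h => ?_, fun i j => ?_⟩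
    · refine Fin.cases ?_ (fun j => ?_) j <;> simp [pkGenMsg]
    · simpa [Fin.ext_iff] using h
    · refine Fin.addCases (fun i => ?_) (fun i => ?_) i
      · simp
      · refine Fin.cases ?_ (fun i => ?_) i <;> simp [pkGenMsg]⟩

theorem pkGenSign_ne_sig (i : Fin (sk + (u + 1) + C.anc)) (j : Fin l) :
    pkGenSign C i ≠ pkGenSig j := by
  induction i using Fin.addCases with
  | left i =>
    induction i using Fin.addCases with
    | left i => simp [pkGenSign, pkGenSig]
    | right i =>
      refine Fin.cases ?_ (fun i => ?_) i
      · simp [pkGenSign, pkGenSig, pkGenMsg, Fin.ext_iff]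
      · simp [pkGenSign, pkGenSig, pkGenMsg, Fin.ext_iff]; omega
  | right i => simp [pkGenSign, pkGenSig]

/-- The gates that generate a public key. -/
def pkGenBody : List (QGate (BodyWire sk (u + (l + 1)) (u + C.anc))) :=
  hLayer ⟨pkGenMsg, pkGenMsg_injective⟩ ++
    (copyBlock C (pkGenSign C) pkGenSig (pkGenSign_ne_sig C) ++
      cxLayer (fun i : Fin u => .inr (.inl (Fin.castAdd (l + 1) i)))
        (fun i => .inr (.inr (Fin.castAdd C.anc i))) (fun _ => by simp))

variable {C} {sign : Bits sk → Bits (u + 1) → Bits l}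

/-- The Hadamard layer makes a uniform superposition of messages `α‖r`, which the signature block
completes to key strings. The last layer copies `r`, but not `A`, to wires that will be discarded.
-/
theorem actL_pkGenBody (hC : C.Computes fun x => sign x.left x.right) (x : Bits sk) :
    actL (pkGenBody C) (bket (bodyState x (fun _ => false) fun _ => false)) =
      rt ^ (u + 1) • ∑ m, bket (bodyState x (keyString (sign x) m)
        (Fin.append (Fin.tail m) fun _ => false)) := by
  rw [pkGenBody, actL_append, actL_hLayer_bket_zero, map_smul, map_sum]
  · congr 1
    refine Finset.sum_congr rfl fun m _ => ?_
    have h1 : Function.extend (pkGenMsg : Fin (u + 1) → BodyWire sk (u + (l + 1)) (u + C.anc)) m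
        (bodyState x (fun _ => false) fun _ => false) =
        bodyState x (Fin.append (Fin.tail m) (Fin.cons (m 0) fun _ => false)) fun _ => false := by
      symm
      refine extend_eq_of_forall pkGenMsg_injective (fun j => ?_) ?_
      · refine Fin.cases ?_ (fun j => ?_) j
        · simp [pkGenMsg, bodyState]
        · simp [pkGenMsg, bodyState, Fin.tail]
      · rintro (i | i | i) hi
        · rfl
        · revert hi
          refine Fin.addCases (fun i hi => ?_) (fun i => Fin.cases (fun hi => ?_) (fun i hi => ?_) i) i
          · exact absurd rfl (hi i.succ)
          · exact absurd rfl (hi 0)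
          · simp [bodyState]
        · rfl
    have h2 : clL (copyBlock C (pkGenSign C) pkGenSig (pkGenSign_ne_sig C))
        (bodyState x (Fin.append (Fin.tail m) (Fin.cons (m 0) fun _ => false)) fun _ => false) =
        bodyState x (keyString (sign x) m) fun _ => false := by
      have hinj : Function.Injective
          (pkGenSig : Fin l → BodyWire sk (u + (l + 1)) (u + C.anc)) := fun i j h => by
        simpa [pkGenSig, Fin.ext_iff] using h
      rw [clL_copyBlock hC _ hinj _ (Fin.append x m)]
      · symm
        refine extend_eq_of_forall hinj (fun j => ?_) ?_
        · simp [pkGenSig, bodyState, keyString]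
        · rintro (i | i | i) hi
          · rfl
          · revert hi
            refine Fin.addCases (fun i hi => ?_)
              (fun i => Fin.cases (fun hi => ?_) (fun i hi => ?_) i) i
            · simp [bodyState, keyString]
            · simp [bodyState, keyString]
            · exact absurd rfl (hi i)
          · rfl
      · simp only [pkGenSign, Function.Embedding.coeFn_mk, comp_append]
        congr 1
        · congr 1
          funext i
          refine Fin.cases ?_ (fun i => ?_) i
          · simp [pkGenMsg, bodyState]
          · simp [pkGenMsg, bodyState, Fin.tail]
    have h3 : clL (cxLayer (fun i : Fin u => .inr (.inl (Fin.castAdd (l + 1) i)))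
        (fun i => .inr (.inr (Fin.castAdd C.anc i))) (fun _ => by simp))
        (bodyState x (keyString (sign x) m) fun _ => false) =
        bodyState x (keyString (sign x) m) (Fin.append (Fin.tail m) fun _ => false) := by
      have hinj : Function.Injective fun i : Fin u =>
          (.inr (.inr (Fin.castAdd C.anc i)) : BodyWire sk (u + (l + 1)) (u + C.anc)) :=
        fun i j h => by simpa [Fin.ext_iff] using h
      rw [clL_cxLayer (fun _ _ => by simp) hinj]
      symm
      refine extend_eq_of_forall hinj (fun j => ?_) ?_
      · simp [bodyState, keyString]
      · rintro (i | i | i) hi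
        · rfl
        · rfl
        · revert hi
          refine Fin.addCases (fun i hi => ?_) (fun i hi => ?_) i
          · exact absurd rfl (hi i)
          · simp [bodyState]
    rw [Function.Embedding.coeFn_mk, h1, actL_append, actL_bket (isCl_copyBlock hC _), h2,
      actL_bket isCl_cxLayer, h3]
  · intro i
    refine Fin.cases ?_ (fun i => ?_) i <;> rfl

end

theorem keyString_inj {u l : ℕ} {sign : Bits (u + 1) → Bits l} {m m' : Bits (u + 1)} :
    keyString sign m = keyString sign m' ↔ m = m' := by
  refine ⟨fun h => ?_, fun h => by rw [h]⟩
  obtain ⟨h1, h2⟩ := append_inj.1 h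
  have h3 : m 0 = m' 0 := congrFun h2 0
  rw [← Fin.cons_self_tail m, ← Fin.cons_self_tail m', h1, h3]

theorem pkVec_apply {u l : ℕ} (sign : Bits (u + 1) → Bits l) (r : Bits u) (y : Bits (u + (l + 1))) :
    pkVec r (sign (Fin.cons false r)) (sign (Fin.cons true r)) y =
      rt * ((if y = keyString sign (Fin.cons false r) then 1 else 0) +
        if y = keyString sign (Fin.cons true r) then 1 else 0) := by
  simp [pkVec, ket, Pi.single_apply, keyString, rt]

section
variable {sk u l : ℕ} {C : QCircuit (sk + (u + 1)) l} {sign : Bits sk → Bits (u + 1) → Bits l}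

theorem sum_bodyState {a b k : ℕ} (X X' : Bits a) (Y Y' y y' : Bits b) (W W' : Bits k) :
    ∑ i, ∑ w, (bket (bodyState X Y W) (bodyState i y w) : ℂ) *
      bket (bodyState X' Y' W') (bodyState i y' w) =
      if X = X' ∧ W = W' ∧ y = Y ∧ y' = Y' then 1 else 0 := by
  simp only [bket_apply, bodyState_inj]
  rw [Finset.sum_eq_single X, Finset.sum_eq_single W]
  · by_cases h1 : X = X' <;> by_cases h2 : W = W' <;> by_cases h3 : y = Y <;>
      by_cases h4 : y' = Y' <;> simp [h1, h2, h3, h4]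
  · intro w _ hw; simp [hw]
  · simp
  · intro i _ hi; simp [hi]
  · simp

theorem star_bket {ι : Type} [Fintype ι] [DecidableEq ι] (x y : ι → Bool) :
    star (bket x y) = bket x y := by
  rw [bket_apply]; split_ifs <;> simp

/-- The discarded copies of `r` make the contributions of different strings orthogonal, so the
partial trace leaves a mixture over `r`. The qubit `A` is not copied, and its two values stay
coherent. -/
theorem pkGen_eq (hC : C.Computes fun x => sign x.left x.right) (x : Bits sk)
    (y y' : Bits (u + (l + 1))) :
    (∑ r : Bits u, ((2 : ℂ) ^ u)⁻¹ • Matrix.vecMulVec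
        (pkVec r (sign x (Fin.cons false r)) (sign x (Fin.cons true r)))
        (star (pkVec r (sign x (Fin.cons false r)) (sign x (Fin.cons true r))))) y y' =
      ∑ c, (wrap (pkGenBody C)).iso (y, c) x * star ((wrap (pkGenBody C)).iso (y', c) x) := by
  rw [sum_wrap_iso]
  simp only [bodyAmp, actL_pkGenBody hC, Pi.smul_apply, Finset.sum_apply, smul_eq_mul, star_mul',
    star_sum, star_pow, star_rt, star_bket]
  have h1 : ∀ (i : Bits sk) (w : Bits (u + C.anc)),
      (rt ^ (u + 1) * ∑ m, bket (bodyState x (keyString (sign x) m)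
        (Fin.append (Fin.tail m) fun _ => false)) (bodyState i y w)) *
      (rt ^ (u + 1) * ∑ m, bket (bodyState x (keyString (sign x) m)
        (Fin.append (Fin.tail m) fun _ => false)) (bodyState i y' w)) =
      (1 / 2) ^ (u + 1) * ∑ m, ∑ m', bket (bodyState x (keyString (sign x) m)
        (Fin.append (Fin.tail m) fun _ => false)) (bodyState i y w) *
        bket (bodyState x (keyString (sign x) m')
        (Fin.append (Fin.tail m') fun _ => false)) (bodyState i y' w) := by
    intro i w
    rw [← Finset.sum_mul_sum, ← rt_mul_rt]
    ring
  simp only [h1]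
  have h2 : ∀ F : Bits sk → Bits (u + C.anc) → Bits (u + 1) → Bits (u + 1) → ℂ,
      ∑ i, ∑ w, (1 / 2) ^ (u + 1) * ∑ m, ∑ m', F i w m m' =
        (1 / 2) ^ (u + 1) * ∑ m, ∑ m', ∑ i, ∑ w, F i w m m' := by
    intro F
    simp only [← Finset.mul_sum]
    congr 1
    rw [show ∑ i, ∑ w, ∑ m, ∑ m', F i w m m' = ∑ p : Bits sk × Bits (u + C.anc),
      ∑ q : Bits (u + 1) × Bits (u + 1), F p.1 p.2 q.1 q.2 by
        simp only [Fintype.sum_prod_type], Finset.sum_comm]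
    simp only [Fintype.sum_prod_type]
  rw [h2]
  -- The trace forces the tails of `m` and `m'` to agree; the first bits remain free and give the
  -- four terms of a rank one matrix.
  simp only [sum_bodyState, append_inj, and_true, true_and]
  simp only [Matrix.sum_apply, Matrix.smul_apply, Matrix.vecMulVec_apply, Pi.star_apply,
    pkVec_apply, smul_eq_mul]
  simp only [sum_bits_succ, Fin.tail_cons]
  have h3 : ∀ (r r' : Bits u) (P Q : Prop) [Decidable P] [Decidable Q],
      (if r = r' ∧ P ∧ Q then (1 : ℂ) else 0) =
        if r = r' then (if P then 1 else 0) * (if Q then 1 else 0) else 0 := by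
    intro r r' P Q _ _
    by_cases h1 : P <;> by_cases h2 : Q <;> simp [h1, h2]
  simp only [h3, Finset.sum_add_distrib, Finset.sum_ite_eq, Finset.mem_univ, if_true]
  rw [← Finset.sum_add_distrib, ← Finset.sum_add_distrib, ← Finset.sum_add_distrib,
    Finset.mul_sum]
  refine Finset.sum_congr rfl fun r _ => ?_
  simp only [star_mul', star_rt, star_add, apply_ite star, star_one, star_zero]
  have h4 := rt_mul_rt
  rw [pow_succ, one_div, inv_pow, ← one_div (2 : ℂ), ← h4]
  ring

end

theorem qpt_pkGen {sk u l : ℕ → ℕ} (hsk : PolyTime sk) (hu : PolyTime u) (hl : PolyTime l)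
    {C : ∀ n, QCircuit (sk n + (u n + 1)) (l n)} (hC : QPT C) :
    QPT fun n => wrap (pkGenBody (C n)) := by
  have hanc := ((qpt_iff C).1 hC).1
  have hr : PolyWires (fun n => bodyNum (sk n) (u n + (l n + 1)) (u n + (C n).anc))
      (fun n (i : Fin (u n)) => .inr (.inl (Fin.castAdd (l n + 1) i))) :=
    .of hu (R := fun _ i => i) (by fun_prop) fun _ _ => rfl
  have hm : PolyWires (fun n => bodyNum (sk n) (u n + (l n + 1)) (u n + (C n).anc))
      (fun n => (pkGenMsg : Fin (u n + 1) → BodyWire (sk n) (u n + (l n + 1)) _)) :=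
    .cons (hu.of_code_eq fun n => rfl) hr
  have hs : PolyWires (fun n => bodyNum (sk n) (u n + (l n + 1)) (u n + (C n).anc))
      (fun n (i : Fin (sk n)) => .inl i) :=
    .of hsk (R := fun n i => sk n + (u n + (l n + 1)) + i) (by fun_prop) fun _ _ => rfl
  have ha : PolyWires (fun n => bodyNum (sk n) (u n + (l n + 1)) (u n + (C n).anc))
      (fun n (i : Fin (C n).anc) => .inr (.inr (Fin.natAdd (u n) i))) :=
    .of hanc (R := fun n i => sk n + (u n + (l n + 1)) + sk n + (u n + i)) (by fun_prop)
      fun _ _ => rfl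
  have hS : PolyWires (fun n => bodyNum (sk n) (u n + (l n + 1)) (u n + (C n).anc))
      (fun n => pkGenSign (C n)) := (hs.append hm).append ha
  refine qpt_wrap hsk (by fun_prop) (by fun_prop) ?_
  refine .append (.hLayer hm) (.append (.copyBlock hC hl hS ?_) (.cxLayer hu hr ?_))
  · exact .of hl (R := fun n i => u n + (i + 1)) (by fun_prop) fun _ _ => rfl
  · exact .of hu (R := fun n i => sk n + (u n + (l n + 1)) + sk n + i) (by fun_prop)
      fun _ _ => rfl

/-! ## Encryption -/

section
variable {v u l : ℕ} (C : QCircuit (v + (u + 1) + l) 1)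

/-- The wires of the public key in the encryption circuit. -/
def encKey {b k : ℕ} (i : Fin (u + (l + 1))) : BodyWire (v + 1 + (u + (l + 1))) b k :=
  .inl (Fin.natAdd (v + 1) i)

theorem encKey_injective {b k : ℕ} :
    Function.Injective (encKey : _ → BodyWire (v + 1 + (u + (l + 1))) b k) := fun i j h => by
  simpa [encKey, Fin.ext_iff] using h

theorem encKey_ne_inr {b k : ℕ} (i : Fin (u + (l + 1))) (x : Fin b ⊕ Fin k) :
    (encKey i : BodyWire (v + 1 + (u + (l + 1))) b k) ≠ .inr x := Sum.inl_ne_inr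

theorem encOut_ne {a b k : ℕ} (i : Fin b) :
    (.inr (.inl 0) : BodyWire a (b + 1) k) ≠ .inr (.inl i.succ) :=
  fun h => Fin.succ_ne_zero i (Sum.inl.inj (Sum.inr.inj h)).symm

/-- The wires on which signatures are checked. -/
def encVer : Fin (v + (u + 1) + l + C.anc) ↪
    BodyWire (v + 1 + (u + (l + 1))) (u + (l + 1) + 1) C.anc :=
  ⟨Fin.append (Fin.append (Fin.append (fun i => .inl (Fin.castAdd _ (Fin.castAdd 1 i)))
      (Fin.cons (encKey (Fin.natAdd u 0)) fun i => encKey (Fin.castAdd (l + 1) i)))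
      fun j => encKey (Fin.natAdd u j.succ)) fun i => .inr (.inr i), by
    refine Fin.append_injective_iff.2 ⟨Fin.append_injective_iff.2 ⟨Fin.append_injective_iff.2
      ⟨fun i j h => ?_, Fin.cons_injective_iff.2 ⟨?_, fun i j h => ?_⟩, fun i j => ?_⟩,
      fun i j h => ?_, fun i j => ?_⟩, fun i j h => ?_, fun i j => ?_⟩
    · simpa [Fin.ext_iff] using h
    · rintro ⟨i, hi⟩
      have := congrArg Fin.val (encKey_injective hi)
      simp at this
      omega
    · have := encKey_injective h
      simpa [Fin.ext_iff] using this
    · refine Fin.cases ?_ (fun j => ?_) j <;>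
        simp only [encKey, ne_eq, Sum.inl.injEq, Fin.ext_iff, Fin.val_castAdd, Fin.val_natAdd,
          Fin.cons_zero, Fin.cons_succ] <;> omega
    · have := encKey_injective h
      simpa [Fin.ext_iff] using this
    · induction i using Fin.addCases with
      | left i =>
        rw [Fin.append_left]
        simp only [encKey, ne_eq, Sum.inl.injEq, Fin.ext_iff, Fin.val_castAdd, Fin.val_natAdd]
        omega
      | right i =>
        rw [Fin.append_right]
        refine Fin.cases ?_ (fun i => ?_) i <;>
          simp only [encKey, ne_eq, Sum.inl.injEq, Fin.ext_iff, Fin.val_castAdd, Fin.val_natAdd,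
            Fin.cons_zero, Fin.cons_succ, Fin.val_succ, Fin.val_zero] <;> omega
    · simpa using h
    · induction i using Fin.addCases with
      | left i =>
        rw [Fin.append_left]
        induction i using Fin.addCases with
        | left i => simp
        | right i =>
          rw [Fin.append_right]
          refine Fin.cases ?_ (fun i => ?_) i <;> simp [encKey]
      | right i => simp [encKey]⟩

theorem encVer_ne_out (i : Fin (v + (u + 1) + l + C.anc)) (j : Fin (u + (l + 1) + 1)) :
    encVer C i ≠ .inr (.inl j) := by
  induction i using Fin.addCases with
  | left i =>
    simp only [encVer, Function.Embedding.coeFn_mk, Fin.append_left]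
    induction i using Fin.addCases with
    | left i =>
      rw [Fin.append_left]
      induction i using Fin.addCases with
      | left i => simp
      | right i =>
        rw [Fin.append_right]
        refine Fin.cases ?_ (fun i => ?_) i <;> simp [encKey]
    | right i => simp [encKey]
  | right i => simp [encVer]

/-- The wires of the qubit `A` and the register `B`. -/
def encAB {b k : ℕ} : Fin (l + 1) ↪ BodyWire (v + 1 + (u + (l + 1))) b k :=
  ⟨fun j => encKey (Fin.natAdd u j), fun i j h => by
    have := encKey_injective h
    simpa [Fin.ext_iff] using this⟩

/-- The gates that encrypt. -/
def encBody : List (QGate (BodyWire (v + 1 + (u + (l + 1))) (u + (l + 1) + 1) C.anc)) :=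
  copyBlock C (encVer C) (fun _ => .inr (.inl 0)) (fun i _ => encVer_ne_out C i 0) ++
    (hLayer encAB ++
      (QGate.cx (.inl (Fin.castAdd _ (Fin.natAdd v 0))) (encAB 0)
        (by simp [encAB, encKey, Fin.ext_iff]; omega) ::
        ccxLayer (fun _ => .inr (.inl 0)) encKey (fun i => .inr (.inl i.succ))
          (fun i => (encKey_ne_inr i _).symm) (fun i => encOut_ne i) (fun i => encKey_ne_inr i _)))

/-- The ciphertext of the string `x` if the check of the signature has the result `v`. -/
def ctString {k : ℕ} (c : Bool) (x : Bits k) : Bits (k + 1) := Fin.cons c fun i => c && x i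

variable {C} {ver : Bits v → Bits (u + 1) → Bits l → Bool}

/-- Since `H Z = X H`, the sign `Z^b` before the Hadamard gates is implemented as a controlled NOT
on the first measured bit after them. The result is copied to the output only if the check
succeeded. -/
theorem actL_encBody
    (hC : C.Computes fun x _ => ver x.left.left x.left.right x.right) (vk : Bits v) (b : Bits 1)
    (p : Bits (u + (l + 1))) :
    actL (encBody C) (bket (bodyState (Fin.append (Fin.append vk b) p) (fun _ => false)
        fun _ => false)) =
      rt ^ (l + 1) • ∑ y, sgn p.right y • bket (bodyState
        (Fin.append (Fin.append vk b) (Fin.append p.left (flipAt (b 0) 0 y)))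
        (ctString (ver vk (Fin.cons (p.right 0) p.left) (Fin.tail p.right))
          (Fin.append p.left (flipAt (b 0) 0 y))) fun _ => false) := by
  set c := ver vk (Fin.cons (p.right 0) p.left) (Fin.tail p.right) with hc
  have h1 : clL (copyBlock C (encVer C) (fun _ => .inr (.inl 0)) fun i _ => encVer_ne_out C i 0)
      (bodyState (Fin.append (Fin.append vk b) p) (fun _ => false) fun _ => false) =
      bodyState (Fin.append (Fin.append vk b) p) (Fin.cons c fun _ => false) fun _ => false := by
    have hinj : Function.Injective (fun _ => .inr (.inl 0) :
        Fin 1 → BodyWire (v + 1 + (u + (l + 1))) (u + (l + 1) + 1) C.anc) :=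
      fun i j _ => Subsingleton.elim _ _
    rw [clL_copyBlock hC _ hinj _ (Fin.append (Fin.append vk (Fin.cons (p.right 0) p.left))
      (Fin.tail p.right))]
    · symm
      refine extend_eq_of_forall hinj (fun j => ?_) ?_
      · simp [bodyState, hc]
      · rintro (i | i | i) hi
        · rfl
        · revert hi
          refine Fin.cases (fun hi => ?_) (fun i hi => ?_) i
          · exact absurd rfl (hi 0)
          · simp [bodyState]
        · rfl
    · simp only [encVer, Function.Embedding.coeFn_mk, comp_append]
      congr 1
      congr 1
      · congr 1
        · funext i; simp [bodyState]
        · funext i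
          refine Fin.cases ?_ (fun i => ?_) i
          · simp [bodyState, encKey, Bits.right]
          · simp [bodyState, encKey, Bits.left]
      · funext i; simp [bodyState, encKey, Bits.right, Fin.tail]
  rw [encBody, actL_append, actL_bket (isCl_copyBlock hC _), h1, actL_append, actL_hLayer_bket,
    map_smul, map_sum]
  congr 1
  refine Finset.sum_congr rfl fun y _ => ?_
  rw [map_smul]
  congr 1
  · congr 1
    funext i
    simp [bodyState, encAB, encKey, Bits.right]
  · have h2 : Function.extend (encAB : Fin (l + 1) →
        BodyWire (v + 1 + (u + (l + 1))) (u + (l + 1) + 1) C.anc) y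
        (bodyState (Fin.append (Fin.append vk b) p) (Fin.cons c fun _ => false) fun _ => false) =
        bodyState (Fin.append (Fin.append vk b) (Fin.append p.left y))
          (Fin.cons c fun _ => false) fun _ => false := by
      symm
      refine extend_eq_of_forall encAB.injective (fun j => ?_) ?_
      · simp [bodyState, encAB, encKey]
      · rintro (i | i | i) hi
        · induction i using Fin.addCases with
          | left i => simp [bodyState]
          | right i =>
            induction i using Fin.addCases with
            | left i => simp [bodyState, Bits.left]
            | right i => exact absurd rfl (hi i)
        · rfl
        · rfl
    rw [h2, actL_cons, QGate.act_bket, actL_bket isCl_ccxLayer]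
    swap
    · trivial
    congr 1
    have h3 : (QGate.cx (.inl (Fin.castAdd _ (Fin.natAdd v 0))) (encAB 0)
        (by simp [encAB, encKey, Fin.ext_iff]; omega) : QGate
          (BodyWire (v + 1 + (u + (l + 1))) (u + (l + 1) + 1) C.anc)).cl
        (bodyState (Fin.append (Fin.append vk b) (Fin.append p.left y))
          (Fin.cons c fun _ => false) fun _ => false) =
        bodyState (Fin.append (Fin.append vk b) (Fin.append p.left (flipAt (b 0) 0 y)))
          (Fin.cons c fun _ => false) fun _ => false := by
      rw [QGate.cl, ← h2, flipAt_extend]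
      have hw : Function.extend (encAB : Fin (l + 1) →
          BodyWire (v + 1 + (u + (l + 1))) (u + (l + 1) + 1) C.anc) y
          (bodyState (Fin.append (Fin.append vk b) p) (Fin.cons c fun _ => false) fun _ => false)
          (.inl (Fin.castAdd _ (Fin.natAdd v 0))) = b 0 := by
        rw [h2]; simp [bodyState]
      rw [hw]
      symm
      refine extend_eq_of_forall encAB.injective (fun j => ?_) ?_
      · simp [bodyState, encAB, encKey]
      · rintro (i | i | i) hi
        · induction i using Fin.addCases with
          | left i => simp [bodyState]
          | right i =>
            induction i using Fin.addCases with
            | left i => simp [bodyState, Bits.left]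
            | right i => exact absurd rfl (hi i)
        · rfl
        · rfl
    have hinj : Function.Injective (fun i => .inr (.inl i.succ) :
        Fin (u + (l + 1)) → BodyWire (v + 1 + (u + (l + 1))) (u + (l + 1) + 1) C.anc) :=
      fun i j h => by simpa using h
    rw [h3, clL_ccxLayer
      (fun i j h => Fin.succ_ne_zero j (Sum.inl.inj (Sum.inr.inj h)).symm) (fun i j => by simp [encKey]) hinj]
    symm
    refine extend_eq_of_forall hinj (fun j => ?_) ?_
    · simp [bodyState, ctString, encKey]
    · rintro (i | i | i) hi
      · rfl
      · revert hi
        refine Fin.cases (fun hi => ?_) (fun i hi => ?_) i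
        · simp [bodyState, ctString]
        · exact absurd rfl (hi i)
      · rfl

end

/-! ### The POVM of the encryption circuit. -/

/-- Orthogonality of the characters of `{0,1}^k`, read off from the unitarity of a layer of Hadamard
gates applied to two basis vectors. -/
theorem sum_sgn_mul_sgn {k : ℕ} (x x' : Bits k) :
    ∑ y, sgn x y * sgn x' y = if x = x' then 2 ^ k else 0 := by
  have h := ip_actL (hLayer (Function.Embedding.refl (Fin k))) (bket x) (bket x')
  have hs : ∀ y, actL (hLayer (Function.Embedding.refl (Fin k))) (bket x) y = rt ^ k * sgn x y :=
    fun y => by rw [actL_hLayer_refl]; simp [bket_apply, sgn_comm]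
  have hs' : ∀ y, actL (hLayer (Function.Embedding.refl (Fin k))) (bket x') y =
      rt ^ k * sgn x' y :=
    fun y => by rw [actL_hLayer_refl]; simp [bket_apply, sgn_comm]
  have hstar : ∀ y, star (sgn x y) = sgn x y := fun y => by
    rw [← sgn_eq]; split_ifs <;> simp
  simp only [ip, hs, hs', star_mul', star_pow, star_rt, hstar, star_bket] at h
  have h1 : ∑ y, rt ^ k * sgn x y * (rt ^ k * sgn x' y) =
      (1 / 2) ^ k * ∑ y, sgn x y * sgn x' y := by
    rw [Finset.mul_sum]
    refine Finset.sum_congr rfl fun y _ => ?_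
    rw [← rt_mul_rt, mul_pow]
    ring
  have h2 : ∑ y, bket x y * bket x' y = if x = x' then (1 : ℂ) else 0 := by
    simp [bket_apply, eq_comm]
  rw [h1, h2] at h
  have h3 : ((2 : ℂ) ^ k) * (1 / 2) ^ k = 1 := by rw [← mul_pow]; norm_num
  calc ∑ y, sgn x y * sgn x' y = 2 ^ k * ((1 / 2) ^ k * ∑ y, sgn x y * sgn x' y) := by
        rw [← mul_assoc, h3, one_mul]
    _ = _ := by rw [h]; simp

theorem star_sgn {k : ℕ} (x y : Bits k) : star (sgn x y) = sgn x y := by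
  rw [← sgn_eq]; split_ifs <;> simp

theorem sgn_flipAt_zero {k : ℕ} (c : Bool) (x y : Bits (k + 1)) :
    sgn x (flipAt c 0 y) = (if c = true ∧ x 0 = true then -1 else 1) * sgn x y := by
  have h : ∀ i : Fin k, flipAt c 0 y i.succ = y i.succ := fun i =>
    flipAt_of_ne (Fin.succ_ne_zero i) y
  rw [sgn, sgn, Fin.prod_univ_succ, Fin.prod_univ_succ, flipAt_self]
  simp only [h]
  cases c <;> cases x 0 <;> cases y 0 <;> simp

theorem hadamardRight_apply {u k : ℕ} (q p : Bits (u + k)) :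
    hadamardRight q p = if q.left = p.left then rt ^ k * sgn q.right p.right else 0 := by
  rw [← sgn_eq]; rfl

theorem enc_transform_apply {u l : ℕ} (ver : Bits (u + 1) → Bits l → Bool) (b : Bool)
    (q p : Bits (u + (l + 1))) :
    (hadamardRight * zPow b * checkProj ver : Matrix (Bits (u + (l + 1))) (Bits (u + (l + 1))) ℂ)
      q p =
      if q.left = p.left ∧ ver (Fin.cons (p.right 0) p.left) (Fin.tail p.right) = true then
        rt ^ (l + 1) * sgn p.right (flipAt b 0 q.right) else 0 := by
  rw [checkProj, Matrix.mul_diagonal, zPow, Matrix.mul_diagonal, hadamardRight_apply,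
    sgn_flipAt_zero, sgn_comm q.right]
  by_cases h1 : q.left = p.left <;>
    by_cases h2 : ver (Fin.cons (p.right 0) p.left) (Fin.tail p.right) = true <;>
    simp [h1, h2]

theorem conjTranspose_mul_vecMulVec_mul {X : Type} [Fintype X] [DecidableEq X]
    (S : Matrix X X ℂ) (q p' p : X) :
    (Sᴴ * Matrix.vecMulVec (Pi.single q (1 : ℂ)) (star (Pi.single q (1 : ℂ))) * S :
      Matrix X X ℂ) p' p =
      star (S q p') * S q p := by
  simp only [Matrix.mul_apply, Matrix.vecMulVec_apply, Matrix.conjTranspose_apply, Pi.star_apply]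
  rw [Finset.sum_eq_single q]
  · rw [Finset.sum_eq_single q]
    · simp
    · intro x _ hx; simp [hx]
    · simp
  · intro x _ hx
    simp [hx]
  · simp

theorem ctString_eq_iff {k : ℕ} (c : Bool) (x : Bits k) (ct : Bits (k + 1)) :
    ct = ctString c x ↔ (ct 0 = true ∧ c = true ∧ Fin.tail ct = x) ∨
      (ct 0 = false ∧ c = false ∧ ct = fun _ => false) := by
  constructor
  · rintro rfl
    cases c
    · right
      refine ⟨rfl, rfl, funext fun i => ?_⟩
      refine Fin.cases ?_ (fun i => ?_) i <;> simp [ctString]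
    · left
      refine ⟨rfl, rfl, funext fun i => ?_⟩
      simp [ctString, Fin.tail]
  · rintro (⟨h1, rfl, rfl⟩ | ⟨h1, rfl, rfl⟩)
    · rw [← Fin.cons_self_tail ct, h1]
      simp [ctString]
    · funext i
      refine Fin.cases ?_ (fun i => ?_) i <;> simp [ctString]

section
variable {v u l : ℕ} {C : QCircuit (v + (u + 1) + l) 1} {ver : Bits v → Bits (u + 1) → Bits l → Bool}

/-- The discarded input wires hold `r` and the Hadamard basis string, so tracing them out measures
both. An accepting ciphertext fixes this string, which leaves one rank one term; the rejecting
ciphertext does not, and one sums over all strings. -/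
theorem enc_eq (hC : C.Computes fun x _ => ver x.left.left x.left.right x.right) (vk : Bits v)
    (b : Bits 1) (ct : Bits (u + (l + 1) + 1)) (p' p : Bits (u + (l + 1))) :
    encPOVM (ver vk) (b 0) ct p' p =
      ∑ c, star ((wrap (encBody C)).iso (ct, c) (Fin.append (Fin.append vk b) p')) *
        (wrap (encBody C)).iso (ct, c) (Fin.append (Fin.append vk b) p) := by
  simp only [mul_comm (star _)]
  rw [sum_wrap_iso]
  simp only [bodyAmp, actL_encBody hC, Pi.smul_apply, Finset.sum_apply, smul_eq_mul, star_mul',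
    star_sum, star_pow, star_rt, star_bket, star_sgn]
  set c := ver vk (Fin.cons (p.right 0) p.left) (Fin.tail p.right) with hc
  set c' := ver vk (Fin.cons (p'.right 0) p'.left) (Fin.tail p'.right) with hc'
  have h1 : ∀ (F G : Bits (v + 1 + (u + (l + 1))) → Bits C.anc → Bits (l + 1) → ℂ)
      (f g : Bits (l + 1) → ℂ),
      ∑ i, ∑ w, rt ^ (l + 1) * (∑ y, f y * F i w y) * (rt ^ (l + 1) * ∑ y, g y * G i w y) =
        (1 / 2) ^ (l + 1) * ∑ y, ∑ y', f y * g y' * ∑ i, ∑ w, F i w y * G i w y' := by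
    intro F G f g
    have e1 : ∀ i w, rt ^ (l + 1) * (∑ y, f y * F i w y) * (rt ^ (l + 1) * ∑ y, g y * G i w y) =
        (1 / 2) ^ (l + 1) * ∑ y, ∑ y', f y * g y' * (F i w y * G i w y') := by
      intro i w
      rw [← rt_mul_rt, mul_pow,
        show ∑ y, ∑ y', f y * g y' * (F i w y * G i w y') =
          (∑ y, f y * F i w y) * ∑ y, g y * G i w y by
          rw [Finset.sum_mul_sum]
          exact Finset.sum_congr rfl fun y _ => Finset.sum_congr rfl fun y' _ => by ring]
      ring
    simp only [e1, ← Finset.mul_sum]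
    congr 1
    rw [show ∑ i, ∑ w, ∑ y, ∑ y', f y * g y' * (F i w y * G i w y') =
      ∑ q : Bits (v + 1 + (u + (l + 1))) × Bits C.anc, ∑ r : Bits (l + 1) × Bits (l + 1),
        f r.1 * g r.2 * (F q.1 q.2 r.1 * G q.1 q.2 r.2) by simp only [Fintype.sum_prod_type],
      Finset.sum_comm]
    simp only [Fintype.sum_prod_type, ← Finset.mul_sum]
  rw [h1]
  simp only [sum_bodyState, append_inj, true_and]
  have hflip : ∀ y y' : Bits (l + 1), flipAt (b 0) 0 y = flipAt (b 0) 0 y' ↔ y = y' := by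
    intro y y'
    refine ⟨fun h => ?_, fun h => by rw [h]⟩
    rw [← flipAt_flipAt (b 0) 0 y, h, flipAt_flipAt]
  simp only [hflip]
  have h2 : ∀ y y', (if (p.left = p'.left ∧ y = y') ∧
      ct = ctString c (Fin.append p.left (flipAt (b 0) 0 y)) ∧
      ct = ctString c' (Fin.append p'.left (flipAt (b 0) 0 y')) then (1 : ℂ) else 0) =
      if y = y' then (if p.left = p'.left ∧
        ct = ctString c (Fin.append p.left (flipAt (b 0) 0 y)) ∧
        ct = ctString c' (Fin.append p'.left (flipAt (b 0) 0 y)) then 1 else 0) else 0 := by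
    intro y y'
    by_cases h : y = y'
    · subst h; simp
    · simp [h]
  simp only [h2, mul_ite, mul_zero, Finset.sum_ite_eq, Finset.mem_univ, if_true, mul_one]
  simp only [ctString_eq_iff]
  rw [encPOVM]
  cases hct : ct 0
  · simp only [Bool.false_eq_true, false_and, true_and, false_or, if_false]
    by_cases h0 : ct = fun _ => false
    · simp only [h0, if_true, and_true]
      rw [← Finset.sum_filter, Finset.filter_const]
      by_cases h3 : p.left = p'.left ∧ c = false ∧ c' = false
      -- In the rejecting case the sum over the unseen string is diagonal by orthogonality of
      -- characters: the Hadamard gates were applied needlessly and cancel, leaving `1 - checkProj`.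
      · rw [if_pos h3, sum_sgn_mul_sgn]
        obtain ⟨h4, h5, h6⟩ := h3
        by_cases h7 : p.right = p'.right
        · have hpp : p = p' := by
            rw [← append_left_right p, ← append_left_right p', h4, h7]
          subst hpp
          rw [if_pos rfl, ← mul_pow]
          simp [checkProj, ← hc, h5]
        · rw [if_neg h7, mul_zero, Matrix.sub_apply, Matrix.one_apply_ne, checkProj,
            Matrix.diagonal_apply_ne, sub_zero] <;>
          · rintro rfl; exact h7 rfl
      · rw [if_neg h3, Finset.sum_empty, mul_zero]
        by_cases hpp : p' = p
        · subst hpp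
          have h8 : c = true := by
            by_contra h9
            exact h3 ⟨rfl, by simpa using h9, by simpa using h9⟩
          simp [checkProj, ← hc, h8]
        · rw [Matrix.sub_apply, Matrix.one_apply_ne hpp, checkProj,
            Matrix.diagonal_apply_ne _ hpp, sub_zero]
    · simp [h0]
  · simp only [true_and, Bool.true_eq_false, false_and, or_false, if_true]
    unfold ket
    rw [conjTranspose_mul_vecMulVec_mul, enc_transform_apply, enc_transform_apply,
      ← hc, ← hc']
    set q : Bits (u + (l + 1)) := Fin.tail ct with hq
    have h3 : ∀ (p : Bits (u + (l + 1))) (y : Bits (l + 1)),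
        q = Fin.append p.left (flipAt (b 0) 0 y) ↔
          q.left = p.left ∧ y = flipAt (b 0) 0 q.right := by
      intro p y
      rw [← append_left_right q, append_inj, left_append, right_append]
      refine and_congr_right fun _ => ⟨fun h => ?_, fun h => ?_⟩
      · rw [h, flipAt_flipAt]
      · rw [h, flipAt_flipAt]
    simp only [h3]
    -- The ciphertext determines the string before the flip by `b`, so only one `y` contributes.
    rw [Finset.sum_eq_single (flipAt (b 0) 0 q.right)]
    · have h4 := rt_mul_rt
      have h5 : (1 / 2 : ℂ) ^ (l + 1) = rt ^ (l + 1) * rt ^ (l + 1) := by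
        rw [← rt_mul_rt, mul_pow]
      rw [h5]
      simp only [apply_ite star, star_mul', star_pow, star_rt, star_sgn, star_zero]
      by_cases h6 : q.left = p.left
      · by_cases h7 : q.left = p'.left
        · have h8 : p.left = p'.left := h6.symm.trans h7
          cases c <;> cases c' <;> simp [h6, h8]
          ring
        · simp [h7]
      · simp [h6]
    · intro y _ hy
      simp [hy]
    · simp

end

theorem qpt_enc {v u l : ℕ → ℕ} (hv : PolyTime v) (hu : PolyTime u) (hl : PolyTime l)
    {C : ∀ n, QCircuit (v n + (u n + 1) + l n) 1} (hC : QPT C) :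
    QPT fun n => wrap (encBody (C n)) := by
  have hanc := ((qpt_iff C).1 hC).1
  set num := fun n => bodyNum (v n + 1 + (u n + (l n + 1))) (u n + (l n + 1) + 1) (C n).anc
    with hnum
  have hvk : PolyWires num (fun n (i : Fin (v n)) => .inl (Fin.castAdd _ (Fin.castAdd 1 i))) :=
    .of hv (R := fun n i => (v n + 1 + (u n + (l n + 1))) + (u n + (l n + 1) + 1) + i)
      (by fun_prop) fun _ _ => rfl
  have hkey : PolyWires num (fun n => (encKey : Fin (u n + (l n + 1)) → _)) :=
    .of (by fun_prop) (R := fun n i => (v n + 1 + (u n + (l n + 1))) + (u n + (l n + 1) + 1) +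
      (v n + 1 + i)) (by fun_prop) fun _ _ => rfl
  have hmsg : PolyWires num (fun n => (Fin.cons (encKey (Fin.natAdd (u n) 0)) fun i =>
      encKey (Fin.castAdd (l n + 1) i) : Fin (u n + 1) → _)) := by
    refine .cons ?_ ?_
    · have : PolyTime fun n => (v n + 1 + (u n + (l n + 1))) + (u n + (l n + 1) + 1) +
        (v n + 1 + u n) := by fun_prop
      exact this.of_code_eq fun _ => rfl
    · exact .of hu (R := fun n i => (v n + 1 + (u n + (l n + 1))) + (u n + (l n + 1) + 1) +
        (v n + 1 + i)) (by fun_prop) fun _ _ => rfl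
  have hsig : PolyWires num (fun n (j : Fin (l n)) => encKey (Fin.natAdd (u n) j.succ)) :=
    .of hl (R := fun n i => (v n + 1 + (u n + (l n + 1))) + (u n + (l n + 1) + 1) +
        (v n + 1 + (u n + (i + 1)))) (by fun_prop) fun _ _ => rfl
  have ha : PolyWires num (fun n (i : Fin (C n).anc) => .inr (.inr i)) :=
    .of hanc (R := fun n i => (v n + 1 + (u n + (l n + 1))) + (u n + (l n + 1) + 1) +
        (v n + 1 + (u n + (l n + 1))) + i) (by fun_prop) fun _ _ => rfl
  have hV : PolyWires num (fun n => encVer (C n)) := ((hvk.append hmsg).append hsig).append ha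
  have hAB : PolyWires num (fun n => (encAB : Fin (l n + 1) ↪ _)) :=
    .of (by fun_prop) (R := fun n i => (v n + 1 + (u n + (l n + 1))) + (u n + (l n + 1) + 1) +
      (v n + 1 + (u n + i))) (by fun_prop) fun _ _ => rfl
  have h0 : ∀ k : ℕ → ℕ, PolyTime k → PolyWires num (fun n (_ : Fin (k n)) => .inr (.inl 0)) :=
    fun k hk => .of hk (R := fun _ _ => 0) (by fun_prop) fun _ _ => rfl
  refine qpt_wrap (by fun_prop) (by fun_prop) hanc ?_
  refine .append (.copyBlock hC (.const 1) hV (h0 _ (.const 1)))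
    (.append (.hLayer hAB) (PolyGates.append (G := fun n => [QGate.cx _ _ _]) ?_
      (.ccxLayer (by fun_prop) (h0 _ (by fun_prop)) hkey ?_)))
  · have : PolyTime fun n => [((1 : ℕ), [(v n + 1 + (u n + (l n + 1))) + (u n + (l n + 1) + 1) +
      v n, (v n + 1 + (u n + (l n + 1))) + (u n + (l n + 1) + 1) + (v n + 1 + u n)])] := by
      fun_prop
    exact this.of_code_eq fun _ => rfl
  · exact .of (by fun_prop) (R := fun n i => i + 1) (by fun_prop) fun _ _ => rfl

/-! ## Decryption -/

theorem dot_succ {k : ℕ} (x y : Bits (k + 1)) :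
    x.dot y = Bool.xor (x 0 && y 0) (Bits.dot (Fin.tail x) (Fin.tail y)) := by
  simp only [Bits.dot, Fin.card_filter_univ_succ]
  by_cases h : x 0 = true ∧ y 0 = true
  · simp only [h, and_self, if_true, Bool.and_self, Bool.true_xor, Nat.odd_add_one, decide_not]
    rfl
  · rw [if_neg h]
    have : (x 0 && y 0) = false := by simpa using h
    rw [this, Bool.false_xor]
    rfl

/-- Toffoli gates that add the inner product of the wires `s` and `t` to the wire `a`. -/
def dotLayer {ι : Type} {k : ℕ} (s t : Fin k → ι) (a : ι) (h1 : ∀ i, s i ≠ t i)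
    (h2 : ∀ i, s i ≠ a) (h3 : ∀ i, t i ≠ a) : List (QGate ι) :=
  (List.finRange k).map fun i => QGate.ccx (s i) (t i) a (h1 i) (h2 i) (h3 i)

theorem clL_dotLayer {ι : Type} [DecidableEq ι] {k : ℕ} {s t : Fin k → ι} {a : ι}
    {h1 : ∀ i, s i ≠ t i} {h2 : ∀ i, s i ≠ a} {h3 : ∀ i, t i ≠ a} (y : ι → Bool) :
    clL (dotLayer s t a h1 h2 h3) y = flipAt (Bits.dot (y ∘ s) (y ∘ t)) a y := by
  induction k generalizing y with
  | zero => simp [dotLayer, Bits.dot, flipAt]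
  | succ k ih =>
    have := ih (s := Fin.tail s) (t := Fin.tail t) (h1 := fun i => h1 i.succ)
      (h2 := fun i => h2 i.succ) (h3 := fun i => h3 i.succ) (flipAt (y (s 0) && y (t 0)) a y)
    simp only [dotLayer, List.finRange_succ, List.map_cons, List.map_map, clL_cons, QGate.cl]
      at this ⊢
    refine this.trans ?_
    rw [dot_succ]
    have e1 : flipAt (y (s 0) && y (t 0)) a y ∘ Fin.tail s = Fin.tail (y ∘ s) :=
      funext fun i => flipAt_of_ne (h2 i.succ) y
    have e2 : flipAt (y (s 0) && y (t 0)) a y ∘ Fin.tail t = Fin.tail (y ∘ t) :=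
      funext fun i => flipAt_of_ne (h3 i.succ) y
    rw [e1, e2]
    simp [flipAt]

theorem isCl_dotLayer {ι : Type} {k : ℕ} {s t : Fin k → ι} {a : ι}
    {h1 : ∀ i, s i ≠ t i} {h2 : ∀ i, s i ≠ a} {h3 : ∀ i, t i ≠ a} :
    ∀ g ∈ dotLayer s t a h1 h2 h3, g.IsCl := by
  intro g hg
  obtain ⟨i, -, rfl⟩ := List.mem_map.1 hg
  trivial

section
variable {sk u l : ℕ} (C : QCircuit (sk + (u + 1)) l)

/-- The wires of the decryption circuit. -/
abbrev DecWire (sk u l k : ℕ) : Type :=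
  BodyWire (sk + (u + (l + 1) + 1)) (1 + 1) (l + 1 + (1 + k))

/-- The wires of the ciphertext in the decryption circuit. -/
def decCt {k : ℕ} (i : Fin (u + (l + 1) + 1)) : DecWire sk u l k := .inl (Fin.natAdd sk i)

/-- The wires for the sum of the two signed strings. -/
def decSum {k : ℕ} (i : Fin (l + 1)) : DecWire sk u l k := .inr (.inr (Fin.castAdd (1 + k) i))

/-- The wire for the decrypted bit. -/
def decAcc {k : ℕ} : DecWire sk u l k := .inr (.inr (Fin.natAdd (l + 1) (Fin.castAdd k 0)))

/-- The wires on which signatures are computed. -/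
def decSign : Fin (sk + (u + 1) + C.anc) ↪ DecWire sk u l C.anc :=
  ⟨Fin.append (Fin.append (fun i => .inl (Fin.castAdd _ i))
      (Fin.cons (decSum 0) fun i => decCt (Fin.succ (Fin.castAdd (l + 1) i))))
      fun i => .inr (.inr (Fin.natAdd (l + 1) (Fin.natAdd 1 i))), by
    refine Fin.append_injective_iff.2 ⟨Fin.append_injective_iff.2
      ⟨fun i j h => ?_, Fin.cons_injective_iff.2 ⟨?_, fun i j h => ?_⟩, fun i j => ?_⟩,
      fun i j h => ?_, fun i j => ?_⟩
    · simpa [Fin.ext_iff] using h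
    · rintro ⟨i, hi⟩
      simp [decCt, decSum] at hi
    · simpa [decCt, Fin.ext_iff] using h
    · refine Fin.cases ?_ (fun j => ?_) j
      · simp [decSum]
      · simp only [decCt, ne_eq, Sum.inl.injEq, Fin.ext_iff, Fin.val_castAdd, Fin.val_natAdd,
          Fin.cons_succ]
        omega
    · simpa [Fin.ext_iff] using h
    · induction i using Fin.addCases with
      | left i => simp
      | right i =>
        rw [Fin.append_right]
        refine Fin.cases ?_ (fun i => ?_) i
        · simp only [decSum, ne_eq, Sum.inr.injEq, Fin.ext_iff, Fin.val_castAdd, Fin.val_natAdd,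
            Fin.cons_zero, Fin.val_zero]
          omega
        · simp [decCt]⟩

theorem decSign_ne (i : Fin (sk + (u + 1) + C.anc)) (j : Fin l) :
    decSign C i ≠ decSum j.succ := by
  induction i using Fin.addCases with
  | left i =>
    simp only [decSign, Function.Embedding.coeFn_mk, Fin.append_left]
    induction i using Fin.addCases with
    | left i => simp [decSum]
    | right i =>
      rw [Fin.append_right]
      refine Fin.cases ?_ (fun i => ?_) i <;> simp [decSum, decCt, Fin.ext_iff]
  | right i =>
    simp only [decSign, Function.Embedding.coeFn_mk, Fin.append_right, decSum, ne_eq,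
      Sum.inr.injEq, Fin.ext_iff, Fin.val_castAdd, Fin.val_natAdd, Fin.val_succ]
    omega

theorem decCt_ne_inr {k : ℕ} (i : Fin (u + (l + 1) + 1)) (x) :
    (decCt i : DecWire sk u l k) ≠ .inr x := Sum.inl_ne_inr

theorem decCt_ne_sum {k : ℕ} (i : Fin (u + (l + 1) + 1)) (j) :
    (decCt i : DecWire sk u l k) ≠ decSum j := Sum.inl_ne_inr

theorem decCt_ne_acc {k : ℕ} (i : Fin (u + (l + 1) + 1)) :
    (decCt i : DecWire sk u l k) ≠ decAcc := Sum.inl_ne_inr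

theorem decAcc_ne_out {k : ℕ} (i : Fin 2) : (decAcc : DecWire sk u l k) ≠ .inr (.inl i) := by
  simp [decAcc]

theorem decSum_ne_acc {k : ℕ} (i : Fin (l + 1)) : (decSum i : DecWire sk u l k) ≠ decAcc := by
  simp only [decSum, decAcc, ne_eq, Sum.inr.injEq, Fin.ext_iff, Fin.val_castAdd,
    Fin.val_natAdd]
  omega

/-- The gates that decrypt. -/
def decBody : List (QGate (DecWire sk u l C.anc)) :=
  copyBlock C (decSign C) (fun j => decSum j.succ) (decSign_ne C) ++
    (QGate.x (decSum 0) ::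
      (copyBlock C (decSign C) (fun j => decSum j.succ) (decSign_ne C) ++
        (dotLayer (fun j => decCt (Fin.succ (Fin.natAdd u j))) decSum decAcc
            (fun _ => decCt_ne_sum _ _) (fun _ => decCt_ne_acc _) decSum_ne_acc ++
          [QGate.cx (decCt 0) (.inr (.inl 0)) (decCt_ne_inr _ _),
            QGate.ccx (decCt 0) decAcc (.inr (.inl 1)) (decCt_ne_acc _) (decCt_ne_inr _ _)
              (decAcc_ne_out _)])))

variable {C} {sign : Bits sk → Bits (u + 1) → Bits l}

/-- The state of the wires of the decryption circuit. -/
def decState {k : ℕ} (x : Bits sk) (ct : Bits (u + (l + 1) + 1)) (y : Bits 2) (s : Bits (l + 1))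
    (a : Bool) : DecWire sk u l k → Bool :=
  bodyState (Fin.append x ct) y (Fin.append s (Fin.append (fun _ => a) fun _ => false))

/-- The wire `decSum 0` doubles as the first bit of the message that is signed, so which of the two
signatures is added is controlled by a NOT gate between two identical blocks. -/
theorem clL_decCopy (hC : C.Computes fun x => sign x.left x.right) (x : Bits sk)
    (ct : Bits (u + (l + 1) + 1)) (y : Bits 2) (s : Bits (l + 1)) (a : Bool) :
    clL (copyBlock C (decSign C) (fun j => decSum j.succ) (decSign_ne C)) (decState x ct y s a) =
      decState x ct y (Fin.cons (s 0) (Bits.xor (Fin.tail s)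
        (sign x (Fin.cons (s 0) (Bits.left (Fin.tail ct : Bits (u + (l + 1)))))))) a := by
  have hinj : Function.Injective (fun j : Fin l => (decSum j.succ : DecWire sk u l C.anc)) :=
    fun i j h => by simpa [decSum, Fin.ext_iff] using h
  rw [clL_copyBlock hC _ hinj _ (Fin.append x (Fin.cons (s 0) (Bits.left
    (Fin.tail ct : Bits (u + (l + 1))))))]
  · symm
    refine extend_eq_of_forall hinj (fun j => ?_) ?_
    · simp [decState, bodyState, decSum, Bits.xor, Fin.tail]
    · rintro (i | i | i) hi
      · rfl
      · rfl
      · induction i using Fin.addCases with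
        | left i =>
          revert hi
          refine Fin.cases (fun hi => ?_) (fun i hi => ?_) i
          · simp [decState, bodyState]
          · exact absurd rfl (hi i)
        | right i => simp [decState, bodyState]
  · simp only [decSign, Function.Embedding.coeFn_mk, comp_append]
    congr 1
    · congr 1
      · funext i; simp [decState, bodyState]
      · funext i
        refine Fin.cases ?_ (fun i => ?_) i
        · simp [decState, bodyState, decSum]
        · simp [decState, bodyState, decCt, Bits.left, Fin.tail]
    · funext i; simp [decState, bodyState]

/-- Adding the signature of `0‖r`, flipping the first bit and adding the signature of `1‖r` leaves
exactly `0‖σ₀ ⊕ 1‖σ₁` in the sum register, since the flipped bit is the sum of the two leading bits.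
-/
theorem clL_decBody (hC : C.Computes fun x => sign x.left x.right) (x : Bits sk)
    (ct : Bits (u + (l + 1) + 1)) :
    ∃ i w, clL (decBody C) (bodyState (Fin.append x ct) (fun _ => false) fun _ => false) =
      bodyState i (encodeOption (decBit (sign x) ct)) w := by
  have h0 : bodyState (Fin.append x ct) (fun _ => false) (fun _ => false) =
      (decState x ct (fun _ => false) (fun _ => false) false : DecWire sk u l C.anc → Bool) := by
    rw [decState]
    congr 1
    funext i
    induction i using Fin.addCases with
    | left i => simp
    | right i => induction i using Fin.addCases <;> simp
  set r : Bits u := Bits.left (Fin.tail ct : Bits (u + (l + 1))) with hr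
  set d : Bits (l + 1) := Bits.right (Fin.tail ct : Bits (u + (l + 1))) with hd
  have h1 : (QGate.x (decSum 0)).cl (decState x ct (fun _ => false)
      (Fin.cons false (Bits.xor (Fin.tail (fun _ => false)) (sign x (Fin.cons false r)))) false) =
      (decState x ct (fun _ => false) (Fin.cons true (sign x (Fin.cons false r))) false :
        DecWire sk u l C.anc → Bool) := by
    funext i
    rcases i with i | i | i
    · rfl
    · rfl
    · induction i using Fin.addCases with
      | left i =>
        refine Fin.cases ?_ (fun i => ?_) i
        · simp [QGate.cl, flipAt, decSum, decState, bodyState]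
        · have h2 : (.inr (.inr (Fin.castAdd (1 + C.anc) i.succ)) : DecWire sk u l C.anc) ≠
              decSum 0 := by simp [decSum, Fin.ext_iff]
          rw [QGate.cl, flipAt_of_ne h2]
          simp [decState, bodyState, Bits.xor, Fin.tail]
      | right i =>
        have h2 : (.inr (.inr (Fin.natAdd (l + 1) i)) : DecWire sk u l C.anc) ≠ decSum 0 := by
          simp only [decSum, ne_eq, Sum.inr.injEq, Fin.ext_iff, Fin.val_castAdd, Fin.val_natAdd,
            Fin.val_zero]
          omega
        rw [QGate.cl, flipAt_of_ne h2]
        simp [decState, bodyState]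
  set t : Bits (l + 1) := Bits.xor (Fin.cons false (sign x (Fin.cons false r)))
    (Fin.cons true (sign x (Fin.cons true r))) with ht
  have h2 : (Fin.cons true (Bits.xor (Fin.tail (Fin.cons true (sign x (Fin.cons false r)) :
      Bits (l + 1))) (sign x (Fin.cons true r))) : Bits (l + 1)) = t := by
    funext i
    refine Fin.cases ?_ (fun i => ?_) i <;> simp [t, Bits.xor]
  rw [h0, decBody, clL_append, clL_decCopy hC, clL_cons, ← hr, h1, clL_append, clL_decCopy hC,
    ← hr, Fin.cons_zero, h2, clL_append, clL_dotLayer]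
  have h3 : flipAt (Bits.dot ((decState x ct (fun _ => false) t false : DecWire sk u l C.anc → Bool)
      ∘ fun j => decCt (Fin.succ (Fin.natAdd u j))) ((decState x ct (fun _ => false) t false :
      DecWire sk u l C.anc → Bool) ∘ decSum)) decAcc (decState x ct (fun _ => false) t false) =
      (decState x ct (fun _ => false) t (d.dot t) : DecWire sk u l C.anc → Bool) := by
    have e1 : (decState x ct (fun _ => false) t false : DecWire sk u l C.anc → Bool)
        ∘ (fun j => decCt (Fin.succ (Fin.natAdd u j))) = d :=
      funext fun i => by simp [decState, bodyState, decCt, hd, Bits.right, Fin.tail]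
    have e2 : (decState x ct (fun _ => false) t false : DecWire sk u l C.anc → Bool) ∘ decSum =
        t := funext fun i => by simp [decState, bodyState, decSum]
    rw [e1, e2]
    funext i
    rcases i with i | i | i
    · rfl
    · rfl
    · induction i using Fin.addCases with
      | left i =>
        refine (flipAt_of_ne (decSum_ne_acc i) _).trans ?_
        simp [decState, bodyState, decSum]
      | right i =>
        induction i using Fin.addCases with
        | left i =>
          have : i = 0 := Subsingleton.elim _ _
          subst this
          simp [flipAt, decAcc, decState, bodyState]
        | right i =>
          have h2 : (.inr (.inr (Fin.natAdd (l + 1) (Fin.natAdd 1 i))) : DecWire sk u l C.anc) ≠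
              decAcc := by simp [decAcc, Fin.ext_iff]
          rw [flipAt_of_ne h2]
          simp [decState, bodyState]
  rw [h3]
  refine ⟨Fin.append x ct, Fin.append t (Fin.append (fun _ => d.dot t) fun _ => false), ?_⟩
  -- The leading output bit says that the result is not `⊥`; masking the decrypted bit with it
  -- produces the all-zero code of `none`.
  have h4 : encodeOption (decBit (sign x) ct) = Fin.cons (ct 0) fun _ => ct 0 && d.dot t := by
    rw [decBit]
    cases ct 0 <;> funext i <;> refine Fin.cases ?_ (fun i => ?_) i <;>
      simp [encodeOption, hd, ht, hr]
  rw [h4]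
  funext i
  simp only [clL_cons, clL_nil, QGate.cl]
  have n1 : (decCt 0 : DecWire sk u l C.anc) ≠ .inr (.inl 0) := decCt_ne_inr _ _
  have n2 : (decAcc : DecWire sk u l C.anc) ≠ .inr (.inl 0) := by simp [decAcc]
  rw [flipAt_of_ne n1, flipAt_of_ne n2]
  have v1 : (decState x ct (fun _ => false) t (d.dot t) : DecWire sk u l C.anc → Bool) (decCt 0) =
      ct 0 := by simp [decState, bodyState, decCt]
  have v2 : (decState x ct (fun _ => false) t (d.dot t) : DecWire sk u l C.anc → Bool) decAcc =
      d.dot t := by simp [decState, bodyState, decAcc]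
  rw [v1, v2]
  rcases i with i | i | i
  · rfl
  · fin_cases i
    · have n3 : (.inr (.inl 0) : DecWire sk u l C.anc) ≠ .inr (.inl 1) := by simp
      refine (flipAt_of_ne n3 _).trans ?_
      refine (flipAt_self _ _ _).trans ?_
      simp [decState, bodyState]
    · have n3 : (.inr (.inl 1) : DecWire sk u l C.anc) ≠ .inr (.inl 0) := by simp
      refine (flipAt_self _ _ _).trans ?_
      rw [flipAt_of_ne n3]
      simp [decState, bodyState]
  · rfl

theorem isCl_decBody (hC : C.Computes fun x => sign x.left x.right) :
    ∀ g ∈ decBody C, g.IsCl := by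
  intro g hg
  simp only [decBody, List.mem_append, List.mem_cons, List.not_mem_nil, or_false] at hg
  rcases hg with h | rfl | h | h | rfl | rfl
  · exact isCl_copyBlock hC _ g h
  · trivial
  · exact isCl_copyBlock hC _ g h
  · exact isCl_dotLayer g h
  · trivial
  · trivial

theorem decBody_computes (hC : C.Computes fun x => sign x.left x.right) :
    (wrap (decBody C)).Computes fun x => encodeOption (decBit (sign x.left) x.right) :=
  wrap_computes (isCl_decBody hC) fun x => by
    obtain ⟨i, w, h⟩ := clL_decBody hC x.left x.right
    exact ⟨i, w, by rw [← h, append_left_right]⟩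

end

theorem qpt_dec {sk u l : ℕ → ℕ} (hsk : PolyTime sk) (hu : PolyTime u) (hl : PolyTime l)
    {C : ∀ n, QCircuit (sk n + (u n + 1)) (l n)} (hC : QPT C) :
    QPT fun n => wrap (decBody (C n)) := by
  have hanc := ((qpt_iff C).1 hC).1
  set num := fun n => bodyNum (sk n + (u n + (l n + 1) + 1)) (1 + 1) (l n + 1 + (1 + (C n).anc))
    with hnum
  let A : ℕ → ℕ := fun n => sk n + (u n + (l n + 1) + 1)
  have hA : PolyTime A := by fun_prop
  have hk : PolyWires num (fun n (i : Fin (sk n)) => .inl (Fin.castAdd _ i)) :=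
    .of hsk (R := fun n i => A n + (1 + 1) + i) (by fun_prop) fun _ _ => rfl
  have h0 : PolyTime fun n => A n + (1 + 1) + A n := by fun_prop
  have hr : PolyWires num (fun n (i : Fin (u n)) =>
      (decCt (Fin.succ (Fin.castAdd (l n + 1) i)) : DecWire (sk n) (u n) (l n) (C n).anc)) :=
    .of hu (R := fun n i => A n + (1 + 1) + (sk n + (i + 1))) (by fun_prop) fun _ _ => rfl
  have hm : PolyWires num (fun n => (Fin.cons (decSum 0) fun i =>
      decCt (Fin.succ (Fin.castAdd (l n + 1) i)) : Fin (u n + 1) → DecWire (sk n) (u n) (l n)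
        (C n).anc)) := .cons (h0.of_code_eq fun _ => rfl) hr
  have ha : PolyWires num (fun n (i : Fin (C n).anc) =>
      .inr (.inr (Fin.natAdd (l n + 1) (Fin.natAdd 1 i)))) :=
    .of hanc (R := fun n i => A n + (1 + 1) + A n + (l n + 1 + (1 + i))) (by fun_prop)
      fun _ _ => rfl
  have hS : PolyWires num (fun n => decSign (C n)) := (hk.append hm).append ha
  have ht : PolyWires num (fun n (j : Fin (l n)) =>
      (decSum j.succ : DecWire (sk n) (u n) (l n) (C n).anc)) :=
    .of hl (R := fun n i => A n + (1 + 1) + A n + (i + 1)) (by fun_prop) fun _ _ => rfl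
  have hc : PolyGates num fun n => copyBlock (C n) (decSign (C n)) (fun j => decSum j.succ)
    (decSign_ne (C n)) := .copyBlock hC hl hS ht
  refine qpt_wrap (by fun_prop) (.const _) (by fun_prop) ?_
  refine .append hc (PolyGates.append (G := fun n => [QGate.x _]) ?_ (.append hc (.append ?_ ?_)))
  · have : PolyTime fun n => [((0 : ℕ), [A n + (1 + 1) + A n])] := by fun_prop
    exact this.of_code_eq fun _ => rfl
  · unfold PolyGates dotLayer
    simp only [List.map_map]
    exact PolyTime.finRange_map (by fun_prop) (R := fun n i => (2, [A n + (1 + 1) +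
      (sk n + (u n + i + 1)), A n + (1 + 1) + A n + i, A n + (1 + 1) + A n + (l n + 1 + 0)]))
      (by fun_prop) fun _ _ => rfl
  · have : PolyTime fun n => [((1 : ℕ), [A n + (1 + 1) + sk n, 0]),
      (2, [A n + (1 + 1) + sk n, A n + (1 + 1) + A n + (l n + 1 + 0), 1])] := by fun_prop
    exact this.of_code_eq fun _ => rfl

theorem PolyTimeLength.pred_of_succ {u : ℕ → ℕ} (h : PolyTime fun n => u n + 1) : PolyTime u := by
  exact (h.sub (.const 1)).of_code_eq fun _ => rfl

theorem ofSig_efficient (u : ℕ → ℕ) (S : SigScheme fun n => u n + 1) (hS : S.Efficient) :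
    (QPKE.ofSig u S).Efficient := by
  obtain ⟨⟨hu, hcoins, hsk, hvk, hsig⟩, hgen, ⟨Cs, hCs, hCs'⟩, Cv, hCv, hCv'⟩ := hS
  have hu' : PolyTime u := PolyTimeLength.pred_of_succ ((polyTimeLength_iff _).1 hu)
  have hsk' := (polyTimeLength_iff _).1 hsk
  have hvk' := (polyTimeLength_iff _).1 hvk
  have hsig' := (polyTimeLength_iff _).1 hsig
  refine ⟨⟨hcoins, hsk, hvk, (polyTimeLength_iff _).2 ?_, (polyTimeLength_iff _).2 ?_,
    (polyTimeLength_iff _).2 ?_⟩, hgen, ⟨fun n => wrap (pkGenBody (Cs n)), ?_, ?_⟩,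
    ⟨fun n => wrap (encBody (Cv n)), ?_, ?_⟩, ⟨fun n => wrap (decBody (Cs n)), ?_, ?_⟩⟩
  · change PolyTime fun n => u n + (S.sigLen n + 1)
    fun_prop
  · exact .const 1
  · change PolyTime fun n => u n + (S.sigLen n + 1) + 1
    fun_prop
  · exact qpt_pkGen hsk' hu' hsig' hCs
  · exact fun n sk p p' => pkGen_eq (hCs' n) sk p p'
  · exact qpt_enc hvk' hu' hsig' hCv
  · exact fun n vk msg ct p' p => enc_eq (hCv' n) vk msg ct p' p
  · exact qpt_dec hsk' hu' hsig' hCs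
  · exact fun n => decBody_computes (hCs' n)

/-! ## Correctness -/

/-- The amplitude of the measurement result `q` in the encryption of `b`, on the basis state `p`. -/
noncomputable def encAmp {u l : ℕ} (ver : Bits (u + 1) → Bits l → Bool) (b : Bool)
    (q p : Bits (u + (l + 1))) : ℂ :=
  if q.left = p.left ∧ ver (Fin.cons (p.right 0) p.left) (Fin.tail p.right) = true then
    rt ^ (l + 1) * sgn p.right (flipAt b 0 q.right) else 0

section
variable {u l : ℕ} (ver : Bits (u + 1) → Bits l → Bool) (b : Bool)

theorem encPOVM_cons_true (q p' p : Bits (u + (l + 1))) :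
    encPOVM ver b (Fin.cons true q) p' p = star (encAmp ver b q p') * encAmp ver b q p := by
  rw [encPOVM, if_pos (by simp)]
  unfold ket
  rw [Fin.tail_cons, conjTranspose_mul_vecMulVec_mul, enc_transform_apply, enc_transform_apply]
  rfl

theorem encPOVM_cons_false (q p' p : Bits (u + (l + 1))) :
    encPOVM ver b (Fin.cons false q) p' p = if q = fun _ => false then
      (if p' = p ∧ ver (Fin.cons (p.right 0) p.left) (Fin.tail p.right) = false then 1 else 0)
      else 0 := by
  rw [encPOVM, if_neg (by simp)]
  have h : (Fin.cons false q : Bits (u + (l + 1) + 1)) = (fun _ => false) ↔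
      q = fun _ => false := by
    constructor
    · intro h; funext i; simpa using congrFun h i.succ
    · rintro rfl; funext i; refine Fin.cases ?_ (fun i => ?_) i <;> simp
  simp only [h]
  split_ifs with h1 h2
  · obtain ⟨rfl, h3⟩ := h2
    simp [checkProj, h3]
  · by_cases h4 : p' = p
    · subst h4
      have : ver (Fin.cons (p'.right 0) p'.left) (Fin.tail p'.right) = true := by
        by_contra h5; exact h2 ⟨rfl, by simpa using h5⟩
      simp [checkProj, this]
    · simp [checkProj, Matrix.one_apply_ne h4, Matrix.diagonal_apply_ne _ h4]
  · rfl

end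

theorem trace_mul_vecMulVec {X : Type} [Fintype X] (M : Matrix X X ℂ) (ψ : X → ℂ) :
    (M * Matrix.vecMulVec ψ (star ψ)).trace = ∑ p', ∑ p, M p' p * ψ p * star (ψ p') := by
  simp only [Matrix.trace, Matrix.diag_apply, Matrix.mul_apply, Matrix.vecMulVec_apply,
    Pi.star_apply, mul_assoc]

theorem sgn_mul_self {k : ℕ} (x y : Bits k) : sgn x y * sgn x y = 1 := by
  rw [← sgn_eq]; split_ifs <;> simp

theorem sgn_xor {k : ℕ} (x y z : Bits k) : sgn (Bits.xor x y) z = sgn x z * sgn y z := by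
  rw [sgn, sgn, sgn, ← Finset.prod_mul_distrib]
  have key : ∀ a b c : Bool, (if Bool.xor a b = true ∧ c = true then (-1 : ℂ) else 1) =
      (if a = true ∧ c = true then -1 else 1) * if b = true ∧ c = true then -1 else 1 := by
    intro a b c
    cases a <;> cases b <;> cases c <;> simp
  exact Finset.prod_congr rfl fun i _ => key _ _ _

section
variable {u l : ℕ} {ver : Bits (u + 1) → Bits l → Bool} {sign : Bits (u + 1) → Bits l} {r : Bits u}

/-- The encryption of `b` under the public key with the string `r`: the amplitude of `q`. -/
noncomputable def pkAmp (ver : Bits (u + 1) → Bits l → Bool) (sign : Bits (u + 1) → Bits l)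
    (r : Bits u) (b : Bool) (q : Bits (u + (l + 1))) : ℂ :=
  ∑ p, encAmp ver b q p * pkVec r (sign (Fin.cons false r)) (sign (Fin.cons true r)) p

theorem pkAmp_eq (h0 : ver (Fin.cons false r) (sign (Fin.cons false r)) = true)
    (h1 : ver (Fin.cons true r) (sign (Fin.cons true r)) = true) (b : Bool)
    (q : Bits (u + (l + 1))) :
    pkAmp ver sign r b q = if q.left = r then rt ^ (l + 2) *
      (sgn (Fin.cons false (sign (Fin.cons false r))) (flipAt b 0 q.right) +
        sgn (Fin.cons true (sign (Fin.cons true r))) (flipAt b 0 q.right)) else 0 := by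
  simp only [pkAmp, pkVec_apply, mul_add, mul_ite, mul_one, mul_zero, Finset.sum_add_distrib,
    Finset.sum_ite_eq', Finset.mem_univ, if_true]
  simp only [encAmp, keyString, left_append, right_append, Fin.tail_cons, Fin.cons_zero, h0, h1,
    and_true]
  split_ifs
  · ring
  · ring

/-- The amplitude of `d` is a multiple of a sum of two signs whose product is 1 exactly if `d`
decrypts to `b`. So it vanishes for every wrong `d`, and the restriction to correct `d` loses
nothing. -/
theorem sum_pkAmp (h0 : ver (Fin.cons false r) (sign (Fin.cons false r)) = true)
    (h1 : ver (Fin.cons true r) (sign (Fin.cons true r)) = true) (b : Bool) :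
    ∑ q : Bits (u + (l + 1)), (if decBit sign (Fin.cons true q) = some (fun _ => b) then
      star (pkAmp ver sign r b q) * pkAmp ver sign r b q else 0) = 1 := by
  set y0 : Bits (l + 1) := Fin.cons false (sign (Fin.cons false r)) with hy0
  set y1 : Bits (l + 1) := Fin.cons true (sign (Fin.cons true r)) with hy1
  have hne : y0 ≠ y1 := fun h => by simpa [hy0, hy1] using congrFun h 0
  rw [sum_bits_append, Finset.sum_eq_single r]
  · have key : ∀ d : Bits (l + 1), (if decBit sign (Fin.cons true (Fin.append r d)) =
        some (fun _ => b) then star (pkAmp ver sign r b (Fin.append r d)) *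
          pkAmp ver sign r b (Fin.append r d) else 0) = (1 / 2) ^ (l + 2) *
          (2 + 2 * (sgn y0 (flipAt b 0 d) * sgn y1 (flipAt b 0 d))) := by
      intro d
      have hd : decBit sign (Fin.cons true (Fin.append r d)) = some (fun _ => b) ↔
          Bits.dot d (Bits.xor y0 y1) = b := by
        rw [decBit, if_pos (by simp)]
        simp only [Fin.tail_cons, left_append, right_append, Option.some.injEq]
        rw [← hy0, ← hy1]
        exact ⟨fun h => congrFun h 0, fun h => funext fun _ => h⟩
      have hs : sgn y0 (flipAt b 0 d) * sgn y1 (flipAt b 0 d) =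
          (if b = true then -1 else 1) * if Bits.dot d (Bits.xor y0 y1) = true then -1 else 1 := by
        rw [sgn_eq, sgn_comm d, sgn_xor, sgn_flipAt_zero, sgn_flipAt_zero]
        simp [hy0, hy1]
      have hsq : star (rt ^ (l + 2) * (sgn y0 (flipAt b 0 d) + sgn y1 (flipAt b 0 d))) *
          (rt ^ (l + 2) * (sgn y0 (flipAt b 0 d) + sgn y1 (flipAt b 0 d))) =
          (1 / 2) ^ (l + 2) * (2 + 2 * (sgn y0 (flipAt b 0 d) * sgn y1 (flipAt b 0 d))) := by
        simp only [star_mul', star_pow, star_rt, star_add, star_sgn]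
        rw [← rt_mul_rt, mul_pow]
        linear_combination rt ^ (l + 2) * rt ^ (l + 2) * (sgn_mul_self y0 (flipAt b 0 d) +
          sgn_mul_self y1 (flipAt b 0 d))
      rw [pkAmp_eq h0 h1, left_append, right_append, if_pos rfl, ← hy0, ← hy1, hsq]
      rw [if_congr hd rfl rfl]
      split_ifs with h
      · rfl
      · rw [hs]
        revert h
        cases b <;> cases Bits.dot d (Bits.xor y0 y1) <;> simp
    simp only [key]
    rw [← Finset.mul_sum, Finset.sum_add_distrib, ← Finset.mul_sum]
    -- The cross terms add up to the scalar product of two different characters; flipping a bit of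
    -- `d` only permutes the summands.
    have hf : ∑ d : Bits (l + 1), sgn y0 (flipAt b 0 d) * sgn y1 (flipAt b 0 d) = 0 := by
      have h2 : ∑ d : Bits (l + 1), sgn y0 (flipAt b 0 d) * sgn y1 (flipAt b 0 d) =
          ∑ d, sgn y0 d * sgn y1 d :=
        Equiv.sum_comp (Function.Involutive.toPerm (flipAt b (0 : Fin (l + 1)))
          (flipAt_flipAt b 0)) fun d => sgn y0 d * sgn y1 d
      rw [h2, sum_sgn_mul_sgn, if_neg hne]
    rw [hf]
    simp only [Finset.sum_const, Finset.card_univ, Fintype.card_pi, Fintype.card_bool,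
      Finset.prod_const, Fintype.card_fin, nsmul_eq_mul, mul_zero, add_zero]
    push_cast
    rw [show (2 : ℂ) ^ (l + 1) * 2 = 2 ^ (l + 2) by ring, ← mul_pow]
    norm_num
  · intro r' _ hr
    refine Finset.sum_eq_zero fun d _ => ?_
    rw [pkAmp_eq h0 h1, left_append, if_neg hr]
    simp
  · simp

end

theorem sum_bits_cons {k : ℕ} {M : Type} [AddCommMonoid M] (F : Bits (k + 1) → M) :
    ∑ x, F x = (∑ q : Bits k, F (Fin.cons true q)) + ∑ q : Bits k, F (Fin.cons false q) := by
  rw [sum_bits_succ, Finset.sum_add_distrib, add_comm]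

theorem decProb_ofSig (u : ℕ → ℕ) (S : SigScheme fun n => u n + 1) (n : ℕ) (msg : Bits 1) :
    (QPKE.ofSig u S).decProb n msg = avg fun ω : Bits (S.coins n) =>
      (∑ r : Bits (u n), ((2 : ℂ) ^ u n)⁻¹ * ∑ q : Bits (u n + (S.sigLen n + 1)),
        if decBit (S.sign n (S.gen n ω).1) (Fin.cons true q) = some (fun _ => msg 0) then
          star (pkAmp (S.ver n (S.gen n ω).2) (S.sign n (S.gen n ω).1) r (msg 0) q) *
            pkAmp (S.ver n (S.gen n ω).2) (S.sign n (S.gen n ω).1) r (msg 0) q else 0).re := by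
  refine congrArg avg (funext fun ω => ?_)
  change ∑ ct : Bits (u n + (S.sigLen n + 1) + 1), (if decBit (S.sign n (S.gen n ω).1) ct = some msg then
    ((encPOVM (S.ver n (S.gen n ω).2) (msg 0) ct) * (∑ r : Bits (u n), ((2 : ℂ) ^ u n)⁻¹ •
    Matrix.vecMulVec (pkVec r (S.sign n (S.gen n ω).1 (Fin.cons false r))
      (S.sign n (S.gen n ω).1 (Fin.cons true r)))
      (star (pkVec r (S.sign n (S.gen n ω).1 (Fin.cons false r))
        (S.sign n (S.gen n ω).1 (Fin.cons true r)))))).trace.re else 0) = _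
  generalize S.ver n (S.gen n ω).2 = ver
  generalize S.sign n (S.gen n ω).1 = sign
  have hmsg : msg = fun _ => msg 0 := funext fun i => by rw [Subsingleton.elim i 0]
  rw [sum_bits_cons]
  have h2 : ∀ q : Bits (u n + (S.sigLen n + 1)),
      decBit sign (Fin.cons false q) ≠ some msg := by
    intro q; rw [decBit, if_neg (by simp)]; simp
  simp only [h2, if_false, Finset.sum_const_zero, add_zero]
  rw [← hmsg]
  simp only [Finset.mul_sum]
  rw [Finset.sum_comm, Complex.re_sum]
  refine Finset.sum_congr rfl fun q _ => ?_
  split_ifs with h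
  · congr 1
    rw [Matrix.trace_sum]
    refine Finset.sum_congr rfl fun r _ => ?_
    rw [Matrix.mul_smul, Matrix.trace_smul, trace_mul_vecMulVec, smul_eq_mul]
    congr 1
    simp only [encPOVM_cons_true, pkAmp, star_sum, star_mul', Finset.sum_mul_sum]
    exact Finset.sum_congr rfl fun p' _ => Finset.sum_congr rfl fun p _ => by ring
  · simp

theorem avg_mono {t : ℕ} {F G : Bits t → ℝ} (h : ∀ ω, F ω ≤ G ω) : avg F ≤ avg G := by
  unfold avg
  gcongr with ω
  exact h ω

theorem avg_add {t : ℕ} (F G : Bits t → ℝ) : avg (fun ω => F ω + G ω) = avg F + avg G := by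
  simp only [avg, Finset.sum_add_distrib, add_div]

theorem avg_const {t : ℕ} (a : ℝ) : avg (fun _ : Bits t => a) = a := by
  simp [avg]

theorem avg_const_mul {t : ℕ} (a : ℝ) (F : Bits t → ℝ) : avg (fun ω => a * F ω) = a * avg F := by
  simp only [avg, ← Finset.mul_sum, mul_div_assoc]

theorem avg_comm {s t : ℕ} (F : Bits s → Bits t → ℝ) :
    (avg fun x => avg fun y => F x y) = avg fun y => avg fun x => F x y := by
  simp only [avg, ← Finset.sum_div]
  rw [Finset.sum_comm, div_right_comm]

/-- For every fixed `r` both messages `0‖r` and `1‖r` verify except with probability `2 ε`, by the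
union bound, and then decryption is certain. Correctness of the signature scheme holds for each
message, so the average over the coins is taken with `r` fixed. -/
theorem ofSig_correct (u : ℕ → ℕ) (S : SigScheme fun n => u n + 1) (hS : S.Correct) :
    (QPKE.ofSig u S).Correct := by
  obtain ⟨ε, hε, h⟩ := hS
  refine ⟨fun n => 2 * ε n, ?_, fun n msg => ?_⟩
  · simpa [Negligible] using (show Asymptotics.SuperpolynomialDecay Filter.atTop
      (fun n : ℕ => (n : ℝ)) _ from hε).const_mul 2
  have hmsg := decProb_ofSig u S n msg
  change 1 - 2 * ε n ≤ (QPKE.ofSig u S).decProb n msg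
  rw [hmsg]
  let V : Bool → Bits (u n) → Bits (S.coins n) → ℝ := fun α r ω =>
    if S.ver n (S.gen n ω).2 (Fin.cons α r) (S.sign n (S.gen n ω).1 (Fin.cons α r)) = true
    then 1 else 0
  have hV : ∀ α r, 1 - ε n ≤ avg (V α r) := fun α r => h n (Fin.cons α r)
  calc 1 - 2 * ε n = avg fun r : Bits (u n) => 1 - 2 * ε n := (avg_const _).symm
    -- The sum of two indicators minus one is at most the indicator that both hold; this is the
    -- union bound in a form that is linear.
    _ ≤ avg fun r => avg fun ω => V false r ω + V true r ω + -1 := by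
        refine avg_mono fun r => ?_
        rw [avg_add, avg_add, avg_const]
        linarith [hV false r, hV true r]
    _ = avg fun ω => avg fun r => V false r ω + V true r ω + -1 := avg_comm _
    _ ≤ _ := by
        refine avg_mono fun ω => ?_
        rw [Complex.re_sum, avg, Finset.sum_div]
        refine Finset.sum_le_sum fun r _ => ?_
        have hc : ((2 : ℂ) ^ u n)⁻¹ = ((((2 : ℝ) ^ u n)⁻¹ : ℝ) : ℂ) := by push_cast; rfl
        rw [hc, Complex.re_ofReal_mul, div_eq_inv_mul]
        refine mul_le_mul_of_nonneg_left ?_ (by positivity)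
        by_cases hv : S.ver n (S.gen n ω).2 (Fin.cons false r)
            (S.sign n (S.gen n ω).1 (Fin.cons false r)) = true ∧
          S.ver n (S.gen n ω).2 (Fin.cons true r) (S.sign n (S.gen n ω).1 (Fin.cons true r)) = true
        · rw [sum_pkAmp hv.1 hv.2]
          simp [V, hv]
        · refine le_trans (b := 0) ?_ ?_
          · simp only [V]
            split_ifs with h1 h2
            · exact absurd ⟨h1, h2⟩ hv
            all_goals norm_num
          · rw [Complex.re_sum]
            refine Finset.sum_nonneg fun q _ => ?_
            split_ifs
            · rw [Complex.star_def, mul_comm, Complex.mul_conj, Complex.ofReal_re]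
              exact Complex.normSq_nonneg _
            · simp

/-! ## The security game for pure states -/

section
variable {v k M : ℕ} (A₁ : QCircuit v (k + (1 + 1))) (A₂ : QCircuit (k + 1 + A₁.rest) 1)

/-- The state after the measurement of the public key register with the POVM element `M`, if the
messages are `μ`. -/
noncomputable def condState {r : ℕ} (M : Matrix (Bits k) (Bits k) ℂ) (μ : Bits (1 + 1))
    (ρ : Matrix (Bits (k + (1 + 1)) × Bits r) (Bits (k + (1 + 1)) × Bits r) ℂ) :
    Matrix (Bits r) (Bits r) ℂ :=
  fun c c' => ∑ p, ∑ p', M p' p * ρ (Fin.append p μ, c) (Fin.append p' μ, c')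

/-- The state `|ct⟩⟨ct| ⊗ τ`. -/
noncomputable def addCt {r : ℕ} (ct : Bits (k + 1)) (τ : Matrix (Bits r) (Bits r) ℂ) :
    Matrix (Bits (k + 1 + r)) (Bits (k + 1 + r)) ℂ :=
  fun x y => if x.left = ct ∧ y.left = ct then τ x.right y.right else 0

/-- The probability that the output of the second stage is `b`, if the first stage is started in
the state `ρ₀` and if the public key register is measured by `E msg`. -/
noncomputable def gameProb (E : Bits 1 → Bits (k + 1) → Matrix (Bits k) (Bits k) ℂ)
    (ρ₀ : Matrix (Bits v) (Bits v) ℂ) (b : Bool) : ℝ :=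
  ∑ msg₀ : Bits 1, ∑ msg₁ : Bits 1, ∑ ct : Bits (k + 1), ∑ c,
    ((A₂.iso * addCt ct (condState (E (if b = true then msg₁ else msg₀) ct)
      (Fin.append msg₀ msg₁) (A₁.iso * ρ₀ * A₁.isoᴴ)) * A₂.isoᴴ)
        ((fun _ => b), c) ((fun _ => b), c)).re

/-- The amplitude of the output `y` of the second stage on the ciphertext `ct` and the state `φ`. -/
noncomputable def secondAmp (ct : Bits (k + 1)) (φ : Bits A₁.rest → ℂ) (y : Bits 1 × Bits A₂.rest) :
    ℂ :=
  ∑ c, A₂.iso y (Fin.append ct c) * φ c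

/-- The probability is linear in the initial density matrix, so a mixture of pure states may be
treated one vector at a time, with amplitudes in place of matrices. -/
theorem gameProb_eq {R : Type} [Fintype R] (E : Bits 1 → Bits (k + 1) → Matrix (Bits k) (Bits k) ℂ)
    (w : ℝ) (K : R → Bits v → ℂ) (b : Bool) :
    gameProb A₁ A₂ E ((w : ℂ) • ∑ r, Matrix.vecMulVec (K r) (star (K r))) b =
      w * ∑ r, ∑ msg₀ : Bits 1, ∑ msg₁ : Bits 1, ∑ ct : Bits (k + 1), ∑ c,
        (∑ p', ∑ p, E (if b = true then msg₁ else msg₀) ct p' p *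
          secondAmp A₁ A₂ ct (fun c' => (A₁.iso *ᵥ K r)
            (Fin.append p (Fin.append msg₀ msg₁), c')) ((fun _ => b), c) *
          star (secondAmp A₁ A₂ ct (fun c' => (A₁.iso *ᵥ K r)
            (Fin.append p' (Fin.append msg₀ msg₁), c')) ((fun _ => b), c))).re := by
  have hρ : A₁.iso * ((w : ℂ) • ∑ r, Matrix.vecMulVec (K r) (star (K r))) * A₁.isoᴴ =
      (w : ℂ) • ∑ r, Matrix.vecMulVec (A₁.iso *ᵥ K r) (star (A₁.iso *ᵥ K r)) := by
    rw [Matrix.mul_smul, Matrix.smul_mul, Matrix.mul_sum, Matrix.sum_mul]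
    congr 1
    refine Finset.sum_congr rfl fun r _ => ?_
    rw [Matrix.mul_vecMulVec, Matrix.vecMulVec_mul, Matrix.star_mulVec]
  simp only [gameProb, hρ]
  have key : ∀ (msg₀ msg₁ : Bits 1) (ct : Bits (k + 1)) (c : Bits A₂.rest),
      (A₂.iso * addCt ct (condState (E (if b = true then msg₁ else msg₀) ct) (Fin.append msg₀ msg₁)
        ((w : ℂ) • ∑ r, Matrix.vecMulVec (A₁.iso *ᵥ K r) (star (A₁.iso *ᵥ K r)))) *
          A₂.isoᴴ) ((fun _ => b), c) ((fun _ => b), c) =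
      (w : ℂ) * ∑ r, ∑ p', ∑ p, E (if b = true then msg₁ else msg₀) ct p' p *
          secondAmp A₁ A₂ ct (fun c' => (A₁.iso *ᵥ K r)
            (Fin.append p (Fin.append msg₀ msg₁), c')) ((fun _ => b), c) *
          star (secondAmp A₁ A₂ ct (fun c' => (A₁.iso *ᵥ K r)
            (Fin.append p' (Fin.append msg₀ msg₁), c')) ((fun _ => b), c)) := by
    intro msg₀ msg₁ ct c
    set Mt := E (if b = true then msg₁ else msg₀) ct
    let Jc : Matrix (Bits 1 × Bits A₂.rest) (Bits A₁.rest) ℂ := fun y c => A₂.iso y (Fin.append ct c)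
    let G : R → Matrix (Bits A₁.rest) (Bits k) ℂ := fun r c p =>
      (A₁.iso *ᵥ K r) (Fin.append p (Fin.append msg₀ msg₁), c)
    have h1 : A₂.iso * addCt ct (condState Mt (Fin.append msg₀ msg₁)
        ((w : ℂ) • ∑ r, Matrix.vecMulVec (A₁.iso *ᵥ K r) (star (A₁.iso *ᵥ K r)))) *
          A₂.isoᴴ =
        -- The conditional state pairs `M p' p` with the matrix element at `(p, p')`, hence the
        -- transpose of the POVM element.
        Jc * ((w : ℂ) • ∑ r, G r * Mtᵀ * (G r)ᴴ) * Jcᴴ := by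
      ext y y'
      simp only [Matrix.mul_apply, Matrix.conjTranspose_apply]
      rw [sum_bits_append, Finset.sum_eq_single ct]
      · refine Finset.sum_congr rfl fun c2 _ => ?_
        congr 1
        rw [sum_bits_append, Finset.sum_eq_single ct]
        · refine Finset.sum_congr rfl fun c1 _ => ?_
          simp only [addCt, left_append, right_append, and_self, if_true, Jc]
          congr 1
          simp only [condState, Matrix.smul_apply, Matrix.sum_apply, Matrix.mul_apply,
            Matrix.conjTranspose_apply, Matrix.vecMulVec_apply, Pi.star_apply, smul_eq_mul,
            Finset.mul_sum]
          rw [Finset.sum_comm' (t' := Finset.univ) (s' := fun _ => Finset.univ) (by simp)]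
          have h2 : ∀ p' : Bits k, (∑ p, ∑ r, Mt p' p * ((w : ℂ) *
              ((A₁.iso *ᵥ K r) (Fin.append p (Fin.append msg₀ msg₁), c1) *
                star ((A₁.iso *ᵥ K r) (Fin.append p' (Fin.append msg₀ msg₁), c2))))) =
              ∑ r, ∑ p, Mt p' p * ((w : ℂ) *
              ((A₁.iso *ᵥ K r) (Fin.append p (Fin.append msg₀ msg₁), c1) *
                star ((A₁.iso *ᵥ K r) (Fin.append p' (Fin.append msg₀ msg₁), c2)))) :=
            fun p' => Finset.sum_comm
          simp only [h2]
          rw [Finset.sum_comm]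
          refine Finset.sum_congr rfl fun r _ => Finset.sum_congr rfl fun p' _ => ?_
          rw [Finset.sum_mul, Finset.mul_sum]
          refine Finset.sum_congr rfl fun p _ => ?_
          rw [Matrix.transpose_apply]
          simp only [G]
          ring
        · intro ct' _ hct
          refine Finset.sum_eq_zero fun c1 _ => ?_
          simp [addCt, hct]
        · simp
      · intro ct' _ hct
        refine Finset.sum_eq_zero fun c2 _ => ?_
        simp [addCt, hct]
      · simp
    rw [h1, Matrix.mul_smul, Matrix.smul_mul, Matrix.smul_apply, smul_eq_mul, Matrix.mul_sum,
      Matrix.sum_mul, Matrix.sum_apply]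
    congr 1
    refine Finset.sum_congr rfl fun r _ => ?_
    rw [show Jc * (G r * Mtᵀ * (G r)ᴴ) * Jcᴴ = (Jc * G r) * Mtᵀ * (Jc * G r)ᴴ by
      rw [Matrix.conjTranspose_mul]; simp only [Matrix.mul_assoc]]
    have h3 : ∀ y p, (Jc * G r) y p = secondAmp A₁ A₂ ct (fun c' => (A₁.iso *ᵥ K r)
            (Fin.append p (Fin.append msg₀ msg₁), c')) y := fun y p => rfl
    rw [Matrix.mul_apply]
    refine Finset.sum_congr rfl fun p' _ => ?_
    rw [Matrix.mul_apply, Finset.sum_mul]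
    refine Finset.sum_congr rfl fun p _ => ?_
    rw [Matrix.transpose_apply, Matrix.conjTranspose_apply, h3, h3]
    ring
  simp only [key, Complex.re_ofReal_mul, Complex.re_sum, ← Finset.mul_sum]
  congr 1
  have hc : ∀ F : R → Bits 1 → Bits 1 → Bits (k + 1) → Bits A₂.rest → ℝ,
      ∑ m0, ∑ m1, ∑ ct, ∑ c, ∑ r, F r m0 m1 ct c = ∑ r, ∑ m0, ∑ m1, ∑ ct, ∑ c, F r m0 m1 ct c := by
    intro F
    rw [show ∑ m0, ∑ m1, ∑ ct, ∑ c, ∑ r, F r m0 m1 ct c =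
      ∑ t : Bits 1 × Bits 1 × Bits (k + 1) × Bits A₂.rest, ∑ r, F r t.1 t.2.1 t.2.2.1 t.2.2.2 by
        simp only [Fintype.sum_prod_type], Finset.sum_comm]
    simp only [Fintype.sum_prod_type]
  rw [hc]

end

/-! ## Norms -/

/-- The squared norm. -/
noncomputable def nsq {X : Type} [Fintype X] (φ : X → ℂ) : ℝ := ∑ x, ‖φ x‖ ^ 2

section
variable {X Y : Type} [Fintype X] [Fintype Y]

theorem nsq_nonneg (φ : X → ℂ) : 0 ≤ nsq φ := Finset.sum_nonneg fun _ _ => by positivity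

theorem star_mul_self_eq (z : ℂ) : star z * z = ((‖z‖ ^ 2 : ℝ) : ℂ) := by
  rw [Complex.star_def, mul_comm, Complex.mul_conj, Complex.normSq_eq_norm_sq]

theorem ip_self (φ : X → ℂ) : ip φ φ = (nsq φ : ℝ) := by
  simp only [ip, nsq, star_mul_self_eq, Complex.ofReal_sum]

theorem nsq_eq_of_ip {φ : X → ℂ} {ψ : Y → ℂ} (h : ip φ φ = ip ψ ψ) : nsq φ = nsq ψ := by
  rw [ip_self, ip_self] at h
  exact_mod_cast h

theorem norm_ip_le (φ ψ : X → ℂ) : ‖ip φ ψ‖ ≤ √(nsq φ) * √(nsq ψ) := by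
  have h := norm_inner_le_norm (𝕜 := ℂ) (WithLp.toLp 2 φ : EuclideanSpace ℂ X) (WithLp.toLp 2 ψ)
  rw [EuclideanSpace.norm_eq, EuclideanSpace.norm_eq] at h
  refine le_trans (le_of_eq ?_) h
  congr 1
  rw [PiLp.inner_apply]
  simp only [ip, RCLike.inner_apply, Complex.star_def]
  exact Finset.sum_congr rfl fun x _ => mul_comm _ _

theorem ip_add_left (φ φ' ψ : X → ℂ) : ip (φ + φ') ψ = ip φ ψ + ip φ' ψ := by
  simp only [ip, Pi.add_apply, star_add, add_mul, Finset.sum_add_distrib]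

theorem ip_add_right (φ ψ ψ' : X → ℂ) : ip φ (ψ + ψ') = ip φ ψ + ip φ ψ' := by
  simp only [ip, Pi.add_apply, mul_add, Finset.sum_add_distrib]

theorem ip_sum_left {I : Type} (s : Finset I) (φ : I → X → ℂ) (ψ : X → ℂ) :
    ip (∑ i ∈ s, φ i) ψ = ∑ i ∈ s, ip (φ i) ψ := by
  simp only [ip, Finset.sum_apply, star_sum, Finset.sum_mul]
  exact Finset.sum_comm

theorem star_ip (φ ψ : X → ℂ) : star (ip φ ψ) = ip ψ φ := by
  simp only [ip, star_sum, star_mul', star_star, mul_comm]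

theorem nsq_add (φ ψ : X → ℂ) : nsq (φ + ψ) = nsq φ + nsq ψ + 2 * (ip φ ψ).re := by
  have h : ((nsq (φ + ψ) : ℝ) : ℂ) = (nsq φ : ℝ) + (nsq ψ : ℝ) + (ip φ ψ + star (ip φ ψ)) := by
    rw [← ip_self, ← ip_self, ← ip_self, star_ip, ip_add_left, ip_add_right, ip_add_right]
    ring
  have h2 := congrArg Complex.re h
  rw [Complex.add_re, Complex.add_re, Complex.add_re, Complex.ofReal_re, Complex.ofReal_re,
    Complex.ofReal_re, Complex.star_def, Complex.conj_re] at h2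
  linarith

theorem nsq_mono {φ ψ : X → ℂ} (h : ∀ x, ‖φ x‖ ≤ ‖ψ x‖) : nsq φ ≤ nsq ψ :=
  Finset.sum_le_sum fun x _ => by gcongr; exact h x

theorem nsq_sum_bket {ι I : Type} [Fintype ι] [DecidableEq ι] (s : Finset I)
    {y : I → ι → Bool} (hy : Set.InjOn y s) (a : I → ℂ) :
    nsq (∑ i ∈ s, a i • bket (y i)) = ∑ i ∈ s, ‖a i‖ ^ 2 := by
  classical
  have h : ∀ x, (∑ i ∈ s, a i • bket (y i) : St ι) x = ∑ i ∈ s, if x = y i then a i else 0 := by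
    intro x; simp [bket_apply]
  have h2 : ∀ x, ‖(∑ i ∈ s, a i • bket (y i) : St ι) x‖ ^ 2 =
      ∑ i ∈ s, if x = y i then ‖a i‖ ^ 2 else 0 := by
    intro x
    rw [h]
    by_cases hx : ∃ i ∈ s, x = y i
    · obtain ⟨i, hi, rfl⟩ := hx
      have hne : ∀ j ∈ s, j ≠ i → y i ≠ y j := fun j hj hji hij => hji (hy hj hi hij.symm)
      rw [Finset.sum_eq_single_of_mem i hi fun j hj hji => if_neg (hne j hj hji),
        Finset.sum_eq_single_of_mem i hi fun j hj hji => if_neg (hne j hj hji), if_pos rfl,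
        if_pos rfl]
    · have hne : ∀ i ∈ s, x ≠ y i := fun i hi hxi => hx ⟨i, hi, hxi⟩
      rw [Finset.sum_eq_zero fun i hi => if_neg (hne i hi),
        Finset.sum_eq_zero fun i hi => if_neg (hne i hi)]
      simp
  simp only [nsq, h2]
  rw [Finset.sum_comm]
  simp

end

/-! ### Isometries -/

theorem QCircuit.sum_iso {a b : ℕ} (C : QCircuit a b) {M : Type} [AddCommMonoid M]
    (F : Bits (a + C.anc) → M) :
    ∑ y : Bits b × Bits C.rest, F (fun i => Fin.append y.1 y.2 (Fin.cast C.size_eq.symm i)) =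
      ∑ z, F z := by
  rw [Fintype.sum_prod_type, ← sum_bits_append (fun z : Bits (b + C.rest) =>
    F fun i => z (Fin.cast C.size_eq.symm i))]
  exact Equiv.sum_comp ((finCongr C.size_eq).arrowCongr (Equiv.refl Bool)) F

theorem QCircuit.iso_mulVec {a b : ℕ} (C : QCircuit a b) (g : Bits a → ℂ)
    (y : Bits b × Bits C.rest) : (C.iso *ᵥ g) y =
      actL C.qgates (∑ x, g x • bket (Fin.append x fun _ => false))
        (fun i => Fin.append y.1 y.2 (Fin.cast C.size_eq.symm i)) := by
  rw [map_sum, Finset.sum_apply]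
  refine Finset.sum_congr rfl fun x _ => ?_
  rw [map_smul, Pi.smul_apply, smul_eq_mul, mul_comm]
  exact congrArg (g x * ·) (C.iso_eq y x)

theorem QCircuit.nsq_iso {a b : ℕ} (C : QCircuit a b) (g : Bits a → ℂ) :
    nsq (C.iso *ᵥ g) = nsq g := by
  have h1 : nsq (C.iso *ᵥ g) =
      nsq (actL C.qgates (∑ x, g x • bket (Fin.append x fun _ => false))) := by
    simp only [nsq, QCircuit.iso_mulVec]
    exact C.sum_iso fun z =>
      ‖actL C.qgates (∑ x, g x • bket (Fin.append x fun _ => false)) z‖ ^ 2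
  rw [h1, nsq_eq_of_ip (ip_actL _ _ _), nsq_sum_bket _ fun x _ x' _ h => (append_inj.1 h).1]
  rfl

/-- Hadamard gates on the last `k` qubits. -/
noncomputable def hadR {u k : ℕ} (φ : Bits (u + k) → ℂ) : Bits (u + k) → ℂ :=
  hadamardRight *ᵥ φ

/-- The matrix `hadamardRight` is the action of a layer of Hadamard gates, whose unitarity is
already known. -/
theorem nsq_hadR {u k : ℕ} (φ : Bits (u + k) → ℂ) : nsq (hadR φ) = nsq φ := by
  let e : Fin k ↪ Fin (u + k) := ⟨Fin.natAdd u, fun i j h => by simpa [Fin.ext_iff] using h⟩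
  have h : hadR φ = actL (hLayer e) φ := by
    funext q
    have he : ∀ y : Bits k, Function.extend e y q = Fin.append q.left y := by
      intro y
      symm
      refine extend_eq_of_forall e.injective (fun j => Fin.append_right _ _ j) fun i hi => ?_
      induction i using Fin.addCases with
      | left i => simp [Bits.left]
      | right i => exact absurd rfl (hi i)
    rw [actL_hLayer, hadR, Matrix.mulVec, dotProduct, sum_bits_append, Finset.sum_eq_single q.left]
    · rw [Finset.mul_sum]
      refine Finset.sum_congr rfl fun y _ => ?_
      rw [hadamardRight_apply, left_append, right_append, if_pos rfl, he, mul_assoc]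
      rfl
    · intro r _ hr
      refine Finset.sum_eq_zero fun y _ => ?_
      rw [hadamardRight_apply, left_append, if_neg hr.symm, zero_mul]
    · simp
  rw [h, nsq_eq_of_ip (ip_actL _ _ _)]

/-! ### The second stage of the adversary -/

section
variable {u l r₁ : ℕ} (A₂ : QCircuit (u + (l + 1) + 1 + r₁) 1)

/-- The amplitudes of the output `β` of the second stage, if the ciphertext is the result of a
measurement of the public key register in the Hadamard basis. -/
noncomputable def chal (β : Bool) : (Bits (u + (l + 1)) × Bits (1 + 1) × Bits r₁ → ℂ) →ₗ[ℂ]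
    (Bits (u + (l + 1)) × Bits (1 + 1) × Bits A₂.rest → ℂ) where
  toFun Φ x := ∑ c, A₂.iso ((fun _ => β), x.2.2) (Fin.append (Fin.cons true x.1) c) *
    hadR (fun p => Φ (p, x.2.1, c)) x.1
  map_add' Φ Φ' := by
    funext x
    simp only [Pi.add_apply, ← Finset.sum_add_distrib, ← mul_add]
    refine Finset.sum_congr rfl fun c _ => ?_
    congr 1
    exact congrFun (Matrix.mulVec_add hadamardRight (fun p => Φ (p, x.2.1, c))
      fun p => Φ' (p, x.2.1, c)) x.1
  map_smul' a Φ := by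
    funext x
    simp only [Pi.smul_apply, smul_eq_mul, RingHom.id_apply, Finset.mul_sum]
    refine Finset.sum_congr rfl fun c _ => ?_
    rw [show hadR (fun p => a * Φ (p, x.2.1, c)) x.1 = a * hadR (fun p => Φ (p, x.2.1, c)) x.1 from
      congrFun (Matrix.mulVec_smul hadamardRight a fun p => Φ (p, x.2.1, c)) x.1]
    ring

/-- With the ciphertext fixed, the second stage is still an isometry, and its output bit is 0 or 1.
-/
theorem sum_secondStage (ct : Bits (u + (l + 1) + 1)) (g : Bits r₁ → ℂ) :
    (∑ c, ‖∑ c', A₂.iso ((fun _ => false), c) (Fin.append ct c') * g c'‖ ^ 2) +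
      ∑ c, ‖∑ c', A₂.iso ((fun _ => true), c) (Fin.append ct c') * g c'‖ ^ 2 = nsq g := by
  let G : Bits (u + (l + 1) + 1 + r₁) → ℂ := fun x => if x.left = ct then g x.right else 0
  have h1 : ∀ y, (A₂.iso *ᵥ G) y = ∑ c', A₂.iso y (Fin.append ct c') * g c' := by
    intro y
    rw [Matrix.mulVec, dotProduct, sum_bits_append, Finset.sum_eq_single ct]
    · simp [G]
    · intro x _ hx
      simp [G, hx]
    · simp
  have h2 : nsq G = nsq g := by
    rw [nsq, sum_bits_append, Finset.sum_eq_single ct]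
    · simp [G, nsq]
    · intro x _ hx
      simp [G, hx]
    · simp
  rw [← h2, ← A₂.nsq_iso G, nsq, Fintype.sum_prod_type, sum_bits_succ]
  simp only [h1, Fintype.sum_unique, Finset.sum_add_distrib]
  congr 1 <;>
  · refine Finset.sum_congr rfl fun c _ => ?_
    congr 4
    funext c'
    congr 3
    funext i
    rw [Subsingleton.elim i 0]
    rfl

/-- The Hadamard gates and the second stage preserve norms, and summing over both outputs is the
total probability. This lets the outcome for the challenge 0 be expressed through the output 1. -/
theorem nsq_chal (Φ : Bits (u + (l + 1)) × Bits (1 + 1) × Bits r₁ → ℂ) :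
    nsq (chal A₂ false Φ) + nsq (chal A₂ true Φ) = nsq Φ := by
  have h1 : ∀ β, nsq (chal A₂ β Φ) = ∑ μ, ∑ q, ∑ c, ‖∑ c', A₂.iso ((fun _ => β), c)
      (Fin.append (Fin.cons true q) c') * hadR (fun p => Φ (p, μ, c')) q‖ ^ 2 := by
    intro β
    simp only [nsq, Fintype.sum_prod_type]
    exact Finset.sum_comm
  rw [h1, h1, ← Finset.sum_add_distrib]
  have h2 : nsq Φ = ∑ μ, ∑ c, nsq fun p => Φ (p, μ, c) := by
    simp only [nsq, Fintype.sum_prod_type]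
    rw [Finset.sum_comm]
    exact Finset.sum_congr rfl fun μ _ => Finset.sum_comm
  rw [h2]
  refine Finset.sum_congr rfl fun μ _ => ?_
  rw [← Finset.sum_add_distrib]
  simp only [sum_secondStage A₂ _ (fun c' => hadR (fun p => Φ (p, μ, c')) _)]
  simp only [nsq]
  rw [Finset.sum_comm]
  exact Finset.sum_congr rfl fun c _ => nsq_hadR fun p => Φ (p, μ, c)

end

section
variable {X Y Z : Type}

/-- The projection onto the basis states whose first component satisfies `P`. -/
noncomputable def mask (P : X → Prop) [DecidablePred P] : (X × Y → ℂ) →ₗ[ℂ] (X × Y → ℂ) where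
  toFun Φ x := if P x.1 then Φ x else 0
  map_add' Φ Φ' := by funext x; by_cases h : P x.1 <;> simp [h]
  map_smul' a Φ := by funext x; by_cases h : P x.1 <;> simp [h]

theorem mask_apply (P : X → Prop) [DecidablePred P] (Φ : X × Y → ℂ) (x : X × Y) :
    mask P Φ x = if P x.1 then Φ x else 0 := rfl

/-- Multiplication by a function of the second component. -/
noncomputable def mulMid (t : Y → ℂ) : (X × Y × Z → ℂ) →ₗ[ℂ] (X × Y × Z → ℂ) where
  toFun Φ x := t x.2.1 * Φ x
  map_add' Φ Φ' := by funext x; simp [mul_add]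
  map_smul' a Φ := by funext x; simp only [Pi.smul_apply, smul_eq_mul, RingHom.id_apply]; ring

theorem mulMid_apply (t : Y → ℂ) (Φ : X × Y × Z → ℂ) (x : X × Y × Z) :
    mulMid t Φ x = t x.2.1 * Φ x := rfl

theorem nsq_mask_le [Fintype X] [Fintype Y] (P : X → Prop) [DecidablePred P] (Φ : X × Y → ℂ) :
    nsq (mask P Φ) ≤ nsq Φ :=
  nsq_mono fun x => by rw [mask_apply]; split_ifs <;> simp

theorem nsq_mask_add_not [Fintype X] [Fintype Y] (P : X → Prop) [DecidablePred P]
    (Φ : X × Y → ℂ) : nsq (mask P Φ) + nsq (mask (fun x => ¬ P x) Φ) = nsq Φ := by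
  simp only [nsq, ← Finset.sum_add_distrib]
  refine Finset.sum_congr rfl fun x _ => ?_
  by_cases h : P x.1 <;> simp [mask_apply, h]

theorem nsq_mulMid [Fintype X] [Fintype Y] [Fintype Z] {t : Y → ℂ} (ht : ∀ y, ‖t y‖ = 1)
    (Φ : X × Y × Z → ℂ) : nsq (mulMid t Φ) = nsq Φ := by
  simp only [nsq, mulMid_apply, norm_mul, ht, one_mul]

theorem nsq_mulMid_le [Fintype X] [Fintype Y] [Fintype Z] {t : Y → ℂ} (ht : ∀ y, ‖t y‖ ≤ 1)
    (Φ : X × Y × Z → ℂ) : nsq (mulMid t Φ) ≤ nsq Φ :=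
  nsq_mono fun x => by
    rw [mulMid_apply, norm_mul]
    exact mul_le_of_le_one_left (norm_nonneg _) (ht _)

end

/-! ### The game as a norm, and the interference term. -/

section
variable {u l : ℕ}

/-- The basis states of the public key register that pass the check of the signature. -/
def Accepted (ver : Bits (u + 1) → Bits l → Bool) (p : Bits (u + (l + 1))) : Prop :=
  ver (Fin.cons (p.right 0) p.left) (Fin.tail p.right) = true

instance (ver : Bits (u + 1) → Bits l → Bool) : DecidablePred (Accepted ver) :=
  fun _ => inferInstanceAs (Decidable (_ = _))

theorem encAmp_eq (ver : Bits (u + 1) → Bits l → Bool) (b : Bool) (q p : Bits (u + (l + 1))) :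
    encAmp ver b q p = hadamardRight q p *
      if Accepted ver p then (if b = true ∧ p.right 0 = true then -1 else 1) else 0 := by
  rw [encAmp, hadamardRight_apply, sgn_flipAt_zero, sgn_comm q.right]
  by_cases h1 : q.left = p.left <;> by_cases h2 : Accepted ver p
  · rw [if_pos ⟨h1, h2⟩, if_pos h1, if_pos h2]; ring
  · rw [if_neg fun h => h2 h.2, if_neg h2, mul_zero]
  · rw [if_neg fun h => h1 h.1, if_neg h1, zero_mul]
  · rw [if_neg fun h => h1 h.1, if_neg h1, zero_mul]

/-- The message that is encrypted if the challenge bit is `b`. -/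
def chosen (b : Bool) (μ : Bits (1 + 1)) : Bool := (if b = true then μ.right else μ.left) 0

/-- The signs that the encryption gives to the basis states with `A = 1`. -/
noncomputable def chosenSign (b : Bool) (μ : Bits (1 + 1)) : ℂ := if chosen b μ = true then -1 else 1

theorem norm_chosenSign (b : Bool) (μ : Bits (1 + 1)) : ‖chosenSign b μ‖ = 1 := by
  rw [chosenSign]; split_ifs <;> simp

variable {w : ℕ} (A₁ : QCircuit w (u + (l + 1) + (1 + 1)))
  (A₂ : QCircuit (u + (l + 1) + 1 + A₁.rest) 1) (ver : Bits (u + 1) → Bits l → Bool)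

/-- The state `Ψ` after the first stage, with the public key register, the messages and the rest as
indices. -/
def splitOut {k r : ℕ} (Ψ : Bits (k + (1 + 1)) × Bits r → ℂ) :
    Bits k × Bits (1 + 1) × Bits r → ℂ :=
  fun x => Ψ (Fin.append x.1 x.2.1, x.2.2)

theorem nsq_splitOut {k r : ℕ} (Ψ : Bits (k + (1 + 1)) × Bits r → ℂ) :
    nsq (splitOut Ψ) = nsq Ψ := by
  simp only [nsq, Fintype.sum_prod_type, sum_bits_append (m := k), splitOut]

/-- The state after the check of the signature and the application of `Z`. -/
noncomputable def checked (b : Bool) (Φ : Bits (u + (l + 1)) × Bits (1 + 1) × Bits A₁.rest → ℂ) :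
    Bits (u + (l + 1)) × Bits (1 + 1) × Bits A₁.rest → ℂ :=
  mask (fun p => Accepted ver p ∧ p.right 0 = false) Φ +
    mulMid (chosenSign b) (mask (fun p => Accepted ver p ∧ p.right 0 = true) Φ)

theorem chal_checked (b β : Bool) (Φ : Bits (u + (l + 1)) × Bits (1 + 1) × Bits A₁.rest → ℂ)
    (q : Bits (u + (l + 1))) (μ : Bits (1 + 1)) (c : Bits A₂.rest) :
    chal A₂ β (checked A₁ ver b Φ) (q, μ, c) = ∑ p, encAmp ver (chosen b μ) q p *
      secondAmp A₁ A₂ (Fin.cons true q) (fun c' => Φ (p, μ, c')) ((fun _ => β), c) := by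
  simp only [chal, LinearMap.coe_mk, AddHom.coe_mk, hadR, Matrix.mulVec, dotProduct, secondAmp,
    Finset.mul_sum]
  rw [Finset.sum_comm]
  refine Finset.sum_congr rfl fun p _ => Finset.sum_congr rfl fun c' _ => ?_
  rw [encAmp_eq]
  simp only [checked, Pi.add_apply, mask_apply, mulMid_apply, chosenSign]
  by_cases h1 : Accepted ver p <;> cases h2 : p.right 0 <;> cases h3 : chosen b μ <;>
    simp [h1] <;> ring

/-- The part of the probability of the output `b` in which the ciphertext is `⊥`. -/
noncomputable def rejectProb (b : Bool)
    (Φ : Bits (u + (l + 1)) × Bits (1 + 1) × Bits A₁.rest → ℂ) : ℝ :=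
  ∑ μ : Bits (1 + 1), ∑ p, if Accepted ver p then 0 else
    ∑ c, ‖∑ c', A₂.iso ((fun _ => b), c) (Fin.append (Fin.cons false fun _ => false) c') *
      Φ (p, μ, c')‖ ^ 2

/-- The ciphertext `⊥` carries no information about the challenge bit, so a rejected key contributes
its whole weight once, as for a random guess. -/
theorem rejectProb_add (Φ : Bits (u + (l + 1)) × Bits (1 + 1) × Bits A₁.rest → ℂ) :
    rejectProb A₁ A₂ ver false Φ + rejectProb A₁ A₂ ver true Φ =
      nsq (mask (fun p => ¬ Accepted ver p) Φ) := by
  rw [rejectProb, rejectProb, ← Finset.sum_add_distrib]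
  have h : nsq (mask (fun p => ¬ Accepted ver p) Φ) =
      ∑ μ, ∑ p, if Accepted ver p then 0 else nsq fun c => Φ (p, μ, c) := by
    simp only [nsq, Fintype.sum_prod_type]
    rw [Finset.sum_comm]
    refine Finset.sum_congr rfl fun μ _ => Finset.sum_congr rfl fun p _ => ?_
    by_cases h : Accepted ver p <;> simp [mask_apply, h]
  rw [h]
  refine Finset.sum_congr rfl fun μ _ => ?_
  rw [← Finset.sum_add_distrib]
  refine Finset.sum_congr rfl fun p _ => ?_
  split_ifs
  · simp
  · exact sum_secondStage A₂ _ _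

theorem quadratic_eq {X : Type} [Fintype X] (E g : X → ℂ) :
    (∑ p', ∑ p, star (E p') * E p * g p * star (g p')).re = ‖∑ p, E p * g p‖ ^ 2 := by
  have h : ∑ p', ∑ p, star (E p') * E p * g p * star (g p') =
      star (∑ p, E p * g p) * ∑ p, E p * g p := by
    rw [star_sum, Finset.sum_mul_sum]
    refine Finset.sum_congr rfl fun p' _ => Finset.sum_congr rfl fun p _ => ?_
    rw [star_mul']
    ring
  rw [h, star_mul_self_eq, Complex.ofReal_re]

/-- Each accepting POVM element has rank one, so its term is the squared modulus of an amplitude of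
`chal`. The rejecting element is diagonal and gives `rejectProb`. -/
theorem game_term_eq (b : Bool) (Ψ : Bits (u + (l + 1) + (1 + 1)) × Bits A₁.rest → ℂ) :
    ∑ msg₀ : Bits 1, ∑ msg₁ : Bits 1, ∑ ct : Bits (u + (l + 1) + 1), ∑ c,
      (∑ p', ∑ p, encPOVM ver ((if b = true then msg₁ else msg₀) 0) ct p' p *
        secondAmp A₁ A₂ ct (fun c' => Ψ (Fin.append p (Fin.append msg₀ msg₁), c'))
          ((fun _ => b), c) *
        star (secondAmp A₁ A₂ ct (fun c' => Ψ (Fin.append p' (Fin.append msg₀ msg₁), c'))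
          ((fun _ => b), c))).re =
      nsq (chal A₂ b (checked A₁ ver b (splitOut Ψ))) +
        rejectProb A₁ A₂ ver b (splitOut Ψ) := by
  have h1 : nsq (chal A₂ b (checked A₁ ver b (splitOut Ψ))) = ∑ μ, ∑ q, ∑ c,
      ‖chal A₂ b (checked A₁ ver b (splitOut Ψ)) (q, μ, c)‖ ^ 2 := by
    simp only [nsq, Fintype.sum_prod_type]
    exact Finset.sum_comm
  rw [h1, rejectProb, ← Finset.sum_add_distrib, sum_bits_append (m := 1)]
  refine Finset.sum_congr rfl fun msg₀ _ => Finset.sum_congr rfl fun msg₁ _ => ?_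
  have hch : chosen b (Fin.append msg₀ msg₁) = (if b = true then msg₁ else msg₀) 0 := by
    rw [chosen, left_append, right_append]
  rw [sum_bits_cons]
  congr 1
  · refine Finset.sum_congr rfl fun q _ => Finset.sum_congr rfl fun c _ => ?_
    rw [chal_checked, hch]
    simp only [encPOVM_cons_true]
    exact quadratic_eq _ _
  · rw [Finset.sum_eq_single fun _ => false]
    · have h2 : ∀ g : Bits (u + (l + 1)) → ℂ, (∑ p', ∑ p,
          encPOVM ver ((if b = true then msg₁ else msg₀) 0) (Fin.cons false fun _ => false) p' p *
            g p * star (g p')).re = ∑ p, if Accepted ver p then 0 else ‖g p‖ ^ 2 := by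
        intro g
        rw [Complex.re_sum]
        refine Finset.sum_congr rfl fun p' _ => ?_
        rw [Finset.sum_eq_single p']
        · rw [encPOVM_cons_false, if_pos rfl]
          by_cases h : Accepted ver p'
          · rw [if_pos h, if_neg (by rw [Accepted] at h; simp [h])]
            simp
          · rw [if_neg h, if_pos ⟨rfl, by rw [Accepted] at h; simpa using h⟩, one_mul, mul_comm,
              star_mul_self_eq, Complex.ofReal_re]
        · intro p _ hp
          rw [encPOVM_cons_false, if_pos rfl, if_neg fun h => hp h.1.symm]
          simp
        · simp
      rw [Finset.sum_congr rfl fun c _ => h2 fun p => secondAmp A₁ A₂ (Fin.cons false fun _ => false)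
        (fun c' => Ψ (Fin.append p (Fin.append msg₀ msg₁), c')) ((fun _ => b), c), Finset.sum_comm]
      refine Finset.sum_congr rfl fun p _ => ?_
      split_ifs
      · simp
      · rfl
    · intro q _ hq
      simp [encPOVM_cons_false, hq]
    · simp

/-- The two messages are measured and not touched by the second stage, so a factor that depends on
them passes through. Thus the sign of the challenge can be moved behind the second stage. -/
theorem chal_mulMid (β : Bool) (t : Bits (1 + 1) → ℂ)
    (Φ : Bits (u + (l + 1)) × Bits (1 + 1) × Bits A₁.rest → ℂ) :
    chal A₂ β (mulMid t Φ) = mulMid t (chal A₂ β Φ) := by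
  funext x
  have h : ∀ c, hadR (fun p => t x.2.1 * Φ (p, x.2.1, c)) x.1 =
      t x.2.1 * hadR (fun p => Φ (p, x.2.1, c)) x.1 := fun c =>
    congrFun (Matrix.mulVec_smul hadamardRight (t x.2.1) fun p => Φ (p, x.2.1, c)) x.1
  simp only [chal, LinearMap.coe_mk, AddHom.coe_mk, mulMid_apply, Finset.mul_sum, h]
  exact Finset.sum_congr rfl fun c _ => by ring

/-- Half the difference of the signs for the two challenge bits. -/
noncomputable def signDiff (μ : Bits (1 + 1)) : ℂ := (chosenSign true μ - chosenSign false μ) / 2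

theorem norm_signDiff_le (μ : Bits (1 + 1)) : ‖signDiff μ‖ ≤ 1 := by
  rw [signDiff, norm_div]
  have := norm_sub_le (chosenSign true μ) (chosenSign false μ)
  rw [norm_chosenSign, norm_chosenSign] at this
  norm_num
  linarith

theorem nsq_checked (b : Bool) (Φ : Bits (u + (l + 1)) × Bits (1 + 1) × Bits A₁.rest → ℂ) :
    nsq (checked A₁ ver b Φ) = nsq (mask (Accepted ver) Φ) := by
  refine Finset.sum_congr rfl fun x _ => ?_
  congr 1
  simp only [checked, Pi.add_apply, mask_apply, mulMid_apply]
  by_cases h1 : Accepted ver x.1 <;> cases h2 : x.1.right 0 <;> simp [h1, norm_chosenSign]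

/-- The two outcomes of the challenge bit differ only in the interference of the accepted parts
with `A = 0` and `A = 1`. -/
theorem game_terms_le (Φ : Bits (u + (l + 1)) × Bits (1 + 1) × Bits A₁.rest → ℂ) :
    (nsq (chal A₂ false (checked A₁ ver false Φ)) + rejectProb A₁ A₂ ver false Φ) +
      (nsq (chal A₂ true (checked A₁ ver true Φ)) + rejectProb A₁ A₂ ver true Φ) ≤
      nsq Φ + 4 * ‖ip (chal A₂ true (mask (fun p => Accepted ver p ∧ p.right 0 = false) Φ))
        (chal A₂ true (mulMid signDiff
          (mask (fun p => Accepted ver p ∧ p.right 0 = true) Φ)))‖ := by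
  have h1 := nsq_chal A₂ (checked A₁ ver false Φ)
  have h2 := rejectProb_add A₁ A₂ ver Φ
  have h3 := nsq_mask_add_not (Accepted ver) Φ
  rw [nsq_checked] at h1
  set a := chal A₂ true (mask (fun p => Accepted ver p ∧ p.right 0 = false) Φ) with ha
  set b := chal A₂ true (mask (fun p => Accepted ver p ∧ p.right 0 = true) Φ) with hb
  -- The parts with `A = 0` and `A = 1` contribute norms that do not depend on the challenge bit;
  -- only the cross term sees the sign.
  have h4 : ∀ β, nsq (chal A₂ true (checked A₁ ver β Φ)) =
      nsq a + nsq b + 2 * (ip a (mulMid (chosenSign β) b)).re := by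
    intro β
    rw [checked, map_add, nsq_add, chal_mulMid, nsq_mulMid (norm_chosenSign β)]
  -- The signs for the two challenge bits differ by twice `signDiff`; with the factor 2 of the cross
  -- term this gives the constant 4 of the bound.
  have h5 : (ip a (mulMid (chosenSign true) b)).re - (ip a (mulMid (chosenSign false) b)).re =
      2 * (ip a (mulMid signDiff b)).re := by
    have : mulMid (chosenSign true) b = mulMid (chosenSign false) b +
        (mulMid signDiff b + mulMid signDiff b) := by
      funext x
      simp only [Pi.add_apply, mulMid_apply, signDiff]
      ring
    rw [this, ip_add_right, ip_add_right, Complex.add_re, Complex.add_re]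
    ring
  have h6 := Complex.re_le_norm (ip a (mulMid signDiff b))
  rw [chal_mulMid, ← hb]
  have h7 := h4 true
  have h8 := h4 false
  linarith

end

/-! ### Bounding the interference by forgeries. -/

section
variable {u l r₁ : ℕ} (A₂ : QCircuit (u + (l + 1) + 1 + r₁) 1)

/-- The interference of two states in the second stage. -/
noncomputable def interf (φ ψ : Bits (u + (l + 1)) × Bits (1 + 1) × Bits r₁ → ℂ) : ℂ :=
  ip (chal A₂ true φ) (mulMid signDiff (chal A₂ true ψ))

theorem nsq_chal_le (β : Bool) (Φ : Bits (u + (l + 1)) × Bits (1 + 1) × Bits r₁ → ℂ) :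
    nsq (chal A₂ β Φ) ≤ nsq Φ := by
  have h := nsq_chal A₂ Φ
  have h1 := nsq_nonneg (chal A₂ false Φ)
  have h2 := nsq_nonneg (chal A₂ true Φ)
  cases β <;> linarith

theorem norm_interf_le (φ ψ : Bits (u + (l + 1)) × Bits (1 + 1) × Bits r₁ → ℂ) :
    ‖interf A₂ φ ψ‖ ≤ √(nsq φ) * √(nsq ψ) := by
  refine (norm_ip_le _ _).trans ?_
  gcongr
  · exact nsq_chal_le _ _ _
  · exact (nsq_mulMid_le norm_signDiff_le _).trans (nsq_chal_le _ _ _)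

theorem interf_add_left (φ φ' ψ : Bits (u + (l + 1)) × Bits (1 + 1) × Bits r₁ → ℂ) :
    interf A₂ (φ + φ') ψ = interf A₂ φ ψ + interf A₂ φ' ψ := by
  rw [interf, map_add, ip_add_left]; rfl

theorem interf_add_right (φ ψ ψ' : Bits (u + (l + 1)) × Bits (1 + 1) × Bits r₁ → ℂ) :
    interf A₂ φ (ψ + ψ') = interf A₂ φ ψ + interf A₂ φ ψ' := by
  rw [interf, map_add, map_add, ip_add_right]; rfl

theorem interf_sum_left {I : Type} (s : Finset I)
    (φ : I → Bits (u + (l + 1)) × Bits (1 + 1) × Bits r₁ → ℂ) (ψ) :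
    interf A₂ (∑ i ∈ s, φ i) ψ = ∑ i ∈ s, interf A₂ (φ i) ψ := by
  rw [interf, map_sum, ip_sum_left]; rfl

theorem chal_apply (β : Bool) (Φ : Bits (u + (l + 1)) × Bits (1 + 1) × Bits r₁ → ℂ) (q μ c) :
    chal A₂ β Φ (q, μ, c) = ∑ c', ∑ p, A₂.iso ((fun _ => β), c) (Fin.append (Fin.cons true q) c') *
      hadamardRight q p * Φ (p, μ, c') := by
  simp only [chal, LinearMap.coe_mk, AddHom.coe_mk, hadR, Matrix.mulVec, dotProduct,
    Finset.mul_sum, mul_assoc]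

/-- The Hadamard gates act only on `A` and `B`, so the string `r` of the key is part of the
ciphertext and is preserved by the second stage. -/
theorem chal_mask_left (β : Bool) (r : Bits u)
    (Φ : Bits (u + (l + 1)) × Bits (1 + 1) × Bits r₁ → ℂ) :
    chal A₂ β (mask (fun p => p.left = r) Φ) = mask (fun p => p.left = r) (chal A₂ β Φ) := by
  funext ⟨q, μ, c⟩
  rw [mask_apply, chal_apply, chal_apply]
  split_ifs with h
  · refine Finset.sum_congr rfl fun c' _ => Finset.sum_congr rfl fun p _ => ?_
    rw [mask_apply, hadamardRight_apply]
    by_cases h1 : q.left = p.left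
    · rw [if_pos (show Bits.left p = r from h1.symm.trans h)]
    · rw [if_neg h1]; simp
  · refine Finset.sum_eq_zero fun c' _ => Finset.sum_eq_zero fun p _ => ?_
    rw [mask_apply, hadamardRight_apply]
    by_cases h1 : q.left = p.left
    · rw [if_neg (show ¬ Bits.left p = r from fun h2 => h (h1.trans h2)), mul_zero]
    · rw [if_neg h1]; simp

/-- Since `r` is preserved, states with different `r` are orthogonal after the second stage:
interference happens only between the strings of one and the same key. -/
theorem interf_mask_left (r : Bits u) (φ ψ : Bits (u + (l + 1)) × Bits (1 + 1) × Bits r₁ → ℂ) :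
    interf A₂ (mask (fun p => p.left = r) φ) ψ =
      interf A₂ (mask (fun p => p.left = r) φ) (mask (fun p => p.left = r) ψ) := by
  rw [interf, interf, chal_mask_left, chal_mask_left]
  refine Finset.sum_congr rfl fun x _ => ?_
  rw [mask_apply, mulMid_apply, mulMid_apply, mask_apply]
  split_ifs <;> simp

variable {m : ℕ} (ver : Bits (u + 1) → Bits l → Bool) (sign : Bits (u + 1) → Bits l)

/-- The interference is small if signatures cannot be forged: `Φ` is the state for public keys with
the strings `r`, and `Φs i a` is its part in which the qubit `A` of the `i`-th key is `a`. -/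
theorem norm_interf_le_sum {r : Fin m → Bits u} (hr : Function.Injective r)
    {Φ : Bits (u + (l + 1)) × Bits (1 + 1) × Bits r₁ → ℂ}
    {Φs : Fin m → Bool → Bits (u + (l + 1)) × Bits (1 + 1) × Bits r₁ → ℂ}
    (hΦ : ∀ i, Φ = Φs i false + Φs i true) (hn : nsq Φ ≤ 1) (hns : ∀ i a, nsq (Φs i a) ≤ 1) :
    ‖interf A₂ (mask (fun p => Accepted ver p ∧ p.right 0 = false) Φ)
      (mask (fun p => Accepted ver p ∧ p.right 0 = true) Φ)‖ ≤
      √(nsq (mask (fun p => (Accepted ver p ∧ p.right 0 = false) ∧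
        ∀ i, p ≠ keyString sign (Fin.cons false (r i))) Φ)) +
      ∑ i, (√(nsq (mask (fun p => Accepted ver p ∧ p = keyString sign (Fin.cons false (r i)))
          (Φs i true))) +
        √(nsq (mask (fun p => (Accepted ver p ∧ p.right 0 = true) ∧ p.left = r i)
          (Φs i false))) +
        √(nsq (mask (fun p => ((Accepted ver p ∧ p.right 0 = true) ∧ p.left = r i) ∧
          p ≠ keyString sign (Fin.cons true (r i))) (Φs i true))) +
        ‖interf A₂
          (mask (fun p => Accepted ver p ∧ p = keyString sign (Fin.cons false (r i)))
            (Φs i false))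
          (mask (fun p => Accepted ver p ∧ p = keyString sign (Fin.cons true (r i)))
            (Φs i true))‖) := by
  have hl : ∀ i α, Bits.left (keyString sign (Fin.cons α (r i))) = r i := fun i α => by
    rw [keyString, left_append, Fin.tail_cons]
  have hA : ∀ i α, Bits.right (keyString sign (Fin.cons α (r i))) 0 = α := fun i α => by
    rw [keyString, right_append, Fin.cons_zero, Fin.cons_zero]
  have hinj : ∀ i j, keyString sign (Fin.cons false (r i)) = keyString sign (Fin.cons false (r j)) →
      i = j := fun i j h => hr (by rw [← hl i false, h, hl])
  set b := mask (fun p => Accepted ver p ∧ p.right 0 = true) Φ with hb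
  have hnb : √(nsq b) ≤ 1 := Real.sqrt_le_one.2 ((nsq_mask_le _ _).trans hn)
  have hsq : ∀ (P : Bits (u + (l + 1)) → Prop) [DecidablePred P] (i a),
      √(nsq (mask P (Φs i a))) ≤ 1 := fun P _ i a =>
    Real.sqrt_le_one.2 ((nsq_mask_le _ _).trans (hns i a))
  -- The accepted strings with `A = 0` are split into those that belong to no key and those of the
  -- single keys. The latter are distinct because `r` is injective.
  have h1 : mask (fun p => Accepted ver p ∧ p.right 0 = false) Φ =
      mask (fun p => (Accepted ver p ∧ p.right 0 = false) ∧
        ∀ i, p ≠ keyString sign (Fin.cons false (r i))) Φ +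
      ∑ i, mask (fun p => Accepted ver p ∧ p = keyString sign (Fin.cons false (r i))) Φ := by
    funext x
    simp only [Pi.add_apply, Finset.sum_apply, mask_apply]
    by_cases h : ∃ i, x.1 = keyString sign (Fin.cons false (r i))
    · obtain ⟨i, hi⟩ := h
      have h2 : ¬ ((Accepted ver x.1 ∧ x.1.right 0 = false) ∧
          ∀ i, x.1 ≠ keyString sign (Fin.cons false (r i))) := fun h => h.2 i hi
      rw [if_neg h2, zero_add, Finset.sum_eq_single i]
      · simp only [hi, hA, and_true]
      · intro j _ hj
        rw [if_neg]
        rintro ⟨-, h⟩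
        exact hj (hinj j i (h.symm.trans hi))
      · simp
    · rw [Finset.sum_eq_zero fun i _ => if_neg fun h2 => h ⟨i, h2.2⟩, add_zero]
      refine if_congr ⟨fun h2 => ⟨h2, fun i hi => h ⟨i, hi⟩⟩, fun h2 => h2.1⟩ rfl rfl
  rw [h1, interf_add_left, interf_sum_left]
  refine (norm_add_le _ _).trans (add_le_add ?_ ((norm_sum_le _ _).trans
    (Finset.sum_le_sum fun i _ => ?_)))
  · exact (norm_interf_le _ _ _).trans (mul_le_of_le_one_right (Real.sqrt_nonneg _) hnb)
  · set P0 : (Bits (u + (l + 1)) × Bits (1 + 1) × Bits r₁ → ℂ) →ₗ[ℂ] _ :=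
      mask (fun p => Accepted ver p ∧ p = keyString sign (Fin.cons false (r i))) with hP0
    have e0 : ∀ φ, P0 φ = mask (fun p => p.left = r i) (P0 φ) := by
      intro φ
      funext x
      simp only [hP0, mask_apply]
      by_cases hx : Accepted ver x.1 ∧ x.1 = keyString sign (Fin.cons false (r i))
      · rw [if_pos (show Bits.left x.1 = r i by rw [hx.2, hl])]
      · rw [if_neg hx, ite_self]
    -- Within the block of `r i`, the accepted part with `A = 1` consists of two kinds of forgery
    -- and of the honest string, which comes from the branch in which the qubit `A` of this key is
    -- 1.
    have e1 : mask (fun p => p.left = r i) b =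
        mask (fun p => (Accepted ver p ∧ p.right 0 = true) ∧ p.left = r i) (Φs i false) +
        mask (fun p => ((Accepted ver p ∧ p.right 0 = true) ∧ p.left = r i) ∧
          p ≠ keyString sign (Fin.cons true (r i))) (Φs i true) +
        mask (fun p => Accepted ver p ∧ p = keyString sign (Fin.cons true (r i)))
            (Φs i true) := by
      funext x
      simp only [hb, Pi.add_apply, mask_apply, hΦ i]
      by_cases hx : x.1 = keyString sign (Fin.cons true (r i))
      · simp only [hx, hl, hA, and_true, ne_eq, not_true, and_false, if_true, if_false, add_zero]
        split_ifs <;> simp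
      · by_cases h2 : Accepted ver x.1 ∧ x.1.right 0 = true <;> by_cases h3 : x.1.left = r i <;>
          simp [h2, h3, hx]
    have e2 : ∀ φ, interf A₂ (P0 φ) b = interf A₂ (P0 φ) (mask (fun p => p.left = r i) b) := by
      intro φ
      conv_lhs => rw [e0, interf_mask_left, ← e0]
    -- Splitting the left state by branch as well, every term contains a forgery, except for the
    -- last: an honest string from each of the two branches.
    have e3 : interf A₂ (P0 Φ) b = interf A₂ (P0 (Φs i true)) b + (
        interf A₂ (P0 (Φs i false)) (mask (fun p => (Accepted ver p ∧ p.right 0 = true) ∧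
          p.left = r i) (Φs i false)) +
        interf A₂ (P0 (Φs i false)) (mask (fun p => ((Accepted ver p ∧ p.right 0 = true) ∧
          p.left = r i) ∧ p ≠ keyString sign (Fin.cons true (r i))) (Φs i true)) +
        interf A₂ (P0 (Φs i false)) (mask (fun p => Accepted ver p ∧
          p = keyString sign (Fin.cons true (r i))) (Φs i true))) := by
      rw [← interf_add_right, ← interf_add_right, ← e1, ← e2, ← interf_add_left, ← map_add,
        add_comm (Φs i true), ← hΦ i]
    have n1 := (norm_interf_le A₂ (P0 (Φs i true)) b).trans
      (mul_le_of_le_one_right (Real.sqrt_nonneg _) hnb)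
    have n2 : ∀ φ, ‖interf A₂ (P0 (Φs i false)) φ‖ ≤ √(nsq φ) := fun φ =>
      (norm_interf_le A₂ _ φ).trans (mul_le_of_le_one_left (Real.sqrt_nonneg _) (hsq _ _ _))
    rw [e3]
    refine (norm_add_le _ _).trans ?_
    rw [add_assoc (√_), add_assoc (√_)]
    refine add_le_add n1 ?_
    exact (norm_add₃_le).trans (add_le_add (add_le_add (n2 _) (n2 _)) le_rfl)

/-- The amplitude with which the second stage of the adversary turns the key `x₁` into `x₀`. -/
noncomputable def swapAmp (x₀ x₁ : Bits (u + (l + 1)))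
    (φ : Bits (u + (l + 1)) × Bits (1 + 1) × Bits r₁ → ℂ) (y : Bits (1 + 1) × Bits r₁) : ℂ :=
  -2 * ∑ q, ∑ c, star (A₂.iso ((fun _ => true), c) (Fin.append (Fin.cons true q) y.2) *
      hadamardRight q x₀) *
    ∑ c', A₂.iso ((fun _ => true), c) (Fin.append (Fin.cons true q) c') *
      hadamardRight q x₁ * φ (x₁, y.1, c')

/-- Restricted to single strings `x₀` and `x₁`, the interference is a scalar product of `φ₀` at `x₀`
with the vector that the projection onto output 1 carries from `x₁` to `x₀`. By Cauchy–Schwarz only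
the norm of the latter matters, and that does not involve `φ₀`: the forger needs just the branch of
`x₁`. -/
theorem norm_interf_le_swapAmp (x₀ x₁ : Bits (u + (l + 1)))
    {φ₀ : Bits (u + (l + 1)) × Bits (1 + 1) × Bits r₁ → ℂ} (h₀ : nsq φ₀ ≤ 1) (φ₁) :
    ‖interf A₂ (mask (fun p => Accepted ver p ∧ p = x₀) φ₀)
      (mask (fun p => Accepted ver p ∧ p = x₁) φ₁)‖ ≤
      √(if Accepted ver x₀ then nsq (swapAmp A₂ x₀ x₁ φ₁) else 0) := by
  have hz : ∀ (x : Bits (u + (l + 1))) (φ : Bits (u + (l + 1)) × Bits (1 + 1) × Bits r₁ → ℂ),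
      ¬ Accepted ver x → mask (fun p => Accepted ver p ∧ p = x) φ = 0 := by
    intro x φ hx
    funext y
    rw [mask_apply, if_neg]
    · rfl
    · rintro ⟨h, rfl⟩; exact hx h
  by_cases hx0 : Accepted ver x₀
  swap
  · refine (norm_interf_le _ _ _).trans ?_
    rw [hz x₀ φ₀ hx0]
    simp [nsq]
  by_cases hx1 : Accepted ver x₁
  swap
  · refine (norm_interf_le _ _ _).trans ?_
    rw [hz x₁ φ₁ hx1]
    simp [nsq]
  have hch : ∀ x, Accepted ver x → ∀ (φ : Bits (u + (l + 1)) × Bits (1 + 1) × Bits r₁ → ℂ) q μ c,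
      chal A₂ true (mask (fun p => Accepted ver p ∧ p = x) φ) (q, μ, c) =
      ∑ c', A₂.iso ((fun _ => true), c) (Fin.append (Fin.cons true q) c') *
        hadamardRight q x * φ (x, μ, c') := by
    intro x hx φ q μ c
    rw [chal_apply]
    refine Finset.sum_congr rfl fun c' _ => ?_
    rw [Finset.sum_eq_single x]
    · rw [mask_apply, if_pos ⟨hx, rfl⟩]
    · intro p _ hp
      rw [mask_apply, if_neg fun h => hp h.2, mul_zero]
    · simp
  have reorder : ∀ (K : Bits (u + (l + 1)) → Bits A₂.rest → Bits r₁ → ℂ) (a : Bits r₁ → ℂ) (s : ℂ)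
      (G : Bits (u + (l + 1)) → Bits A₂.rest → ℂ),
      ∑ q, ∑ c, star (∑ c', K q c c' * a c') * (s * G q c) =
        -(1 / 2) * ∑ c', star (a c') * (s * (-2 * ∑ q, ∑ c, star (K q c c') * G q c)) := by
    intro K a s G
    simp only [star_sum, Finset.sum_mul, Finset.mul_sum]
    rw [Finset.sum_comm (γ := Bits r₁)]
    refine Finset.sum_congr rfl fun q _ => ?_
    rw [Finset.sum_comm]
    refine Finset.sum_congr rfl fun c' _ => Finset.sum_congr rfl fun c _ => ?_
    rw [star_mul']
    ring
  -- The factor `-(1 / 2)` compensates for the `-2` in `swapAmp`, which comes from the reflection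
  -- that a circuit can apply in place of the projection.
  have key : interf A₂ (mask (fun p => Accepted ver p ∧ p = x₀) φ₀)
      (mask (fun p => Accepted ver p ∧ p = x₁) φ₁) =
      -(1 / 2) * ip (fun y : Bits (1 + 1) × Bits r₁ => φ₀ (x₀, y.1, y.2))
        (fun y => signDiff y.1 * swapAmp A₂ x₀ x₁ φ₁ y) := by
    rw [interf, ip, ip, Fintype.sum_prod_type, Fintype.sum_prod_type, Finset.mul_sum]
    simp only [Fintype.sum_prod_type, mulMid_apply, hch x₀ hx0, hch x₁ hx1]
    rw [Finset.sum_comm]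
    refine Finset.sum_congr rfl fun μ _ => ?_
    exact reorder _ _ _ _
  rw [key, if_pos hx0, norm_mul]
  have h1 : nsq (fun y : Bits (1 + 1) × Bits r₁ => φ₀ (x₀, y.1, y.2)) ≤ 1 := by
    refine le_trans ?_ h₀
    rw [nsq, nsq, Fintype.sum_prod_type (f := fun x => ‖φ₀ x‖ ^ 2)]
    exact Finset.single_le_sum (f := fun p => ∑ y : Bits (1 + 1) × Bits r₁, ‖φ₀ (p, y)‖ ^ 2)
      (fun p _ => Finset.sum_nonneg fun y _ => by positivity) (Finset.mem_univ x₀)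
  have h2 : nsq (fun y => signDiff y.1 * swapAmp A₂ x₀ x₁ φ₁ y) ≤ nsq (swapAmp A₂ x₀ x₁ φ₁) :=
    nsq_mono fun y => by
      rw [norm_mul]
      exact mul_le_of_le_one_left (norm_nonneg _) (norm_signDiff_le _)
  calc _ ≤ 1 * (√1 * √(nsq (swapAmp A₂ x₀ x₁ φ₁))) := by
        refine mul_le_mul (by norm_num) ((norm_ip_le _ _).trans ?_) (norm_nonneg _) zero_le_one
        gcongr
    _ = _ := by simp

end

/-! ## The public keys in the game -/

section
variable {u l m v : ℕ}

/-- The basis state of `m` keys with the strings `r` and the qubits `A` in the state `f`. -/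
def keysString (sign : Bits (u + 1) → Bits l) (r : Fin m → Bits u) (f : Fin m → Bool) :
    Bits (m * (u + (l + 1))) := fun t =>
  keyString sign (Fin.cons (f (finProdFinEquiv.symm t).1) (r (finProdFinEquiv.symm t).1))
    (finProdFinEquiv.symm t).2

theorem eq_keysString_iff {sign : Bits (u + 1) → Bits l} {r : Fin m → Bits u} {f : Fin m → Bool}
    {x : Bits (m * (u + (l + 1)))} : x = keysString sign r f ↔
      ∀ i, (fun j => x (finProdFinEquiv (i, j))) = keyString sign (Fin.cons (f i) (r i)) := by
  constructor
  · rintro rfl i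
    funext j
    simp [keysString]
  · intro h
    funext t
    have := congrFun (h (finProdFinEquiv.symm t).1) (finProdFinEquiv.symm t).2
    simp only [Prod.mk.eta, Equiv.apply_symm_apply] at this
    exact this

theorem keysString_injective (sign : Bits (u + 1) → Bits l) (r : Fin m → Bits u) :
    Function.Injective (keysString sign r) := by
  intro f f' h
  funext i
  have h1 := (eq_keysString_iff.1 h) i
  have h2 := (eq_keysString_iff.1 (rfl : keysString sign r f = _)) i
  have h3 := keyString_inj.1 (h2.symm.trans h1)
  simpa using congrFun h3 0

/-- The public keys with the strings `r`, restricted to the states `f ∈ s` of the qubits `A`. -/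
noncomputable def keysVec (vk : Bits v) (sign : Bits (u + 1) → Bits l) (r : Fin m → Bits u)
    (s : Finset (Fin m → Bool)) : Bits (v + m * (u + (l + 1))) → ℂ :=
  ∑ f ∈ s, rt ^ m • bket (Fin.append vk (keysString sign r f))

theorem norm_rt_pow_sq (k : ℕ) : ‖rt ^ k‖ ^ 2 = (1 / 2) ^ k := by
  have h : ‖rt‖ ^ 2 = 1 / 2 := by
    have := congrArg Complex.re (star_mul_self_eq rt)
    rw [star_rt, rt_mul_rt, Complex.ofReal_re] at this
    rw [← this]
    norm_num
  rw [norm_pow, ← pow_mul, mul_comm, pow_mul, h]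

/-- The branches are orthonormal up to the weight `2 ^ (-m)`, and there are at most `2 ^ m` of them.
The vector is not normalized: the missing weight is the probability of the other branches. -/
theorem nsq_keysVec_le (vk : Bits v) (sign : Bits (u + 1) → Bits l) (r : Fin m → Bits u)
    (s : Finset (Fin m → Bool)) : nsq (keysVec vk sign r s) ≤ 1 := by
  rw [keysVec, nsq_sum_bket s fun f _ f' _ h => keysString_injective sign r (append_inj.1 h).2]
  simp only [norm_rt_pow_sq, Finset.sum_const, nsmul_eq_mul]
  calc (s.card : ℝ) * (1 / 2) ^ m ≤ 2 ^ m * (1 / 2) ^ m := by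
        gcongr
        have := Finset.card_le_univ s
        simp only [Fintype.card_pi, Fintype.card_bool, Finset.prod_const, Finset.card_univ,
          Fintype.card_fin] at this
        exact_mod_cast this
    _ = 1 := by rw [← mul_pow]; norm_num

/-- Expanding the product over the keys of sums over their qubits `A` gives the sum over all `f`. -/
theorem keysVec_apply (vk : Bits v) (sign : Bits (u + 1) → Bits l) (r : Fin m → Bits u)
    (x : Bits (v + m * (u + (l + 1)))) :
    keysVec vk sign r Finset.univ x = if x.left = vk then
      ∏ i, pkVec (r i) (sign (Fin.cons false (r i))) (sign (Fin.cons true (r i)))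
        (fun j => x.right (finProdFinEquiv (i, j))) else 0 := by
  have h1 : ∀ i, pkVec (r i) (sign (Fin.cons false (r i))) (sign (Fin.cons true (r i)))
        (fun j => x.right (finProdFinEquiv (i, j))) = rt * ∑ a : Bool,
      if (fun j => x.right (finProdFinEquiv (i, j))) = keyString sign (Fin.cons a (r i)) then 1
      else 0 := by
    intro i
    rw [pkVec_apply, Fintype.sum_bool, add_comm]
  have hx : ∀ f, x = Fin.append vk (keysString sign r f) ↔ x.left = vk ∧
      ∀ i, (fun j => x.right (finProdFinEquiv (i, j))) = keyString sign (Fin.cons (f i) (r i)) := by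
    intro f
    rw [← eq_keysString_iff]
    conv_lhs => rw [← append_left_right x, append_inj]
  simp only [h1, Finset.prod_mul_distrib, Finset.prod_const, Finset.card_univ, Fintype.card_fin,
    Finset.prod_univ_sum, Fintype.piFinset_univ, Finset.prod_boole, Finset.mem_univ, true_implies]
  rw [keysVec, Finset.sum_apply]
  simp only [Pi.smul_apply, bket_apply, smul_eq_mul, hx, ← Finset.mul_sum]
  by_cases h : x.left = vk
  · simp [h]
  · simp [h]

/-- The `m`-fold tensor power of a mixture over `r` is the mixture over `m`-tuples of strings; this
reduces the game to pure states. -/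
theorem keysState_eq (vk : Bits v) (sign : Bits (u + 1) → Bits l) :
    keysState m vk (∑ r : Bits u, ((2 : ℂ) ^ u)⁻¹ •
      Matrix.vecMulVec (pkVec r (sign (Fin.cons false r)) (sign (Fin.cons true r)))
        (star (pkVec r (sign (Fin.cons false r)) (sign (Fin.cons true r))))) =
      (((((2 : ℝ) ^ u)⁻¹) ^ m : ℝ) : ℂ) • ∑ r : Fin m → Bits u,
        Matrix.vecMulVec (keysVec vk sign r Finset.univ)
          (star (keysVec vk sign r Finset.univ)) := by
  ext x y
  simp only [keysState, Matrix.smul_apply, Matrix.sum_apply, Matrix.vecMulVec_apply, Pi.star_apply,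
    keysVec_apply, smul_eq_mul]
  by_cases h1 : x.left = vk
  · by_cases h2 : y.left = vk
    · rw [if_pos ⟨h1, h2⟩]
      simp only [if_pos h1, if_pos h2]
      simp only [← Finset.mul_sum, Finset.prod_mul_distrib, Finset.prod_const, Finset.card_univ,
        Fintype.card_fin, Finset.prod_univ_sum, Fintype.piFinset_univ, star_prod]
      push_cast
      rfl
    · simp [h2]
  · simp [h1]

variable (A₁ : QCircuit (v + m * (u + (l + 1))) (u + (l + 1) + (1 + 1)))
  (A₂ : QCircuit (u + (l + 1) + 1 + A₁.rest) 1) (ver : Bits (u + 1) → Bits l → Bool)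
  (sign : Bits (u + 1) → Bits l) (vk : Bits v) (r : Fin m → Bits u)

/-- The state after the first stage, for the keys with the strings `r`, restricted to the states
`f ∈ s` of the qubits `A`. -/
noncomputable def firstState (s : Finset (Fin m → Bool)) :
    Bits (u + (l + 1)) × Bits (1 + 1) × Bits A₁.rest → ℂ :=
  splitOut (A₁.iso *ᵥ keysVec vk sign r s)

theorem nsq_firstState_le (s : Finset (Fin m → Bool)) : nsq (firstState A₁ sign vk r s) ≤ 1 := by
  rw [firstState, nsq_splitOut, A₁.nsq_iso]
  exact nsq_keysVec_le _ _ _ _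

/-- The states `f` with `f i = a`. -/
def fixBit (i : Fin m) (a : Bool) : Finset (Fin m → Bool) := Finset.univ.filter fun f => f i = a

theorem firstState_eq_add (i : Fin m) : firstState A₁ sign vk r Finset.univ =
    firstState A₁ sign vk r (fixBit i false) + firstState A₁ sign vk r (fixBit i true) := by
  have h : keysVec vk sign r Finset.univ =
      keysVec vk sign r (fixBit i false) + keysVec vk sign r (fixBit i true) := by
    have := Finset.sum_filter_add_sum_filter_not (Finset.univ : Finset (Fin m → Bool))
      (fun f => f i = false) fun f => rt ^ m • bket (Fin.append vk (keysString sign r f))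
    simp only [Bool.not_eq_false] at this
    exact this.symm
  funext x
  simp only [firstState, splitOut, h, Matrix.mulVec_add, Pi.add_apply]

/-- The norms of the parts of the states of the adversary that are forgeries, for the keys with
the strings `r`. -/
noncomputable def forgeryNorm : ℝ :=
  √(nsq (mask (fun p => (Accepted ver p ∧ p.right 0 = false) ∧
      ∀ i, p ≠ keyString sign (Fin.cons false (r i))) (firstState A₁ sign vk r Finset.univ))) +
    ∑ i, (√(nsq (mask (fun p => Accepted ver p ∧ p = keyString sign (Fin.cons false (r i)))
        (firstState A₁ sign vk r (fixBit i true)))) +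
      √(nsq (mask (fun p => (Accepted ver p ∧ p.right 0 = true) ∧ p.left = r i)
        (firstState A₁ sign vk r (fixBit i false)))) +
      √(nsq (mask (fun p => ((Accepted ver p ∧ p.right 0 = true) ∧ p.left = r i) ∧
        p ≠ keyString sign (Fin.cons true (r i))) (firstState A₁ sign vk r (fixBit i true)))) +
      √(if Accepted ver (keyString sign (Fin.cons false (r i))) then
        nsq (swapAmp A₂ (keyString sign (Fin.cons false (r i)))
          (keyString sign (Fin.cons true (r i))) (firstState A₁ sign vk r (fixBit i true))) else 0))

open Classical in
-- For distinct strings the advantage is bounded by forgeries. When strings collide there is no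
-- control over the interference, and the trivial bound 2 for the sum of two probabilities is used;
-- such tuples are rare.
theorem gameProb_add_le :
    gameProb A₁ A₂ (fun msg ct => encPOVM ver (msg 0) ct) (keysState m vk
      (∑ r : Bits u, ((2 : ℂ) ^ u)⁻¹ •
        Matrix.vecMulVec (pkVec r (sign (Fin.cons false r)) (sign (Fin.cons true r)))
          (star (pkVec r (sign (Fin.cons false r)) (sign (Fin.cons true r)))))) false +
    gameProb A₁ A₂ (fun msg ct => encPOVM ver (msg 0) ct) (keysState m vk
      (∑ r : Bits u, ((2 : ℂ) ^ u)⁻¹ •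
        Matrix.vecMulVec (pkVec r (sign (Fin.cons false r)) (sign (Fin.cons true r)))
          (star (pkVec r (sign (Fin.cons false r)) (sign (Fin.cons true r)))))) true ≤
    (((2 : ℝ) ^ u)⁻¹) ^ m * ∑ r : Fin m → Bits u,
      if Function.Injective r then 1 + 4 * forgeryNorm A₁ A₂ ver sign vk r else 2 := by
  rw [keysState_eq, gameProb_eq, gameProb_eq, ← mul_add, ← Finset.sum_add_distrib]
  refine mul_le_mul_of_nonneg_left (Finset.sum_le_sum fun r _ => ?_) (by positivity)
  refine le_trans (le_of_eq (congrArg₂ (· + ·) (game_term_eq A₁ A₂ ver false _)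
    (game_term_eq A₁ A₂ ver true _))) ?_
  change (nsq (chal A₂ false (checked A₁ ver false (firstState A₁ sign vk r Finset.univ))) +
    rejectProb A₁ A₂ ver false (firstState A₁ sign vk r Finset.univ)) +
    (nsq (chal A₂ true (checked A₁ ver true (firstState A₁ sign vk r Finset.univ))) +
    rejectProb A₁ A₂ ver true (firstState A₁ sign vk r Finset.univ)) ≤ _
  have hn := nsq_firstState_le A₁ sign vk r Finset.univ
  split_ifs with hr
  · refine (game_terms_le A₁ A₂ ver _).trans (add_le_add hn ?_)
    refine mul_le_mul_of_nonneg_left ?_ (by norm_num)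
    rw [chal_mulMid]
    refine (norm_interf_le_sum A₂ ver sign hr (firstState_eq_add A₁ sign vk r) hn
      (fun i a => nsq_firstState_le A₁ sign vk r (fixBit i a))).trans ?_
    rw [forgeryNorm]
    refine add_le_add le_rfl (Finset.sum_le_sum fun i _ => add_le_add le_rfl ?_)
    exact norm_interf_le_swapAmp A₂ ver _ _ (nsq_firstState_le A₁ sign vk r (fixBit i false)) _
  · have h1 : ∀ b, nsq (chal A₂ b (checked A₁ ver b (firstState A₁ sign vk r Finset.univ))) ≤
        nsq (mask (Accepted ver) (firstState A₁ sign vk r Finset.univ)) := fun b =>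
      (nsq_chal_le _ _ _).trans (nsq_checked A₁ ver b _).le
    have h2 := rejectProb_add A₁ A₂ ver (firstState A₁ sign vk r Finset.univ)
    have h3 := nsq_mask_add_not (Accepted ver) (firstState A₁ sign vk r Finset.univ)
    have h4 := h1 false
    have h5 := h1 true
    have h6 := nsq_nonneg (mask (fun p => ¬ Accepted ver p) (firstState A₁ sign vk r Finset.univ))
    linarith

end

theorem winProb_eq_gameProb (u : ℕ → ℕ) (S : SigScheme fun n => u n + 1) (m : ℕ → ℕ)
    (A : (QPKE.ofSig u S).Adversary m) (n : ℕ) (sk : Bits (S.skLen n)) (vk : Bits (S.vkLen n))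
    (b : Bool) : A.winProb n sk vk b =
      gameProb (k := u n + (S.sigLen n + 1)) (A.first n) (A.second n)
        (fun msg ct => encPOVM (S.ver n vk) (msg 0) ct) (keysState (m n) vk
        (∑ r : Bits (u n), ((2 : ℂ) ^ u n)⁻¹ •
          Matrix.vecMulVec (pkVec r (S.sign n sk (Fin.cons false r)) (S.sign n sk (Fin.cons true r)))
            (star (pkVec r (S.sign n sk (Fin.cons false r)) (S.sign n sk (Fin.cons true r)))))) b :=
  rfl

/-! ## Deferred measurement of oracle queries -/

/-- A gate or an oracle query on arbitrary wires. -/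
inductive QOp (ι : Type) (s t : ℕ) : Type
  | gate (g : QGate ι) : QOp ι s t
  | query (c : ι) (q : Fin s → ι) (a : Fin t → ι) : QOp ι s t

/-- The wire that a gate changes. -/
def QGate.tgt {ι : Type} : QGate ι → ι
  | .x i => i
  | .cx _ j _ => j
  | .ccx _ _ k _ _ _ => k
  | .h i => i
  | .t i => i
  | .tdg i => i

section
variable {ι : Type} [DecidableEq ι] {s t N : ℕ}

/-- A gate mixes only basis states that differ at its target. The truth of `B` depends on wires in
`P`, which exclude the target, so restricting to `B` commutes with the gate. -/
theorem QGate.act_restrict {P : Set ι} (g : QGate ι) (hg : g.tgt ∉ P)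
    (B : (ι → Bool) → Prop) [DecidablePred B]
    (hB : ∀ x y : ι → Bool, (∀ i ∈ P, x i = y i) → (B x ↔ B y)) (ψ : St ι) :
    g.act (fun x => if B x then ψ x else 0) = fun x => if B x then g.act ψ x else 0 := by
  have hup : ∀ (x : ι → Bool) b, B (Function.update x g.tgt b) ↔ B x := fun x b =>
    hB _ _ fun i hi => Function.update_of_ne (fun h => hg (by rwa [← h])) _ _
  funext x
  cases g with
  | x i => exact if_congr (hup x _) rfl rfl
  | cx i j h => exact if_congr (hup x _) rfl rfl
  | ccx i j k h1 h2 h3 => exact if_congr (hup x _) rfl rfl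
  | h i =>
    have h1 := hup x true
    have h2 := hup x false
    simp only [QGate.tgt] at h1 h2
    simp only [QGate.act_h, h1, h2]
    split_ifs <;> simp
  | t i => simp only [QGate.act_t]; split_ifs <;> simp
  | tdg i => simp only [QGate.act_tdg]; split_ifs <;> simp

/-- Add the string `z` to the wires `a`. -/
def xorAt (a : Fin t → ι) (z : Bits t) (x : ι → Bool) : ι → Bool :=
  fun i => Bool.xor (x i) (decide (∃ j, a j = i ∧ z j = true))

theorem xorAt_of_ne {a : Fin t → ι} {i : ι} (h : ∀ j, a j ≠ i) (z : Bits t) (x : ι → Bool) :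
    xorAt a z x i = x i := by
  have : ¬ ∃ j, a j = i ∧ z j = true := fun ⟨j, hj, _⟩ => h j hj
  simp [xorAt, this]

theorem xorAt_apply {a : Fin t → ι} (ha : Function.Injective a) (z : Bits t) (x : ι → Bool)
    (j : Fin t) : xorAt a z x (a j) = Bool.xor (x (a j)) (z j) := by
  have : (∃ j', a j' = a j ∧ z j' = true) ↔ z j = true :=
    ⟨fun ⟨j', h, h'⟩ => ha h ▸ h', fun h => ⟨j, rfl, h⟩⟩
  simp [xorAt, this]

/-- The action of a query on basis states, the query not being measured. -/
def ask (O : Bits s → Bits t) (c : ι) (q : Fin s → ι) (a : Fin t → ι) (x : ι → Bool) : ι → Bool :=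
  if x c = true then xorAt a (O (x ∘ q)) x else x

/-- The action of gates and queries on state vectors, the queries not being measured. -/
noncomputable def actO (O : Bits s → Bits t) : List (QOp ι s t) → St ι → St ι
  | [], ψ => ψ
  | .gate g :: ops, ψ => actO O ops (g.act ψ)
  | .query c q a :: ops, ψ => actO O ops fun x => ψ (ask O c q a x)

/-- The queries and answers that are read off from a basis state. -/
def queried (O : Bits s → Bits t) : List (QOp ι s t) → (ι → Bool) → Finset (Bits s × Bits t)
  | [], _ => ∅
  | .gate _ :: ops, x => queried O ops x
  | .query c q _ :: ops, x =>
      if x c = true then insert (x ∘ q, O (x ∘ q)) (queried O ops x) else queried O ops x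

/-- The wires in `P` are not changed, and queries are controlled by and made on wires in `P`. -/
def QOp.Fixes (P : Set ι) : QOp ι s t → Prop
  | .gate g => g.tgt ∉ P
  | .query c q a => c ∈ P ∧ (∀ j, q j ∈ P) ∧ ∀ j, a j ∉ P

theorem ask_of_mem {P : Set ι} (O : Bits s → Bits t) {c : ι} {q : Fin s → ι} {a : Fin t → ι}
    (ha : ∀ j, a j ∉ P) (x : ι → Bool) {i : ι} (hi : i ∈ P) : ask O c q a x i = x i := by
  rw [ask]
  split_ifs
  · exact xorAt_of_ne (fun j h => ha j (by rwa [h])) _ _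
  · rfl

theorem actO_restrict {P : Set ι} (O : Bits s → Bits t) (ops : List (QOp ι s t))
    (hops : ∀ o ∈ ops, o.Fixes P) (B : (ι → Bool) → Prop) [DecidablePred B]
    (hB : ∀ x y : ι → Bool, (∀ i ∈ P, x i = y i) → (B x ↔ B y)) (ψ : St ι) :
    actO O ops (fun x => if B x then ψ x else 0) = fun x => if B x then actO O ops ψ x else 0 := by
  induction ops generalizing ψ with
  | nil => rfl
  | cons o ops ih =>
    have ih := ih fun o ho => hops o (List.mem_cons_of_mem _ ho)
    have ho := hops o List.mem_cons_self
    cases o with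
    | gate g =>
      simp only [actO]
      rw [g.act_restrict ho B hB, ih]
    | query c q a =>
      simp only [actO]
      rw [← ih]
      congr 1
      funext x
      exact if_congr (hB _ _ fun i hi => ask_of_mem O ho.2.2 x hi) rfl rfl

/-- A gate or query on numbered wires. -/
def QOp.toOp (f : ι ≃ Fin N) : QOp ι s t → OracleOp N s t
  | .gate g => .gate (g.map f.toEmbedding).toGate
  | .query c q a => .query (f c) (f ∘ q) (f ∘ a)

theorem act_map_equiv (f : ι ≃ Fin N) (g : QGate ι) (ψ : St ι) :
    (g.map f.toEmbedding).act (fun x : Bits N => ψ (x ∘ f)) = fun x => g.act ψ (x ∘ f) := by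
  funext x
  have h := actL_map_apply f.toEmbedding [g] (fun x : Bits N => ψ (x ∘ f)) x
  simp only [List.map_cons, List.map_nil, actL_cons, actL_nil] at h
  rw [h]
  have : slice f.toEmbedding x (fun x : Bits N => ψ (x ∘ f)) = ψ := by
    funext y
    simp only [slice]
    congr 1
    funext i
    exact f.injective.extend_apply _ _ _
  rw [this]
  rfl

theorem runOracle_gates (O : Bits s → Bits t) (win) (f : ι ≃ Fin N) (gs : List (QGate ι))
    (ops : List (QOp ι s t)) (ψ : St ι) (Q) :
    runOracle O win ((gs.map QOp.gate ++ ops).map (QOp.toOp f)) (fun x => ψ (x ∘ f)) Q =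
      runOracle O win (ops.map (QOp.toOp f)) (fun x => actL gs ψ (x ∘ f)) Q := by
  induction gs generalizing ψ with
  | nil => rfl
  | cons g gs ih =>
    simp only [List.map_cons, List.cons_append, QOp.toOp, runOracle, Gate.mat_mulVec,
      QGate.toQ_toGate, act_map_equiv, actL_cons]
    exact ih _

theorem xorInto_comp (f : ι ≃ Fin N) (a : Fin t → ι) (z : Bits t) (x : Bits N) :
    xorInto (f ∘ a) z x ∘ f = xorAt a z (x ∘ f) := by
  funext i
  simp [xorInto, xorAt]

/-- The measurements of the queries can be deferred to the end. -/
theorem runOracle_eq [Fintype ι] {P : Set ι} (O : Bits s → Bits t)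
    (win : Finset (Bits s × Bits t) → Bits N → Bool) (f : ι ≃ Fin N)
    (ops : List (QOp ι s t)) (hops : ∀ o ∈ ops, o.Fixes P) (ψ : St ι)
    (Q : Finset (Bits s × Bits t)) :
    runOracle O win (ops.map (QOp.toOp f)) (fun x => ψ (x ∘ f)) Q =
      ∑ x : ι → Bool, if win (Q ∪ queried O ops x) (x ∘ f.symm) = true then
        ‖actO O ops ψ x‖ ^ 2 else 0 := by
  induction ops generalizing ψ Q with
  | nil =>
    simp only [List.map_nil, runOracle, queried, Finset.union_empty, actO]
    rw [← Equiv.sum_comp (f.arrowCongr (Equiv.refl Bool))]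
    refine Finset.sum_congr rfl fun x _ => ?_
    have h : (f.arrowCongr (Equiv.refl Bool)) x = x ∘ f.symm := rfl
    have h2 : (x ∘ f.symm) ∘ f = x := by funext i; simp
    rw [h, h2]
  | cons o ops ih =>
    have ho := hops o List.mem_cons_self
    have hops' := fun o ho => hops o (List.mem_cons_of_mem _ ho)
    have ih := ih hops'
    cases o with
    | gate g =>
      simp only [List.map_cons, QOp.toOp, runOracle, Gate.mat_mulVec, QGate.toQ_toGate,
        act_map_equiv, queried, actO]
      exact ih _ _
    | query c q a =>
      obtain ⟨hc, hq, ha⟩ := ho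
      set φ : St ι := fun x => ψ (ask O c q a x) with hφ
      simp only [List.map_cons, QOp.toOp, runOracle]
      have e0 : (fun x : Bits N => if x (f c) = true then (0 : ℂ) else ψ (x ∘ f)) =
          fun x => (fun y : ι → Bool => if y c = false then φ y else 0) (x ∘ f) := by
        funext x
        by_cases h : x (f c) = true
        · simp [h]
        · simp only [Bool.not_eq_true] at h
          simp [h, hφ, ask]
      -- The controls and query wires are not among the answer wires, so the measured values are the
      -- same before and after the answer is added, and the branch for the result `m` is the
      -- restriction of one common vector.
      have e1 : ∀ m : Bits s, (fun x : Bits N =>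
          if xorInto (f ∘ a) (O m) x (f c) = true ∧
            (fun j => xorInto (f ∘ a) (O m) x ((f ∘ q) j)) = m then
            ψ (xorInto (f ∘ a) (O m) x ∘ f) else 0) =
          fun x => (fun y : ι → Bool => if y c = true ∧ y ∘ q = m then φ y else 0) (x ∘ f) := by
        intro m
        funext x
        have h1 : ∀ i ∈ P, xorInto (f ∘ a) (O m) x (f i) = x (f i) := fun i hi =>
          (congrFun (xorInto_comp f a (O m) x) i).trans
            (xorAt_of_ne (fun j h => ha j (by rwa [h])) _ _)
        have h2 : (fun j => xorInto (f ∘ a) (O m) x ((f ∘ q) j)) = (x ∘ f) ∘ q :=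
          funext fun j => h1 _ (hq j)
        rw [h1 c hc, h2, xorInto_comp]
        by_cases h : x (f c) = true ∧ (x ∘ f) ∘ q = m
        · rw [if_pos h]
          refine Eq.trans ?_ (if_pos h).symm
          rw [hφ]
          simp only [ask]
          refine congrArg ψ (Eq.trans ?_ (if_pos h.1).symm)
          rw [h.2]
        · rw [if_neg h]
          exact (if_neg h).symm
      have hB0 : ∀ x y : ι → Bool, (∀ i ∈ P, x i = y i) → (x c = false ↔ y c = false) :=
        fun x y h => by rw [h c hc]
      have hB1 : ∀ (m : Bits s) (x y : ι → Bool), (∀ i ∈ P, x i = y i) →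
          (x c = true ∧ x ∘ q = m ↔ y c = true ∧ y ∘ q = m) := fun m x y h => by
        rw [h c hc, show x ∘ q = y ∘ q from funext fun j => h _ (hq j)]
      refine (congrArg₂ (· + ·)
        ((congrArg (fun z => runOracle O win (ops.map (QOp.toOp f)) z Q) e0).trans
          (ih (fun y => if y c = false then φ y else 0) _))
        (Finset.sum_congr rfl fun m _ => (congrArg (fun z => runOracle O win
          (ops.map (QOp.toOp f)) z (insert (m, O m) Q)) (e1 m)).trans
          (ih (fun y => if y c = true ∧ y ∘ q = m then φ y else 0) _))).trans ?_
      -- Later operations fix the wires in `P`, so the restrictions made by the measurement can be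
      -- moved to the end, where exactly one branch contains the basis state `x`.
      rw [actO_restrict O ops hops' _ hB0]
      simp only [actO_restrict O ops hops' _ (hB1 _)]
      rw [Finset.sum_comm, ← Finset.sum_add_distrib]
      refine Finset.sum_congr rfl fun x _ => ?_
      have h2 : actO O (.query c q a :: ops) ψ x = actO O ops φ x := rfl
      rw [h2]
      by_cases hx : x c = true
      · have h1 : queried O (.query c q a :: ops) x = insert (x ∘ q, O (x ∘ q)) (queried O ops x) :=
          if_pos hx
        have h3 : Q ∪ insert (x ∘ q, O (x ∘ q)) (queried O ops x) =
            insert (x ∘ q, O (x ∘ q)) Q ∪ queried O ops x := by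
          rw [Finset.insert_union, Finset.union_insert]
        rw [h1, h3, Finset.sum_eq_single (x ∘ q)]
        · simp [hx]
        · intro m _ hm
          simp [hm.symm]
        · simp
      · have h1 : queried O (.query c q a :: ops) x = queried O ops x := if_neg hx
        rw [h1]
        simp [hx]

end

/-! ## The forger: wires and preparation of the keys -/

section
variable {ι : Type} [DecidableEq ι]

/-- A layer of gates is verified by naming the state after it and checking the targets and the other
wires; this form composes by rewriting. -/
theorem clL_layer {J : Type} {g : J → QGate ι} {tgt : J → ι} {F : J → (ι → Bool) → Bool}
    {L : List J} (hL : L.Nodup) (hm : ∀ j, j ∈ L)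
    (hg : ∀ j y, (g j).cl y = flipAt (F j y) (tgt j) y)
    (hF : ∀ j y j' c, F j (flipAt c (tgt j') y) = F j y) (ht : Function.Injective tgt)
    {y y' : ι → Bool} (h1 : ∀ j, y' (tgt j) = Bool.xor (y (tgt j)) (F j y))
    (h2 : ∀ k, (∀ j, tgt j ≠ k) → y' k = y k) : clL (L.map g) y = y' := by
  obtain ⟨h3, h4⟩ := clL_parallel hg hF ht hL y
  funext k
  by_cases hk : ∃ j, tgt j = k
  · obtain ⟨j, rfl⟩ := hk
    rw [h3 j (hm j), h1]
  · rw [h4 k fun j _ h => hk ⟨j, h⟩, h2 k fun j h => hk ⟨j, h⟩]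

end

/-- All pairs of elements of `Fin a` and `Fin b`. -/
def pairs (a b : ℕ) : List (Fin a × Fin b) := (List.finRange a).product (List.finRange b)

theorem nodup_pairs (a b : ℕ) : (pairs a b).Nodup :=
  (List.nodup_finRange a).product (List.nodup_finRange b)

theorem mem_pairs {a b : ℕ} (x : Fin a × Fin b) : x ∈ pairs a b :=
  List.mem_product.2 ⟨List.mem_finRange _, List.mem_finRange _⟩

/-- All pairs of a bit and an element of `Fin a`. -/
def boolPairs (a : ℕ) : List (Bool × Fin a) := [false, true].product (List.finRange a)

theorem nodup_boolPairs (a : ℕ) : (boolPairs a).Nodup :=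
  List.Nodup.product (by simp) (List.nodup_finRange a)

theorem mem_boolPairs {a : ℕ} (x : Bool × Fin a) : x ∈ boolPairs a :=
  List.mem_product.2 ⟨by simp, List.mem_finRange _⟩

/-- The wires of the first stage of the adversary: the verification key, the strings `r`, the
qubits `A` and the registers `B` of the public keys, and the ancillas. -/
abbrev FstWire (v m u l a : ℕ) : Type :=
  Fin v ⊕ (Fin m × Fin u) ⊕ Fin m ⊕ (Fin m × Fin l) ⊕ Fin a

/-- The further wires of the forger that are not measured before the second stage: the ciphertext,
the ancillas of the second stage, and a copy of the public key. -/
abbrev SndWire (k b : ℕ) : Type := Fin (k + 1) ⊕ Fin b ⊕ Fin k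

/-- The wires that control the queries. -/
abbrev CtlWire (m u l κ : ℕ) : Type :=
  (Bool × Fin κ) ⊕ (Fin m × Fin u) ⊕ (Fin (κ + 1) × Fin m) ⊕ (Bool × Fin m) ⊕
    ((Bool × Fin m) × Fin l) ⊕ Bool

/-- The wires of the forger. -/
abbrev FWire (v m u l a k b κ : ℕ) : Type :=
  (FstWire v m u l a ⊕ SndWire k b) ⊕ CtlWire m u l κ

section
variable {v m u l a k b κ : ℕ}

instance : DecidableEq (FstWire v m u l a) := inferInstance
instance : DecidableEq (SndWire k b) := inferInstance
set_option synthInstance.maxSize 1000 in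
instance : DecidableEq (CtlWire m u l κ) := inferInstance
instance : DecidableEq (FWire v m u l a k b κ) := inferInstance

/-- The wires of the strings `r` of the keys. -/
abbrev wKey (x : Fin m × Fin u) : FWire v m u l a k b κ := .inl (.inl (.inr (.inl x)))
/-- The qubits `A` of the keys. -/
abbrev wA (x : Fin m) : FWire v m u l a k b κ := .inl (.inl (.inr (.inr (.inl x))))
/-- The registers `B` of the keys. -/
abbrev wB (x : Fin m × Fin l) : FWire v m u l a k b κ :=
  .inl (.inl (.inr (.inr (.inr (.inl x)))))
/-- The random bits for the selection of a key, and their negations. -/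
abbrev wCoin (x : Bool × Fin κ) : FWire v m u l a k b κ := .inr (.inl x)
/-- Copies of the strings `r`. -/
abbrev wR (x : Fin m × Fin u) : FWire v m u l a k b κ := .inr (.inr (.inl x))
/-- The wire `(t, i)` says whether the first `t` random bits are those of the number `i`. -/
abbrev wH (x : Fin (κ + 1) × Fin m) : FWire v m u l a k b κ := .inr (.inr (.inr (.inl x)))
/-- The wire `(α, i)` says whether the signature of `α‖rᵢ` is queried. -/
abbrev wC (x : Bool × Fin m) : FWire v m u l a k b κ := .inr (.inr (.inr (.inr (.inl x))))
/-- The signatures. -/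
abbrev wSg (x : (Bool × Fin m) × Fin l) : FWire v m u l a k b κ :=
  .inr (.inr (.inr (.inr (.inr (.inl x)))))
/-- The constants 0 and 1. -/
abbrev wK (x : Bool) : FWire v m u l a k b κ := .inr (.inr (.inr (.inr (.inr (.inr x)))))

/-- A basis state of the wires of the forger. -/
def fState (vk : Bits v) (R : Fin m × Fin u → Bool) (F : Fin m → Bool) (B : Fin m × Fin l → Bool)
    (J : Bool × Fin κ → Bool) (r : Fin m × Fin u → Bool) (h : Fin (κ + 1) × Fin m → Bool)
    (c : Bool × Fin m → Bool) (sg : (Bool × Fin m) × Fin l → Bool) (o : Bool → Bool) :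
    FWire v m u l a k b κ → Bool :=
  Sum.elim (Sum.elim (Sum.elim vk (Sum.elim R (Sum.elim F (Sum.elim B fun _ => false))))
      fun _ => false)
    (Sum.elim J (Sum.elim r (Sum.elim h (Sum.elim c (Sum.elim sg o)))))

/-- Whether the first `t` bits of `j` are those of `i`. -/
def agree (j : Bits κ) (t : ℕ) (i : ℕ) : Bool :=
  decide (∀ s : Fin κ, s.val < t → j s = Nat.testBit i s)

theorem agree_zero (j : Bits κ) (i : ℕ) : agree j 0 i = true := by simp [agree]

theorem agree_succ (j : Bits κ) (t : Fin κ) (i : ℕ) :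
    agree j (t + 1) i = (agree j t i && (j t == Nat.testBit i t)) := by
  rw [Bool.eq_iff_iff]
  simp only [agree, decide_eq_true_eq, Bool.and_eq_true, beq_iff_eq]
  constructor
  · exact fun h => ⟨fun s hs => h s (by omega), h t (by omega)⟩
  · rintro ⟨h1, h2⟩ s hs
    rcases Nat.lt_succ_iff_lt_or_eq.1 hs with h | h
    · exact h1 s h
    · rw [Fin.ext h]; exact h2

/-- The gates of step `t` of the selection of a key. -/
def selectStep (t : Fin κ) : List (QGate (FWire v m u l a k b κ)) :=
  (List.finRange m).map fun i => QGate.ccx (wH (t.castSucc, i)) (wCoin (Nat.testBit i t, t))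
    (wH (t.succ, i)) (by simp) (by simp [Fin.ext_iff]) (by simp)

/-- The gates that prepare the selection of a key and the queries. -/
def prepare : List (QGate (FWire v m u l a k b κ)) :=
  (List.finRange κ).map (fun t => QGate.x (wCoin (false, t))) ++
  ((List.finRange m).map (fun i => QGate.x (wH (0, i))) ++
  ((boolPairs m).map (fun p => QGate.x (wC p)) ++
  ([()].map (fun _ => QGate.x (wK true)) ++
  ((List.finRange κ).map (fun t => QGate.cx (wCoin (true, t)) (wCoin (false, t)) (by simp)) ++
  ((List.finRange κ).flatMap selectStep ++
  ((boolPairs m).map (fun p => QGate.ccx (wH (Fin.last κ, p.2)) (wA p.2) (wC p)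
    (by simp) (by simp) (by simp)) ++
  ((List.finRange m).map (fun i => QGate.cx (wH (Fin.last κ, i)) (wC (true, i)) (by simp)) ++
  (pairs m u).map (fun x => QGate.cx (wR x) (wKey x) (by simp)))))))))

/-- The state before and after the gates `prepare`. -/
def preState (vk : Bits v) (j : Bits κ) (r : Fin m × Fin u → Bool) (f : Fin m → Bool) :
    FWire v m u l a k b κ → Bool :=
  fState vk (fun _ => false) f (fun _ => false) (fun x => x.1 && j x.2) r (fun _ => false)
    (fun _ => false) (fun _ => false) fun _ => false

/-- Whether the signature of `α‖rᵢ` is queried. -/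
def asks (j : Bits κ) (f : Fin m → Bool) (x : Bool × Fin m) : Bool :=
  !(agree j κ x.2 && (f x.2 != x.1))

/-- The wire `(t + 1, i)` is the conjunction of the wire `(t, i)` and the comparison of bit `t`.
Each random bit is stored with its negation, so the comparison with a constant digit is just a
choice of the control wire. -/
theorem clL_selectStep (τ : ℕ) (hτ : τ ≤ κ) (vk : Bits v) (R f B) (j : Bits κ) (r c sg o) :
    clL (((List.finRange κ).take τ).flatMap selectStep)
      (fState vk R f B (fun x => j x.2 == x.1) r (fun x => decide (x.1 = 0)) c sg o :
        FWire v m u l a k b κ → Bool) =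
      fState vk R f B (fun x => j x.2 == x.1) r
        (fun x => decide (x.1.val ≤ τ) && agree j x.1 x.2) c sg o := by
  induction τ with
  | zero =>
    simp only [List.take_zero, List.flatMap_nil, clL_nil]
    congr 1
    funext ⟨x, i⟩
    refine Fin.cases ?_ (fun x => ?_) x
    · simp [agree_zero]
    · simp
  | succ τ ih =>
    have hlt : τ < (List.finRange κ).length := by simpa using hτ
    rw [List.take_succ_eq_append_getElem hlt, List.flatMap_append, clL_append, ih (by omega)]
    simp only [List.getElem_finRange, List.flatMap_cons, List.flatMap_nil, List.append_nil,
      selectStep]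
    refine clL_layer (tgt := fun i => wH (Fin.succ ⟨τ, hτ⟩, i)) (F := fun i y =>
      y (wH (Fin.castSucc ⟨τ, hτ⟩, i)) && y (wCoin (Nat.testBit i τ, ⟨τ, hτ⟩)))
      (List.nodup_finRange _) List.mem_finRange (fun i y => rfl) (fun i y i' c => ?_)
      (fun i i' h => by simpa using h) (fun i => ?_) ?_
    · rw [flipAt_of_ne (by simp [Fin.ext_iff]), flipAt_of_ne (by simp)]
    · have := agree_succ j ⟨τ, hτ⟩ i
      simp only at this
      simp [fState, this]
    · rintro (w | w | w | ⟨t, i⟩ | w) hw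
      · rfl
      · rfl
      · rfl
      · have ht : t.val ≠ τ + 1 := fun h => hw i (by
          congr; exact Fin.ext h.symm)
        have : t.val ≤ τ + 1 ↔ t.val ≤ τ := by omega
        simp [fState, this]
      · rfl

/-- All query flags start at 1. For a selected key both are flipped if `f i` is 1, and then the one
for `α = 1` is flipped back to select the signature of `f i‖rᵢ` alone; keys that are not selected
keep both flags. The copy of `r` in the wires of the keys is made because the original will be
measured and must not be changed by the adversary. -/
theorem clL_prepare (vk : Bits v) (j : Bits κ) (r : Fin m × Fin u → Bool) (f : Fin m → Bool) :
    clL prepare (preState vk j r f : FWire v m u l a k b κ → Bool) =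
      fState vk r f (fun _ => false) (fun x => j x.2 == x.1) r (fun x => agree j x.1 x.2)
        (asks j f) (fun _ => false) id := by
  rw [prepare, clL_append, preState]
  rw [clL_layer (tgt := fun t => wCoin (false, t)) (F := fun _ _ => true)
    (y' := fState vk (fun _ => false) f (fun _ => false) (fun x => !x.1 || j x.2) r (fun _ => false)
      (fun _ => false) (fun _ => false) fun _ => false)
    (List.nodup_finRange _) List.mem_finRange (fun i y => rfl) (fun i y i' c => rfl)
    (fun i i' h => by simpa using h) (fun i => by simp [fState])]
  swap
  · rintro (w | ⟨_ | _, t⟩ | w) hw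
    · rfl
    · exact absurd rfl (hw t)
    · rfl
    · rfl
  rw [clL_append, clL_layer (tgt := fun t => wH (0, t)) (F := fun _ _ => true)
    (y' := fState vk (fun _ => false) f (fun _ => false) (fun x => !x.1 || j x.2) r
      (fun x => decide (x.1 = 0)) (fun _ => false) (fun _ => false) fun _ => false)
    (List.nodup_finRange _) List.mem_finRange (fun i y => rfl) (fun i y i' c => rfl)
    (fun i i' h => by simpa using h) (fun i => by simp [fState])]
  swap
  · rintro (w | w | w | ⟨t, i⟩ | w) hw
    · rfl
    · rfl
    · rfl
    · have : t ≠ 0 := fun h => hw i (by rw [h])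
      simp [fState, this]
    · rfl
  rw [clL_append, clL_layer (tgt := fun t => wC t) (F := fun _ _ => true)
    (y' := fState vk (fun _ => false) f (fun _ => false) (fun x => !x.1 || j x.2) r
      (fun x => decide (x.1 = 0)) (fun _ => true) (fun _ => false) fun _ => false)
    (nodup_boolPairs _) mem_boolPairs (fun i y => rfl) (fun i y i' c => rfl)
    (fun i i' h => by simpa using h) (fun i => by simp [fState])]
  swap
  · rintro (w | w | w | w | w | w) hw <;> first | rfl | exact absurd rfl (hw w)
  rw [clL_append, clL_layer (J := Unit) (L := [()]) (g := fun _ => QGate.x (wK true))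
    (tgt := fun t => wK true) (F := fun _ _ => true)
    (y' := fState vk (fun _ => false) f (fun _ => false) (fun x => !x.1 || j x.2) r
      (fun x => decide (x.1 = 0)) (fun _ => true) (fun _ => false) id)
    (by simp) (by simp) (fun i y => rfl) (fun i y i' c => rfl)
    (fun i i' h => rfl) (fun i => by simp [fState])]
  swap
  · rintro (w | w | w | w | w | w | _ | _) hw <;> first | rfl | exact absurd rfl (hw ())
  rw [clL_append, clL_layer (tgt := fun t => wCoin (false, t)) (F := fun t y => y (wCoin (true, t)))
    (y' := fState vk (fun _ => false) f (fun _ => false) (fun x => j x.2 == x.1) r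
      (fun x => decide (x.1 = 0)) (fun _ => true) (fun _ => false) id)
    (List.nodup_finRange _) List.mem_finRange (fun i y => rfl)
    (fun i y i' c => flipAt_of_ne (by simp) _)
    (fun i i' h => by simpa using h) (fun i => by simp [fState])]
  swap
  · rintro (w | ⟨_ | _, t⟩ | w) hw
    · rfl
    · exact absurd rfl (hw t)
    · simp [fState]
    · rfl
  have hs := clL_selectStep (a := a) (k := k) (b := b) κ le_rfl vk (fun _ : Fin m × Fin u => false) f
    (fun _ : Fin m × Fin l => false) j r (fun _ => true) (fun _ => false) id
  rw [List.take_of_length_le (by simp)] at hs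
  have hd : ∀ x : Fin (κ + 1), decide (x.val ≤ κ) = true := fun x => by simp; omega
  simp only [hd, Bool.true_and] at hs
  rw [clL_append, hs]
  rw [clL_append, clL_layer (tgt := fun t => wC t)
    (F := fun p y => y (wH (Fin.last κ, p.2)) && y (wA p.2))
    (y' := fState vk (fun _ => false) f (fun _ => false) (fun x => j x.2 == x.1) r
      (fun x => agree j x.1 x.2) (fun x => !(agree j κ x.2 && f x.2)) (fun _ => false) id)
    (nodup_boolPairs _) mem_boolPairs (fun i y => rfl)
    (fun i y i' c => by rw [flipAt_of_ne (by simp), flipAt_of_ne (by simp)])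
    (fun i i' h => by simpa using h) (fun i => by simp [fState])]
  swap
  · rintro (w | w | w | w | w | w) hw <;> first | rfl | exact absurd rfl (hw w)
  rw [clL_append, clL_layer (tgt := fun t => wC (true, t))
    (F := fun i y => y (wH (Fin.last κ, i)))
    (y' := fState vk (fun _ => false) f (fun _ => false) (fun x => j x.2 == x.1) r
      (fun x => agree j x.1 x.2) (asks j f) (fun _ => false) id)
    (List.nodup_finRange _) List.mem_finRange (fun i y => rfl)
    (fun i y i' c => flipAt_of_ne (by simp) _)
    (fun i i' h => by simpa using h) (fun i => ?_)]
  · refine clL_layer (tgt := fun t => wKey t) (F := fun x y => y (wR x)) (nodup_pairs _ _) mem_pairs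
      (fun i y => rfl) (fun i y i' c => flipAt_of_ne (by simp) _) (fun i i' h => by simpa using h)
      (fun i => by simp [fState]) ?_
    rintro (((w | w | w) | w) | w) hw <;> first | rfl | exact absurd rfl (hw w)
  · rintro (w | w | w | w | ⟨_ | _, i⟩ | w) hw
    · rfl
    · rfl
    · rfl
    · rfl
    · simp [fState, asks]
    · exact absurd rfl (hw i)
    · rfl
  -- The two flips together leave the flag of `α = 1` equal to `f i` for a selected key.
  · simp only [fState, asks, Sum.elim_inr, Sum.elim_inl, Fin.val_last]
    cases agree j κ i <;> cases f i <;> rfl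

end

/-! ## The forger: the queries and the public keys -/

section
variable {ι : Type} [DecidableEq ι] {s t : ℕ}

theorem actO_gates (O : Bits s → Bits t) (gs : List (QGate ι)) (ψ : St ι) :
    actO O (gs.map QOp.gate) ψ = actL gs ψ := by
  induction gs generalizing ψ with
  | nil => rfl
  | cons g gs ih => exact ih _

theorem queried_gates (O : Bits s → Bits t) (gs : List (QGate ι)) (x : ι → Bool) :
    queried O (gs.map QOp.gate) x = ∅ := by
  induction gs with
  | nil => rfl
  | cons g gs ih => exact ih

end

theorem sum_bits_curry {m u : ℕ} {M : Type} [AddCommMonoid M] (F : (Fin m → Bits u) → M) :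
    ∑ x : Bits (m * u), F (fun i j => x (finProdFinEquiv (i, j))) = ∑ r, F r :=
  Equiv.sum_comp ((finProdFinEquiv.symm.arrowCongr (Equiv.refl Bool)).trans
    (Equiv.curry (Fin m) (Fin u) Bool)) F

theorem sum_bket_comp {ι X Y Z : Type} [Fintype ι] [DecidableEq ι] [Fintype X] [Fintype Y]
    [Fintype Z] (c : ℂ) (A : (ι → Bool) → ι → Bool) {S S' : X → Y → Z → ι → Bool}
    (h : ∀ i j k x, A x = S i j k ↔ x = S' i j k) :
    (fun x => (c • ∑ i, ∑ j, ∑ k, bket (S i j k)) (A x)) =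
      c • ∑ i, ∑ j, ∑ k, bket (S' i j k) := by
  funext x
  simp only [Pi.smul_apply, Finset.sum_apply, bket_apply, h]

section
variable {v m u l a k b κ : ℕ} (O : Bits (u + 1) → Bits l)

/-- The wires of the coins of the forger, of the strings `r`, and of the qubits `A`. -/
def superposed : Fin (κ + (m * u + m)) ↪ FWire v m u l a k b κ :=
  ⟨Fin.append (fun t => wCoin (true, t)) (Fin.append (fun t => wR (finProdFinEquiv.symm t)) wA), by
    refine Fin.append_injective_iff.2 ⟨fun i j h => by simpa using h,
      Fin.append_injective_iff.2 ⟨fun i j h => ?_, fun i j h => by simpa using h,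
        fun i j => by simp⟩, fun i j => ?_⟩
    · exact finProdFinEquiv.symm.injective (Sum.inl.inj (Sum.inr.inj (Sum.inr.inj h)))
    · induction j using Fin.addCases <;> simp⟩

theorem extend_superposed (vk : Bits v) (x : Bits κ) (y : Bits (m * u)) (f : Bits m) :
    Function.extend (superposed : _ → FWire v m u l a k b κ) (Fin.append x (Fin.append y f))
      (fState vk (fun _ => false) (fun _ => false) (fun _ => false) (fun _ => false)
        (fun _ => false) (fun _ => false) (fun _ => false) (fun _ => false) fun _ => false) =
      preState vk x (fun p => y (finProdFinEquiv p)) f := by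
  symm
  refine extend_eq_of_forall superposed.injective (fun i => ?_) ?_
  · induction i using Fin.addCases with
    | left i => simp [superposed, preState, fState]
    | right i =>
      induction i using Fin.addCases <;>
        simp [superposed, preState, fState, -finProdFinEquiv_symm_apply]
  · rintro (((w | w | w | w) | w) | ⟨_ | _, t⟩ | w | w) hw
    · rfl
    · rfl
    · exact absurd (by simp [superposed]) (hw (Fin.natAdd _ (Fin.natAdd _ w)))
    · rfl
    · rfl
    · rfl
    · exact absurd (by simp [superposed]) (hw (Fin.castAdd _ t))
    · exact absurd (by simp [superposed, -finProdFinEquiv_symm_apply])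
        (hw (Fin.natAdd _ (Fin.castAdd _ (finProdFinEquiv w))))
    · rfl

/-- Coins, strings and qubits `A` are all put into uniform superposition. The random choices become
random only when their wires are measured by the queries or at the end. -/
theorem actL_superposed (vk : Bits v) :
    actL (hLayer (superposed : _ ↪ FWire v m u l a k b κ))
      (bket (fState vk (fun _ => false) (fun _ => false) (fun _ => false) (fun _ => false)
        (fun _ => false) (fun _ => false) (fun _ => false) (fun _ => false) fun _ => false)) =
      rt ^ (κ + (m * u + m)) • ∑ j, ∑ r : Fin m → Bits u, ∑ f,
        bket (preState vk j (fun x => r x.1 x.2) f) := by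
  rw [actL_hLayer_bket_zero, sum_bits_append]
  · congr 1
    refine Finset.sum_congr rfl fun j _ => ?_
    rw [sum_bits_append, ← sum_bits_curry]
    refine Finset.sum_congr rfl fun r _ => Finset.sum_congr rfl fun f _ => ?_
    rw [extend_superposed]
  · intro i
    induction i using Fin.addCases with
    | left i => simp [superposed, fState]
    | right i => induction i using Fin.addCases <;> simp [superposed, fState]

/-- The query of the signature of `α‖rᵢ`. -/
def keyQuery (p : Bool × Fin m) : QOp (FWire v m u l a k b κ) (u + 1) l :=
  .query (wC p) (Fin.cons (wK p.1) fun j => wR (p.2, j)) fun j => wSg (p, j)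

/-- The answers to the queries `L` are added. -/
def askL (L : List (Bool × Fin m)) (x : FWire v m u l a k b κ → Bool) :
    FWire v m u l a k b κ → Bool
  | .inr (.inr (.inr (.inr (.inr (.inl (p, j)))))) => Bool.xor (x (wSg (p, j)))
      (decide (p ∈ L) && (x (wC p) && O (Fin.cons (x (wK p.1)) fun j => x (wR (p.2, j))) j))
  | w => x w

theorem ask_askL {p : Bool × Fin m} {L : List (Bool × Fin m)} (hp : p ∉ L)
    (x : FWire v m u l a k b κ → Bool) :
    ask O (wC p) (Fin.cons (wK p.1) fun j => wR (p.2, j)) (fun j => wSg (p, j)) (askL O L x) =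
      askL O (p :: L) x := by
  have hinj : Function.Injective fun j : Fin l => (wSg (p, j) : FWire v m u l a k b κ) :=
    fun i j h => by simpa using h
  have hq : askL O L x ∘ (Fin.cons (wK p.1) fun j => wR (p.2, j) :
      Fin (u + 1) → FWire v m u l a k b κ) = Fin.cons (x (wK p.1)) fun j => x (wR (p.2, j)) := by
    funext i
    refine Fin.cases ?_ (fun i => ?_) i <;> rfl
  have hc : askL O L x (wC p) = x (wC p) := rfl
  rw [ask, hq, hc]
  by_cases hx : x (wC p) = true
  · rw [if_pos hx]
    funext w
    by_cases hw : ∃ j, wSg (p, j) = w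
    · obtain ⟨j, rfl⟩ := hw
      rw [xorAt_apply hinj]
      simp [askL, hp, hx]
    · rw [xorAt_of_ne fun j h => hw ⟨j, h⟩]
      rcases w with w | w | w | w | w | ⟨p', j⟩ | w <;> try rfl
      have : p' ≠ p := fun h => hw ⟨j, by rw [h]⟩
      simp [askL, this]
  · rw [if_neg hx]
    funext w
    rcases w with w | w | w | w | w | ⟨p', j⟩ | w <;> try rfl
    by_cases h : p' = p
    · subst h
      simp [askL, hp, hx]
    · simp [askL, h]

/-- Different queries write to different registers and none writes to a control or query wire, so
together they act as one permutation of the basis states. -/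
theorem actO_keyQuery {L : List (Bool × Fin m)} (hL : L.Nodup)
    (ops : List (QOp (FWire v m u l a k b κ) (u + 1) l)) (ψ : St (FWire v m u l a k b κ)) :
    actO O (L.map keyQuery ++ ops) ψ = actO O ops fun x => ψ (askL O L x) := by
  induction L generalizing ψ with
  | nil =>
    have : ∀ x : FWire v m u l a k b κ → Bool, askL O [] x = x := fun x => by
      funext w
      rcases w with w | w | w | w | w | ⟨p', j⟩ | w <;> simp [askL]
    simp only [this]
    rfl
  | cons p L ih =>
    obtain ⟨hp, hL⟩ := List.nodup_cons.1 hL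
    simp only [List.map_cons, List.cons_append, keyQuery, actO]
    refine (ih hL _).trans ?_
    simp only [ask_askL O hp]

theorem mem_queried_keyQuery {L : List (Bool × Fin m)} {gs : List (QGate (FWire v m u l a k b κ))}
    {x : FWire v m u l a k b κ → Bool} {y : Bits (u + 1) × Bits l}
    (hy : y ∈ queried O (L.map keyQuery ++ gs.map QOp.gate) x) :
    ∃ p, x (wC p) = true ∧ y.1 = Fin.cons (x (wK p.1)) (fun j => x (wR (p.2, j))) ∧
      y.2 = O y.1 := by
  induction L with
  | nil => simp [queried_gates] at hy
  | cons p L ih =>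
    simp only [List.map_cons, List.cons_append, keyQuery, queried] at hy
    split_ifs at hy with h
    · rcases Finset.mem_insert.1 hy with rfl | hy
      · refine ⟨p, h, ?_, rfl⟩
        funext i
        refine Fin.cases ?_ (fun i => ?_) i <;> rfl
      · exact ih hy
    · exact ih hy

theorem askL_askL (L : List (Bool × Fin m)) (x : FWire v m u l a k b κ → Bool) :
    askL O L (askL O L x) = x := by
  funext w
  rcases w with w | w | w | w | w | ⟨p', j⟩ | w <;> try rfl
  simp [askL]

theorem askL_eq_iff (L : List (Bool × Fin m)) (x y : FWire v m u l a k b κ → Bool) :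
    askL O L x = y ↔ x = askL O L y :=
  ⟨fun h => by rw [← h, askL_askL], fun h => by rw [h, askL_askL]⟩

/-- The gates that copy the signatures to the public keys. -/
def fillB : List (QGate (FWire v m u l a k b κ)) :=
  (pairs m l).map (fun x => QGate.cx (wSg ((false, x.1), x.2)) (wB x) (by simp)) ++
  ((pairs m l).map (fun x => QGate.ccx (wA x.1) (wSg ((false, x.1), x.2)) (wB x)
    (by simp) (by simp) (by simp)) ++
  (pairs m l).map (fun x => QGate.ccx (wA x.1) (wSg ((true, x.1), x.2)) (wB x)
    (by simp) (by simp) (by simp)))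

/-- The state of the forger when the public keys are ready. -/
def keyState (vk : Bits v) (j : Bits κ) (r : Fin m → Bits u) (f : Fin m → Bool) :
    FWire v m u l a k b κ → Bool :=
  fState vk (fun x => r x.1 x.2) f (fun x => O (Fin.cons (f x.1) (r x.1)) x.2)
    (fun x => j x.2 == x.1) (fun x => r x.1 x.2) (fun x => agree j x.1 x.2) (asks j f)
    (fun x => asks j f x.1 && O (Fin.cons x.1.1 (r x.1.2)) x.2) id

/-- Selecting one of two signatures by the qubit `A` takes three layers: add the first, remove it
again if `A = 1`, and add the second if `A = 1`. -/
theorem clL_fillB (vk : Bits v) (R F J r h c sg o) :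
    clL fillB (fState vk R F (fun _ => false) J r h c sg o : FWire v m u l a k b κ → Bool) =
      fState vk R F (fun x => bif F x.1 then sg ((true, x.1), x.2) else sg ((false, x.1), x.2))
        J r h c sg o := by
  rw [fillB, clL_append, clL_layer (tgt := wB) (F := fun x y => y (wSg ((false, x.1), x.2)))
    (y' := fState vk R F (fun x => sg ((false, x.1), x.2)) J r h c sg o)
    (nodup_pairs _ _) mem_pairs (fun i y => rfl) (fun i y i' c => flipAt_of_ne (by simp) _)
    (fun i i' h => by simpa using h) (fun i => by simp [fState])]
  swap
  · rintro (((w | w | w | w | w) | w) | w) hw <;> first | rfl | exact absurd rfl (hw w)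
  rw [clL_append]
  refine (congrArg (clL _) (clL_layer (tgt := wB)
    (F := fun x y => y (wA x.1) && y (wSg ((false, x.1), x.2)))
    (y' := fState vk R F (fun x => !F x.1 && sg ((false, x.1), x.2)) J r h c sg o)
    (nodup_pairs _ _) mem_pairs (fun i y => rfl)
    (fun i y i' c => by rw [flipAt_of_ne (by simp), flipAt_of_ne (by simp)])
    (fun i i' h => by simpa using h) (fun i => ?_) ?_)).trans ?_
  rotate_left 2
  · refine clL_layer (tgt := wB) (F := fun x y => y (wA x.1) && y (wSg ((true, x.1), x.2)))
      (nodup_pairs _ _) mem_pairs (fun i y => rfl)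
      (fun i y i' c => by rw [flipAt_of_ne (by simp), flipAt_of_ne (by simp)])
      (fun i i' h => by simpa using h) (fun i => ?_) ?_
    · simp only [fState, Sum.elim_inl, Sum.elim_inr]
      cases F i.1 <;> simp
    · rintro (((w | w | w | w | w) | w) | w) hw <;> first | rfl | exact absurd rfl (hw w)
  · simp only [fState, Sum.elim_inl, Sum.elim_inr]
    cases F i.1 <;> simp
  · rintro (((w | w | w | w | w) | w) | w) hw <;> first | rfl | exact absurd rfl (hw w)

theorem isCl_prepare : ∀ g ∈ (prepare : List (QGate (FWire v m u l a k b κ))), g.IsCl := by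
  intro g hg
  simp only [prepare, selectStep, List.mem_append, List.mem_map, List.mem_flatMap] at hg
  rcases hg with ⟨_, _, rfl⟩ | ⟨_, _, rfl⟩ | ⟨_, _, rfl⟩ | ⟨_, _, rfl⟩ | ⟨_, _, rfl⟩ |
    ⟨_, _, _, _, rfl⟩ | ⟨_, _, rfl⟩ | ⟨_, _, rfl⟩ | ⟨_, _, rfl⟩ <;> trivial

theorem isCl_fillB : ∀ g ∈ (fillB : List (QGate (FWire v m u l a k b κ))), g.IsCl := by
  intro g hg
  simp only [fillB, List.mem_append, List.mem_map] at hg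
  rcases hg with ⟨_, _, rfl⟩ | ⟨_, _, rfl⟩ | ⟨_, _, rfl⟩ <;> trivial

/-- The state before the queries. -/
def preparedState (vk : Bits v) (j : Bits κ) (r : Fin m → Bits u) (f : Fin m → Bool) :
    FWire v m u l a k b κ → Bool :=
  fState vk (fun x => r x.1 x.2) f (fun _ => false) (fun x => j x.2 == x.1)
    (fun x => r x.1 x.2) (fun x => agree j x.1 x.2) (asks j f) (fun _ => false) id

/-- The state after the queries. -/
def askedState (vk : Bits v) (j : Bits κ) (r : Fin m → Bits u) (f : Fin m → Bool) :
    FWire v m u l a k b κ → Bool :=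
  fState vk (fun x => r x.1 x.2) f (fun _ => false) (fun x => j x.2 == x.1)
    (fun x => r x.1 x.2) (fun x => agree j x.1 x.2) (asks j f)
    (fun x => asks j f x.1 && O (Fin.cons x.1.1 (r x.1.2)) x.2) id

theorem askL_preparedState (vk : Bits v) (j : Bits κ) (r : Fin m → Bits u) (f : Fin m → Bool) :
    askL O (boolPairs m) (preparedState vk j r f : FWire v m u l a k b κ → Bool) =
      askedState O vk j r f := by
  funext w
  rcases w with w | w | w | w | w | ⟨p', j⟩ | w <;> try rfl
  simp [askL, preparedState, askedState, fState, mem_boolPairs]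

/-- For a selected key one signature register may be empty, but it is the one for the value that `A`
does not have, so the key is complete nevertheless. -/
theorem clL_fillB_askedState (vk : Bits v) (j : Bits κ) (r : Fin m → Bits u) (f : Fin m → Bool) :
    clL fillB (askedState O vk j r f : FWire v m u l a k b κ → Bool) = keyState O vk j r f := by
  rw [askedState, clL_fillB, keyState]
  congr 1
  funext ⟨i, t⟩
  cases h : f i <;> simp [asks, h]

/-- The state of the forger at the beginning. -/
def startState (vk : Bits v) : FWire v m u l a k b κ → Bool :=
  fState vk (fun _ => false) (fun _ => false) (fun _ => false) (fun _ => false)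
    (fun _ => false) (fun _ => false) (fun _ => false) (fun _ => false) fun _ => false

theorem actL_prepare (vk : Bits v) :
    actL (hLayer superposed ++ prepare) (bket (startState vk : FWire v m u l a k b κ → Bool)) =
      rt ^ (κ + (m * u + m)) • ∑ j, ∑ r : Fin m → Bits u, ∑ f, bket (preparedState vk j r f) := by
  rw [actL_append, startState, actL_superposed]
  simp only [map_smul, map_sum, actL_bket isCl_prepare, clL_prepare]
  rfl

theorem actL_fillB_askedState (c : ℂ) (vk : Bits v) :
    actL fillB (c • ∑ j, ∑ r : Fin m → Bits u, ∑ f,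
      bket (askedState O vk j r f : FWire v m u l a k b κ → Bool)) =
      c • ∑ j, ∑ r : Fin m → Bits u, ∑ f, bket (keyState O vk j r f) := by
  simp only [map_smul, map_sum, actL_bket isCl_fillB, clL_fillB_askedState]

/-- The state before the adversary is run. -/
theorem actO_keys (vk : Bits v) (gs : List (QGate (FWire v m u l a k b κ))) :
    actO O ((boolPairs m).map keyQuery ++ (fillB ++ gs).map QOp.gate)
      (actL (hLayer superposed ++ prepare) (bket (startState vk))) =
      actL gs (rt ^ (κ + (m * u + m)) • ∑ j, ∑ r : Fin m → Bits u, ∑ f,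
        bket (keyState O vk j r f)) := by
  rw [actO_keyQuery O (nodup_boolPairs m), actO_gates, actL_append, actL_prepare,
    ← actL_fillB_askedState]
  have h := sum_bket_comp (rt ^ (κ + (m * u + m))) (askL O (boolPairs m))
    (S := preparedState vk) (S' := askedState O vk)
    fun j (r : Fin m → Bits u) f (x : FWire v m u l a k b κ → Bool) => by
      rw [askL_eq_iff, askL_preparedState]
  exact congrArg (fun φ => actL gs (actL fillB φ)) h

end

/-! ## The forger -/

section
variable {v m u l a k b κ : ℕ}

/-- The numbers of the wires of the first stage. -/
def fstEquiv : FstWire v m u l a ≃ Fin (v + m * (u + (l + 1)) + a) where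
  toFun
    | .inl i => Fin.castAdd a (Fin.castAdd _ i)
    | .inr (.inl (i, j)) => Fin.castAdd a (Fin.natAdd v (finProdFinEquiv (i, Fin.castAdd (l + 1) j)))
    | .inr (.inr (.inl i)) => Fin.castAdd a (Fin.natAdd v (finProdFinEquiv (i, Fin.natAdd u 0)))
    | .inr (.inr (.inr (.inl (i, j)))) =>
        Fin.castAdd a (Fin.natAdd v (finProdFinEquiv (i, Fin.natAdd u j.succ)))
    | .inr (.inr (.inr (.inr i))) => Fin.natAdd _ i
  invFun := Fin.addCases (Fin.addCases .inl fun t =>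
      Fin.addCases (fun j => .inr (.inl ((finProdFinEquiv.symm t).1, j)))
        (Fin.cases (.inr (.inr (.inl (finProdFinEquiv.symm t).1)))
          fun j => .inr (.inr (.inr (.inl ((finProdFinEquiv.symm t).1, j)))))
        (finProdFinEquiv.symm t).2)
    fun i => .inr (.inr (.inr (.inr i)))
  left_inv := by
    rintro (i | ⟨i, j⟩ | i | ⟨i, j⟩ | i) <;>
      simp only [Fin.addCases_left, Fin.addCases_right, Equiv.symm_apply_apply, Fin.cases_zero,
        Fin.cases_succ]
  right_inv := by
    intro t
    induction t using Fin.addCases with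
    | left t =>
      induction t using Fin.addCases with
      | left t => simp only [Fin.addCases_left]
      | right t =>
        obtain ⟨⟨i, j⟩, rfl⟩ := finProdFinEquiv.surjective t
        simp only [Fin.addCases_left, Fin.addCases_right, Equiv.symm_apply_apply]
        induction j using Fin.addCases with
        | left j => simp only [Fin.addCases_left]
        | right j =>
          simp only [Fin.addCases_right]
          refine Fin.cases ?_ (fun j => ?_) j <;> simp only [Fin.cases_zero, Fin.cases_succ]
    | right t => simp only [Fin.addCases_right]

/-- The numbers of pairs with a bit. -/
def boolProdEquiv (n : ℕ) : Bool × Fin n ≃ Fin (2 * n) :=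
  (Equiv.prodCongr finTwoEquiv.symm (Equiv.refl _)).trans finProdFinEquiv

/-- The numbers of the further wires before the second stage. -/
def sndEquiv : SndWire k b ≃ Fin (k + 1 + (b + k)) :=
  (Equiv.sumCongr (Equiv.refl _) finSumFinEquiv).trans finSumFinEquiv

/-- The number of wires that control the queries. -/
abbrev ctlCard (m u l κ : ℕ) : ℕ := 2 * κ + (m * u + ((κ + 1) * m + (2 * m + (2 * m * l + 2))))

/-- The numbers of the wires that control the queries. -/
def ctlEquiv : CtlWire m u l κ ≃ Fin (ctlCard m u l κ) :=
  (Equiv.sumCongr (boolProdEquiv κ) ((Equiv.sumCongr finProdFinEquiv ((Equiv.sumCongr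
    finProdFinEquiv ((Equiv.sumCongr (boolProdEquiv m) ((Equiv.sumCongr
      ((Equiv.prodCongr (boolProdEquiv m) (Equiv.refl _)).trans finProdFinEquiv)
      finTwoEquiv.symm).trans finSumFinEquiv)).trans finSumFinEquiv)).trans
        finSumFinEquiv)).trans finSumFinEquiv)).trans finSumFinEquiv

/-- The number of ancillas of the forger. -/
abbrev forgerAnc (m u l a k b κ : ℕ) : ℕ :=
  m * (u + (l + 1)) + a + (k + 1 + (b + k)) + ctlCard m u l κ

/-- The numbers of the wires of the forger. -/
def wireEquiv : FWire v m u l a k b κ ≃ Fin (v + forgerAnc m u l a k b κ) :=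
  ((Equiv.sumCongr ((Equiv.sumCongr fstEquiv sndEquiv).trans finSumFinEquiv) ctlEquiv).trans
    finSumFinEquiv).trans (finCongr (by simp only [forgerAnc]; omega))

theorem startState_eq (vk : Bits v) :
    (Fin.append vk fun _ => false) ∘ wireEquiv = (startState vk : FWire v m u l a k b κ → Bool) := by
  have h1 : ∀ t : Fin (v + forgerAnc m u l a k b κ), v ≤ t.val →
      Fin.append vk (fun _ => false) t = false := by
    intro t ht
    induction t using Fin.addCases with
    | left i => simp at ht; omega
    | right i => simp
  have h2 : ∀ w : FWire v m u l a k b κ, v ≤ (wireEquiv w).val →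
      (∀ i, w ≠ .inl (.inl (.inl i))) → ((Fin.append vk fun _ => false) ∘ wireEquiv) w =
        startState vk w := by
    intro w hw hn
    refine (h1 _ hw).trans ?_
    rcases w with ((w | w | w | w | w) | w) | w | w | w | w | w | w <;>
      first | rfl | exact absurd rfl (hn w)
  funext w
  have e : ∀ i : Fin v, wireEquiv (.inl (.inl (.inl i)) : FWire v m u l a k b κ) =
      Fin.castAdd _ i := fun i => rfl
  have e2 : ∀ x : FstWire v m u l a, (wireEquiv (.inl (.inl x) : FWire v m u l a k b κ)).val =
    (fstEquiv x).val := fun x => rfl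
  have e3 : ∀ x : SndWire k b, (wireEquiv (.inl (.inr x) : FWire v m u l a k b κ)).val =
    v + m * (u + (l + 1)) + a + (sndEquiv x).val := fun x => rfl
  have e4 : ∀ x : CtlWire m u l κ, (wireEquiv (.inr x : FWire v m u l a k b κ)).val =
    v + m * (u + (l + 1)) + a + (k + 1 + (b + k)) + (ctlEquiv x).val := fun x => rfl
  rcases w with ((w | w | w | w | w) | w) | w
  · simp [e, startState, fState]
  · exact h2 _ (by rw [e2]; simp [fstEquiv]) (by simp)
  · exact h2 _ (by rw [e2]; simp [fstEquiv]) (by simp)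
  · exact h2 _ (by rw [e2]; simp [fstEquiv]) (by simp)
  · exact h2 _ (by rw [e2]; simp [fstEquiv]; omega) (by simp)
  · exact h2 _ (by rw [e3]; omega) (by simp)
  · exact h2 _ (by rw [e4]; omega) (by simp)

/-- The wires that are not measured before the second stage, as wires of the forger. -/
def unmeasured : Fin (v + m * (u + (l + 1)) + a) ⊕ SndWire k b ↪ FWire v m u l a k b κ :=
  ⟨fun w => .inl (Sum.map fstEquiv.symm id w), fun _ _ h =>
    (Sum.map_injective.2 ⟨fstEquiv.symm.injective, Function.injective_id⟩) (Sum.inl.inj h)⟩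

@[simp] theorem unmeasured_inl (t : Fin (v + m * (u + (l + 1)) + a)) :
    (unmeasured (.inl t) : FWire v m u l a k b κ) = .inl (.inl (fstEquiv.symm t)) := rfl

@[simp] theorem unmeasured_inr (t : SndWire k b) :
    (unmeasured (.inr t) : FWire v m u l a k b κ) = .inl (.inr t) := rfl

/-- The state of the wires that are not measured, when the public keys are ready. -/
def unmeasuredState (sign : Bits (u + 1) → Bits l) (vk : Bits v) (r : Fin m → Bits u)
    (f : Fin m → Bool) : Fin (v + m * (u + (l + 1)) + a) ⊕ SndWire k b → Bool :=
  Sum.elim (Fin.append (Fin.append vk (keysString sign r f)) fun _ => false) fun _ => false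

theorem keyState_comp (sign : Bits (u + 1) → Bits l) (vk : Bits v) (j : Bits κ)
    (r : Fin m → Bits u) (f : Fin m → Bool) :
    (keyState sign vk j r f : FWire v m u l a k b κ → Bool) ∘ unmeasured =
      unmeasuredState sign vk r f := by
  have h : ∀ x : FstWire v m u l a, keyState (k := k) (b := b) sign vk j r f (.inl (.inl x)) =
      Fin.append (Fin.append vk (keysString sign r f)) (fun _ => false) (fstEquiv x) := by
    rintro (i | ⟨i, j⟩ | i | ⟨i, j⟩ | i)
    · simp [keyState, fState, fstEquiv]
    all_goals
      simp only [keyState, fState, fstEquiv, Equiv.coe_fn_mk, Fin.append_left, Fin.append_right,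
        Sum.elim_inl, Sum.elim_inr, keysString, Equiv.symm_apply_apply, keyString, Fin.tail_cons,
        Fin.cons_zero, Fin.cons_succ]
  funext w
  rcases w with w | w
  · obtain ⟨x, rfl⟩ := fstEquiv.surjective w
    refine Eq.trans ?_ (h x)
    simp
  · rfl

/-- The query flags reveal `f` exactly at the selected keys. This is why measuring them leaves the
other qubits `A` in superposition. -/
theorem asks_eq_iff {j : Bits κ} {f f' : Fin m → Bool} :
    asks j f' = asks j f ↔ ∀ i : Fin m, agree j κ i = true → f' i = f i := by
  constructor
  · intro h i hi
    have := congrFun h (false, i)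
    simpa [asks, hi] using this
  · intro h
    funext ⟨α, i⟩
    simp only [asks]
    rcases hi : agree j κ i with _ | _
    · simp
    · rw [h i hi]

/-- The state of the wires that control the queries. -/
def ctlState (sign : Bits (u + 1) → Bits l) (j : Bits κ) (r : Fin m → Bits u) (f : Fin m → Bool) :
    CtlWire m u l κ → Bool :=
  Sum.elim (fun x => j x.2 == x.1) (Sum.elim (fun x => r x.1 x.2)
    (Sum.elim (fun x => agree j x.1 x.2) (Sum.elim (asks j f)
      (Sum.elim (fun x => asks j f x.1 && sign (Fin.cons x.1.1 (r x.1.2)) x.2) id))))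

/-- The registers of the signatures need no separate treatment: they are a function of the flags and
of `r`, so they reveal nothing further about `f`. -/
theorem ctlState_eq_iff {sign : Bits (u + 1) → Bits l} {j j' : Bits κ} {r r' : Fin m → Bits u}
    {f f' : Fin m → Bool} : ctlState sign j' r' f' = ctlState sign j r f ↔
      j' = j ∧ r' = r ∧ ∀ i : Fin m, agree j κ i = true → f' i = f i := by
  constructor
  · intro h
    have hj : j' = j := by
      funext t
      simpa [ctlState] using congrFun h (.inl (true, t))
    have hr : r' = r := by
      funext i t
      exact congrFun h (.inr (.inl (i, t)))
    subst hj
    exact ⟨rfl, hr, asks_eq_iff.1 (funext fun p => congrFun h (.inr (.inr (.inr (.inl p)))))⟩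
  · rintro ⟨rfl, rfl, h⟩
    have h := asks_eq_iff.2 h
    simp only [ctlState, h]

variable (sign : Bits (u + 1) → Bits l) (vk : Bits v)

/-- A basis state of the wires of the forger. -/
def mixState (j : Bits κ) (r : Fin m → Bits u) (f : Fin m → Bool)
    (q : Fin (v + m * (u + (l + 1)) + a) ⊕ SndWire k b → Bool) : FWire v m u l a k b κ → Bool :=
  Sum.elim (q ∘ Sum.map fstEquiv id) (ctlState sign j r f)

theorem mixState_comp (j : Bits κ) (r : Fin m → Bits u) (f : Fin m → Bool)
    (q : Fin (v + m * (u + (l + 1)) + a) ⊕ SndWire k b → Bool) :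
    mixState sign j r f q ∘ unmeasured = q := by
  funext w
  rcases w with w | w <;> simp [mixState]

theorem keyState_eq_mixState (j : Bits κ) (r : Fin m → Bits u) (f : Fin m → Bool) :
    (keyState sign vk j r f : FWire v m u l a k b κ → Bool) =
      mixState sign j r f (unmeasuredState sign vk r f) := by
  rw [← keyState_comp sign vk j r f]
  funext w
  rcases w with (w | w) | w
  · simp [mixState]
  · simp [mixState]
  · rfl

theorem mixState_eq_iff {j j' : Bits κ} {r r' : Fin m → Bits u} {f f' : Fin m → Bool}
    {q q' : Fin (v + m * (u + (l + 1)) + a) ⊕ SndWire k b → Bool} :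
    mixState sign j' r' f' q' = mixState sign j r f q ↔
      (j' = j ∧ r' = r ∧ ∀ i : Fin m, agree j κ i = true → f' i = f i) ∧ q' = q := by
  rw [← ctlState_eq_iff (sign := sign)]
  refine ⟨fun h => ⟨funext fun w => congrFun h (.inr w), ?_⟩, fun h => ?_⟩
  · rw [← mixState_comp sign j' r' f' q', h, mixState_comp]
  · rw [mixState, mixState, h.1, h.2]

theorem extend_mixState (j : Bits κ) (r : Fin m → Bits u) (f : Fin m → Bool)
    (q y : Fin (v + m * (u + (l + 1)) + a) ⊕ SndWire k b → Bool) :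
    Function.extend unmeasured y (mixState sign j r f q) = mixState sign j r f y := by
  symm
  refine extend_eq_of_forall unmeasured.injective
    (fun w => congrFun (mixState_comp sign j r f y) w) ?_
  rintro (w | w) hw
  · exact absurd (by rcases w with w | w <;> simp ) (hw (Sum.map fstEquiv id w))
  · rfl

/-- The states of the qubits `A` of the keys that are compatible with the result of the
measurement of the qubits of the selected keys. -/
def compatible (j : Bits κ) (f : Fin m → Bool) : Finset (Fin m → Bool) :=
  Finset.univ.filter fun f' => ∀ i : Fin m, agree j κ i = true → f' i = f i

/-- The state of the adversary's wires after the control wires have been measured: the honest key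
state restricted to the values `f'` that agree with `f` at the selected keys. -/
theorem slice_keyState (c : ℂ) (j : Bits κ) (r : Fin m → Bits u) (f : Fin m → Bool)
    (q : Fin (v + m * (u + (l + 1)) + a) ⊕ SndWire k b → Bool) :
    slice unmeasured (mixState sign j r f q) (c • ∑ j, ∑ r : Fin m → Bits u, ∑ f,
      bket (keyState sign vk j r f)) =
      c • ∑ f' ∈ compatible j f, bket (unmeasuredState sign vk r f') := by
  funext y
  simp only [slice, Pi.smul_apply, Finset.sum_apply, bket_apply, extend_mixState,
    keyState_eq_mixState, mixState_eq_iff]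
  congr 1
  rw [Finset.sum_eq_single j, Finset.sum_eq_single r, compatible, Finset.sum_filter]
  · refine Finset.sum_congr rfl fun f' _ => ?_
    have : (∀ i : Fin m, agree j κ i = true → f i = f' i) ↔
        ∀ i : Fin m, agree j κ i = true → f' i = f i :=
      forall_congr' fun i => imp_congr_right fun _ => eq_comm
    simp only [this, true_and, ite_and]
  · intro r' _ h
    simp [h.symm]
  · simp
  · intro j' _ h
    simp [h.symm]
  · simp

end

theorem sum_le_sum_of_injective {X Y : Type} [Fintype X] [Fintype Y] {e : X → Y}
    (he : Function.Injective e) {F : X → ℝ} {G : Y → ℝ} (hG : ∀ y, 0 ≤ G y)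
    (h : ∀ x, F x ≤ G (e x)) : ∑ x, F x ≤ ∑ y, G y := by
  calc ∑ x, F x ≤ ∑ x, G (e x) := Finset.sum_le_sum fun x _ => h x
    _ = ∑ y ∈ Finset.univ.map ⟨e, he⟩, G y := by simp
    _ ≤ ∑ y, G y := Finset.sum_le_univ_sum_of_nonneg hG

/-! ### The success probability of a forger. -/

section
variable {u l m v : ℕ} {b : ℕ} (A₁ : QCircuit (v + m * (u + (l + 1))) (u + (l + 1) + (1 + 1)))

/-- The wires of the public key register that is returned by the first stage. -/
def keyWire (t : Fin (u + (l + 1))) :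
    Fin (v + m * (u + (l + 1)) + A₁.anc) ⊕ SndWire (u + (l + 1)) b :=
  .inl (A₁.outWire (Fin.castAdd (1 + 1) t))

/-- The gates and queries of the forger. -/
def forgerOps (κ : ℕ)
    (gs : List (QGate (Fin (v + m * (u + (l + 1)) + A₁.anc) ⊕ SndWire (u + (l + 1)) b))) :
    List (QOp (FWire v m u l A₁.anc (u + (l + 1)) b κ) (u + 1) l) :=
  (hLayer superposed ++ prepare).map QOp.gate ++ ((boolPairs m).map keyQuery ++
    (fillB ++ gs.map (QGate.map unmeasured)).map QOp.gate)

/-- The forger that prepares the public keys with a few measured qubits `A`, runs the gates `gs`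
and returns the public key register. -/
def forger (κ : ℕ)
    (gs : List (QGate (Fin (v + m * (u + (l + 1)) + A₁.anc) ⊕ SndWire (u + (l + 1)) b))) :
    Forger v (u + 1) l where
  anc := forgerAnc m u l A₁.anc (u + (l + 1)) b κ
  ops := (forgerOps A₁ κ gs).map (QOp.toOp wireEquiv)
  outMsg := Fin.cons (wireEquiv (unmeasured (keyWire A₁ (Fin.natAdd u 0))))
    fun j => wireEquiv (unmeasured (keyWire A₁ (Fin.castAdd (l + 1) j)))
  outSig j := wireEquiv (unmeasured (keyWire A₁ (Fin.natAdd u j.succ)))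

variable {A₁}

/-- The wires that control the queries, without the signatures. -/
def measured {a k κ : ℕ} : Set (FWire v m u l a k b κ) :=
  {w | ∃ x, w = .inr x ∧ ∀ y, w ≠ wSg y}

theorem fixes_keyQuery {a k κ : ℕ} (p : Bool × Fin m) :
    (keyQuery p : QOp (FWire v m u l a k b κ) (u + 1) l).Fixes measured := by
  refine ⟨⟨_, rfl, by simp⟩, fun j => ?_, fun j ⟨x, _, h⟩ => h _ rfl⟩
  refine Fin.cases ?_ (fun j => ?_) j
  · exact ⟨_, rfl, by simp⟩
  · exact ⟨_, rfl, by simp⟩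

theorem not_measured_inl {a k κ : ℕ} (w) : (.inl w : FWire v m u l a k b κ) ∉ measured := by
  rintro ⟨x, h, _⟩
  cases h

theorem fixes_ops {a k κ : ℕ} (gs : List (QGate (Fin (v + m * (u + (l + 1)) + a) ⊕ SndWire k b))) :
    ∀ o ∈ (boolPairs m).map keyQuery ++ (fillB ++ gs.map (QGate.map unmeasured)).map QOp.gate,
      (o : QOp (FWire v m u l a k b κ) (u + 1) l).Fixes measured := by
  intro o ho
  rcases List.mem_append.1 ho with h | h
  · obtain ⟨p, -, rfl⟩ := List.mem_map.1 h
    exact fixes_keyQuery p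
  · obtain ⟨g, hg, rfl⟩ := List.mem_map.1 h
    change g.tgt ∉ measured
    rcases List.mem_append.1 hg with h | h
    · simp only [fillB, List.mem_append, List.mem_map] at h
      rcases h with ⟨_, _, rfl⟩ | ⟨_, _, rfl⟩ | ⟨_, _, rfl⟩ <;> exact not_measured_inl _
    · obtain ⟨g, -, rfl⟩ := List.mem_map.1 h
      cases g <;> exact not_measured_inl _

/-- Each result for the coins and the strings `r` has weight `2 ^ (-(κ + m * u))`. The remaining
factor `rt ^ m` is kept as the normalization of the honest key state. -/
theorem smul_sum_bket_unmeasured {a k κ : ℕ} (sign : Bits (u + 1) → Bits l) (vk : Bits v)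
    (gs : List (QGate (Fin (v + m * (u + (l + 1)) + a) ⊕ SndWire k b))) (j : Bits κ)
    (r : Fin m → Bits u) (f : Fin m → Bool)
    (q : Fin (v + m * (u + (l + 1)) + a) ⊕ SndWire k b → Bool) :
    ‖actL (gs.map (QGate.map unmeasured)) (rt ^ (κ + (m * u + m)) • ∑ j, ∑ r : Fin m → Bits u, ∑ f,
        bket (keyState sign vk j r f)) (mixState sign j r f q)‖ ^ 2 =
      (1 / 2) ^ (κ + m * u) * ‖actL gs (∑ f' ∈ compatible j f,
        rt ^ m • bket (unmeasuredState sign vk r f')) q‖ ^ 2 := by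
  rw [actL_map_apply, slice_keyState, mixState_comp, ← Finset.smul_sum,
    show rt ^ (κ + (m * u + m)) = rt ^ (κ + m * u) * rt ^ m by ring, mul_smul, map_smul, Pi.smul_apply, norm_smul, mul_pow, norm_rt_pow_sq]

/-- The forger wins at least with the probability that the adversary returns an accepted public key
register that is not part of a signature that was queried. -/
theorem le_winProb_forger {κ : ℕ} (sign : Bits (u + 1) → Bits l) (ver : Bits (u + 1) → Bits l → Bool)
    (vk : Bits v)
    (gs : List (QGate (Fin (v + m * (u + (l + 1)) + A₁.anc) ⊕ SndWire (u + (l + 1)) b)))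
    (j : Bits κ) (f : Fin m → Bool) (W : (Fin m → Bits u) →
      (Fin (v + m * (u + (l + 1)) + A₁.anc) ⊕ SndWire (u + (l + 1)) b → Bool) → Prop)
    [∀ r q, Decidable (W r q)]
    (hW : ∀ r q, W r q → Accepted ver (q ∘ keyWire A₁) ∧
      ∀ p, asks j f p = true → q ∘ keyWire A₁ ≠ keyString sign (Fin.cons p.1 (r p.2))) :
    (1 / 2) ^ (κ + m * u) * ∑ r : Fin m → Bits u, ∑ q, (if W r q then
      ‖actL gs (∑ f' ∈ compatible j f, rt ^ m • bket (unmeasuredState sign vk r f')) q‖ ^ 2 else 0) ≤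
      (forger A₁ κ gs).winProb sign ver vk := by
  set win : Finset (Bits (u + 1) × Bits l) →
    Bits (v + forgerAnc m u l A₁.anc (u + (l + 1)) b κ) → Bool := fun Q x =>
      decide (((fun j => x ((forger A₁ κ gs).outMsg j)), fun j => x ((forger A₁ κ gs).outSig j)) ∉ Q)
        && ver (fun j => x ((forger A₁ κ gs).outMsg j)) (fun j => x ((forger A₁ κ gs).outSig j))
    with hwin
  set ops : List (QOp (FWire v m u l A₁.anc (u + (l + 1)) b κ) (u + 1) l) :=
    (boolPairs m).map keyQuery ++ (fillB ++ gs.map (QGate.map unmeasured)).map QOp.gate with hops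
  have h0 : (Pi.single (Fin.append vk fun _ => false) 1 :
      Bits (v + forgerAnc m u l A₁.anc (u + (l + 1)) b κ) → ℂ) =
      fun x => bket (startState vk) (x ∘ wireEquiv) := by
    funext x
    rw [bket_apply, Pi.single_apply, ← startState_eq]
    refine if_congr ⟨fun h => by rw [h], fun h => ?_⟩ rfl rfl
    funext i
    obtain ⟨w, rfl⟩ := wireEquiv.surjective i
    exact congrFun h w
  have h1 : (forger A₁ κ gs).winProb sign ver vk = ∑ x, if win (∅ ∪ queried sign ops x)
      (x ∘ wireEquiv.symm) = true then ‖actO sign ops (actL (hLayer superposed ++ prepare)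
        (bket (startState vk))) x‖ ^ 2 else 0 := by
    have h2 := runOracle_gates sign win wireEquiv (hLayer superposed ++ prepare) ops
      (bket (startState vk)) ∅
    rw [runOracle_eq sign win wireEquiv ops (fixes_ops gs)] at h2
    refine Eq.trans ?_ h2
    rw [← h0]
    rfl
  rw [h1, hops, actO_keys, ← hops]
  have h3 : (1 / 2 : ℝ) ^ (κ + m * u) * ∑ r : Fin m → Bits u, ∑ q, (if W r q then
      ‖actL gs (∑ f' ∈ compatible j f, rt ^ m • bket (unmeasuredState sign vk r f')) q‖ ^ 2 else 0)
      = ∑ x : (Fin m → Bits u) × (_ → Bool), if W x.1 x.2 then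
        (1 / 2 : ℝ) ^ (κ + m * u) * ‖actL gs (∑ f' ∈ compatible j f,
          rt ^ m • bket (unmeasuredState sign vk x.1 f')) x.2‖ ^ 2 else 0 := by
    rw [Fintype.sum_prod_type, Finset.mul_sum]
    refine Finset.sum_congr rfl fun r _ => ?_
    rw [Finset.mul_sum]
    refine Finset.sum_congr rfl fun q _ => ?_
    split_ifs <;> simp
  rw [h3]
  -- For fixed `j` and `f`, different pairs of `r` and `q` are different basis states of the forger.
  -- All other basis states are dropped, so only the guess `j` and a value `f` of interest are
  -- counted.
  refine sum_le_sum_of_injective (e := fun x => mixState sign j x.1 f x.2) (fun x y h => ?_)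
    (fun y => by positivity) fun x => ?_
  · obtain ⟨⟨-, h1, -⟩, h2⟩ := (mixState_eq_iff sign).1 h
    exact Prod.ext h1 h2
  · rw [smul_sum_bket_unmeasured]
    by_cases hx : W x.1 x.2
    · obtain ⟨ha, hq⟩ := hW _ _ hx
      rw [if_pos hx, if_pos]
      set p : Bits (u + (l + 1)) := x.2 ∘ keyWire A₁ with hp
      have hw : ∀ t, (mixState sign j x.1 f x.2 ∘ wireEquiv.symm)
          (wireEquiv (unmeasured (keyWire A₁ t))) = p t := fun t => by
        rw [Function.comp_apply, Equiv.symm_apply_apply]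
        exact congrFun (mixState_comp sign j x.1 f x.2) (keyWire A₁ t)
      have hM : (fun t => (mixState sign j x.1 f x.2 ∘ wireEquiv.symm)
          ((forger A₁ κ gs).outMsg t)) = Fin.cons (p.right 0) p.left := by
        funext t
        refine Fin.cases ?_ (fun t => ?_) t
        · exact hw _
        · exact hw _
      have hS : (fun t => (mixState sign j x.1 f x.2 ∘ wireEquiv.symm)
          ((forger A₁ κ gs).outSig t)) = Fin.tail p.right := funext fun t => hw _
      simp only [hwin, hM, hS, Finset.empty_union, Bool.and_eq_true, decide_eq_true_eq]
      refine ⟨fun hQ => ?_, ha⟩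
      -- If the returned pair were in the set of queries, the returned string would be the key
      -- string of a query that was asked, against the assumption on `W`.
      obtain ⟨y, h1, h2, h3⟩ := mem_queried_keyQuery sign hQ
      refine hq y h1 ?_
      have h4 : (Fin.cons (p.right 0) p.left : Bits (u + 1)) = Fin.cons y.1 (x.1 y.2) := h2
      have h5 : Fin.tail p.right = sign (Fin.cons (p.right 0) p.left) := h3
      rw [← h4, keyString, Fin.tail_cons, Fin.cons_zero, ← h5, Fin.cons_self_tail,
        append_left_right]
    · rw [if_neg hx]
      positivity

end

/-! ### A phase flip by Hadamard and NOT gates, and the first stage inside the forger. -/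

section
variable {ι κ : Type} [DecidableEq ι] [DecidableEq κ]

theorem actL_clL {gs : List (QGate ι)} (hg : ∀ g ∈ gs, g.IsCl) (ψ : St ι) (y : ι → Bool) :
    actL gs ψ (clL gs y) = ψ y := by
  induction gs generalizing ψ y with
  | nil => rfl
  | cons g gs ih =>
    rw [actL_cons, clL_cons, ih fun g hg' => hg g (List.mem_cons_of_mem _ hg'),
      QGate.act_cl (hg g List.mem_cons_self), g.cl_involutive]

/-- The identity `H X H = Z`: a reflection about the output bit made from elementary gates. -/
theorem actL_hxh (i : ι) (ψ : St ι) (x : ι → Bool) :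
    actL [QGate.h i, QGate.x i, QGate.h i] ψ x = if x i = true then -ψ x else ψ x := by
  simp only [actL_cons, actL_nil, QGate.act_h, QGate.act_cl (g := QGate.x i) trivial, QGate.cl,
    flipAt, Function.update_idem, Function.update_self, Bool.false_xor, Bool.true_xor,
    Bool.not_true]
  have h := rt_mul_rt
  by_cases hx : x i = true
  · have e : Function.update x i true = x := by rw [← hx, Function.update_eq_self]
    simp only [e, hx, if_true, Bool.false_eq_true, if_false]
    linear_combination (-2 * ψ x) * h
  · have hx' : x i = false := by simpa using hx
    have e : Function.update x i false = x := by rw [← hx', Function.update_eq_self]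
    simp only [e, hx', if_true, Bool.false_eq_true, if_false]
    linear_combination (2 * ψ x) * h

end

section
variable {u l m v b : ℕ} (A₁ : QCircuit (v + m * (u + (l + 1))) (u + (l + 1) + (1 + 1)))
  (sign : Bits (u + 1) → Bits l) (vk : Bits v) (r : Fin m → Bits u)

/-- The wires of the first stage after the first stage. -/
def afterFirst (p : Bits (u + (l + 1))) (μ : Bits (1 + 1)) (c : Bits A₁.rest) :
    Bits (v + m * (u + (l + 1)) + A₁.anc) :=
  fun i => Fin.append (Fin.append p μ) c (Fin.cast A₁.size_eq.symm i)

theorem firstState_apply (s : Finset (Fin m → Bool)) (p μ c) :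
    firstState A₁ sign vk r s (p, μ, c) = actL A₁.qgates (∑ f ∈ s, rt ^ m •
      bket (Fin.append (Fin.append vk (keysString sign r f)) fun _ => false))
        (afterFirst A₁ p μ c) := by
  rw [firstState, splitOut, QCircuit.iso_mulVec]
  refine congrFun (congrArg _ ?_) _
  have h : ∀ x, keysVec vk sign r s x • bket (Fin.append x fun _ : Fin A₁.anc => false) =
      ∑ f ∈ s, (bket (Fin.append vk (keysString sign r f)) x : ℂ) •
        (rt ^ m • bket (Fin.append x fun _ : Fin A₁.anc => false)) := fun x => by
    rw [keysVec, Finset.sum_apply, Finset.sum_smul]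
    refine Finset.sum_congr rfl fun f _ => ?_
    rw [Pi.smul_apply, smul_eq_mul, smul_smul, mul_comm (rt ^ m)]
  simp only [h]
  rw [Finset.sum_comm]
  refine Finset.sum_congr rfl fun f _ => ?_
  simp only [bket_apply, ite_smul, one_smul, zero_smul, Finset.sum_ite_eq', Finset.mem_univ,
    if_true]

/-- The gates of the first stage. -/
def firstGates : List (QGate (Fin (v + m * (u + (l + 1)) + A₁.anc) ⊕ SndWire (u + (l + 1)) b)) :=
  A₁.qgates.map (QGate.map Function.Embedding.inl)

theorem afterFirst_comp (p μ c) (y : SndWire (u + (l + 1)) b → Bool) :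
    Sum.elim (afterFirst A₁ p μ c) y ∘ keyWire A₁ = p := by
  funext t
  simp [afterFirst, keyWire, QCircuit.outWire]

theorem afterFirst_inj {p p' μ μ' c c'} :
    afterFirst A₁ p μ c = afterFirst A₁ p' μ' c' ↔ p = p' ∧ μ = μ' ∧ c = c' := by
  refine ⟨fun h => ?_, fun ⟨h1, h2, h3⟩ => by rw [h1, h2, h3]⟩
  have h1 : Fin.append (Fin.append p μ) c = Fin.append (Fin.append p' μ') c' := by
    funext i
    have := congrFun h (Fin.cast A₁.size_eq i)
    simpa [afterFirst] using this
  obtain ⟨h2, h3⟩ := append_inj.1 h1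
  obtain ⟨h4, h5⟩ := append_inj.1 h2
  exact ⟨h4, h5, h3⟩

/-- The first stage does not touch the wires of the second, which stay at zero; on its own wires the
forger reproduces the adversary's state exactly. -/
theorem actL_firstGates (s : Finset (Fin m → Bool)) (p μ c) (y : SndWire (u + (l + 1)) b → Bool) :
    actL (firstGates A₁) (∑ f ∈ s, rt ^ m • bket (unmeasuredState sign vk r f))
      (Sum.elim (afterFirst A₁ p μ c) y) =
      if y = fun _ => false then firstState A₁ sign vk r s (p, μ, c) else 0 := by
  have he : ∀ z, Function.extend (Function.Embedding.inl : _ ↪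
      Fin (v + m * (u + (l + 1)) + A₁.anc) ⊕ SndWire (u + (l + 1)) b) z
      (Sum.elim (afterFirst A₁ p μ c) y) = Sum.elim z y := by
    intro z
    symm
    refine extend_eq_of_forall Function.Embedding.inl.injective (fun i => rfl) ?_
    rintro (w | w) hw
    · exact absurd rfl (hw w)
    · rfl
  have h : slice Function.Embedding.inl (Sum.elim (afterFirst A₁ p μ c) y)
      (∑ f ∈ s, rt ^ m • bket (unmeasuredState sign vk r f)) =
      if y = fun _ => false then ∑ f ∈ s, rt ^ m •
        bket (Fin.append (Fin.append vk (keysString sign r f)) fun _ => false) else 0 := by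
    funext z
    simp only [slice, he, unmeasuredState, Finset.sum_apply, Pi.smul_apply, bket_apply]
    have h1 : ∀ z' : Bits (v + m * (u + (l + 1)) + A₁.anc), (Sum.elim z y = Sum.elim z'
        fun _ => false) ↔ z = z' ∧ y = fun _ => false := fun z' =>
      ⟨fun h => ⟨funext fun i => congrFun h (.inl i), funext fun i => congrFun h (.inr i)⟩,
        fun h => by rw [h.1, h.2]⟩
    simp only [h1]
    by_cases hy : y = fun _ => false <;> simp [hy, bket_apply]
  rw [firstGates, actL_map_apply, h, firstState_apply]
  split_ifs <;> simp
  rfl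

/-- The forger that runs the first stage. -/
theorem nsq_mask_firstState_le {κ : ℕ} (ver : Bits (u + 1) → Bits l → Bool) (j : Bits κ)
    (f : Fin m → Bool) (P : (Fin m → Bits u) → Bits (u + (l + 1)) → Prop) [∀ r, DecidablePred (P r)]
    (hP : ∀ r p, P r p → Accepted ver p ∧
      ∀ x, asks j f x = true → p ≠ keyString sign (Fin.cons x.1 (r x.2))) :
    (1 / 2) ^ (κ + m * u) * ∑ r, nsq (mask (P r) (firstState A₁ sign vk r (compatible j f))) ≤
      (forger A₁ κ (firstGates (b := b) A₁)).winProb sign ver vk := by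
  refine le_trans (mul_le_mul_of_nonneg_left (Finset.sum_le_sum fun r _ => ?_) (by positivity))
    (le_winProb_forger sign ver vk (firstGates A₁) j f (fun r q => P r (q ∘ keyWire A₁))
      fun r q h => hP r _ h)
  rw [nsq]
  refine sum_le_sum_of_injective
    (e := fun x => Sum.elim (afterFirst A₁ x.1 x.2.1 x.2.2) fun _ => false) (fun x y h => ?_)
    (fun q => by positivity) fun x => ?_
  · obtain ⟨h1, h2, h3⟩ := (afterFirst_inj A₁).1 (funext fun i => congrFun h (.inl i))
    exact Prod.ext h1 (Prod.ext h2 h3)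
  · rw [afterFirst_comp, mask_apply, actL_firstGates, if_pos rfl]
    split_ifs <;> simp

end

/-! ## The forger that runs the second stage -/

section
variable {u l m v : ℕ} {A₁ : QCircuit (v + m * (u + (l + 1))) (u + (l + 1) + (1 + 1))}
  (A₂ : QCircuit (u + (l + 1) + 1 + A₁.rest) 1)

/-- The wires of the two stages. -/
abbrev StageWire : Type :=
  Fin (v + m * (u + (l + 1)) + A₁.anc) ⊕ SndWire (u + (l + 1)) A₂.anc

/-- The wires of the second stage. -/
def toSecond : Fin (u + (l + 1) + 1 + A₁.rest + A₂.anc) ↪ StageWire A₂ :=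
  ⟨Fin.append (Fin.append (fun i => .inr (.inl i)) fun i => .inl (A₁.restWire i))
      fun i => .inr (.inr (.inl i)), by
    refine Fin.append_injective_iff.2 ⟨Fin.append_injective_iff.2 ⟨fun i j h => by simpa using h,
      fun i j h => by simpa [QCircuit.restWire, Fin.ext_iff] using h, fun i j => by simp⟩,
      fun i j h => by simpa using h, fun i j => ?_⟩
    induction i using Fin.addCases <;> simp⟩

/-- The wires of the qubit `A` and the register `B` of the key that is returned. -/
def keyRight : Fin (l + 1) ↪ StageWire A₂ :=
  ⟨fun j => keyWire A₁ (Fin.natAdd u j), fun i j h => by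
    simpa [keyWire, QCircuit.outWire, Fin.ext_iff] using h⟩

/-- A basis state of the wires of the two stages. -/
def stageState (p : Bits (u + (l + 1))) (μ : Bits (1 + 1))
    (z : Bits (u + (l + 1) + 1 + A₁.rest + A₂.anc)) (d : Bits (u + (l + 1))) :
    StageWire A₂ → Bool :=
  Sum.elim (afterFirst A₁ p μ z.left.right) (Sum.elim z.left.left (Sum.elim z.right d))

/-- The wires of the ciphertext, without the first one. -/
def ctWire (i : Fin (u + (l + 1))) : StageWire A₂ := .inr (.inl i.succ)

/-- The wires of the copy of the key. -/
def copyWire (i : Fin (u + (l + 1))) : StageWire A₂ := .inr (.inr (.inr i))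

/-- The first wire of the ciphertext. -/
def ctFlag : StageWire A₂ := .inr (.inl 0)

theorem keyWire_ne_inr (i : Fin (u + (l + 1))) (x : SndWire (u + (l + 1)) A₂.anc) :
    (keyWire A₁ i : StageWire A₂) ≠ .inr x := Sum.inl_ne_inr

theorem keyWire_ne_ctWire (i j : Fin (u + (l + 1))) :
    (keyWire A₁ i : StageWire A₂) ≠ ctWire A₂ j := keyWire_ne_inr A₂ _ _

theorem keyWire_ne_copyWire (i j : Fin (u + (l + 1))) :
    (keyWire A₁ i : StageWire A₂) ≠ copyWire A₂ j := keyWire_ne_inr A₂ _ _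

/-- The gates that copy the key to the ciphertext. -/
def copyCt : List (QGate (StageWire A₂)) :=
  cxLayer (keyWire A₁) (ctWire A₂) fun _ => keyWire_ne_ctWire A₂ _ _

/-- The gates that copy the key. -/
def copyKey : List (QGate (StageWire A₂)) :=
  cxLayer (keyWire A₁) (copyWire A₂) fun _ => keyWire_ne_copyWire A₂ _ _

/-- The gates that encrypt zero and run the second stage. -/
def secondGates : List (QGate (StageWire A₂)) :=
  QGate.x (ctFlag A₂) :: (hLayer (keyRight A₂) ++
    (copyCt A₂ ++ A₂.qgates.map (QGate.map (toSecond A₂))))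

/-- The gates that copy the key, run the second stage, negate the sign of its output, and undo the
second stage. -/
def swapGates : List (QGate (StageWire A₂)) :=
  copyKey A₂ ++
    (secondGates A₂ ++
      ([QGate.h (toSecond A₂ (A₂.outWire 0)), QGate.x (toSecond A₂ (A₂.outWire 0)),
        QGate.h (toSecond A₂ (A₂.outWire 0))] ++ invL (secondGates A₂)))

variable {A₂}

theorem wire_cases (w : Fin (v + m * (u + (l + 1)) + A₁.anc)) :
    (∃ t, w = A₁.outWire (Fin.castAdd (1 + 1) t)) ∨ (∃ t, w = A₁.outWire (Fin.natAdd _ t)) ∨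
      ∃ t, w = A₁.restWire t := by
  obtain ⟨w, rfl⟩ := (finCongr A₁.size_eq).surjective w
  induction w using Fin.addCases with
  | left w =>
    induction w using Fin.addCases with
    | left w => exact .inl ⟨w, rfl⟩
    | right w => exact .inr (.inl ⟨w, rfl⟩)
  | right w => exact .inr (.inr ⟨w, rfl⟩)

@[simp] theorem afterFirst_key (p μ c t) :
    afterFirst A₁ p μ c (A₁.outWire (Fin.castAdd (1 + 1) t)) = p t := by
  simp [afterFirst, QCircuit.outWire]

@[simp] theorem afterFirst_msg (p μ c t) :
    afterFirst A₁ p μ c (A₁.outWire (Fin.natAdd _ t)) = μ t := by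
  simp [afterFirst, QCircuit.outWire]

@[simp] theorem afterFirst_rest (p μ c t) : afterFirst A₁ p μ c (A₁.restWire t) = c t := by
  simp [afterFirst, QCircuit.restWire]

theorem stageState_comp_toSecond (p μ z d) : stageState A₂ p μ z d ∘ toSecond A₂ = z := by
  funext i
  induction i using Fin.addCases with
  | left i =>
    induction i using Fin.addCases with
    | left i => simp [stageState, toSecond, Bits.left]
    | right i => simp [stageState, toSecond, Bits.left, Bits.right]
  | right i => simp [stageState, toSecond, Bits.right]

theorem stageState_comp_keyWire (p μ z d) : stageState A₂ p μ z d ∘ keyWire A₁ = p := by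
  funext i
  simp [stageState, keyWire]

theorem extend_toSecond (p μ z z' d) :
    Function.extend (toSecond A₂) z' (stageState A₂ p μ z d) = stageState A₂ p μ z' d := by
  symm
  refine extend_eq_of_forall (toSecond A₂).injective
    (fun i => congrFun (stageState_comp_toSecond p μ z' d) i) ?_
  rintro (w | w | w | w) hw
  · rcases wire_cases w with ⟨t, rfl⟩ | ⟨t, rfl⟩ | ⟨t, rfl⟩
    · simp [stageState]
    · simp [stageState]
    · exact absurd (by simp [toSecond]) (hw (Fin.castAdd _ (Fin.natAdd _ t)))
  · exact absurd (by simp [toSecond]) (hw (Fin.castAdd _ (Fin.castAdd _ w)))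
  · exact absurd (by simp [toSecond]) (hw (Fin.natAdd _ w))
  · rfl

theorem extend_keyRight (p μ z d) (y : Bits (l + 1)) :
    Function.extend (keyRight A₂) y (stageState A₂ p μ z d) =
      stageState A₂ (Fin.append p.left y) μ z d := by
  symm
  refine extend_eq_of_forall (keyRight A₂).injective (fun i => ?_) ?_
  · simp [keyRight, keyWire, stageState]
  · rintro (w | w) hw
    · rcases wire_cases w with ⟨t, rfl⟩ | ⟨t, rfl⟩ | ⟨t, rfl⟩
      · induction t using Fin.addCases with
        | left t => simp [stageState, Bits.left]
        | right t => exact absurd rfl (hw t)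
      · simp [stageState]
      · simp [stageState]
    · rfl

/-- Add a string to the ciphertext. -/
def xorCt (e : Bits (u + (l + 1) + 1)) (z : Bits (u + (l + 1) + 1 + A₁.rest + A₂.anc)) :
    Bits (u + (l + 1) + 1 + A₁.rest + A₂.anc) :=
  Fin.append (Fin.append (Bits.xor z.left.left e) z.left.right) z.right

theorem clL_copyCt (p μ z d) :
    clL (copyCt A₂)
      (stageState A₂ p μ z d) = stageState A₂ p μ (xorCt (Fin.cons false p) z) d := by
  have hinj : Function.Injective (ctWire A₂) :=
    fun i j h => by simpa [ctWire, copyWire] using h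
  rw [copyCt, clL_cxLayer (keyWire_ne_ctWire A₂) hinj]
  symm
  refine extend_eq_of_forall hinj (fun i => ?_) ?_
  · have := congrFun (stageState_comp_keyWire (A₂ := A₂) p μ z d) i
    rw [Function.comp_apply] at this
    rw [this]
    simp [stageState, ctWire, xorCt, Bits.xor]
  · rintro (w | w | w | w) hw
    · simp [stageState, xorCt]
    · revert hw
      refine Fin.cases (fun hw => ?_) (fun w hw => ?_) w
      · simp [stageState, xorCt, Bits.xor]
      · exact absurd rfl (hw w)
    · simp [stageState, xorCt]
    · rfl

theorem cl_x_ct (p μ z d) : (QGate.x (ctFlag A₂)).cl (stageState A₂ p μ z d) =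
    stageState A₂ p μ (xorCt (Fin.cons true fun _ => false) z) d := by
  funext w
  rcases w with w | w | w | w
  · simp [stageState, xorCt, ctFlag, QGate.cl, flipAt]
  · by_cases hw : w = 0
    · subst hw
      simp [stageState, xorCt, ctFlag, QGate.cl, flipAt, Bits.xor]
    · obtain ⟨w, rfl⟩ := Fin.exists_succ_eq.2 hw
      simp [stageState, xorCt, ctFlag, QGate.cl, flipAt, Bits.xor]
  · simp [stageState, xorCt, ctFlag, QGate.cl, flipAt]
  · simp [stageState, xorCt, ctFlag, QGate.cl, flipAt]

theorem clL_copyKey (p μ z d) :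
    clL (copyKey A₂)
      (stageState A₂ p μ z d) = stageState A₂ p μ z (Bits.xor d p) := by
  have hinj : Function.Injective (copyWire A₂) :=
    fun i j h => by simpa [ctWire, copyWire] using h
  rw [copyKey, clL_cxLayer (keyWire_ne_copyWire A₂) hinj]
  symm
  refine extend_eq_of_forall hinj (fun i => ?_) ?_
  · have := congrFun (stageState_comp_keyWire (A₂ := A₂) p μ z d) i
    rw [Function.comp_apply] at this
    rw [this]
    simp [stageState, copyWire, Bits.xor]
  · rintro (w | w | w | w) hw
    · rfl
    · rfl
    · rfl
    · exact absurd rfl (hw w)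

theorem xorCt_eq (q : Bits (u + (l + 1))) (z : Bits (u + (l + 1) + 1 + A₁.rest + A₂.anc)) :
    (xorCt (Fin.cons true fun _ => false) (xorCt (Fin.cons false q) z)).left.left =
      (fun _ => false) ↔ z.left.left = Fin.cons true q := by
  simp only [xorCt, left_append]
  constructor
  · intro h
    funext i
    have := congrFun h i
    revert this
    refine Fin.cases ?_ (fun i => ?_) i
    · simp [Bits.xor]
    · simp [Bits.xor]
  · intro h
    rw [h]
    funext i
    refine Fin.cases ?_ (fun i => ?_) i <;> simp [Bits.xor]

theorem xorCt_xorCt (e : Bits (u + (l + 1) + 1)) (z : Bits (u + (l + 1) + 1 + A₁.rest + A₂.anc)) :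
    xorCt e (xorCt e z) = z := by
  have h : Bits.xor (Bits.xor z.left.left e) e = z.left.left := by funext i; simp [Bits.xor]
  simp only [xorCt, left_append, right_append, h, append_left_right]

/-- Copying the key to the ciphertext after the Hadamard gates makes the key wires and the
ciphertext agree on `q`. Therefore the key wires of the final basis state tell which ciphertext the
second stage was run on, and the sum over `q` collapses. -/
theorem actL_secondGates {χ : St (StageWire A₂)}
    {χ₀ : Bits (u + (l + 1)) → Bits (1 + 1) → Bits A₁.rest → Bits (u + (l + 1)) → ℂ}
    (hχ : ∀ p μ z d, χ (stageState A₂ p μ z d) =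
      if z.left.left = (fun _ => false) ∧ z.right = (fun _ => false) then χ₀ p μ z.left.right d
      else 0) (q μ z d) :
    actL (secondGates A₂) χ (stageState A₂ q μ z d) =
      ∑ c, (∑ p, hadamardRight q p * χ₀ p μ c d) *
        actL A₂.qgates (bket (Fin.append (Fin.append (Fin.cons true q) c) fun _ => false)) z := by
  rw [secondGates, actL_cons, actL_append, actL_append, actL_map_apply, stageState_comp_toSecond]
  have h : slice (toSecond A₂) (stageState A₂ q μ z d)
      (actL (copyCt A₂) (actL (hLayer (keyRight A₂)) ((QGate.x (ctFlag A₂)).act χ))) =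
      ∑ c, (∑ p, hadamardRight q p * χ₀ p μ c d) •
        bket (Fin.append (Fin.append (Fin.cons true q) c) fun _ => false) := by
    funext (y : Bits (u + (l + 1) + 1 + A₁.rest + A₂.anc))
    have h1 := actL_clL (gs := copyCt A₂) isCl_cxLayer (actL (hLayer (keyRight A₂))
      ((QGate.x (ctFlag A₂)).act χ)) (stageState A₂ q μ (xorCt (Fin.cons false q) y) d)
    rw [clL_copyCt, xorCt_xorCt] at h1
    have h2 : (stageState A₂ q μ (xorCt (Fin.cons false q) y) d) ∘ keyRight A₂ = q.right := by
      funext i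
      exact congrFun (stageState_comp_keyWire q μ _ d) (Fin.natAdd u i)
    rw [slice, extend_toSecond, h1, actL_hLayer, h2]
    simp only [extend_keyRight, QGate.act_cl (g := QGate.x (ctFlag A₂)) trivial, cl_x_ct, hχ,
      xorCt_eq, Finset.sum_apply, Pi.smul_apply, bket_apply, smul_eq_mul]
    have h3 : ∀ c, y = Fin.append (Fin.append (Fin.cons true q) c) (fun _ => false) ↔
        c = y.left.right ∧ y.left.left = Fin.cons true q ∧ y.right = fun _ => false := by
      intro c
      conv_lhs => rw [← append_left_right y, append_inj, ← append_left_right y.left, append_inj]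
      constructor
      · rintro ⟨⟨h1, h2⟩, h3⟩; exact ⟨h2.symm, h1, h3⟩
      · rintro ⟨h1, h2, h3⟩; exact ⟨⟨h2, h1.symm⟩, h3⟩
    simp only [h3]
    have h4 : ∀ c, ∑ p, hadamardRight q p * χ₀ p μ c d =
        rt ^ (l + 1) * ∑ w, sgn q.right w * χ₀ (Fin.append q.left w) μ c d := by
      intro c
      rw [sum_bits_append, Finset.sum_eq_single q.left]
      · rw [Finset.mul_sum]
        refine Finset.sum_congr rfl fun w _ => ?_
        rw [hadamardRight_apply, left_append, right_append, if_pos rfl, mul_assoc]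
      · intro x _ hx
        refine Finset.sum_eq_zero fun w _ => ?_
        rw [hadamardRight_apply, left_append, if_neg hx.symm, zero_mul]
      · simp
    simp only [h4, xorCt, left_append, right_append]
    by_cases hy : y.left.left = Fin.cons true q ∧ y.right = fun _ => false
    · simp [hy]
    · simp [hy]
  rw [h, map_sum, Finset.sum_apply]
  refine Finset.sum_congr rfl fun c _ => ?_
  rw [map_smul]
  rfl

/-- The basis states of the wires of the two stages. -/
def stageEquiv : Bits (u + (l + 1)) × Bits (1 + 1) ×
    Bits (u + (l + 1) + 1 + A₁.rest + A₂.anc) × Bits (u + (l + 1)) ≃ (StageWire A₂ → Bool) where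
  toFun x := stageState A₂ x.1 x.2.1 x.2.2.1 x.2.2.2
  invFun x := (x ∘ keyWire A₁, fun t => x (.inl (A₁.outWire (Fin.natAdd _ t))), x ∘ toSecond A₂,
    fun t => x (.inr (.inr (.inr t))))
  left_inv := fun ⟨p, μ, z, d⟩ => by
    simp only [stageState_comp_keyWire, stageState_comp_toSecond]
    simp [stageState]
  right_inv := fun x => by
    funext w
    rcases w with w | w | w | w
    · rcases wire_cases w with ⟨t, rfl⟩ | ⟨t, rfl⟩ | ⟨t, rfl⟩
      · simp [stageState, keyWire]
      · simp [stageState]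
      · simp [stageState, toSecond, Bits.left, Bits.right]
    · simp [stageState, toSecond, Bits.left]
    · simp [stageState, toSecond, Bits.right]
    · rfl

theorem sum_stageState {M : Type} [AddCommMonoid M] (F : (StageWire A₂ → Bool) → M) :
    ∑ x, F x = ∑ p, ∑ μ, ∑ z, ∑ d, F (stageState A₂ p μ z d) := by
  rw [← Equiv.sum_comp stageEquiv F]
  simp only [Fintype.sum_prod_type]
  rfl

theorem stageState_inj {p p' μ μ' z z' d d'} :
    stageState A₂ p μ z d = stageState A₂ p' μ' z' d' ↔ p = p' ∧ μ = μ' ∧ z = z' ∧ d = d' := by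
  refine ⟨fun h => ?_, fun ⟨h1, h2, h3, h4⟩ => by rw [h1, h2, h3, h4]⟩
  have := stageEquiv.injective (a₁ := (p, μ, z, d)) (a₂ := (p', μ', z', d')) h
  simpa using this

theorem ip_bket {ι : Type} [Fintype ι] [DecidableEq ι] (x : ι → Bool) (ψ : St ι) :
    ip (bket x) ψ = ψ x := by
  simp [ip, bket_apply, apply_ite star]

/-- The copy of the key is the label `x₁` of the branch, so only the part of `φ` at `x₁` reaches a
final state with this label. Arriving with `x₀` in the key register is then due to the reflection
alone. -/
theorem actL_swapGates {Φ : St (StageWire A₂)}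
    {φ : Bits (u + (l + 1)) × Bits (1 + 1) × Bits A₁.rest → ℂ}
    (hΦ : ∀ p μ z d, Φ (stageState A₂ p μ z d) =
      if (z.left.left = (fun _ => false) ∧ z.right = (fun _ => false)) ∧ d = (fun _ => false) then
        φ (p, μ, z.left.right) else 0) {x₀ x₁ : Bits (u + (l + 1))} (hx : x₀ ≠ x₁) (μ c) :
    actL (swapGates A₂) Φ (stageState A₂ x₀ μ
      (Fin.append (Fin.append (fun _ => false) c) fun _ => false) x₁) =
      swapAmp A₂ x₀ x₁ φ (μ, c) := by
  set s₀ := stageState A₂ x₀ μ (Fin.append (Fin.append (fun _ => false) c) fun _ => false) x₁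
    with hs₀
  set Φ₁ := actL (copyKey A₂) Φ with hΦ₁
  set o : StageWire A₂ := toSecond A₂ (A₂.outWire 0) with ho
  have h1 : ∀ p μ z d, Φ₁ (stageState A₂ p μ z d) =
      if z.left.left = (fun _ => false) ∧ z.right = (fun _ => false) then
        (if p = d then φ (p, μ, z.left.right) else 0) else 0 := by
    intro p μ z d
    have e1 := actL_clL (gs := copyKey A₂) isCl_cxLayer Φ (stageState A₂ p μ z (Bits.xor d p))
    have e2 : Bits.xor (Bits.xor d p) p = d := by funext i; simp [Bits.xor]
    have e3 : Bits.xor d p = (fun _ => false) ↔ p = d := by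
      simp only [funext_iff, Bits.xor]
      refine forall_congr' fun i => ?_
      cases d i <;> cases p i <;> simp
    rw [clL_copyKey, e2, hΦ] at e1
    rw [hΦ₁, e1, ite_and]
    exact if_congr Iff.rfl (if_congr e3 rfl rfl) rfl
  have h2 : ∀ p ν z d, (bket s₀ : St (StageWire A₂)) (stageState A₂ p ν z d) =
      if z.left.left = (fun _ => false) ∧ z.right = (fun _ => false) then
        (if p = x₀ ∧ ν = μ ∧ z.left.right = c ∧ d = x₁ then 1 else 0) else 0 := by
    intro p ν z d
    rw [bket_apply, hs₀, ← ite_and]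
    refine if_congr ?_ rfl rfl
    rw [stageState_inj]
    conv_lhs => rw [← append_left_right z, append_inj, ← append_left_right z.left, append_inj]
    tauto
  -- Moving the inverse of the second stage to the other side of the scalar product: the amplitude
  -- compares the forward images of the final and of the initial state.
  have h3 : actL (swapGates A₂) Φ s₀ = ip (actL (secondGates A₂) (bket s₀))
      (actL [QGate.h o, QGate.x o, QGate.h o] (actL (secondGates A₂) Φ₁)) := by
    rw [swapGates, actL_append, actL_append, actL_append]
    exact (ip_bket s₀ _).symm.trans (by rw [ip_actL_right, invL_invL])
  -- Before the second stage key and copy agree, whereas `s₀` has `x₀ ≠ x₁`; so the identity part of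
  -- the reflection `1 - 2P` contributes nothing.
  have h4 : ip (actL (secondGates A₂) (bket s₀)) (actL (secondGates A₂) Φ₁) = 0 := by
    rw [ip_actL, ip_bket, hs₀, h1]
    simp [hx]
  have h5 : ip (actL (secondGates A₂) (bket s₀))
      (actL [QGate.h o, QGate.x o, QGate.h o] (actL (secondGates A₂) Φ₁)) =
      ip (actL (secondGates A₂) (bket s₀)) (actL (secondGates A₂) Φ₁) - 2 * ∑ x,
        if x o = true then star (actL (secondGates A₂) (bket s₀) x) * actL (secondGates A₂) Φ₁ x
        else 0 := by
    rw [ip, ip, Finset.mul_sum, ← Finset.sum_sub_distrib]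
    refine Finset.sum_congr rfl fun x _ => ?_
    rw [actL_hxh]
    split_ifs <;> ring
  rw [h3, h5, h4, zero_sub, ← neg_mul, swapAmp, sum_stageState]
  congr 1
  refine Finset.sum_congr rfl fun q _ => ?_
  have h6 : ∀ ν z d, actL (secondGates A₂) (bket s₀) (stageState A₂ q ν z d) =
      if ν = μ ∧ d = x₁ then hadamardRight q x₀ * actL A₂.qgates
        (bket (Fin.append (Fin.append (Fin.cons true q) c) fun _ => false)) z else 0 := by
    intro ν z d
    rw [actL_secondGates (χ₀ := fun p ν c' d => if p = x₀ ∧ ν = μ ∧ c' = c ∧ d = x₁ then 1 else 0)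
      h2]
    by_cases h : ν = μ ∧ d = x₁
    · rw [if_pos h]
      simp [h.1, h.2, ite_and]
    · rw [if_neg h]
      have : ∀ p c', ¬ (p = x₀ ∧ ν = μ ∧ c' = c ∧ d = x₁) := fun p c' h' => h ⟨h'.2.1, h'.2.2.2⟩
      simp [this]
  have h7 : ∀ z, actL (secondGates A₂) Φ₁ (stageState A₂ q μ z x₁) =
      ∑ c', hadamardRight q x₁ * φ (x₁, μ, c') * actL A₂.qgates
        (bket (Fin.append (Fin.append (Fin.cons true q) c') fun _ => false)) z := by
    intro z
    rw [actL_secondGates (χ₀ := fun p μ c d => if p = d then φ (p, μ, c) else 0) h1]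
    simp
  have h8 : ∀ ν z d, stageState A₂ q ν z d o = z (A₂.outWire 0) := fun ν z d =>
    congrFun (stageState_comp_toSecond q ν z d) (A₂.outWire 0)
  rw [Finset.sum_eq_single μ]
  rotate_left
  · intro ν _ hν
    refine Finset.sum_eq_zero fun z _ => Finset.sum_eq_zero fun d _ => ?_
    have h := (h6 ν z d).trans (if_neg fun h => hν h.1)
    simp [h]
  · simp
  have h9 : ∀ z, (∑ d, if stageState A₂ q μ z d o = true then
      star (actL (secondGates A₂) (bket s₀) (stageState A₂ q μ z d)) *
        actL (secondGates A₂) Φ₁ (stageState A₂ q μ z d) else 0) =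
      if z (A₂.outWire 0) = true then star (hadamardRight q x₀ * actL A₂.qgates
        (bket (Fin.append (Fin.append (Fin.cons true q) c) fun _ => false)) z) *
        ∑ c', hadamardRight q x₁ * φ (x₁, μ, c') * actL A₂.qgates
          (bket (Fin.append (Fin.append (Fin.cons true q) c') fun _ => false)) z else 0 := by
    intro z
    rw [Finset.sum_eq_single x₁]
    · rw [h8, (h6 μ z x₁).trans (if_pos ⟨rfl, rfl⟩), h7]
    · intro d _ hd
      have h := (h6 μ z d).trans (if_neg fun h => hd h.2)
      simp [h]
    · simp
  simp only [h9]
  -- Splitting the final string into output bit and rest, the projection keeps output 1, as in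
  -- `swapAmp`.
  rw [← A₂.sum_iso, Fintype.sum_prod_type, sum_bits_succ]
  have hb : ∀ b : Bool, ∀ y : Bits 0, (Fin.cons b y : Bits 1) = fun _ => b := fun b y => by
    funext i
    exact Fin.cases rfl (fun i => i.elim0) i
  have hw : ∀ (b : Bool) (c'' : Bits A₂.rest), Fin.append (fun _ : Fin 1 => b) c''
      (Fin.cast A₂.size_eq.symm (A₂.outWire 0)) = b := fun b c'' => by
    simp only [QCircuit.outWire, Fin.cast_cast, Fin.cast_eq_self]
    exact Fin.append_left _ _ _
  simp only [hb, hw, Bool.false_eq_true, if_false, if_true, Finset.sum_const_zero, zero_add,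
    Finset.univ_unique, Finset.sum_singleton]
  refine Finset.sum_congr rfl fun c'' _ => ?_
  simp only [A₂.iso_eq]
  rw [mul_comm (hadamardRight q x₀)]
  congr 1
  refine Finset.sum_congr rfl fun c' _ => ?_
  ring

end

/-! ### Choosing the guesses, and collecting the bounds. -/

section
variable {κ : ℕ}

/-- The last bits of a number. -/
def bitsOf (κ x : ℕ) : Bits κ := fun t => Nat.testBit x t

theorem agree_bitsOf {x i : ℕ} (hx : x < 2 ^ κ) (hi : i < 2 ^ κ) :
    agree (bitsOf κ x) κ i = true ↔ i = x := by
  rw [agree, decide_eq_true_iff]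
  refine ⟨fun h => Nat.eq_of_testBit_eq fun t => ?_, fun h s _ => by rw [h, bitsOf]⟩
  by_cases ht : t < κ
  · exact (h ⟨t, ht⟩ ht).symm
  · have hp : 2 ^ κ ≤ 2 ^ t := Nat.pow_le_pow_right (by norm_num) (not_lt.1 ht)
    rw [Nat.testBit_eq_false_of_lt (hi.trans_le hp), Nat.testBit_eq_false_of_lt (hx.trans_le hp)]

/-- Cauchy–Schwarz for the uniform distribution: `D` is the reciprocal of the number of points. -/
theorem mul_sum_sqrt_le {X : Type} [Fintype X] {D : ℝ} (hD : D * Fintype.card X = 1) (F : X → ℝ)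
    (hF : ∀ x, 0 ≤ F x) : D * ∑ x, √(F x) ≤ √(D * ∑ x, F x) := by
  refine Real.le_sqrt_of_sq_le ?_
  have h := sq_sum_le_card_mul_sum_sq (s := Finset.univ) (f := fun x => √(F x))
  simp only [Real.sq_sqrt (hF _), Finset.card_univ] at h
  calc (D * ∑ x, √(F x)) ^ 2 = D ^ 2 * (∑ x, √(F x)) ^ 2 := by ring
    _ ≤ D ^ 2 * (Fintype.card X * ∑ x, F x) := mul_le_mul_of_nonneg_left h (sq_nonneg D)
    _ = D * Fintype.card X * (D * ∑ x, F x) := by ring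
    _ = D * ∑ x, F x := by rw [hD, one_mul]

end

section
variable {u l m v b κ : ℕ}

theorem left_keyString (sign : Bits (u + 1) → Bits l) (α : Bool) (s : Bits u) :
    (keyString sign (Fin.cons α s)).left = s := by
  rw [keyString, left_append, Fin.tail_cons]

theorem right_keyString (sign : Bits (u + 1) → Bits l) (α : Bool) (s : Bits u) :
    (keyString sign (Fin.cons α s)).right 0 = α := by
  rw [keyString, right_append, Fin.cons_zero, Fin.cons_zero]

/-- The number `m` is the index of no key but fits into `κ` bits; this guess selects nothing, and
all qubits `A` stay in superposition. -/
theorem compatible_eq_univ (hκ : m < 2 ^ κ) (f : Fin m → Bool) :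
    compatible (bitsOf κ m) f = Finset.univ := by
  rw [compatible, Finset.filter_true_of_mem]
  intro f' _ i hi
  exact absurd ((agree_bitsOf hκ (i.2.trans hκ)).1 hi) i.2.ne

theorem compatible_eq_fixBit (hκ : m < 2 ^ κ) (i : Fin m) (a : Bool) :
    compatible (bitsOf κ i) (fun _ => a) = fixBit i a := by
  rw [compatible, fixBit]
  refine Finset.filter_congr fun f' _ => ⟨fun h => h i ?_, fun h i' hi => ?_⟩
  · exact (agree_bitsOf (i.2.trans hκ) (i.2.trans hκ)).2 rfl
  · rw [← Fin.ext ((agree_bitsOf (i.2.trans hκ) (i'.2.trans hκ)).1 hi)] at h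
    exact h

/-- For the selected key, the signature of the other message is never requested; this is what makes
that signature a forgery. -/
theorem asks_fixed (hκ : m < 2 ^ κ) (i : Fin m) (a : Bool) {x : Bool × Fin m}
    (h : asks (bitsOf κ i) (fun _ => a) x = true) : x.2 = i → x.1 = a := by
  obtain ⟨α, i'⟩ := x
  rintro rfl
  have h1 := (agree_bitsOf (i'.2.trans hκ) (i'.2.trans hκ)).2 rfl
  simp only [asks] at h
  rw [h1] at h
  cases a <;> cases α <;> first | rfl | exact Bool.noConfusion h

variable (A₁ : QCircuit (v + m * (u + (l + 1))) (u + (l + 1) + (1 + 1)))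
  (A₂ : QCircuit (u + (l + 1) + 1 + A₁.rest) 1)
  (ver : Bits (u + 1) → Bits l → Bool) (sign : Bits (u + 1) → Bits l) (vk : Bits v)

/-- The squared norm of `swapAmp` is the probability that the forger ends with `x₀` in the key
register, `x₁` in the copy and the auxiliary wires at zero; other outcomes are not counted.
Acceptance of `x₀` is part of the hypothesis on `P`. -/
theorem nsq_swapAmp_le (j : Bits κ) (f : Fin m → Bool) (P : (Fin m → Bits u) → Prop)
    [DecidablePred P] (x₀ x₁ : (Fin m → Bits u) → Bits (u + (l + 1))) (hx : ∀ r, x₀ r ≠ x₁ r)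
    (hP : ∀ r, P r → Accepted ver (x₀ r) ∧
      ∀ x, asks j f x = true → x₀ r ≠ keyString sign (Fin.cons x.1 (r x.2))) :
    (1 / 2) ^ (κ + m * u) * ∑ r, (if P r then nsq (swapAmp A₂ (x₀ r) (x₁ r)
      (firstState A₁ sign vk r (compatible j f))) else 0) ≤
      (forger A₁ κ (firstGates A₁ ++ swapGates A₂)).winProb sign ver vk := by
  refine le_trans (mul_le_mul_of_nonneg_left (Finset.sum_le_sum fun r _ => ?_) (by positivity))
    (le_winProb_forger sign ver vk (firstGates A₁ ++ swapGates A₂) j f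
      (fun r q => P r ∧ q ∘ keyWire A₁ = x₀ r) fun r q h => by rw [h.2]; exact hP r h.1)
  by_cases hr : P r
  swap
  · rw [if_neg hr]
    exact Finset.sum_nonneg fun q _ => by positivity
  rw [if_pos hr, nsq]
  refine sum_le_sum_of_injective (e := fun x => stageState A₂ (x₀ r) x.1
    (Fin.append (Fin.append (fun _ => false) x.2) fun _ => false) (x₁ r)) (fun x y h => ?_)
    (fun q => by positivity) fun x => ?_
  · obtain ⟨-, h1, h2, -⟩ := stageState_inj.1 h
    exact Prod.ext h1 (append_inj.1 (append_inj.1 h2).1).2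
  · rw [stageState_comp_keyWire, if_pos ⟨hr, rfl⟩, actL_append]
    refine le_of_eq (congrArg (fun z : ℂ => ‖z‖ ^ 2) (actL_swapGates (fun p μ z d => ?_)
      (hx r) x.1 x.2).symm)
    rw [stageState, actL_firstGates]
    refine if_congr ?_ rfl rfl
    constructor
    · intro h
      have h1 := fun w => congrFun h w
      exact ⟨⟨funext fun i => h1 (.inl i), funext fun i => h1 (.inr (.inl i))⟩,
        funext fun i => h1 (.inr (.inr i))⟩
    · rintro ⟨⟨h1, h2⟩, h3⟩
      rw [h1, h2, h3]
      funext w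
      rcases w with w | w | w <;> rfl

/-- The bounds on the probabilities that the forgers obtain a signature that they did not query. -/
theorem forgery_bounds (hκ : m < 2 ^ κ) {w₀ w₁ : ℝ}
    (h₀ : (forger A₁ κ (firstGates (b := 0) A₁)).winProb sign ver vk = w₀)
    (h₁ : (forger A₁ κ (firstGates A₁ ++ swapGates A₂)).winProb sign ver vk = w₁) :
    ((1 / 2) ^ (κ + m * u) * ∑ r : Fin m → Bits u, (open Classical in if Function.Injective r then
      nsq (mask (fun p => (Accepted ver p ∧ p.right 0 = false) ∧
        ∀ i, p ≠ keyString sign (Fin.cons false (r i))) (firstState A₁ sign vk r Finset.univ))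
      else 0) ≤ w₀) ∧
    (∀ i : Fin m, (1 / 2) ^ (κ + m * u) * ∑ r : Fin m → Bits u, (open Classical in
      if Function.Injective r then
        nsq (mask (fun p => Accepted ver p ∧ p = keyString sign (Fin.cons false (r i)))
          (firstState A₁ sign vk r (fixBit i true))) else 0) ≤ w₀) ∧
    (∀ i : Fin m, (1 / 2) ^ (κ + m * u) * ∑ r : Fin m → Bits u, (open Classical in
      if Function.Injective r then
        nsq (mask (fun p => (Accepted ver p ∧ p.right 0 = true) ∧ p.left = r i)
          (firstState A₁ sign vk r (fixBit i false))) else 0) ≤ w₀) ∧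
    (∀ i : Fin m, (1 / 2) ^ (κ + m * u) * ∑ r : Fin m → Bits u, (open Classical in
      if Function.Injective r then
        nsq (mask (fun p => ((Accepted ver p ∧ p.right 0 = true) ∧ p.left = r i) ∧
          p ≠ keyString sign (Fin.cons true (r i))) (firstState A₁ sign vk r (fixBit i true)))
      else 0) ≤ w₀) ∧
    ∀ i : Fin m, (1 / 2) ^ (κ + m * u) * ∑ r : Fin m → Bits u, (open Classical in
      if Function.Injective r then
        (if Accepted ver (keyString sign (Fin.cons false (r i))) then
          nsq (swapAmp A₂ (keyString sign (Fin.cons false (r i)))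
            (keyString sign (Fin.cons true (r i))) (firstState A₁ sign vk r (fixBit i true))) else 0)
      else 0) ≤ w₁ := by
  classical
  have hl := left_keyString sign
  have hr' := right_keyString sign
  have key : ∀ (x : Fin (m + 1)) (f : Fin m → Bool)
      (P : (Fin m → Bits u) → Bits (u + (l + 1)) → Prop) [∀ r, DecidablePred (P r)],
      (∀ r p, Function.Injective r → P r p → Accepted ver p ∧ ∀ x', asks (bitsOf κ x) f x' = true →
        p ≠ keyString sign (Fin.cons x'.1 (r x'.2))) →
      (1 / 2) ^ (κ + m * u) * ∑ r : Fin m → Bits u, (if Function.Injective r then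
        nsq (mask (P r) (firstState A₁ sign vk r (compatible (bitsOf κ x) f))) else 0) ≤ w₀ := by
    intro x f P _ hP
    rw [← h₀]
    refine le_trans (le_of_eq ?_) (nsq_mask_firstState_le A₁ sign vk ver (bitsOf κ x) f
      (fun r p => Function.Injective r ∧ P r p) fun r p h => hP r p h.1 h.2)
    congr 1
    refine Finset.sum_congr rfl fun r _ => ?_
    by_cases hi : Function.Injective r
    · rw [if_pos hi]
      congr 1
      funext y
      simp [mask_apply, hi]
    · rw [if_neg hi, nsq]
      simp [mask_apply, hi]
  have hf : ∀ i : Fin m, (bitsOf κ (Fin.castSucc i).val) = bitsOf κ i := fun i => rfl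
  refine ⟨?_, fun i => ?_, fun i => ?_, fun i => ?_, fun i => ?_⟩
  -- No key is selected here. The string may be an unqueried message or a second signature of a
  -- queried one; for the latter strong unforgeability is needed.
  · have h := key (Fin.last m) (fun _ => false) (fun r p => (Accepted ver p ∧ p.right 0 = false) ∧
        ∀ i, p ≠ keyString sign (Fin.cons false (r i))) ?_
    · rw [Fin.val_last, compatible_eq_univ hκ] at h
      exact h
    · rintro r p hr ⟨⟨h1, h2⟩, h3⟩
      refine ⟨h1, ?_⟩
      rintro ⟨α, i⟩ - h4
      rcases α with _ | _
      · exact h3 i h4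
      · rw [h4, hr'] at h2
        exact Bool.noConfusion h2
  -- Key `i` is measured to be 1, so only `1‖rᵢ` was asked for it; no other key has the same string
  -- because `r` is injective.
  · have h := key i.castSucc (fun _ => true)
      (fun r p => Accepted ver p ∧ p = keyString sign (Fin.cons false (r i))) ?_
    · rw [hf, compatible_eq_fixBit hκ] at h
      exact h
    · rintro r p hr ⟨h1, h2⟩
      refine ⟨h1, ?_⟩
      rintro ⟨α, i'⟩ ha h4
      have h5 := keyString_inj.1 (h2.symm.trans h4)
      have h6 : i = i' := hr (Fin.cons_inj.1 h5).2
      exact Bool.noConfusion ((Fin.cons_inj.1 h5).1.trans (asks_fixed hκ i true ha h6.symm))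
  -- The mirror image: key `i` is measured to be 0, so every accepted signature of `1‖rᵢ` is new.
  · have h := key i.castSucc (fun _ => false)
      (fun r p => (Accepted ver p ∧ p.right 0 = true) ∧ p.left = r i) ?_
    · rw [hf, compatible_eq_fixBit hκ] at h
      exact h
    · rintro r p hr ⟨⟨h1, h2⟩, h3⟩
      refine ⟨h1, ?_⟩
      rintro ⟨α, i'⟩ ha h4
      rw [h4, hl] at h3
      rw [h4, hr'] at h2
      exact Bool.noConfusion (h2.symm.trans (asks_fixed hκ i false ha (hr h3)))
  -- Here `1‖rᵢ` was asked, but the string carries another signature; strong unforgeability is used.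
  · have h := key i.castSucc (fun _ => true)
      (fun r p => ((Accepted ver p ∧ p.right 0 = true) ∧ p.left = r i) ∧
          p ≠ keyString sign (Fin.cons true (r i))) ?_
    · rw [hf, compatible_eq_fixBit hκ] at h
      exact h
    · rintro r p hr ⟨⟨⟨h1, h2⟩, h3⟩, h5⟩
      refine ⟨h1, ?_⟩
      rintro ⟨α, i'⟩ ha h4
      rw [h4, hl] at h3
      rw [h4, hr'] at h2
      refine h5 ?_
      rw [h4, ← h3, ← h2]
  -- The forger that runs both stages, with key `i` measured to be 1, obtains the signature of
  -- `0‖rᵢ`, which it did not ask for.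
  · rw [← h₁, ← compatible_eq_fixBit hκ]
    refine le_trans (le_of_eq ?_) (nsq_swapAmp_le A₁ A₂ ver sign vk (bitsOf κ i) (fun _ => true)
      (fun r => Function.Injective r ∧ Accepted ver (keyString sign (Fin.cons false (r i))))
      (fun r => keyString sign (Fin.cons false (r i)))
      (fun r => keyString sign (Fin.cons true (r i))) (fun r h => ?_) fun r h => ⟨h.2, ?_⟩)
    · congr 1
      refine Finset.sum_congr rfl fun r _ => ?_
      rw [← ite_and]
    · exact Bool.noConfusion (Fin.cons_inj.1 (keyString_inj.1 h)).1
    · rintro ⟨α, i'⟩ ha h4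
      have h5 := keyString_inj.1 h4
      have h6 : i = i' := h.1 (Fin.cons_inj.1 h5).2
      exact Bool.noConfusion ((Fin.cons_inj.1 h5).1.trans (asks_fixed hκ i true ha h6.symm))

open Classical in
-- One bound without a selected key, and for each key three with the first forger and one with the
-- second. Each passes from squared norms to norms by Cauchy–Schwarz.
theorem sum_forgeryNorm_le (hκ : m < 2 ^ κ) {w₀ w₁ : ℝ}
    (h₀ : (forger A₁ κ (firstGates (b := 0) A₁)).winProb sign ver vk = w₀)
    (h₁ : (forger A₁ κ (firstGates A₁ ++ swapGates A₂)).winProb sign ver vk = w₁) :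
    ((2 ^ u : ℝ)⁻¹) ^ m * ∑ r : Fin m → Bits u,
      (if Function.Injective r then forgeryNorm A₁ A₂ ver sign vk r else 0) ≤
      (1 + 3 * m) * √(2 ^ κ * w₀) + m * √(2 ^ κ * w₁) := by
  obtain ⟨b0, b1, b2, b3, b4⟩ := forgery_bounds A₁ A₂ ver sign vk hκ h₀ h₁
  -- The game averages over `r` only, the forger also over its guess; the factor `2 ^ κ` is the
  -- price of guessing.
  have hD : ((2 ^ u : ℝ)⁻¹) ^ m = 2 ^ κ * (1 / 2) ^ (κ + m * u) := by
    rw [pow_add, ← mul_assoc, ← mul_pow, mul_comm m u, pow_mul, ← inv_pow, ← one_div]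
    norm_num
  have hcard : ((2 ^ u : ℝ)⁻¹) ^ m * Fintype.card (Fin m → Bits u) = 1 := by
    simp
  have key : ∀ (F : (Fin m → Bits u) → ℝ) (w : ℝ), (∀ r, 0 ≤ F r) →
      (1 / 2) ^ (κ + m * u) * ∑ r, (if Function.Injective r then F r else 0) ≤ w →
      ((2 ^ u : ℝ)⁻¹) ^ m * ∑ r, (if Function.Injective r then √(F r) else 0) ≤ √(2 ^ κ * w) := by
    intro F w hF h
    have h1 : ∀ r : Fin m → Bits u, (if Function.Injective r then √(F r) else 0) =
        √(if Function.Injective r then F r else 0) := fun r => by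
      split_ifs <;> simp
    simp only [h1]
    refine (mul_sum_sqrt_le hcard _ fun r => ?_).trans (Real.sqrt_le_sqrt ?_)
    · split_ifs
      · exact hF r
      · exact le_rfl
    · rw [hD, mul_assoc]
      exact mul_le_mul_of_nonneg_left h (by positivity)
  have e : ∀ r : Fin m → Bits u, (if Function.Injective r then forgeryNorm A₁ A₂ ver sign vk r else 0) =
      (if Function.Injective r then √(nsq (mask (fun p => (Accepted ver p ∧ p.right 0 = false) ∧
      ∀ i, p ≠ keyString sign (Fin.cons false (r i))) (firstState A₁ sign vk r Finset.univ))) else 0) +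
    ∑ i, ((if Function.Injective r then
        √(nsq (mask (fun p => Accepted ver p ∧ p = keyString sign (Fin.cons false (r i)))
        (firstState A₁ sign vk r (fixBit i true)))) else 0) +
      (if Function.Injective r then
        √(nsq (mask (fun p => (Accepted ver p ∧ p.right 0 = true) ∧ p.left = r i)
        (firstState A₁ sign vk r (fixBit i false)))) else 0) +
      (if Function.Injective r then
        √(nsq (mask (fun p => ((Accepted ver p ∧ p.right 0 = true) ∧ p.left = r i) ∧
        p ≠ keyString sign (Fin.cons true (r i))) (firstState A₁ sign vk r (fixBit i true)))) else 0) +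
      (if Function.Injective r then
        √(if Accepted ver (keyString sign (Fin.cons false (r i))) then
        nsq (swapAmp A₂ (keyString sign (Fin.cons false (r i)))
          (keyString sign (Fin.cons true (r i))) (firstState A₁ sign vk r (fixBit i true))) else 0)
        else 0)) := by
    intro r
    by_cases hr : Function.Injective r
    · simp only [if_pos hr, forgeryNorm]
    · simp only [if_neg hr, add_zero, Finset.sum_const_zero]
  have c0 := key _ _ (fun r => nsq_nonneg _) b0
  have c1 := fun i => key _ _ (fun r => nsq_nonneg _) (b1 i)
  have c2 := fun i => key _ _ (fun r => nsq_nonneg _) (b2 i)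
  have c3 := fun i => key _ _ (fun r => nsq_nonneg _) (b3 i)
  have c4 := fun i => key _ _ (fun r => by split_ifs; exacts [nsq_nonneg _, le_rfl]) (b4 i)
  simp only [e]
  rw [Finset.sum_add_distrib, Finset.sum_comm, mul_add,
    Finset.mul_sum Finset.univ (fun i : Fin m => _)]
  refine (add_le_add c0 (Finset.sum_le_sum fun i _ => (?_ : _ ≤
    3 * √(2 ^ κ * w₀) + √(2 ^ κ * w₁)))).trans (le_of_eq ?_)
  · simp only [Finset.sum_add_distrib, mul_add]
    have := c1 i
    have := c2 i
    have := c3 i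
    have := c4 i
    linarith
  · rw [Finset.sum_const, Finset.card_univ, Fintype.card_fin, nsmul_eq_mul]
    ring

end

/-! ## The forgers run in polynomial time -/

theorem map_pairs {a b : ℕ} {β : Type} (F : Fin a × Fin b → β) :
    (pairs a b).map F =
      (List.finRange a).flatMap fun i => (List.finRange b).map fun j => F (i, j) := by
  simp only [pairs, List.product, List.map_flatMap, List.map_map, Function.comp_def]

theorem map_boolPairs {a : ℕ} {β : Type} (F : Bool × Fin a → β) :
    (boolPairs a).map F = ((List.finRange a).map fun i => F (false, i)) ++
      (List.finRange a).map fun i => F (true, i) := by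
  simp [boolPairs, List.product, Function.comp_def]

theorem finRange_map_eq {k : ℕ} {β : Type} {F : Fin k → β} {R : ℕ → β} (h : ∀ i, F i = R i.val) :
    (List.finRange k).map F = (List.range k).map R := by
  rw [← List.map_coe_finRange_eq_range, List.map_map]
  exact List.map_congr_left fun i _ => h i

theorem val_finTwoEquiv_symm (c : Bool) : (finTwoEquiv.symm c).val = c.toNat := by
  cases c <;> rfl

section
variable {α : Type} [TreeCode α] {β : Type} [TreeCode β]

theorem PolyTime.pairs_map {k k' : α → ℕ} (hk : PolyTime k) (hk' : PolyTime k')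
    {F : ∀ x, Fin (k x) × Fin (k' x) → β} {R : α → ℕ → ℕ → β}
    (hR : PolyTime fun p : (α × ℕ) × ℕ => R p.1.1 p.1.2 p.2)
    (h : ∀ x i j, F x (i, j) = R x i.val j.val) : PolyTime fun x => (pairs (k x) (k' x)).map (F x) := by
  simp only [map_pairs]
  refine PolyTime.finRange_flatMap hk (R := fun x i => (List.range (k' x)).map (R x i))
    (PolyTime.listMap (f := fun p : α × ℕ => List.range (k' p.1)) (by fun_prop) hR)
    fun x i => finRange_map_eq (h x i)

theorem PolyTime.boolPairs_map {k : α → ℕ} (hk : PolyTime k)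
    {F : ∀ x, Bool × Fin (k x) → β} {R : α → ℕ → ℕ → β}
    (hR : PolyTime fun p : (α × ℕ) × ℕ => R p.1.1 p.1.2 p.2)
    (h : ∀ x c i, F x (c, i) = R x c.toNat i.val) : PolyTime fun x => (boolPairs (k x)).map (F x) := by
  simp only [map_boolPairs]
  have h0 : PolyTime fun p : α × ℕ => R p.1 0 p.2 := by
    have : PolyTime fun p : α × ℕ => ((p.1, 0), p.2) := by fun_prop
    exact hR.comp this
  have h1 : PolyTime fun p : α × ℕ => R p.1 1 p.2 := by
    have : PolyTime fun p : α × ℕ => ((p.1, 1), p.2) := by fun_prop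
    exact hR.comp this
  exact PolyTime.listAppend (PolyTime.finRange_map hk h0 fun x i => h x false i)
    (PolyTime.finRange_map hk h1 fun x i => h x true i)

end

section
variable {v m u l a b κ : ℕ → ℕ} (hv : PolyTime v) (hm : PolyTime m) (hu : PolyTime u)
  (hl : PolyTime l) (ha : PolyTime a) (hb : PolyTime b) (hκ : PolyTime κ)

/-- The numbers of the wires of the forgers. -/
abbrev forgerNum (v m u l a b κ : ℕ → ℕ) (n : ℕ) :
    FWire (v n) (m n) (u n) (l n) (a n) (u n + (l n + 1)) (b n) (κ n) → ℕ :=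
  fun w => (wireEquiv w).val

/-- The number of wires before those that control the queries. -/
abbrev ctlStart (v m u l a b : ℕ → ℕ) (n : ℕ) : ℕ :=
  v n + m n * (u n + (l n + 1)) + a n + (u n + (l n + 1) + 1 + (b n + (u n + (l n + 1))))

include hv hm hu hl ha hb

theorem polyTime_ctlStart : PolyTime (ctlStart v m u l a b) := by
  unfold ctlStart
  fun_prop

include hκ

theorem polyWires_superposed :
    PolyWires (forgerNum v m u l a b κ) (fun n => (superposed : Fin (κ n + (m n * u n + m n)) ↪
      FWire (v n) (m n) (u n) (l n) (a n) (u n + (l n + 1)) (b n) (κ n))) := by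
  have hC := polyTime_ctlStart hv hm hu hl ha hb
  have h1 : PolyWires (forgerNum v m u l a b κ) fun n (t : Fin (κ n)) => wCoin (true, t) :=
    .of hκ (R := fun n t => ctlStart v m u l a b n + (t + κ n * 1)) (by fun_prop) fun _ _ => rfl
  have h2 : PolyWires (forgerNum v m u l a b κ) fun n (t : Fin (m n * u n)) =>
      wR (finProdFinEquiv.symm t) := by
    refine .of (hm.mul hu) (R := fun n t => ctlStart v m u l a b n + (2 * κ n + t)) (by fun_prop)
      fun n t => ?_
    obtain ⟨x, rfl⟩ := finProdFinEquiv.surjective t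
    rw [Equiv.symm_apply_apply]
    rfl
  have h3 : PolyWires (forgerNum v m u l a b κ) fun n (i : Fin (m n)) => wA i :=
    .of hm (R := fun n i => v n + (u n + 0 + (u n + (l n + 1)) * i)) (by fun_prop) fun _ _ => rfl
  exact h1.append (h2.append h3)

/-- The expressions in `R` are the wire numbers given by `wireEquiv`: offsets of the blocks plus `j
+ n * i` for a pair `(i, j)`, as in `finProdFinEquiv`. With them spelled out, the gate lists are
visibly polynomial time. -/
theorem polyGates_prepare : PolyGates (forgerNum v m u l a b κ) (fun _ => prepare) := by
  have hC := polyTime_ctlStart hv hm hu hl ha hb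
  unfold prepare
  refine .append ?_ (.append ?_ (.append ?_ (.append ?_ (.append ?_ (.append ?_ (.append ?_
    (.append ?_ ?_))))))) <;> unfold PolyGates <;> simp only [List.map_map]
  · exact PolyTime.finRange_map hκ (R := fun n t => (0, [ctlStart v m u l a b n + (t + κ n * 0)]))
      (by fun_prop) fun _ _ => rfl
  · exact PolyTime.finRange_map hm (R := fun n i => (0, [ctlStart v m u l a b n +
      (2 * κ n + (m n * u n + (i + m n * 0)))])) (by fun_prop) fun _ _ => rfl
  · refine PolyTime.boolPairs_map hm (R := fun n c i => (0, [ctlStart v m u l a b n +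
      (2 * κ n + (m n * u n + ((κ n + 1) * m n + (i + m n * c))))])) (by fun_prop) fun n c i => ?_
    cases c <;> rfl
  · have : PolyTime fun n => [((0 : ℕ), [ctlStart v m u l a b n + (2 * κ n + (m n * u n +
        ((κ n + 1) * m n + (2 * m n + (2 * m n * l n + 1)))))])] := by fun_prop
    exact this.of_code_eq fun _ => rfl
  · exact PolyTime.finRange_map hκ (R := fun n t => (1, [ctlStart v m u l a b n + (t + κ n * 1),
      ctlStart v m u l a b n + (t + κ n * 0)])) (by fun_prop) fun _ _ => rfl
  · simp only [List.map_flatMap, selectStep, List.map_map]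
    refine PolyTime.finRange_flatMap hκ (R := fun n t => (List.range (m n)).map fun i =>
      (2, [ctlStart v m u l a b n + (2 * κ n + (m n * u n + (i + m n * t))),
        ctlStart v m u l a b n + (t + κ n * (i / 2 ^ t % 2)),
        ctlStart v m u l a b n + (2 * κ n + (m n * u n + (i + m n * (t + 1))))]))
      (by fun_prop) fun n t => finRange_map_eq fun i => ?_
    -- The control wire depends on a binary digit of the index of the key, which is computed by
    -- division and parity.
    rw [← Nat.toNat_testBit, ← val_finTwoEquiv_symm]
    rfl
  · refine PolyTime.boolPairs_map hm (R := fun n c i => (2, [ctlStart v m u l a b n +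
      (2 * κ n + (m n * u n + (i + m n * κ n))), v n + (u n + 0 + (u n + (l n + 1)) * i),
      ctlStart v m u l a b n + (2 * κ n + (m n * u n + ((κ n + 1) * m n + (i + m n * c))))]))
      (by fun_prop) fun n c i => ?_
    cases c <;> rfl
  · exact PolyTime.finRange_map hm (R := fun n i => (1, [ctlStart v m u l a b n +
      (2 * κ n + (m n * u n + (i + m n * κ n))),
      ctlStart v m u l a b n + (2 * κ n + (m n * u n + ((κ n + 1) * m n + (i + m n * 1))))]))
      (by fun_prop) fun _ _ => rfl
  · exact PolyTime.pairs_map hm hu (R := fun n i j => (1, [ctlStart v m u l a b n +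
      (2 * κ n + (j + u n * i)), v n + (j + (u n + (l n + 1)) * i)])) (by fun_prop) fun _ _ _ => rfl

theorem polyGates_fillB : PolyGates (forgerNum v m u l a b κ) (fun _ => fillB) := by
  have hC := polyTime_ctlStart hv hm hu hl ha hb
  unfold fillB
  refine .append ?_ (.append ?_ ?_) <;> unfold PolyGates <;> simp only [List.map_map]
  · exact PolyTime.pairs_map hm hl (R := fun n i j => (1, [ctlStart v m u l a b n + (2 * κ n +
      (m n * u n + ((κ n + 1) * m n + (2 * m n + (j + l n * (i + m n * 0)))))),
      v n + (u n + (j + 1) + (u n + (l n + 1)) * i)])) (by fun_prop) fun _ _ _ => rfl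
  · exact PolyTime.pairs_map hm hl (R := fun n i j => (2, [v n + (u n + 0 + (u n + (l n + 1)) * i),
      ctlStart v m u l a b n + (2 * κ n +
      (m n * u n + ((κ n + 1) * m n + (2 * m n + (j + l n * (i + m n * 0)))))),
      v n + (u n + (j + 1) + (u n + (l n + 1)) * i)])) (by fun_prop) fun _ _ _ => rfl
  · exact PolyTime.pairs_map hm hl (R := fun n i j => (2, [v n + (u n + 0 + (u n + (l n + 1)) * i),
      ctlStart v m u l a b n + (2 * κ n +
      (m n * u n + ((κ n + 1) * m n + (2 * m n + (j + l n * (i + m n * 1)))))),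
      v n + (u n + (j + 1) + (u n + (l n + 1)) * i)])) (by fun_prop) fun _ _ _ => rfl

end

/-! ### Descriptions of the forgers. -/

section
variable {s t : ℕ} {ι : Type} {N : ℕ}

/-- The description of a gate of an oracle circuit, in terms of its kind and wires. -/
def gateCode (g : ℕ × List ℕ) : Data := .cons .nil (TreeCode.code g)

/-- The description of a query, in terms of its wires. -/
def queryCode (x : ℕ × List ℕ × List ℕ) : Data := .cons (Data.ofNat 1) (TreeCode.code x)

theorem encode_gate (f : ι ≃ Fin N) (g : QGate ι) :
    ((QOp.gate g : QOp ι s t).toOp f).encode = gateCode (g.raw fun w => (f w).val) := by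
  simp only [QOp.toOp, OracleOp.encode, QGate.encode_toGate, gateCode, QGate.code_raw]
  exact congrArg _ (QGate.enc_map _ _ _)

theorem ofWires_ofFn {k : ℕ} (e : Fin k → Fin N) :
    Data.ofWires (List.ofFn e) = TreeCode.code (List.ofFn fun i => (e i).val) := by
  have h : ∀ L : List (Fin N), Data.ofWires L = TreeCode.code (L.map Fin.val) := by
    intro L
    induction L with
    | nil => rfl
    | cons i L ih => exact congrArg (Data.cons _) ih
  rw [h, List.map_ofFn]
  rfl

theorem encode_query (f : ι ≃ Fin N) (c : ι) (q : Fin s → ι) (a : Fin t → ι) :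
    ((QOp.query c q a : QOp ι s t).toOp f).encode = queryCode ((f c).val,
      List.ofFn fun j => (f (q j)).val, List.ofFn fun j => (f (a j)).val) := by
  simp only [QOp.toOp, OracleOp.encode, queryCode, ofWires_ofFn]
  rfl

end

section
variable {v m u l b κ : ℕ → ℕ} (hv : PolyTime v) (hm : PolyTime m) (hu : PolyTime u)
  (hl : PolyTime l) (hb : PolyTime b) (hκ : PolyTime κ)
  {A₁ : ∀ n, QCircuit (v n + m n * (u n + (l n + 1))) (u n + (l n + 1) + (1 + 1))} (hA : QPT A₁)

/-- The numbers of the wires of the two stages. -/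
abbrev stageNum (A₁ : ∀ n, QCircuit (v n + m n * (u n + (l n + 1))) (u n + (l n + 1) + (1 + 1)))
    (b : ℕ → ℕ) (n : ℕ) : Fin (v n + m n * (u n + (l n + 1)) + (A₁ n).anc) ⊕
      SndWire (u n + (l n + 1)) (b n) → ℕ
  | .inl i => i
  | .inr x => v n + m n * (u n + (l n + 1)) + (A₁ n).anc + (sndEquiv x).val

include hv hm hu hl hb hκ hA

theorem polyTimeGenerated_forger {gs : ∀ n, List (QGate (Fin (v n + m n * (u n + (l n + 1)) +
    (A₁ n).anc) ⊕ SndWire (u n + (l n + 1)) (b n)))} (hgs : PolyGates (stageNum A₁ b) gs) :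
    PolyTimeGenerated fun n => (forger (A₁ n) (κ n) (gs n)).encode := by
  have ha := ((qpt_iff A₁).1 hA).1
  set a := fun n => (A₁ n).anc with ha'
  have hC := polyTime_ctlStart hv hm hu hl ha hb
  -- The wires of both stages keep their numbers inside the forger, so gates of the adversary are
  -- copied without renumbering.
  have hU : ∀ n w, forgerNum v m u l a b κ n (unmeasured w) = stageNum A₁ b n w := by
    rintro n (w | w)
    · change (fstEquiv (fstEquiv.symm w)).val = w.val
      rw [Equiv.apply_symm_apply]
    · rfl
  have g1 : PolyGates (forgerNum v m u l a b κ) fun n =>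
      hLayer (superposed : Fin (κ n + (m n * u n + m n)) ↪
        FWire (v n) (m n) (u n) (l n) (a n) (u n + (l n + 1)) (b n) (κ n)) ++ prepare :=
    .append (.hLayer (polyWires_superposed hv hm hu hl ha hb hκ))
      (polyGates_prepare hv hm hu hl ha hb hκ)
  have g2 : PolyGates (forgerNum v m u l a b κ) fun n =>
      fillB ++ (gs n).map (QGate.map unmeasured) := by
    refine .append (polyGates_fillB hv hm hu hl ha hb hκ) ?_
    unfold PolyGates at hgs ⊢
    simp only [List.map_map]
    refine hgs.of_code_eq fun n => ?_
    congr 1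
    refine List.map_congr_left fun g _ => ?_
    have h := funext (hU n)
    rw [← h]
    cases g <;> rfl
  unfold PolyGates at g1 g2
  have hc : PolyTime gateCode := by
    unfold gateCode
    fun_prop
  have hq : PolyTime queryCode := by
    unfold queryCode
    fun_prop
  have q : PolyTime fun n => (boolPairs (m n)).map fun p => ((keyQuery p :
      QOp (FWire (v n) (m n) (u n) (l n) (a n) (u n + (l n + 1)) (b n) (κ n)) (u n + 1) (l n)).toOp
        wireEquiv).encode := by
    refine PolyTime.boolPairs_map hm (R := fun n c i => queryCode (ctlStart v m u l a b n +
      (2 * κ n + (m n * u n + ((κ n + 1) * m n + (i + m n * c)))),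
      (ctlStart v m u l a b n + (2 * κ n + (m n * u n +
        ((κ n + 1) * m n + (2 * m n + (2 * m n * l n + c)))))) ::
        ((List.range (u n)).map fun j => ctlStart v m u l a b n + (2 * κ n + (j + u n * i))),
      (List.range (l n)).map fun j => ctlStart v m u l a b n + (2 * κ n +
        (m n * u n + ((κ n + 1) * m n + (2 * m n + (j + l n * (i + m n * c))))))))
      (by fun_prop) fun n c i => ?_
    rw [keyQuery, encode_query, List.ofFn_succ]
    simp only [List.ofFn_eq_map, Fin.cons_zero, Fin.cons_succ]
    congr 1
    refine Prod.ext ?_ (Prod.ext (congrArg₂ _ ?_ (finRange_map_eq fun j => rfl))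
      (finRange_map_eq fun j => ?_)) <;> cases c <;> rfl
  have ho : PolyTime fun n => ((forger (A₁ n) (κ n) (gs n)).ops.map OracleOp.encode) := by
    have h : PolyTime fun n => ((hLayer (superposed : Fin (κ n + (m n * u n + m n)) ↪
        FWire (v n) (m n) (u n) (l n) (a n) (u n + (l n + 1)) (b n) (κ n)) ++ prepare).map
          (QGate.raw (forgerNum v m u l a b κ n))).map gateCode ++
        (((boolPairs (m n)).map fun p => ((keyQuery p :
          QOp (FWire (v n) (m n) (u n) (l n) (a n) (u n + (l n + 1)) (b n) (κ n))
            (u n + 1) (l n)).toOp wireEquiv).encode) ++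
        ((fillB ++ (gs n).map (QGate.map unmeasured)).map
          (QGate.raw (forgerNum v m u l a b κ n))).map gateCode) := by
      fun_prop
    refine h.of_code_eq fun n => ?_
    congr 1
    simp only [forger, forgerOps, List.map_append, List.map_map, Function.comp_def, encode_gate]
    rfl
  have hN : PolyTime fun n => (forger (A₁ n) (κ n) (gs n)).anc := by
    change PolyTime fun n => forgerAnc (m n) (u n) (l n) (a n) (u n + (l n + 1)) (b n) (κ n)
    simp only [forgerAnc, ctlCard]
    fun_prop
  have hM : PolyTime fun n => (u n + 0) :: List.range (u n) := by fun_prop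
  have hS : PolyTime fun n => (List.range (l n)).map fun j => u n + (j + 1) := by fun_prop
  have h : PolyTime fun n => ((forger (A₁ n) (κ n) (gs n)).anc,
      Data.ofList ((forger (A₁ n) (κ n) (gs n)).ops.map OracleOp.encode), (u n + 0) :: List.range (u n),
      (List.range (l n)).map fun j => u n + (j + 1)) := by fun_prop
  rw [polyTimeGenerated_iff]
  refine h.toData.of_code_eq fun n => ?_
  have e1 : Data.ofWires (List.ofFn (forger (A₁ n) (κ n) (gs n)).outMsg) =
      TreeCode.code ((u n + 0) :: List.range (u n)) := by
    rw [ofWires_ofFn, List.ofFn_succ, List.ofFn_eq_map]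
    exact congrArg TreeCode.code (congrArg₂ List.cons (hU n _)
      ((finRange_map_eq (R := id) fun i => hU n _).trans (List.map_id _)))
  have e2 : Data.ofWires (List.ofFn (forger (A₁ n) (κ n) (gs n)).outSig) =
      TreeCode.code ((List.range (l n)).map fun j => u n + (j + 1)) := by
    rw [ofWires_ofFn, List.ofFn_eq_map]
    exact congrArg TreeCode.code (finRange_map_eq fun i => hU n _)
  rw [Forger.encode, e1, e2]
  rfl

/-- The forger that runs the first stage runs in polynomial time. -/
theorem polyGates_firstGates : PolyGates (stageNum A₁ b) fun n => firstGates (A₁ n) := by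
  have ha := ((qpt_iff A₁).1 hA).1
  refine ((qpt_iff A₁).1 hA).2.mapWires _ (.of (by fun_prop) (R := fun _ i => i) (by fun_prop) ?_)
  exact fun _ _ => rfl

/-- The forger that runs both stages runs in polynomial time. -/
theorem polyGates_swapGates {A₂ : ∀ n, QCircuit (u n + (l n + 1) + 1 + (A₁ n).rest) 1}
    (hA₂ : QPT A₂) : PolyGates (stageNum A₁ fun n => (A₂ n).anc) fun n => swapGates (A₂ n) := by
  have ha := ((qpt_iff A₁).1 hA).1
  have hb := ((qpt_iff A₂).1 hA₂).1
  set a := fun n => (A₁ n).anc with ha'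
  set b := fun n => (A₂ n).anc with hb'
  -- The number of leftover qubits is not part of the description of a circuit; it is recovered from
  -- the size equation by subtraction.
  have hr : PolyTime fun n => (A₁ n).rest := by
    have h : PolyTime fun n => v n + m n * (u n + (l n + 1)) + a n - (u n + (l n + 1) + (1 + 1)) := by
      fun_prop
    refine h.of_code_eq fun n => congrArg _ ?_
    have := (A₁ n).size_eq
    have : a n = (A₁ n).anc := rfl
    omega
  have hk : PolyTime fun n => u n + (l n + 1) := by fun_prop
  have wk : PolyWires (stageNum A₁ b) fun n (i : Fin (u n + (l n + 1))) => keyWire (A₁ n) i :=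
    .of hk (R := fun _ i => i) (by fun_prop) fun _ _ => rfl
  have wc : PolyWires (stageNum A₁ b) fun n => copyWire (A₂ n) :=
    .of hk (R := fun n i => v n + m n * (u n + (l n + 1)) + a n +
      (u n + (l n + 1) + 1 + (b n + i))) (by fun_prop) fun _ _ => rfl
  have wt : PolyWires (stageNum A₁ b) fun n => ctWire (A₂ n) :=
    .of hk (R := fun n i => v n + m n * (u n + (l n + 1)) + a n + (i + 1)) (by fun_prop)
      fun _ _ => rfl
  have wr : PolyWires (stageNum A₁ b) fun n => keyRight (A₂ n) :=
    .of (k := fun n => l n + 1) (by fun_prop) (R := fun n i => u n + i) (by fun_prop) fun _ _ => rfl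
  have w1 : PolyWires (stageNum A₁ b) fun n (i : Fin (u n + (l n + 1) + 1)) => .inr (.inl i) :=
    .of (by fun_prop) (R := fun n i => v n + m n * (u n + (l n + 1)) + a n + i) (by fun_prop)
      fun _ _ => rfl
  have w2 : PolyWires (stageNum A₁ b) fun n (i : Fin (A₁ n).rest) => .inl ((A₁ n).restWire i) :=
    .of hr (R := fun n i => u n + (l n + 1) + (1 + 1) + i) (by fun_prop) fun _ _ => rfl
  have w3 : PolyWires (stageNum A₁ b) fun n (i : Fin (b n)) => .inr (.inr (.inl i)) :=
    .of hb (R := fun n i => v n + m n * (u n + (l n + 1)) + a n + (u n + (l n + 1) + 1 + i))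
      (by fun_prop) fun _ _ => rfl
  have ws : PolyWires (stageNum A₁ b) fun n => toSecond (A₂ n) := (w1.append w2).append w3
  have gc : PolyGates (stageNum A₁ b) fun n => copyKey (A₂ n) := .cxLayer hk wk wc
  have gt : PolyGates (stageNum A₁ b) fun n => copyCt (A₂ n) := .cxLayer hk wk wt
  have gx : PolyGates (stageNum A₁ b) fun n => [QGate.x (ctFlag (A₂ n))] := by
    have : PolyTime fun n => [((0 : ℕ), [v n + m n * (u n + (l n + 1)) + a n + 0])] := by fun_prop
    exact this.of_code_eq fun _ => rfl
  have g2 : PolyGates (stageNum A₁ b) fun n => secondGates (A₂ n) :=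
    gx.append (.append (.hLayer wr) (gt.append (((qpt_iff A₂).1 hA₂).2.mapWires _ ws)))
  have gz : PolyGates (stageNum A₁ b) fun n => [QGate.h (toSecond (A₂ n) ((A₂ n).outWire 0)),
      QGate.x (toSecond (A₂ n) ((A₂ n).outWire 0)), QGate.h (toSecond (A₂ n) ((A₂ n).outWire 0))] := by
    obtain ⟨L, hL, hL'⟩ := ws.exists_list
    have : PolyTime fun n => [((3 : ℕ), [(L n).getD 0 0]), (0, [(L n).getD 0 0]),
      (3, [(L n).getD 0 0])] := by fun_prop
    refine this.of_code_eq fun n => congrArg _ ?_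
    have := hL' n ((A₂ n).outWire 0)
    have e : ((A₂ n).outWire 0).val = 0 := rfl
    rw [e] at this
    rw [← this]
    rfl
  exact gc.append (g2.append (gz.append g2.inv))

end

/-! ## Security -/

/-- Decay against `n ^ (2 * k)` becomes decay against `n ^ k` after taking the root. -/
theorem Negligible.sqrt {ε : ℕ → ℝ} (h : Negligible ε) : Negligible fun n => √(ε n) := by
  intro k
  have h1 := (h (2 * k)).sqrt
  rw [Real.sqrt_zero] at h1
  refine h1.congr fun n => ?_
  have : (n : ℝ) ^ (2 * k) = ((n : ℝ) ^ k) ^ 2 := by rw [← pow_mul, mul_comm]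
  rw [Real.sqrt_mul (by positivity), this, Real.sqrt_sq (by positivity)]

theorem Negligible.eval_mul {ε : ℕ → ℝ} (h : Negligible ε) (p : Polynomial ℕ) :
    Negligible fun n => ((p.eval n : ℕ) : ℝ) * ε n := by
  have := Asymptotics.SuperpolynomialDecay.polynomial_mul h (p.map (Nat.castRingHom ℝ))
  simp only [Polynomial.eval_natCast_map, eq_natCast, Nat.cast_id] at this
  exact this

theorem negligible_two_pow_inv {u : ℕ → ℕ}
    (hu : Filter.Tendsto (fun n => (u n : ℝ) / Real.log n) Filter.atTop Filter.atTop) :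
    Negligible fun n => ((2 : ℝ) ^ u n)⁻¹ := by
  intro k
  refine squeeze_zero' (Filter.Eventually.of_forall fun n => by positivity) ?_
    tendsto_inv_atTop_nhds_zero_nat
  filter_upwards [hu.eventually_ge_atTop ((k + 1) / Real.log 2), Filter.eventually_ge_atTop 2]
    with n hn h2
  have h2' : (2 : ℝ) ≤ n := by exact_mod_cast h2
  have hlog : 0 < Real.log n := Real.log_pos (by linarith)
  have hlog2 : 0 < Real.log 2 := Real.log_pos (by norm_num)
  -- The growth of `u` beats any multiple of the logarithm. The extra factor `n` leaves `1 / n`,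
  -- which tends to zero.
  have h3 : (n : ℝ) ^ (k + 1) ≤ 2 ^ u n := by
    rw [← Real.log_le_log_iff (by positivity) (by positivity), Real.log_pow, Real.log_pow]
    rw [div_le_div_iff₀ hlog2 hlog] at hn
    push_cast
    linarith
  rw [← div_eq_mul_inv, div_le_iff₀ (by positivity), ← div_eq_inv_mul, le_div_iff₀ (by positivity),
    ← pow_succ]
  exact h3

theorem avg_sqrt_le {t : ℕ} {F : Bits t → ℝ} (hF : ∀ ω, 0 ≤ F ω) :
    (avg fun ω => √(F ω)) ≤ √(avg F) := by
  have := mul_sum_sqrt_le (D := ((2 : ℝ) ^ t)⁻¹) (X := Bits t) (by simp) F hF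
  rwa [← div_eq_inv_mul, ← div_eq_inv_mul] at this

/-- The birthday bound: a union bound over ordered pairs of positions, each colliding with
probability one over the number of values. -/
theorem sum_not_injective_le (m : ℕ) {β : Type} [Fintype β] [Nonempty β]
    [DecidablePred (Function.Injective : (Fin m → β) → Prop)] :
    ((Fintype.card β : ℝ)⁻¹) ^ m * ∑ r : Fin m → β, (if Function.Injective r then 0 else 1) ≤
      m ^ 2 * (Fintype.card β : ℝ)⁻¹ := by
  classical
  set c : ℝ := (Fintype.card β : ℝ) with hc
  have hc0 : 0 < c := Nat.cast_pos.2 Fintype.card_pos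
  have h1 : ∀ i j : Fin m, i ≠ j →
      (c⁻¹) ^ m * ∑ r : Fin m → β, (if r i = r j then (1 : ℝ) else 0) = c⁻¹ := by
    intro i j hij
    have e1 : ∑ r : Fin m → β, (if r i = r j then (1 : ℝ) else 0) =
        Fintype.card ({x // x ≠ j} → β) := by
      rw [← Equiv.sum_comp (Equiv.funSplitAt j β).symm, Fintype.sum_prod_type, Finset.sum_comm]
      simp [Equiv.funSplitAt, Equiv.piSplitAt, hij]
    have e2 : (c : ℝ) ^ m = c * Fintype.card ({x // x ≠ j} → β) := by
      have := Fintype.card_congr (Equiv.funSplitAt j β)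
      rw [Fintype.card_prod, Fintype.card_fun, Fintype.card_fin] at this
      rw [hc]
      exact_mod_cast this
    rw [e1, inv_pow, e2, mul_inv, mul_assoc, inv_mul_cancel₀, mul_one]
    intro h
    rw [h, mul_zero] at e2
    exact (pow_pos hc0 m).ne' e2
  have h2 : ∀ r : Fin m → β, (if Function.Injective r then (0 : ℝ) else 1) ≤
      ∑ i, ∑ j, if i ≠ j then (if r i = r j then (1 : ℝ) else 0) else 0 := by
    intro r
    have hn : ∀ i j : Fin m, (0 : ℝ) ≤ if i ≠ j then (if r i = r j then (1 : ℝ) else 0) else 0 :=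
      fun i j => by positivity
    by_cases hr : Function.Injective r
    · rw [if_pos hr]
      exact Finset.sum_nonneg fun i _ => Finset.sum_nonneg fun j _ => hn i j
    · rw [if_neg hr]
      simp only [Function.Injective, not_forall] at hr
      obtain ⟨i, j, h, hij⟩ := hr
      calc (1 : ℝ) = if i ≠ j then (if r i = r j then (1 : ℝ) else 0) else 0 := by simp [h, hij]
        _ ≤ ∑ j, if i ≠ j then (if r i = r j then (1 : ℝ) else 0) else 0 :=
          Finset.single_le_sum (f := fun j => if i ≠ j then (if r i = r j then (1 : ℝ) else 0) else 0)
            (fun j _ => hn i j) (Finset.mem_univ j)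
        _ ≤ _ := Finset.single_le_sum
            (f := fun i => ∑ j, if i ≠ j then (if r i = r j then (1 : ℝ) else 0) else 0)
            (fun i _ => Finset.sum_nonneg fun j _ => hn i j) (Finset.mem_univ i)
  calc (c⁻¹) ^ m * ∑ r : Fin m → β, (if Function.Injective r then 0 else 1)
      ≤ (c⁻¹) ^ m * ∑ r : Fin m → β,
          ∑ i, ∑ j, if i ≠ j then (if r i = r j then (1 : ℝ) else 0) else 0 :=
        mul_le_mul_of_nonneg_left (Finset.sum_le_sum fun r _ => h2 r) (by positivity)
    _ = ∑ i, ∑ j, if i ≠ j then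
          (c⁻¹) ^ m * ∑ r : Fin m → β, (if r i = r j then (1 : ℝ) else 0) else 0 := by
        rw [Finset.sum_comm, Finset.mul_sum]
        refine Finset.sum_congr rfl fun i _ => ?_
        rw [Finset.sum_comm, Finset.mul_sum]
        refine Finset.sum_congr rfl fun j _ => ?_
        split_ifs <;> simp
    _ ≤ ∑ i : Fin m, ∑ j : Fin m, c⁻¹ := by
        refine Finset.sum_le_sum fun i _ => Finset.sum_le_sum fun j _ => ?_
        split_ifs with h
        · exact (h1 i j h).le
        · positivity
    _ = m ^ 2 * c⁻¹ := by
        simp only [Finset.sum_const, Finset.card_univ, Fintype.card_fin, nsmul_eq_mul]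
        ring

/-- The loss from guessing a key stays linear in the number of keys, so it does not harm
negligibility. -/
theorem two_pow_size_le (m : ℕ) : 2 ^ Nat.size m ≤ 2 * m + 1 := by
  rcases h : Nat.size m with _ | s
  · simp
  · have := Nat.lt_size.1 (h ▸ Nat.lt_succ_self s : s < Nat.size m)
    rw [pow_succ]
    omega

theorem runOracle_nonneg {N s t : ℕ} (O : Bits s → Bits t) (win) (ops : List (OracleOp N s t))
    (ψ : Bits N → ℂ) (Q) : 0 ≤ runOracle O win ops ψ Q := by
  induction ops generalizing ψ Q with
  | nil => exact Finset.sum_nonneg fun x _ => by positivity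
  | cons o ops ih =>
    cases o with
    | gate g => exact ih _ _
    | query c q a => exact add_nonneg (ih _ _) (Finset.sum_nonneg fun m _ => ih _ _)

section
variable {u l m v : ℕ} (A₁ : QCircuit (v + m * (u + (l + 1))) (u + (l + 1) + (1 + 1)))
  (A₂ : QCircuit (u + (l + 1) + 1 + A₁.rest) 1)
  (ver : Bits (u + 1) → Bits l → Bool) (sign : Bits (u + 1) → Bits l) (vk : Bits v)

/-- The advantage of the adversary is bounded by the success probabilities of the two forgers. -/
theorem gameProb_le {w₀ w₁ : ℝ}
    (h₀ : (forger A₁ (Nat.size m) (firstGates (b := 0) A₁)).winProb sign ver vk = w₀)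
    (h₁ : (forger A₁ (Nat.size m) (firstGates A₁ ++ swapGates A₂)).winProb sign ver vk = w₁) :
    (gameProb A₁ A₂ (fun msg ct => encPOVM ver (msg 0) ct) (keysState m vk
      (∑ r : Bits u, ((2 : ℂ) ^ u)⁻¹ •
        Matrix.vecMulVec (pkVec r (sign (Fin.cons false r)) (sign (Fin.cons true r)))
          (star (pkVec r (sign (Fin.cons false r)) (sign (Fin.cons true r)))))) false +
    gameProb A₁ A₂ (fun msg ct => encPOVM ver (msg 0) ct) (keysState m vk
      (∑ r : Bits u, ((2 : ℂ) ^ u)⁻¹ •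
        Matrix.vecMulVec (pkVec r (sign (Fin.cons false r)) (sign (Fin.cons true r)))
          (star (pkVec r (sign (Fin.cons false r)) (sign (Fin.cons true r)))))) true) / 2 ≤
    1 / 2 + (m ^ 2 * ((2 : ℝ) ^ u)⁻¹ + ((2 + 6 * m) * √((2 * m + 1) * w₀) +
      2 * m * √((2 * m + 1) * w₁))) := by
  classical
  have hw₀ : 0 ≤ w₀ := h₀ ▸ runOracle_nonneg _ _ _ _ _
  have hw₁ : 0 ≤ w₁ := h₁ ▸ runOracle_nonneg _ _ _ _ _
  have hκ : ((2 : ℝ) ^ Nat.size m) ≤ 2 * m + 1 := by exact_mod_cast two_pow_size_le m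
  have a1 := gameProb_add_le A₁ A₂ ver sign vk
  have a2 := sum_forgeryNorm_le A₁ A₂ ver sign vk (Nat.lt_size_self m) h₀ h₁
  have a3 := sum_not_injective_le m (β := Bits u)
  have hcard : (Fintype.card (Bits u) : ℝ) = 2 ^ u := by simp
  have hD : ((2 ^ u : ℝ)⁻¹) ^ m * Fintype.card (Fin m → Bits u) = 1 := by simp
  rw [hcard] at a3
  -- Both cases exceed 1 by a term that is small on average: a forgery norm, or the indicator of a
  -- collision.
  have a4 : ∀ r : Fin m → Bits u,
      (if Function.Injective r then 1 + 4 * forgeryNorm A₁ A₂ ver sign vk r else 2) =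
      1 + (4 * (if Function.Injective r then forgeryNorm A₁ A₂ ver sign vk r else 0) +
        if Function.Injective r then 0 else 1) := by
    intro r
    split_ifs <;> norm_num
  have a5 : ((2 ^ u : ℝ)⁻¹) ^ m * ∑ r : Fin m → Bits u,
      (if Function.Injective r then 1 + 4 * forgeryNorm A₁ A₂ ver sign vk r else 2) =
      ((2 ^ u : ℝ)⁻¹) ^ m * Fintype.card (Fin m → Bits u) + (4 * (((2 ^ u : ℝ)⁻¹) ^ m *
        ∑ r : Fin m → Bits u,
          (if Function.Injective r then forgeryNorm A₁ A₂ ver sign vk r else 0)) +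
        ((2 ^ u : ℝ)⁻¹) ^ m * ∑ r : Fin m → Bits u, (if Function.Injective r then 0 else 1)) := by
    simp only [a4, Finset.sum_add_distrib, ← Finset.mul_sum]
    rw [Finset.sum_const, Finset.card_univ, nsmul_eq_mul]
    ring
  have s : ∀ w : ℝ, 0 ≤ w → √(2 ^ Nat.size m * w) ≤ √((2 * m + 1) * w) := fun w hw =>
    Real.sqrt_le_sqrt (mul_le_mul_of_nonneg_right hκ hw)
  have s₀ := mul_le_mul_of_nonneg_left (s w₀ hw₀) (by positivity : (0 : ℝ) ≤ 1 + 3 * m)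
  have s₁ := mul_le_mul_of_nonneg_left (s w₁ hw₁) (by positivity : (0 : ℝ) ≤ m)
  have s₂ : 0 ≤ (m : ℝ) ^ 2 * ((2 : ℝ) ^ u)⁻¹ := by positivity
  rw [a5, hD] at a1
  linarith

end

/-- For each adversary the two forgers are polynomial time, so their success probabilities are
negligible. The bound on the advantage keeps this: polynomial factors and square roots preserve
negligibility, and Jensen's inequality moves the average over the coins of `Gen` under the root. -/
theorem ofSig_indpkTCPA (u : ℕ → ℕ)
    (hu : Filter.Tendsto (fun n => (u n : ℝ) / Real.log n) Filter.atTop Filter.atTop)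
    (S : SigScheme fun n => u n + 1) (hS : S.StrongEUFCMASecure) :
    (QPKE.ofSig u S).INDpkTCPA := by
  obtain ⟨⟨⟨hu1, -, -, hv, hl⟩, -⟩, -, hsec⟩ := hS
  rw [polyTimeLength_iff] at hu1 hv hl
  have hu' : PolyTime u := hu1.pred
  intro m A ⟨hA₁, hA₂⟩
  have hm := PolyTime.polynomialEval m
  have hκ : PolyTime fun n => Nat.size (m.eval n) := hm.natSize
  let A₁ : ∀ n, QCircuit (S.vkLen n + m.eval n * (u n + (S.sigLen n + 1)))
    (u n + (S.sigLen n + 1) + (1 + 1)) := A.first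
  let A₂ : ∀ n, QCircuit (u n + (S.sigLen n + 1) + 1 + (A₁ n).rest) 1 := A.second
  have hA₁ : QPT A₁ := hA₁
  have hA₂ : QPT A₂ := hA₂
  have hb := ((qpt_iff A₂).1 hA₂).1
  -- The first forger never runs the second stage and gets no ancillas for it.
  let F₀ : ∀ n, Forger (S.vkLen n) (u n + 1) (S.sigLen n) := fun n =>
    forger (A₁ n) (Nat.size (m.eval n)) (firstGates (b := 0) (A₁ n))
  let F₁ : ∀ n, Forger (S.vkLen n) (u n + 1) (S.sigLen n) := fun n =>
    forger (A₁ n) (Nat.size (m.eval n)) (firstGates (A₁ n) ++ swapGates (A₂ n))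
  have p₀ := hsec F₀ (polyTimeGenerated_forger hv hm hu' hl (.const 0) hκ hA₁
    (polyGates_firstGates hv hm hu' hl (.const 0) hκ hA₁))
  have p₁ := hsec F₁ (polyTimeGenerated_forger hv hm hu' hl hb hκ hA₁
    ((polyGates_firstGates hv hm hu' hl hb hκ hA₁).append
      (polyGates_swapGates hv hm hu' hl hb hκ hA₁ hA₂)))
  have e1 := (negligible_two_pow_inv hu).eval_mul (m ^ 2)
  have e2 := ((p₀.eval_mul (2 * m + 1)).sqrt).eval_mul (2 + 6 * m)
  have e3 := ((p₁.eval_mul (2 * m + 1)).sqrt).eval_mul (2 * m)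
  refine ⟨_, Asymptotics.SuperpolynomialDecay.add e1 (Asymptotics.SuperpolynomialDecay.add e2 e3),
    fun n => ?_⟩
  refine (avg_mono fun ω => (gameProb_le (A₁ n) (A₂ n) (S.ver n (S.gen n ω).2)
    (S.sign n (S.gen n ω).1) (S.gen n ω).2 rfl rfl)).trans ?_
  rw [avg_add, avg_const, avg_add, avg_const, avg_add, avg_const_mul, avg_const_mul]
  have key : ∀ F : ∀ n, Forger (S.vkLen n) (u n + 1) (S.sigLen n),
      (avg fun ω => √((2 * (m.eval n : ℕ) + 1) *
        (F n).winProb (S.sign n (S.gen n ω).1) (S.ver n (S.gen n ω).2) (S.gen n ω).2)) ≤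
      √((2 * (m.eval n : ℕ) + 1) * avg fun ω =>
        (F n).winProb (S.sign n (S.gen n ω).1) (S.ver n (S.gen n ω).2) (S.gen n ω).2) := by
    intro F
    rw [← avg_const_mul]
    exact avg_sqrt_le fun ω => mul_nonneg (by positivity) (runOracle_nonneg _ _ _ _ _)
  have c : ((2 * m + 1).eval n : ℕ) = 2 * m.eval n + 1 := by simp
  have c1 : ((m ^ 2).eval n : ℕ) = m.eval n ^ 2 := by simp
  have c2 : ((2 + 6 * m).eval n : ℕ) = 2 + 6 * m.eval n := by simp
  have c3 : ((2 * m).eval n : ℕ) = 2 * m.eval n := by simp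
  simp only [Pi.add_apply, c, c1, c2, c3]
  push_cast
  have k₀ := mul_le_mul_of_nonneg_left (key F₀) (by positivity : (0 : ℝ) ≤ 2 + 6 * (m.eval n : ℕ))
  have k₁ := mul_le_mul_of_nonneg_left (key F₁) (by positivity : (0 : ℝ) ≤ 2 * (m.eval n : ℕ))
  exact add_le_add le_rfl (add_le_add le_rfl (add_le_add k₀ k₁))

end PkT

theorem mainTheorem2 (u : ℕ → ℕ)
    (hu : Filter.Tendsto (fun n => (u n : ℝ) / Real.log n) Filter.atTop Filter.atTop)
    (S : PkT.SigScheme fun n => u n + 1) (hS : S.StrongEUFCMASecure) :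
    (PkT.QPKE.ofSig u S).Efficient ∧ (PkT.QPKE.ofSig u S).Correct ∧
      (PkT.QPKE.ofSig u S).INDpkTCPA := by
  exact ⟨PkT.ofSig_efficient u S hS.1, PkT.ofSig_correct u S hS.2.1, PkT.ofSig_indpkTCPA u hu S hS⟩
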